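/- **Setting.** Let $\underline{C}$ be a triangulated category with a weight structure $w$ in the cohomological convention: classes $\underline{C}^{w\ge 0}$, $\underline{C}^{w\le 0}$ that are additive and closed under retracts, with $\underline{C}^{w\ge 0}\subset \underline{C}^{w\ge 0}[1]$, $\underline{C}^{w\le 0}[1]\subset \underline{C}^{w\le 0}$, $\underline{C}(X,Y[1])=0$ for $X\in\underline{C}^{w\ge 0}$, $Y\in\underline{C}^{w\le 0}$, and such that every $X$ has a weight decomposition, i.e. a distinguished triangle $B[-1]\to X\to A\to B$ with $A\in \underline{C}^{w\le 0}$, $B\in \underline{C}^{w\ge 0}$. Put $\underline{C}^{w\ge l}=\underline{C}^{w\ge 0}[-l]$, $\underline{C}^{w\le l}=\underline{C}^{w\le 0}[-l]$. Shifting weight decompositions gives, for every $l$, distinguished triangles $w_{\ge l+1}X\to X\to w_{\le l}X\to (w_{\ge l+1}X)[1]$ with $w_{\ge l+1}X\in\underline{C}^{w\ge l+1}$, $w_{\le l}X\in\underline{C}^{w\le l}$ (not unique). $X$ is bounded if it lies in some $\underline{C}^{w\ge a}$ and in some $\underline{C}^{w\le b}$. Let $\underline{A}$ be an abelian category and $H:\underline{C}^{op}\to\underline{A}$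 a cohomological functor; for any contravariant functor $G$ put $G^i(X)=G(X[-i])$. For a contravariant functor $G$ put $(W^kG)(X)=\mathrm{Im}(G(w_{\le k}X)\to G(X))$ and define the virtual $t$-truncations $$\tau_{\le k}G(X)=\mathrm{Im}(G(w_{\le k}X)\to G(w_{\le k+1}X)),\qquad \tau_{\ge k}G(X)=\mathrm{Im}(G(w_{\ge k-1}X)\to G(w_{\ge k}X)),$$ where the morphisms are induced by the morphisms of weight truncations compatible with $\mathrm{id}_X$; further $\tau_{[m,k]}G=\tau_{\le k}(\tau_{\ge m}G)$ and $G^{\tau=k}(X)=(\tau_{\ge 0}\tau_{\le 0}G)(X[k])$. They are functorial in $X$ and $G$; there are natural transformations $\tau_{\le k}G\to G\to\tau_{\ge k+1}G$ and $\tau_{\ge k}G\to\tau_{\ge k+1}G$, and a connecting transformation $\delta:(\tau_{\ge k+1}G)(X[1])\to(\tau_{\le k}G)(X)$ induced by the boundary morphisms $w_{\le k}X\to (w_{\ge k+1}X)[1]$. A weight Postnikov tower for $X$ consists of objects $Y_p$ ($p\in\mathbb{Z}$) with morphisms $Y_p\to X$ that are choices of $w_{\ge 1-p}X\to X$, morphisms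 $Y_p\to Y_{p+1}$ over $X$, and distinguished triangles $Y_p\to Y_{p+1}\to X_p\to Y_p[1]$. Put $X^{-p}=X_p[-p]$ and $X^{w\ge 1-p}=Y_p[1-p]$; the compositions $X_{p+1}\to Y_{p+1}[1]\to X_p[1]$ give morphisms $X^{-p-1}\to X^{-p}$. For a contravariant functor $G$ put $F^pG(X)=\mathrm{Ker}(G(X)\to G(Y_p))$; for $G=H^m$ this is the step given by $(E_1^{l,m-l}:\ l\ge p)$ of the filtration on $H^m(X)$. A morphism of towers over $g:X\to X'$ is a family of morphisms $Y_p\to Y'_p$, $X_p\to X'_p$ compatible with $g$ and with all the morphisms of the towers. **Theorem.** Let $k,m\in\mathbb{Z}$. I.1. For any weight Postnikov tower for $X$, the triangles of the tower give an exact couple with $E_1^{pq}=H^q(X^{-p})$, $D_1^{pq}=H^q(X^{w\ge 1-p})$, and hence a spectral sequence $T=T(H,X)$ with $E_1^{pq}=H^q(X^{-p})$ (naturally in $H$ and in the tower), whose $d_1:E_1^{pq}\to E_1^{p+1,q}$ is induced by $X^{-p-1}\to X^{-p}$. If $X$ is bounded, then $T\Rightarrow H^{p+q}(X)$: the filtrations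 $F^\bullet H^m(X)$ are finite (exhaustive and separated), and for all sufficiently large $r$ (uniformly in $p,q$) one has $d_r=0$ and $E_r^{pq}\cong F^pH^{p+q}(X)/F^{p+1}H^{p+q}(X)$, compatibly with the morphisms $E_r^{pq}\to D_r^{p+1,q}\subset D_1^{p+1,q}\cong H^{p+q}(Y_{p+1})$. I.2. $T$ is covariantly functorial in $H$ and, from $E_2$ on, contravariantly $\underline{C}$-functorial in $X$: every object has a weight Postnikov tower, every morphism $X\to X'$ extends to a morphism of any given towers, and there is a functor $T_2$ of $(H,X)$, with values in spectral sequences starting at the second page, to which the pages $E_r$, $r\ge 2$, of $T$ are isomorphic naturally in $H$ and in the tower. I.3. $F^{-k}H^m(X)=(W^kH^m)(X)$ as subobjects of $H^m(X)$. II. The derived exact couple $(D_2,E_2)$ of the couple of I.1 is isomorphic, naturally in $H$ and in the tower and compatibly with the three morphisms of the couples, to the couple $(D_2',E_2')$ with $$E_2'^{pq}=(H^q)^{\tau=-p}(X),\qquad D_2'^{pq}=(\tau_{\ge q}H)^q(X[1-p]),$$ where, up to the canonical identifications of shifts, $D_2'^{pq}\to D_2'^{p-1,q+1}$ is induced by $\tau_{\ge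 q}H\to\tau_{\ge q+1}H$; $E_2'^{pq}\to D_2'^{p+1,q}$ by $\tau_{\ge 0}\tau_{\le 0}H^q\to\tau_{\ge 0}H^q$; and $D_2'^{p-1,q+1}\to E_2'^{pq}$ is the composition of the connecting morphism $\delta:(\tau_{\ge q+1}H)(Y[1])\to(\tau_{\le q}H)(Y)$ for $Y=X[-p][-q]$ with $\tau_{\le 0}H^q\to\tau_{\ge 0}\tau_{\le 0}H^q$ at $X[-p]$. III.1. $F^{-k}H^m(X)=\mathrm{Im}((\tau_{\le k}(H^m))(X)\to H^m(X))$. III.2. For all $r\ge 2$ and $p,q\in\mathbb{Z}$ there is an isomorphism $$E_r^{pq}\cong F^p\bigl(\tau_{[-p+2-r,\,-p+r-2]}(H^{p+q})\bigr)(X)\big/F^{p+1}\bigl(\tau_{[-p+2-r,\,-p+r-2]}(H^{p+q})\bigr)(X),$$ functorial in $H$ and in the tower. -/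

import Mathlib

open CategoryTheory CategoryTheory.Limits CategoryTheory.Pretriangulated Opposite

universe v u v' u'

noncomputable section

namespace WeightSS

section Weight

variable (C : Type u) [Category.{v} C] [Preadditive C] [HasZeroObject C] [HasShift C ℤ]
  [∀ n : ℤ, (shiftFunctor C n).Additive] [Pretriangulated C]

/-- A weight structure, in the cohomological convention. -/
structure WeightStructure where
  /-- the class `C^{w ≤ 0}` -/
  le₀ : ObjectProperty C
  /-- the class `C^{w ≥ 0}` -/
  ge₀ : ObjectProperty C
  le₀_zero : le₀.ContainsZero
  ge₀_zero : ge₀.ContainsZero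
  le₀_sum : le₀.IsClosedUnderBinaryProducts
  ge₀_sum : ge₀.IsClosedUnderBinaryProducts
  le₀_retract : le₀.IsStableUnderRetracts
  ge₀_retract : ge₀.IsStableUnderRetracts
  /-- `C^{w ≥ 0} ⊆ C^{w ≥ 0}[1]` -/
  ge₀_shift : ∀ X : C, ge₀ X → ge₀ (X⟦(-1 : ℤ)⟧)
  /-- `C^{w ≤ 0}[1] ⊆ C^{w ≤ 0}` -/
  le₀_shift : ∀ X : C, le₀ X → le₀ (X⟦(1 : ℤ)⟧)
  /-- `C^{w ≥ 0} ⊥ C^{w ≤ 0}[1]` -/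
  orth : ∀ (X Y : C), ge₀ X → le₀ Y → ∀ f : X ⟶ Y⟦(1 : ℤ)⟧, f = 0
  /-- every `X` has a weight decomposition `B[-1] ⟶ X ⟶ A ⟶ B` -/
  exists_dec : ∀ X : C, ∃ (A B : C) (_ : le₀ A) (_ : ge₀ B) (f : B⟦(-1 : ℤ)⟧ ⟶ X) (g : X ⟶ A)
    (h : A ⟶ B⟦(-1 : ℤ)⟧⟦(1 : ℤ)⟧), Triangle.mk f g h ∈ distTriang C

variable {C}

namespace WeightStructure

variable (w : WeightStructure C)

/-- `C^{w ≤ k} = C^{w ≤ 0}[-k]` -/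
def le (k : ℤ) : ObjectProperty C := fun X => w.le₀ (X⟦k⟧)

/-- `C^{w ≥ k} = C^{w ≥ 0}[-k]` -/
def ge (k : ℤ) : ObjectProperty C := fun X => w.ge₀ (X⟦k⟧)

/-- `C^b`, the class of bounded objects. -/
def bounded : ObjectProperty C := fun X => (∃ k, w.le k X) ∧ ∃ k, w.ge k X

lemma le₀_of_iso {X Y : C} (e : X ≅ Y) (h : w.le₀ X) : w.le₀ Y :=
  w.le₀_retract.of_retract (Retract.ofIso e.symm) h

lemma ge₀_of_iso {X Y : C} (e : X ≅ Y) (h : w.ge₀ X) : w.ge₀ Y :=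
  w.ge₀_retract.of_retract (Retract.ofIso e.symm) h

lemma le_shift {k n k' : ℤ} (hk : n + k' = k) {X : C} (h : w.le k X) : w.le k' (X⟦n⟧) :=
  w.le₀_of_iso ((shiftFunctorAdd' C n k' k hk).app X) h

lemma ge_shift {k n k' : ℤ} (hk : n + k' = k) {X : C} (h : w.ge k X) : w.ge k' (X⟦n⟧) :=
  w.ge₀_of_iso ((shiftFunctorAdd' C n k' k hk).app X) h

lemma le_mono {k k' : ℤ} (h : k ≤ k') {X : C} (hX : w.le k X) : w.le k' X := by
  obtain ⟨n, rfl⟩ := Int.le.dest h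
  clear h
  induction n with
  | zero => simpa using hX
  | succ n ih =>
    exact w.le₀_of_iso ((shiftFunctorAdd' C (k + n) 1 (k + (n + 1 : ℕ)) (by push_cast; ring)).app X).symm
      (w.le₀_shift _ ih)

/-- Orthogonality: `C^{w ≥ a} ⊥ C^{w ≤ b}` for `b < a`. -/
lemma hom_eq_zero {a b : ℤ} (h : b < a) {X Y : C} (hX : w.ge a X) (hY : w.le b Y) (f : X ⟶ Y) :
    f = 0 := by
  have hY' : w.le₀ (Y⟦a - 1⟧) := w.le_mono (by lia : b ≤ a - 1) hY
  have h0 := w.orth _ _ hX hY' (f⟦a⟧' ≫ (shiftFunctorAdd' C (a - 1) 1 a (by ring)).hom.app Y)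
  have h1 : f⟦a⟧' = 0 := by
    rw [← cancel_mono ((shiftFunctorAdd' C (a - 1) 1 a (by ring)).hom.app Y), h0, zero_comp]
  exact (shiftFunctor C a).map_injective (by rw [h1, Functor.map_zero])

end WeightStructure

/-- A choice of shifted weight decomposition `w_{≥ k+1} X ⟶ X ⟶ w_{≤ k} X ⟶ (w_{≥ k+1} X)[1]`. -/
structure WeightDec (w : WeightStructure C) (k : ℤ) (X : C) where
  P : C
  Q : C
  ι : P ⟶ X
  π : X ⟶ Q
  δ : Q ⟶ P⟦(1 : ℤ)⟧
  ge : w.ge (k + 1) P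
  le : w.le k Q
  dist : Triangle.mk ι π δ ∈ distTriang C

lemma shift_dist' {P X Q : C} {f : P ⟶ X} {g : X ⟶ Q} {h : Q ⟶ P⟦(1 : ℤ)⟧}
    (hT : Triangle.mk f g h ∈ distTriang C) (n : ℤ) :
    Triangle.mk (f⟦n⟧') (g⟦n⟧')
      (n.negOnePow • (h⟦n⟧' ≫ (shiftFunctorComm C 1 n).hom.app P)) ∈ distTriang C := by
  refine isomorphic_distinguished _ (Triangle.shift_distinguished _ hT n) _ ?_
  refine Triangle.isoMk _ _ (Iso.refl _) (n.negOnePow • Iso.refl _) (Iso.refl _) ?_ ?_ ?_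
  · change f⟦n⟧' ≫ (n.negOnePow • 𝟙 _) = 𝟙 (P⟦n⟧) ≫ (n.negOnePow • f⟦n⟧')
    simp
  · change g⟦n⟧' ≫ 𝟙 _ = (n.negOnePow • 𝟙 _) ≫ (n.negOnePow • g⟦n⟧')
    simp [smul_smul]
  · change (n.negOnePow • (h⟦n⟧' ≫ (shiftFunctorComm C 1 n).hom.app P)) ≫
      (shiftFunctor C 1).map (𝟙 (P⟦n⟧)) =
        𝟙 (Q⟦n⟧) ≫ (n.negOnePow • h⟦n⟧' ≫ (shiftFunctorComm C 1 n).hom.app P)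
    simp

namespace WeightDec

variable {w : WeightStructure C}

/-- Shift of a weight decomposition. -/
def shift {k : ℤ} {X : C} (D : WeightDec w k X) (n k' : ℤ) (h : n + k' = k) :
    WeightDec w k' (X⟦n⟧) where
  P := D.P⟦n⟧
  Q := D.Q⟦n⟧
  ι := D.ι⟦n⟧'
  π := D.π⟦n⟧'
  δ := n.negOnePow • (D.δ⟦n⟧' ≫ (shiftFunctorComm C 1 n).hom.app D.P)
  ge := w.ge_shift (by lia) D.ge
  le := w.le_shift h D.le
  dist := shift_dist' D.dist n

lemma exists_lift {k a : ℤ} {X A : C} (D : WeightDec w k X) (hA : w.ge a A) (h : k < a)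
    (f : A ⟶ X) : ∃ f' : A ⟶ D.P, f' ≫ D.ι = f := by
  obtain ⟨f', hf'⟩ := Triangle.coyoneda_exact₂ _ D.dist f (w.hom_eq_zero h hA D.le _)
  exact ⟨f', hf'.symm⟩

lemma lift_unique {k a : ℤ} {X A : C} (D : WeightDec w k X) (hA : w.ge a A) (h : k + 1 < a)
    {f f' : A ⟶ D.P} (hf : f ≫ D.ι = f' ≫ D.ι) : f = f' := by
  rw [← sub_eq_zero]
  have h0 : (f - f') ≫ D.ι = 0 := by rw [Preadditive.sub_comp, hf, sub_self]
  obtain ⟨g, hg⟩ := Triangle.coyoneda_exact₂ _ (inv_rot_of_distTriang _ D.dist) (f - f') h0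
  have : g = 0 := w.hom_eq_zero h hA (w.le_shift (by lia) D.le) g
  rw [hg, this]
  exact zero_comp

lemma exists_desc {k b : ℤ} {X B : C} (D : WeightDec w k X) (hB : w.le b B) (h : b ≤ k)
    (f : X ⟶ B) : ∃ f' : D.Q ⟶ B, D.π ≫ f' = f := by
  obtain ⟨f', hf'⟩ := Triangle.yoneda_exact₂ _ D.dist f (w.hom_eq_zero (by lia) D.ge hB _)
  exact ⟨f', hf'.symm⟩

lemma desc_unique {k b : ℤ} {X B : C} (D : WeightDec w k X) (hB : w.le b B) (h : b < k)
    {f f' : D.Q ⟶ B} (hf : D.π ≫ f = D.π ≫ f') : f = f' := by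
  rw [← sub_eq_zero]
  have h0 : D.π ≫ (f - f') = 0 := by rw [Preadditive.comp_sub, hf, sub_self]
  obtain ⟨g, hg⟩ := Triangle.yoneda_exact₃ _ D.dist (f - f') h0
  have : g = 0 := w.hom_eq_zero h (w.ge_shift (by lia) D.ge) hB g
  rw [hg, this]
  exact comp_zero

end WeightDec

namespace WeightStructure

variable (w : WeightStructure C)

lemma nonempty_dec (k : ℤ) (X : C) : Nonempty (WeightDec w k X) := by
  obtain ⟨A, B, hA, hB, f, g, h, hT⟩ := w.exists_dec (X⟦k⟧)
  have hA' : w.le 0 A := w.le₀_of_iso ((shiftFunctorZero C ℤ).symm.app A) hA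
  have hB' : w.ge 1 (B⟦(-1 : ℤ)⟧) :=
    w.ge_shift (k := 0) (by lia) (w.ge₀_of_iso ((shiftFunctorZero C ℤ).symm.app B) hB)
  let D : WeightDec w 0 (X⟦k⟧) := ⟨_, _, f, g, h, hB', hA', hT⟩
  let D' := D.shift (-k) k (by lia)
  let e : X⟦k⟧⟦-k⟧ ≅ X := (shiftEquiv C k).unitIso.symm.app X
  refine ⟨⟨D'.P, D'.Q, D'.ι ≫ e.hom, e.inv ≫ D'.π, D'.δ, D'.ge, D'.le, ?_⟩⟩
  refine isomorphic_distinguished _ D'.dist _ ?_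
  refine Triangle.isoMk _ _ (Iso.refl _) e.symm (Iso.refl _) ?_ ?_ ?_
  · change (D'.ι ≫ e.hom) ≫ e.inv = 𝟙 D'.P ≫ D'.ι
    rw [Category.assoc, e.hom_inv_id, Category.comp_id, Category.id_comp]
  · change (e.inv ≫ D'.π) ≫ 𝟙 D'.Q = e.inv ≫ D'.π
    simp
  · change D'.δ ≫ (shiftFunctor C 1).map (𝟙 D'.P) = 𝟙 D'.Q ≫ D'.δ
    simp

/-- A chosen weight decomposition of index `k`. -/
def dec (k : ℤ) (X : C) : WeightDec w k X := (w.nonempty_dec k X).some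

/-- The chosen `w_{≤ k} X`. -/
abbrev leObj (k : ℤ) (X : C) : C := (w.dec k X).Q

/-- The chosen `w_{≥ k} X`. -/
abbrev geObj (k : ℤ) (X : C) : C := (w.dec (k - 1) X).P

/-- The morphism `X ⟶ w_{≤ k} X`. -/
def leπ (k : ℤ) (X : C) : X ⟶ w.leObj k X := (w.dec k X).π

/-- The morphism `w_{≥ k} X ⟶ X`. -/
def geι (k : ℤ) (X : C) : w.geObj k X ⟶ X := (w.dec (k - 1) X).ι

end WeightStructure

namespace WeightStructure

variable (w : WeightStructure C)

lemma le_leObj (k : ℤ) (X : C) : w.le k (w.leObj k X) := (w.dec k X).le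

lemma ge_geObj (k : ℤ) (X : C) : w.ge k (w.geObj k X) := by
  have := (w.dec (k - 1) X).ge
  rwa [sub_add_cancel] at this

lemma geObj_ext {a l : ℤ} {A X : C} (hA : w.ge a A) (h : l < a) {f f' : A ⟶ w.geObj l X}
    (hf : f ≫ w.geι l X = f' ≫ w.geι l X) : f = f' :=
  (w.dec (l - 1) X).lift_unique hA (by lia) hf

lemma leObj_ext {b k : ℤ} {B X : C} (hB : w.le b B) (h : b < k) {f f' : w.leObj k X ⟶ B}
    (hf : w.leπ k X ≫ f = w.leπ k X ≫ f') : f = f' :=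
  (w.dec k X).desc_unique hB h hf

/-- A morphism `w_{≤ k} X ⟶ w_{≤ l} X'` compatible with `g : X ⟶ X'` (unique if `l < k`). -/
def leMap {X X' : C} (g : X ⟶ X') {k l : ℤ} (h : l ≤ k) : w.leObj k X ⟶ w.leObj l X' :=
  ((w.dec k X).exists_desc (w.le_leObj l X') h (g ≫ w.leπ l X')).choose

lemma leπ_leMap {X X' : C} (g : X ⟶ X') {k l : ℤ} (h : l ≤ k) :
    w.leπ k X ≫ w.leMap g h = g ≫ w.leπ l X' :=
  ((w.dec k X).exists_desc (w.le_leObj l X') h (g ≫ w.leπ l X')).choose_spec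

/-- A morphism `w_{≥ k} X ⟶ w_{≥ l} X'` compatible with `g : X ⟶ X'` (unique if `l < k`). -/
def geMap {X X' : C} (g : X ⟶ X') {k l : ℤ} (h : l ≤ k) : w.geObj k X ⟶ w.geObj l X' :=
  ((w.dec (l - 1) X').exists_lift (w.ge_geObj k X) (by lia) (w.geι k X ≫ g)).choose

lemma geMap_geι {X X' : C} (g : X ⟶ X') {k l : ℤ} (h : l ≤ k) :
    w.geMap g h ≫ w.geι l X' = w.geι k X ≫ g :=
  ((w.dec (l - 1) X').exists_lift (w.ge_geObj k X) (by lia) (w.geι k X ≫ g)).choose_spec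

lemma leMap_comp {X X' X'' : C} (g : X ⟶ X') (g' : X' ⟶ X'') {k l m : ℤ} (h : l ≤ k)
    (h' : m ≤ l) (hlt : m < k) (g'' : X ⟶ X'') (hg : g ≫ g' = g'') :
    w.leMap g h ≫ w.leMap g' h' = w.leMap g'' hlt.le := by
  subst hg
  apply w.leObj_ext (w.le_leObj _ _) hlt
  rw [← Category.assoc, leπ_leMap, Category.assoc, leπ_leMap, leπ_leMap, Category.assoc]

lemma geMap_comp {X X' X'' : C} (g : X ⟶ X') (g' : X' ⟶ X'') {k l m : ℤ} (h : l ≤ k)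
    (h' : m ≤ l) (hlt : m < k) (g'' : X ⟶ X'') (hg : g ≫ g' = g'') :
    w.geMap g h ≫ w.geMap g' h' = w.geMap g'' hlt.le := by
  subst hg
  apply w.geObj_ext (w.ge_geObj _ _) hlt
  rw [Category.assoc, geMap_geι, geMap_geι, ← Category.assoc, geMap_geι, Category.assoc]

end WeightStructure

end Weight

section Images

variable {A : Type u'} [Category.{v'} A] [Abelian A]

/-- The morphism of images induced by a commutative square. -/
def imgMap {X Y X' Y' : A} {f : X ⟶ Y} {f' : X' ⟶ Y'} (u : X ⟶ X') (v : Y ⟶ Y')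
    (h : u ≫ f' = f ≫ v) : image f ⟶ image f' :=
  image.map (Arrow.homMk' u v h)

lemma imgMap_ι {X Y X' Y' : A} {f : X ⟶ Y} {f' : X' ⟶ Y'} (u : X ⟶ X') (v : Y ⟶ Y')
    (h : u ≫ f' = f ≫ v) : imgMap u v h ≫ image.ι f' = image.ι f ≫ v :=
  image.map_ι (Arrow.homMk' u v h)

lemma fac_imgMap {X Y X' Y' : A} {f : X ⟶ Y} {f' : X' ⟶ Y'} (u : X ⟶ X') (v : Y ⟶ Y')
    (h : u ≫ f' = f ≫ v) : factorThruImage f ≫ imgMap u v h = u ≫ factorThruImage f' :=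
  image.factor_map (Arrow.homMk' u v h)

lemma img_ext {X Y X' Y' : A} {f : X ⟶ Y} {f' : X' ⟶ Y'} {a b : image f ⟶ image f'}
    (h : factorThruImage f ≫ a ≫ image.ι f' = factorThruImage f ≫ b ≫ image.ι f') : a = b := by
  rwa [cancel_epi, cancel_mono] at h

lemma imgMap_comp {X Y X' Y' X'' Y'' : A} {f : X ⟶ Y} {f' : X' ⟶ Y'} {f'' : X'' ⟶ Y''}
    (u : X ⟶ X') (v : Y ⟶ Y') (h : u ≫ f' = f ≫ v) (u' : X' ⟶ X'') (v' : Y' ⟶ Y'')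
    (h' : u' ≫ f'' = f' ≫ v') :
    imgMap u v h ≫ imgMap u' v' h' =
      imgMap (u ≫ u') (v ≫ v') (by rw [Category.assoc, h', ← Category.assoc, h, Category.assoc]) := by
  apply img_ext
  rw [Category.assoc, imgMap_ι, imgMap_ι, ← Category.assoc (imgMap _ _ _) (image.ι _), imgMap_ι,
    Category.assoc]

lemma imgMap_comp_eq {X Y X₁ Y₁ X₂ Y₂ X' Y' : A} {f : X ⟶ Y} {f₁ : X₁ ⟶ Y₁} {f₂ : X₂ ⟶ Y₂}
    {f' : X' ⟶ Y'} {u₁ : X ⟶ X₁} {v₁ : Y ⟶ Y₁} {h₁ : u₁ ≫ f₁ = f ≫ v₁} {u₁' : X₁ ⟶ X'}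
    {v₁' : Y₁ ⟶ Y'} {h₁' : u₁' ≫ f' = f₁ ≫ v₁'} {u₂ : X ⟶ X₂} {v₂ : Y ⟶ Y₂}
    {h₂ : u₂ ≫ f₂ = f ≫ v₂} {u₂' : X₂ ⟶ X'} {v₂' : Y₂ ⟶ Y'} {h₂' : u₂' ≫ f' = f₂ ≫ v₂'}
    (h : f ≫ v₁ ≫ v₁' = f ≫ v₂ ≫ v₂') :
    imgMap u₁ v₁ h₁ ≫ imgMap u₁' v₁' h₁' = imgMap u₂ v₂ h₂ ≫ imgMap u₂' v₂' h₂' := by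
  apply img_ext
  rw [imgMap_comp, imgMap_comp, imgMap_ι, imgMap_ι, image.fac_assoc, image.fac_assoc, h]

end Images

section VirtualTruncation

variable {C : Type u} [Category.{v} C] [Preadditive C] [HasZeroObject C] [HasShift C ℤ]
  [∀ n : ℤ, (shiftFunctor C n).Additive] [Pretriangulated C]
  {A : Type u'} [Category.{v'} A] [Abelian A]

namespace WeightStructure

variable (w : WeightStructure C)

/-- `τ_{≤ k} H : X ↦ Im (H (w_{≤ k} X) ⟶ H (w_{≤ k+1} X))`. -/
def tauLEObj (k : ℤ) (H : Cᵒᵖ ⥤ A) : Cᵒᵖ ⥤ A where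
  obj X := image (H.map (w.leMap (𝟙 X.unop) (by lia : k ≤ k + 1)).op)
  map {X Y} g := imgMap (H.map (w.leMap g.unop le_rfl).op) (H.map (w.leMap g.unop le_rfl).op) (by
    rw [← H.map_comp, ← H.map_comp, ← op_comp, ← op_comp,
      w.leMap_comp _ _ _ _ (by lia) g.unop (by simp), w.leMap_comp _ _ _ _ (by lia) g.unop (by simp)])
  map_id X := by
    apply img_ext
    rw [imgMap_ι, Category.id_comp, image.fac, image.fac_assoc, ← H.map_comp, ← op_comp,
      w.leMap_comp _ _ _ _ (by lia) (𝟙 X.unop) (by simp)]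
  map_comp {X Y Z} f g := by
    apply img_ext
    rw [imgMap_ι, Category.assoc, imgMap_ι, ← Category.assoc (imgMap _ _ _) (image.ι _), imgMap_ι,
      image.fac_assoc, Category.assoc, image.fac_assoc, ← H.map_comp, ← H.map_comp, ← H.map_comp,
      ← op_comp, ← op_comp, ← op_comp, Category.assoc,
      w.leMap_comp f.unop _ _ _ (by lia) f.unop (by simp),
      w.leMap_comp _ _ _ _ (by lia) (f ≫ g).unop (by simp),
      w.leMap_comp _ _ _ _ (by lia) (f ≫ g).unop (by simp)]

/-- `τ_{≥ k} H : X ↦ Im (H (w_{≥ k-1} X) ⟶ H (w_{≥ k} X))`. -/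
def tauGEObj (k : ℤ) (H : Cᵒᵖ ⥤ A) : Cᵒᵖ ⥤ A where
  obj X := image (H.map (w.geMap (𝟙 X.unop) (by lia : k - 1 ≤ k)).op)
  map {X Y} g := imgMap (H.map (w.geMap g.unop le_rfl).op) (H.map (w.geMap g.unop le_rfl).op) (by
    rw [← H.map_comp, ← H.map_comp, ← op_comp, ← op_comp,
      w.geMap_comp _ _ _ _ (by lia) g.unop (by simp), w.geMap_comp _ _ _ _ (by lia) g.unop (by simp)])
  map_id X := by
    apply img_ext
    rw [imgMap_ι, Category.id_comp, image.fac, image.fac_assoc, ← H.map_comp, ← op_comp,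
      w.geMap_comp _ _ _ _ (by lia) (𝟙 X.unop) (by simp)]
  map_comp {X Y Z} f g := by
    apply img_ext
    rw [imgMap_ι, Category.assoc, imgMap_ι, ← Category.assoc (imgMap _ _ _) (image.ι _), imgMap_ι,
      image.fac_assoc, Category.assoc, image.fac_assoc, ← H.map_comp, ← H.map_comp, ← H.map_comp,
      ← op_comp, ← op_comp, ← op_comp, Category.assoc,
      w.geMap_comp f.unop _ _ _ (by lia) f.unop (by simp),
      w.geMap_comp _ _ _ _ (by lia) (f ≫ g).unop (by simp),
      w.geMap_comp _ _ _ _ (by lia) (f ≫ g).unop (by simp)]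

variable (A)

/-- The virtual `t`-truncation `τ_{≤ k}`, as a functor of `H`. -/
def tauLE (k : ℤ) : (Cᵒᵖ ⥤ A) ⥤ (Cᵒᵖ ⥤ A) where
  obj H := w.tauLEObj k H
  map {H H'} α :=
    { app X := imgMap (f := H.map (w.leMap (𝟙 X.unop) (by lia : k ≤ k + 1)).op)
        (f' := H'.map (w.leMap (𝟙 X.unop) (by lia : k ≤ k + 1)).op) (α.app _) (α.app _) (by simp)
      naturality X Y g := by
        apply img_ext
        dsimp only [tauLEObj]
        rw [Category.assoc, imgMap_ι, Category.assoc, imgMap_ι,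
          ← Category.assoc (imgMap _ _ _) (image.ι _), imgMap_ι,
          ← Category.assoc (imgMap _ _ _) (image.ι _), imgMap_ι]
        simp }
  map_id H := by
    ext X
    apply img_ext
    dsimp only [tauLEObj]
    rw [imgMap_ι]
    simp
  map_comp α β := by
    ext X
    exact (imgMap_comp _ _ _ _ _ _).symm

/-- The virtual `t`-truncation `τ_{≥ k}`, as a functor of `H`. -/
def tauGE (k : ℤ) : (Cᵒᵖ ⥤ A) ⥤ (Cᵒᵖ ⥤ A) where
  obj H := w.tauGEObj k H
  map {H H'} α :=
    { app X := imgMap (f := H.map (w.geMap (𝟙 X.unop) (by lia : k - 1 ≤ k)).op)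
        (f' := H'.map (w.geMap (𝟙 X.unop) (by lia : k - 1 ≤ k)).op) (α.app _) (α.app _) (by simp)
      naturality X Y g := by
        apply img_ext
        dsimp only [tauGEObj]
        rw [Category.assoc, imgMap_ι, Category.assoc, imgMap_ι,
          ← Category.assoc (imgMap _ _ _) (image.ι _), imgMap_ι,
          ← Category.assoc (imgMap _ _ _) (image.ι _), imgMap_ι]
        simp }
  map_id H := by
    ext X
    apply img_ext
    dsimp only [tauGEObj]
    rw [imgMap_ι]
    simp
  map_comp α β := by
    ext X
    exact (imgMap_comp _ _ _ _ _ _).symm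

/-- `τ_{[m, k]} H = τ_{≤ k} (τ_{≥ m} H)`. -/
def tauIcc (m k : ℤ) : (Cᵒᵖ ⥤ A) ⥤ (Cᵒᵖ ⥤ A) := w.tauGE A m ⋙ w.tauLE A k

/-- The transformation `τ_{≤ k} H ⟶ H`, induced by `X ⟶ w_{≤ k+1} X`. -/
def tauLEι (k : ℤ) : w.tauLE A k ⟶ 𝟭 (Cᵒᵖ ⥤ A) where
  app H :=
    { app X := image.ι (H.map (w.leMap (𝟙 X.unop) (by lia : k ≤ k + 1)).op) ≫
        H.map (w.leπ (k + 1) X.unop).op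
      naturality X Y g := by
        dsimp only [tauLEObj, tauLE, Functor.id_obj]
        rw [← Category.assoc, imgMap_ι, Category.assoc, Category.assoc, ← H.map_comp, ← op_comp,
          leπ_leMap, op_comp, H.map_comp, Quiver.Hom.op_unop] }
  naturality H H' α := by
    ext X
    refine (Category.assoc _ _ _).symm.trans ((congrArg (· ≫ _) (imgMap_ι _ _ _)).trans ?_)
    change (_ ≫ _) ≫ _ = (_ ≫ _) ≫ _
    rw [Category.assoc, Category.assoc, ← α.naturality]
    rfl

/-- The transformation `H ⟶ τ_{≥ k} H`, induced by `w_{≥ k-1} X ⟶ X`. -/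
def tauGEπ (k : ℤ) : 𝟭 (Cᵒᵖ ⥤ A) ⟶ w.tauGE A k where
  app H :=
    { app X := H.map (w.geι (k - 1) X.unop).op ≫
        factorThruImage (H.map (w.geMap (𝟙 X.unop) (by lia : k - 1 ≤ k)).op)
      naturality X Y g := by
        dsimp only [tauGEObj, tauGE, Functor.id_obj]
        rw [Category.assoc, fac_imgMap, ← Category.assoc, ← Category.assoc, ← H.map_comp,
          ← H.map_comp, ← op_comp, geMap_geι, op_comp, Quiver.Hom.op_unop] }
  naturality H H' α := by
    ext X
    refine Eq.trans ?_ ((congrArg (_ ≫ ·) (fac_imgMap _ _ _)).symm.trans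
      (Category.assoc _ _ _).symm)
    exact (NatTrans.naturality_assoc α _ _).symm

/-- The transformation `τ_{≥ k} H ⟶ τ_{≥ k'} H` for `k ≤ k'`, induced by `id_X`. -/
def tauGETrans (k k' : ℤ) (h : k ≤ k') : w.tauGE A k ⟶ w.tauGE A k' where
  app H :=
    { app X := imgMap (f := H.map (w.geMap (𝟙 X.unop) (by lia : k - 1 ≤ k)).op)
        (f' := H.map (w.geMap (𝟙 X.unop) (by lia : k' - 1 ≤ k')).op)
        (H.map (w.geMap (𝟙 X.unop) (by lia : k - 1 ≤ k' - 1)).op)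
        (H.map (w.geMap (𝟙 X.unop) h).op) (by
          rw [← H.map_comp, ← H.map_comp, ← op_comp, ← op_comp,
            w.geMap_comp _ _ _ _ (by lia) (𝟙 _) (by simp),
            w.geMap_comp _ _ _ _ (by lia) (𝟙 _) (by simp)])
      naturality X Y g := by
        apply img_ext
        dsimp only [tauGEObj, tauGE]
        rw [Category.assoc, imgMap_ι, Category.assoc, imgMap_ι,
          ← Category.assoc (imgMap _ _ _) (image.ι _), imgMap_ι,
          ← Category.assoc (imgMap _ _ _) (image.ι _), imgMap_ι,
          Category.assoc, image.fac_assoc, Category.assoc, image.fac_assoc,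
          ← H.map_comp, ← H.map_comp, ← H.map_comp, ← H.map_comp,
          ← op_comp, ← op_comp, ← op_comp, ← op_comp]
        congr 2
        rw [Category.assoc, Category.assoc, w.geMap_comp _ (𝟙 _) _ _ (by lia) g.unop (by simp),
          w.geMap_comp _ (𝟙 _) _ _ (by lia) (𝟙 _) (by simp),
          w.geMap_comp _ _ _ _ (by lia) g.unop (by simp),
          w.geMap_comp _ _ _ _ (by lia) g.unop (by simp)] }
  naturality H H' α := by
    ext X
    apply img_ext
    dsimp only [tauGEObj, tauGE, NatTrans.comp_app]
    rw [Category.assoc, imgMap_ι, Category.assoc, imgMap_ι,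
      ← Category.assoc (imgMap _ _ _) (image.ι _), imgMap_ι,
      ← Category.assoc (imgMap _ _ _) (image.ι _), imgMap_ι]
    simp

end WeightStructure

end VirtualTruncation

section Shifts

variable {C : Type u} [Category.{v} C] [Preadditive C] [HasZeroObject C] [HasShift C ℤ]
  [∀ n : ℤ, (shiftFunctor C n).Additive] [Pretriangulated C]

/-- The canonical isomorphism `X[a][b] ≅ X[c][d]` for `a + b = c + d`. -/
def shIso (a b c d : ℤ) (h : a + b = c + d) :
    shiftFunctor C a ⋙ shiftFunctor C b ≅ shiftFunctor C c ⋙ shiftFunctor C d :=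
  (shiftFunctorAdd' C a b (a + b) rfl).symm ≪≫ shiftFunctorAdd' C c d (a + b) h.symm

variable (C) (A : Type u') [Category.{v'} A] [Abelian A]

/-- `H ↦ (X ↦ H (X[n]))`. -/
def precomp (n : ℤ) : (Cᵒᵖ ⥤ A) ⥤ (Cᵒᵖ ⥤ A) :=
  (Functor.whiskeringLeft Cᵒᵖ Cᵒᵖ A).obj (shiftFunctor C n).op

/-- `H ↦ H^n`, where `H^n (X) = H (X[-n])`. -/
def coh (n : ℤ) : (Cᵒᵖ ⥤ A) ⥤ (Cᵒᵖ ⥤ A) := precomp C A (-n)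

/-- The canonical transformation `H (X[a][b]) ⟶ H (X[c][d])` for `a + b = c + d`. -/
def shTrans (a b c d : ℤ) (h : a + b = c + d) :
    precomp C A b ⋙ precomp C A a ⟶ precomp C A d ⋙ precomp C A c where
  app H :=
    { app X := H.map ((shIso c d a b h.symm).hom.app X.unop).op
      naturality X Y g := by
        change H.map _ ≫ H.map _ = H.map _ ≫ H.map _
        rw [← H.map_comp, ← H.map_comp]
        congr 1
        exact congrArg Quiver.Hom.op ((shIso c d a b h.symm).hom.naturality g.unop).symm }
  naturality H H' α := by
    ext X
    exact (α.naturality _).symm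

variable {C} (w : WeightStructure C)

namespace WeightStructure

lemma exists_bd (k l : ℤ) (h : l ≤ k) (X : C) :
    ∃ t : (w.dec k X).P⟦(1 : ℤ)⟧ ⟶ w.geObj l (X⟦(1 : ℤ)⟧),
      t ≫ w.geι l (X⟦(1 : ℤ)⟧) = (w.dec k X).ι⟦(1 : ℤ)⟧' :=
  (w.dec (l - 1) (X⟦(1 : ℤ)⟧)).exists_lift
    (w.ge_shift (by lia : 1 + k = k + 1) (w.dec k X).ge) (by lia) _

/-- The morphism `w_{≤ k} X ⟶ (w_{≥ k+1} X)[1] ⟶ w_{≥ l} (X[1])` for `l ≤ k`. -/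
def bd (k l : ℤ) (h : l ≤ k) (X : C) : w.leObj k X ⟶ w.geObj l (X⟦(1 : ℤ)⟧) :=
  (w.dec k X).δ ≫ (w.exists_bd k l h X).choose

lemma leMap_bd {X X' : C} (g : X ⟶ X') {k k' l l' : ℤ} (hk : k' < k) (h₁ : l ≤ k') (h₂ : l' ≤ k)
    (hl : l ≤ l') :
    w.leMap g hk.le ≫ w.bd k' l h₁ X' = w.bd k l' h₂ X ≫ w.geMap (g⟦(1 : ℤ)⟧') hl := by
  obtain ⟨a, ha⟩ := (w.dec k' X').exists_lift (w.dec k X).ge (by lia) ((w.dec k X).ι ≫ g)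
  obtain ⟨c, hc₁, hc₂⟩ : ∃ c : (w.dec k X).Q ⟶ (w.dec k' X').Q,
      (w.dec k X).π ≫ c = g ≫ (w.dec k' X').π ∧
        (w.dec k X).δ ≫ a⟦(1 : ℤ)⟧' = c ≫ (w.dec k' X').δ :=
    complete_distinguished_triangle_morphism _ _ (w.dec k X).dist (w.dec k' X').dist a g ha.symm
  have hc : w.leMap g hk.le = c := by
    apply w.leObj_ext (w.le_leObj _ _) hk
    rw [leπ_leMap]
    exact hc₁.symm
  have h3 : a⟦(1 : ℤ)⟧' ≫ (w.exists_bd k' l h₁ X').choose =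
      (w.exists_bd k l' h₂ X).choose ≫ w.geMap (g⟦(1 : ℤ)⟧') hl := by
    apply w.geObj_ext (w.ge_shift (by lia : 1 + k = k + 1) (w.dec k X).ge) (by lia)
    rw [Category.assoc, Category.assoc, geMap_geι, (w.exists_bd k' l h₁ X').choose_spec,
      ← Category.assoc, (w.exists_bd k l' h₂ X).choose_spec, ← Functor.map_comp,
      ← Functor.map_comp, ha]
  rw [hc, bd, bd, Category.assoc, ← h3, ← Category.assoc, ← Category.assoc, hc₂]

/-- The connecting transformation `(τ_{≥ k+1} H) ∘ [1] ⟶ τ_{≤ k} H` of the long exact sequence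
`⋯ ⟶ (τ_{≥ k+1} H) ∘ [1] ⟶ τ_{≤ k} H ⟶ H ⟶ τ_{≥ k+1} H ⟶ ⋯`. It is induced by
`w_{≤ k} X ⟶ (w_{≥ k+1} X)[1]` and `w_{≤ k+1} X ⟶ (w_{≥ k+2} X)[1]`. -/
def tauδ (k k' : ℤ) (h : k + 1 = k') : w.tauGE A k' ⋙ precomp C A 1 ⟶ w.tauLE A k where
  app H :=
    { app X := imgMap
        (f := H.map (w.geMap (𝟙 (X.unop⟦(1 : ℤ)⟧)) (by lia : k' - 1 ≤ k')).op)
        (f' := H.map (w.leMap (𝟙 X.unop) (by lia : k ≤ k + 1)).op)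
        (H.map (w.bd k (k' - 1) (by lia) X.unop).op)
        (H.map (w.bd (k + 1) k' (by lia) X.unop).op) (by
          rw [← H.map_comp, ← H.map_comp, ← op_comp, ← op_comp,
            w.leMap_bd (𝟙 X.unop) (by lia) (by lia) (by lia : k' ≤ k + 1) (by lia),
            CategoryTheory.Functor.map_id])
      naturality X Y g := by
        refine imgMap_comp_eq ?_
        change H.map (w.geMap (𝟙 (X.unop⟦(1 : ℤ)⟧)) (by lia : k' - 1 ≤ k')).op ≫
          H.map (w.geMap (g.unop⟦(1 : ℤ)⟧') le_rfl).op ≫ _ =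
            H.map (w.geMap (𝟙 (X.unop⟦(1 : ℤ)⟧)) (by lia : k' - 1 ≤ k')).op ≫ _
        rw [← H.map_comp, ← H.map_comp, ← H.map_comp, ← H.map_comp, ← op_comp, ← op_comp,
          ← op_comp, ← op_comp]
        congr 2
        rw [Category.assoc, Category.assoc, w.geMap_comp _ _ _ _ (by lia) (g.unop⟦(1 : ℤ)⟧') (by simp),
          ← w.leMap_bd g.unop (by lia : k < k + 1) (by lia) (by lia) (by lia)]
        have := w.leMap_bd (𝟙 X.unop) (by lia : k < k + 1) (by lia : k' - 1 ≤ k)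
          (by lia : k' ≤ k + 1) (by lia)
        rw [CategoryTheory.Functor.map_id] at this
        rw [← this, ← Category.assoc, w.leMap_comp _ _ _ _ (by lia) g.unop (by simp)] }
  naturality H H' α := by
    ext X
    refine (imgMap_comp _ _ _ _ _ _).trans (Eq.trans ?_ (imgMap_comp _ _ _ _ _ _).symm)
    congr 1
    · exact (α.naturality _).symm
    · exact (α.naturality _).symm

lemma exists_leSh (n l l' : ℤ) (h : l' + n ≤ l) (X : C) :
    ∃ t : (w.leObj l X)⟦n⟧ ⟶ w.leObj l' (X⟦n⟧), (w.leπ l X)⟦n⟧' ≫ t = w.leπ l' (X⟦n⟧) :=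
  ((w.dec l X).shift n (l - n) (by lia)).exists_desc (w.le_leObj l' (X⟦n⟧)) (by lia) _

/-- A morphism `(w_{≤ l} X)[n] ⟶ w_{≤ l'} (X[n])` compatible with `id_{X[n]}`. -/
def leSh (n l l' : ℤ) (h : l' + n ≤ l) (X : C) : (w.leObj l X)⟦n⟧ ⟶ w.leObj l' (X⟦n⟧) :=
  (w.exists_leSh n l l' h X).choose

lemma leπ_leSh (n l l' : ℤ) (h : l' + n ≤ l) (X : C) :
    (w.leπ l X)⟦n⟧' ≫ w.leSh n l l' h X = w.leπ l' (X⟦n⟧) :=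
  (w.exists_leSh n l l' h X).choose_spec

lemma leSh_comp {X X' : C} (g : X ⟶ X') (n : ℤ) {l m a b : ℤ} (h₁ : a + n ≤ l) (h₂ : b ≤ a)
    (h₃ : m ≤ l) (h₄ : b + n ≤ m) (h : b + n < l) :
    w.leSh n l a h₁ X ≫ w.leMap (g⟦n⟧') h₂ = (w.leMap g h₃)⟦n⟧' ≫ w.leSh n m b h₄ X' := by
  apply ((w.dec l X).shift n (l - n) (by lia)).desc_unique (w.le_leObj b (X'⟦n⟧)) (by lia)
  change (w.leπ l X)⟦n⟧' ≫ _ = (w.leπ l X)⟦n⟧' ≫ _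
  rw [← Category.assoc, leπ_leSh, leπ_leMap, ← Category.assoc, ← Functor.map_comp, leπ_leMap,
    Functor.map_comp, Category.assoc, leπ_leSh]

/-- The canonical transformation `(τ_{≤ k'} H)(X[n]) ⟶ (τ_{≤ k} (H ∘ [n]))(X)` for
`k' + n = k`, induced by `id_{X[n]}`. -/
def tauLESh (n k k' : ℤ) (h : k' + n = k) :
    w.tauLE A k' ⋙ precomp C A n ⟶ precomp C A n ⋙ w.tauLE A k where
  app H :=
    { app X := imgMap
        (f := H.map (w.leMap (𝟙 (X.unop⟦n⟧)) (by lia : k' ≤ k' + 1)).op)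
        (f' := H.map ((w.leMap (𝟙 X.unop) (by lia : k ≤ k + 1))⟦n⟧').op)
        (H.map (w.leSh n k k' (by lia) X.unop).op)
        (H.map (w.leSh n (k + 1) (k' + 1) (by lia) X.unop).op) (by
          rw [← H.map_comp, ← H.map_comp, ← op_comp, ← op_comp,
            ← w.leSh_comp (𝟙 X.unop) n (by lia : k' + 1 + n ≤ k + 1) (by lia) (by lia) (by lia)
              (by lia), CategoryTheory.Functor.map_id])
      naturality X Y g := by
        refine imgMap_comp_eq ?_
        change H.map (w.leMap (𝟙 (X.unop⟦n⟧)) (by lia : k' ≤ k' + 1)).op ≫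
          H.map (w.leMap (g.unop⟦n⟧') le_rfl).op ≫ _ =
            H.map (w.leMap (𝟙 (X.unop⟦n⟧)) (by lia : k' ≤ k' + 1)).op ≫ _ ≫
              H.map ((w.leMap g.unop le_rfl)⟦n⟧').op
        rw [← H.map_comp, ← H.map_comp, ← H.map_comp, ← H.map_comp, ← op_comp, ← op_comp,
          ← op_comp, ← op_comp]
        congr 2
        rw [Category.assoc, Category.assoc,
          w.leMap_comp _ _ _ _ (by lia) (g.unop⟦n⟧') (by simp),
          w.leSh_comp g.unop n _ _ (by lia : k ≤ k + 1) (by lia) (by lia)]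
        have := w.leSh_comp (𝟙 X.unop) n (by lia : k' + 1 + n ≤ k + 1) (by lia : k' ≤ k' + 1)
          (by lia : k ≤ k + 1) (by lia) (by lia)
        rw [CategoryTheory.Functor.map_id] at this
        rw [this, ← Category.assoc, ← Functor.map_comp,
          w.leMap_comp _ _ _ _ (by lia) g.unop (by simp)] }
  naturality H H' α := by
    ext X
    refine (imgMap_comp _ _ _ _ _ _).trans (Eq.trans ?_ (imgMap_comp _ _ _ _ _ _).symm)
    congr 1
    · exact (α.naturality _).symm
    · exact (α.naturality _).symm

lemma exists_geSh (n l l' : ℤ) (h : l ≤ l' + n) (X : C) :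
    ∃ t : w.geObj l' (X⟦n⟧) ⟶ (w.geObj l X)⟦n⟧, t ≫ (w.geι l X)⟦n⟧' = w.geι l' (X⟦n⟧) :=
  ((w.dec (l - 1) X).shift n (l - 1 - n) (by lia)).exists_lift (w.ge_geObj l' (X⟦n⟧)) (by lia) _

/-- A morphism `w_{≥ l'} (X[n]) ⟶ (w_{≥ l} X)[n]` compatible with `id_{X[n]}`. -/
def geSh (n l l' : ℤ) (h : l ≤ l' + n) (X : C) : w.geObj l' (X⟦n⟧) ⟶ (w.geObj l X)⟦n⟧ :=
  (w.exists_geSh n l l' h X).choose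

lemma geSh_geι (n l l' : ℤ) (h : l ≤ l' + n) (X : C) :
    w.geSh n l l' h X ≫ (w.geι l X)⟦n⟧' = w.geι l' (X⟦n⟧) :=
  (w.exists_geSh n l l' h X).choose_spec

lemma geSh_comp {X X' : C} (g : X ⟶ X') (n : ℤ) {l m a b : ℤ} (h₁ : l ≤ a + n) (h₂ : b ≤ a)
    (h₃ : m ≤ l) (h₄ : m ≤ b + n) (h : m < a + n) :
    w.geSh n l a h₁ X ≫ (w.geMap g h₃)⟦n⟧' = w.geMap (g⟦n⟧') h₂ ≫ w.geSh n m b h₄ X' := by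
  apply ((w.dec (m - 1) X').shift n (m - 1 - n) (by lia)).lift_unique (w.ge_geObj a (X⟦n⟧)) (by lia)
  change (_ ≫ _) ≫ (w.geι m X')⟦n⟧' = (_ ≫ _) ≫ (w.geι m X')⟦n⟧'
  rw [Category.assoc, Category.assoc, geSh_geι, ← Functor.map_comp, geMap_geι, geMap_geι,
    Functor.map_comp, ← Category.assoc, geSh_geι]

/-- The canonical transformation `(τ_{≥ k} (H ∘ [n]))(X) ⟶ (τ_{≥ k'} H)(X[n])` for
`k' + n = k`, induced by `id_{X[n]}`. -/
def tauGESh (n k k' : ℤ) (h : k' + n = k) :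
    precomp C A n ⋙ w.tauGE A k ⟶ w.tauGE A k' ⋙ precomp C A n where
  app H :=
    { app X := imgMap
        (f := H.map ((w.geMap (𝟙 X.unop) (by lia : k - 1 ≤ k))⟦n⟧').op)
        (f' := H.map (w.geMap (𝟙 (X.unop⟦n⟧)) (by lia : k' - 1 ≤ k')).op)
        (H.map (w.geSh n (k - 1) (k' - 1) (by lia) X.unop).op)
        (H.map (w.geSh n k k' (by lia) X.unop).op) (by
          rw [← H.map_comp, ← H.map_comp, ← op_comp, ← op_comp,
            w.geSh_comp (𝟙 X.unop) n (by lia : k ≤ k' + n) (by lia : k' - 1 ≤ k') (by lia) (by lia)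
              (by lia), CategoryTheory.Functor.map_id])
      naturality X Y g := by
        refine imgMap_comp_eq ?_
        change H.map ((w.geMap (𝟙 X.unop) (by lia : k - 1 ≤ k))⟦n⟧').op ≫
          H.map ((w.geMap g.unop le_rfl)⟦n⟧').op ≫ _ =
            H.map ((w.geMap (𝟙 X.unop) (by lia : k - 1 ≤ k))⟦n⟧').op ≫ _ ≫
              H.map (w.geMap (g.unop⟦n⟧') le_rfl).op
        rw [← H.map_comp, ← H.map_comp, ← H.map_comp, ← H.map_comp, ← op_comp, ← op_comp,
          ← op_comp, ← op_comp]
        congr 2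
        rw [Category.assoc, Category.assoc, ← Functor.map_comp,
          w.geMap_comp _ _ _ _ (by lia) g.unop (by simp),
          w.geSh_comp (𝟙 X.unop) n (by lia : k ≤ k' + n) (by lia : k' - 1 ≤ k') (by lia) (by lia)
            (by lia), ← Category.assoc, CategoryTheory.Functor.map_id,
          w.geMap_comp _ _ _ _ (by lia) (g.unop⟦n⟧') (by simp),
          w.geSh_comp g.unop n _ (by lia : k' - 1 ≤ k') _ (by lia) (by lia)] }
  naturality H H' α := by
    ext X
    refine (imgMap_comp _ _ _ _ _ _).trans (Eq.trans ?_ (imgMap_comp _ _ _ _ _ _).symm)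
    congr 1
    · exact (α.naturality _).symm
    · exact (α.naturality _).symm

end WeightStructure

end Shifts

section Couples

variable (A : Type u') [Category.{v'} A] [Abelian A]

/-- Two bigraded families of objects `D`, `E` with morphisms `i : D ⟶ D`, `j : D ⟶ E`, `k : E ⟶ D`
of bidegrees `(-1, 1)`, `(r - 1, 1 - r)` and `(1, 0)`. -/
structure CoupleData (r : ℤ) where
  D : ℤ × ℤ → A
  E : ℤ × ℤ → A
  i : ∀ a b : ℤ × ℤ, a + (-1, 1) = b → (D a ⟶ D b)
  j : ∀ a b : ℤ × ℤ, a + (r - 1, 1 - r) = b → (D a ⟶ E b)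
  k : ∀ a b : ℤ × ℤ, a + (1, 0) = b → (E a ⟶ D b)

variable {A}

namespace CoupleData

/-- Morphisms of couples. -/
@[ext]
structure Hom {r : ℤ} (S T : CoupleData A r) where
  hD : ∀ a, S.D a ⟶ T.D a
  hE : ∀ a, S.E a ⟶ T.E a
  comm_i : ∀ a b h, S.i a b h ≫ hD b = hD a ≫ T.i a b h
  comm_j : ∀ a b h, S.j a b h ≫ hE b = hD a ≫ T.j a b h
  comm_k : ∀ a b h, S.k a b h ≫ hD b = hE a ≫ T.k a b h

/-- Composition of morphisms of couples. -/
def Hom.comp {r : ℤ} {S T U : CoupleData A r} (f : Hom S T) (g : Hom T U) : Hom S U where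
  hD a := f.hD a ≫ g.hD a
  hE a := f.hE a ≫ g.hE a
  comm_i a b h := by rw [← Category.assoc, f.comm_i, Category.assoc, g.comm_i, Category.assoc]
  comm_j a b h := by rw [← Category.assoc, f.comm_j, Category.assoc, g.comm_j, Category.assoc]
  comm_k a b h := by rw [← Category.assoc, f.comm_k, Category.assoc, g.comm_k, Category.assoc]

instance {r : ℤ} : Category (CoupleData A r) where
  Hom := Hom
  id S := ⟨fun _ => 𝟙 _, fun _ => 𝟙 _, by simp, by simp, by simp⟩
  comp := Hom.comp
  id_comp f := Hom.ext (funext fun _ => Category.id_comp _) (funext fun _ => Category.id_comp _)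
  comp_id f := Hom.ext (funext fun _ => Category.comp_id _) (funext fun _ => Category.comp_id _)
  assoc f g h := Hom.ext (funext fun _ => Category.assoc _ _ _) (funext fun _ => Category.assoc _ _ _)

end CoupleData

variable (A)

/-- Exact couples, bigraded as on the `r`-th page of a cohomological spectral sequence. -/
structure ExactCouple (r : ℤ) extends CoupleData A r where
  zero_ij : ∀ a b c hab hbc, i a b hab ≫ j b c hbc = 0
  zero_jk : ∀ a b c hab hbc, j a b hab ≫ k b c hbc = 0
  zero_ki : ∀ a b c hab hbc, k a b hab ≫ i b c hbc = 0
  exact_ij : ∀ a b c hab hbc, (ShortComplex.mk _ _ (zero_ij a b c hab hbc)).Exact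
  exact_jk : ∀ a b c hab hbc, (ShortComplex.mk _ _ (zero_jk a b c hab hbc)).Exact
  exact_ki : ∀ a b c hab hbc, (ShortComplex.mk _ _ (zero_ki a b c hab hbc)).Exact

variable {A}

namespace ExactCouple

instance {r : ℤ} : Category (ExactCouple A r) where
  Hom S T := CoupleData.Hom S.toCoupleData T.toCoupleData
  id S := 𝟙 S.toCoupleData
  comp f g := CoupleData.Hom.comp f g
  id_comp f := Category.id_comp (obj := CoupleData A r) f
  comp_id f := Category.comp_id (obj := CoupleData A r) f
  assoc f g h := Category.assoc (obj := CoupleData A r) f g h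

/-- The functor forgetting exactness. -/
def forget (A : Type u') [Category.{v'} A] [Abelian A] (r : ℤ) : ExactCouple A r ⥤ CoupleData A r where
  obj S := S.toCoupleData
  map f := f

variable {r : ℤ}

/-- The complex `(E, d = j ∘ k)`. -/
@[reducible]
def complex (S : ExactCouple A r) :
    HomologicalComplex A (ComplexShape.up' (⟨r, 1 - r⟩ : ℤ × ℤ)) where
  X := S.E
  d a b := if h : a + (r, 1 - r) = b then S.k a (a + (1, 0)) rfl ≫ S.j (a + (1, 0)) b (by
    rw [← h]; ext <;> simp) else 0
  shape a b h := dif_neg h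
  d_comp_d' a b c h h' := by
    rw [dif_pos (show a + (r, 1 - r) = b from h), dif_pos (show b + (r, 1 - r) = c from h'), Category.assoc, ← Category.assoc (S.j _ _ _), S.zero_jk, zero_comp,
      comp_zero]

lemma complex_d (S : ExactCouple A r) {a b c : ℤ × ℤ} (h : a + (1, 0) = b)
    (h' : b + (r - 1, 1 - r) = c) : S.complex.d a c = S.k a b h ≫ S.j b c h' := by
  subst h
  exact dif_pos (by rw [← h']; ext <;> simp)

/-- The morphism of complexes induced by a morphism of exact couples. -/
def complexMap {S T : ExactCouple A r} (f : S ⟶ T) : S.complex ⟶ T.complex where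
  f := CoupleData.Hom.hE f
  comm' a b h := by
    have h' : a + (1, 0) + (r - 1, 1 - r) = b := by
      rw [← (show a + (r, 1 - r) = b from h)]; ext <;> simp
    rw [complex_d _ rfl h', complex_d _ rfl h', Category.assoc]
    rw [CoupleData.Hom.comm_j f, ← Category.assoc, ← Category.assoc, CoupleData.Hom.comm_k f]

variable (S : ExactCouple A r)

lemma lift_ij {a b c : ℤ × ℤ} (hab : a + (-1, 1) = b) (hbc : b + (r - 1, 1 - r) = c) {T : A}
    (x : T ⟶ S.D b) (hx : x ≫ S.j b c hbc = 0) :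
    ∃ (T' : A) (π : T' ⟶ T) (_ : Epi π) (y : T' ⟶ S.D a), π ≫ x = y ≫ S.i a b hab :=
  (S.exact_ij a b c hab hbc).exact_up_to_refinements x hx

lemma lift_jk {a b c : ℤ × ℤ} (hab : a + (r - 1, 1 - r) = b) (hbc : b + (1, 0) = c) {T : A}
    (x : T ⟶ S.E b) (hx : x ≫ S.k b c hbc = 0) :
    ∃ (T' : A) (π : T' ⟶ T) (_ : Epi π) (y : T' ⟶ S.D a), π ≫ x = y ≫ S.j a b hab :=
  (S.exact_jk a b c hab hbc).exact_up_to_refinements x hx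

lemma lift_ki {a b c : ℤ × ℤ} (hab : a + (1, 0) = b) (hbc : b + (-1, 1) = c) {T : A}
    (x : T ⟶ S.D b) (hx : x ≫ S.i b c hbc = 0) :
    ∃ (T' : A) (π : T' ⟶ T) (_ : Epi π) (y : T' ⟶ S.E a), π ≫ x = y ≫ S.k a b hab :=
  (S.exact_ki a b c hab hbc).exact_up_to_refinements x hx

/-- `D'` of the derived couple: the image of `i`. -/
abbrev derD (a : ℤ × ℤ) : A := image (S.i (a + (1, -1)) a (by ext <;> simp))

/-- The inclusion `D' ⟶ D`. -/
def derι (a : ℤ × ℤ) : S.derD a ⟶ S.D a := image.ι _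

instance (a : ℤ × ℤ) : Mono (S.derι a) := by unfold derι; infer_instance

/-- The projection `D ⟶ D'` induced by `i`. -/
def derπ (a b : ℤ × ℤ) (h : a + (-1, 1) = b) : S.D a ⟶ S.derD b :=
  eqToHom (congrArg S.D (by rw [← h]; ext <;> simp)) ≫
    factorThruImage (S.i (b + (1, -1)) b (by ext <;> simp))

instance (a b : ℤ × ℤ) (h : a + (-1, 1) = b) : Epi (S.derπ a b h) := by
  unfold derπ; infer_instance

lemma derπ_derι (a b : ℤ × ℤ) (h : a + (-1, 1) = b) : S.derπ a b h ≫ S.derι b = S.i a b h := by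
  have key : ∀ (a' : ℤ × ℤ) (e : a = a') (h' : a' + (-1, 1) = b),
      (eqToHom (congrArg S.D e) ≫ factorThruImage (S.i a' b h')) ≫ image.ι (S.i a' b h') =
        S.i a b h := by
    intro a' e h'
    subst e
    simp
  exact key _ (by rw [← h]; ext <;> simp) _

lemma i_derπ (a b b' c : ℤ × ℤ) (h : a + (-1, 1) = b) (h' : b + (-1, 1) = c)
    (h₁ : a + (-1, 1) = b') (h₂ : b' + (-1, 1) = c) :
    S.i a b h ≫ S.derπ b c h' = S.i a b' h₁ ≫ S.derπ b' c h₂ := by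
  subst h h₁
  rfl

lemma derι_j (a b : ℤ × ℤ) (h : a + (r - 1, 1 - r) = b) : S.derι a ≫ S.j a b h = 0 := by
  rw [← cancel_epi (S.derπ (a + (1, -1)) a (by ext <;> simp)), ← Category.assoc, derπ_derι,
    S.zero_ij, comp_zero]

lemma k_derπ (a b c : ℤ × ℤ) (h : a + (1, 0) = b) (h' : b + (-1, 1) = c) :
    S.k a b h ≫ S.derπ b c h' = 0 := by
  rw [← cancel_mono (S.derι c), Category.assoc, derπ_derι, S.zero_ki, zero_comp]

lemma j_d (a b c : ℤ × ℤ) (h : a + (r - 1, 1 - r) = b) : S.j a b h ≫ S.complex.d b c = 0 := by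
  by_cases hc : b + (r, 1 - r) = c
  · rw [S.complex_d (b := b + (1, 0)) rfl (by rw [← hc]; ext <;> simp), ← Category.assoc, S.zero_jk,
      zero_comp]
  · rw [S.complex.shape _ _ hc, comp_zero]

/-- `D ⟶ E ⟶ H(E)`, the morphism `j` followed by the passage to homology classes. -/
def jHom (a b : ℤ × ℤ) (h : a + (r - 1, 1 - r) = b) : S.D a ⟶ S.complex.homology b :=
  S.complex.liftCycles (S.j a b h) _ rfl (S.j_d a b _ h) ≫ S.complex.homologyπ b

lemma k_jHom (a b c : ℤ × ℤ) (h : a + (1, 0) = b) (h' : b + (r - 1, 1 - r) = c) :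
    S.k a b h ≫ S.jHom b c h' = 0 := by
  rw [jHom, ← Category.assoc, HomologicalComplex.comp_liftCycles]
  apply S.complex.liftCycles_homologyπ_eq_zero_of_boundary (i' := a) _ _ _ (𝟙 _)
  rw [Category.id_comp, S.complex_d h h']

lemma derπ_kernel (a b c : ℤ × ℤ) (h : a + (-1, 1) = b) (h' : a + (r - 1, 1 - r) = c) :
    kernel.ι (S.derπ a b h) ≫ S.jHom a c h' = 0 := by
  have h0 : a + (-1, 0) + (1, 0) = a := by ext <;> simp
  obtain ⟨T, π, _, x, hx⟩ := S.lift_ki h0 h (kernel.ι (S.derπ a b h)) (by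
    rw [← derπ_derι, ← Category.assoc, kernel.condition, zero_comp])
  rw [← cancel_epi π, ← Category.assoc, hx, Category.assoc, k_jHom, comp_zero, comp_zero]

/-- `j'` of the derived couple. -/
def derj {r' : ℤ} (hr : r + 1 = r') (a b : ℤ × ℤ) (h : a + (r' - 1, 1 - r') = b) :
    S.derD a ⟶ S.complex.homology b :=
  Abelian.epiDesc (S.derπ (a + (1, -1)) a (by ext <;> simp))
    (S.jHom (a + (1, -1)) b (by rw [← h, ← hr]; ext <;> simp <;> ring)) (S.derπ_kernel _ _ _ _ _)

lemma derπ_derj {r' : ℤ} (hr : r + 1 = r') (a b c : ℤ × ℤ) (h : a + (-1, 1) = b)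
    (h' : b + (r' - 1, 1 - r') = c) (h'' : a + (r - 1, 1 - r) = c) :
    S.derπ a b h ≫ S.derj hr b c h' = S.jHom a c h'' := by
  obtain rfl : a = b + (1, -1) := by rw [← h]; ext <;> simp
  exact Abelian.comp_epiDesc _ _ _

lemma iCycles_k_aux (a b : ℤ × ℤ) (h : a + (1, 0) = b) :
    (S.complex.iCycles a ≫ S.k a b h) ≫ cokernel.π (S.derι b) = 0 := by
  have h0 : b + (1, -1) + (-1, 1) = b := by ext <;> simp
  obtain ⟨T, π, _, x, hx⟩ := S.lift_ij h0 rfl (S.complex.iCycles a ≫ S.k a b h) (by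
    rw [Category.assoc, ← S.complex_d h rfl, HomologicalComplex.iCycles_d])
  rw [← cancel_epi π, ← Category.assoc, hx, ← derπ_derι, Category.assoc, Category.assoc,
    cokernel.condition, comp_zero, comp_zero, comp_zero]

/-- The morphism from cycles in `E` to `D'` induced by `k`. -/
def cyclesk (a b : ℤ × ℤ) (h : a + (1, 0) = b) : S.complex.cycles a ⟶ S.derD b :=
  Abelian.monoLift (S.derι b) (S.complex.iCycles a ≫ S.k a b h) (S.iCycles_k_aux a b h)

lemma cyclesk_derι (a b : ℤ × ℤ) (h : a + (1, 0) = b) :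
    S.cyclesk a b h ≫ S.derι b = S.complex.iCycles a ≫ S.k a b h :=
  Abelian.monoLift_comp _ _ _

lemma toCycles_cyclesk (a b c : ℤ × ℤ) (h : a + (1, 0) = b) :
    S.complex.toCycles c a ≫ S.cyclesk a b h = 0 := by
  rw [← cancel_mono (S.derι b), Category.assoc, cyclesk_derι, ← Category.assoc,
    HomologicalComplex.toCycles_i, zero_comp]
  by_cases hc : c + (r, 1 - r) = a
  · rw [S.complex_d (b := c + (1, 0)) rfl (by rw [← hc]; ext <;> simp), Category.assoc, S.zero_jk,
      comp_zero]
  · rw [S.complex.shape _ _ hc, zero_comp]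

/-- `k'` of the derived couple. -/
def derk (a b : ℤ × ℤ) (h : a + (1, 0) = b) : S.complex.homology a ⟶ S.derD b :=
  (S.complex.homologyIsCokernel _ a rfl).desc (CokernelCofork.ofπ (S.cyclesk a b h)
    (S.toCycles_cyclesk a b _ h))

lemma homologyπ_derk (a b : ℤ × ℤ) (h : a + (1, 0) = b) :
    S.complex.homologyπ a ≫ S.derk a b h = S.cyclesk a b h :=
  (S.complex.homologyIsCokernel _ a rfl).fac _ WalkingParallelPair.one

lemma jHom_derk (a b c : ℤ × ℤ) (h : a + (r - 1, 1 - r) = b) (h' : b + (1, 0) = c) :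
    S.jHom a b h ≫ S.derk b c h' = 0 := by
  rw [jHom, Category.assoc, homologyπ_derk, ← cancel_mono (S.derι c), Category.assoc, cyclesk_derι,
    HomologicalComplex.liftCycles_i_assoc, S.zero_jk, zero_comp]

lemma homology_lift {a : ℤ × ℤ} {T : A} (x : T ⟶ S.complex.homology a) :
    ∃ (T' : A) (π : T' ⟶ T) (_ : Epi π) (y : T' ⟶ S.E a)
      (hy : y ≫ S.complex.d a ((ComplexShape.up' (⟨r, 1 - r⟩ : ℤ × ℤ)).next a) = 0),
      π ≫ x = S.complex.liftCycles y _ rfl hy ≫ S.complex.homologyπ a := by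
  obtain ⟨T', π, _, z, hz⟩ := surjective_up_to_refinements_of_epi (S.complex.homologyπ a) x
  refine ⟨T', π, inferInstance, z ≫ S.complex.iCycles a, by
    rw [Category.assoc, HomologicalComplex.iCycles_d, comp_zero], ?_⟩
  rw [hz]
  congr 1
  rw [← cancel_mono (S.complex.iCycles a), HomologicalComplex.liftCycles_i]

lemma homology_zero {a b c : ℤ × ℤ} (hab : a + (1, 0) = b) (hbc : b + (r - 1, 1 - r) = c) {T : A}
    (y : T ⟶ S.E c) (hy : y ≫ S.complex.d c ((ComplexShape.up' (⟨r, 1 - r⟩ : ℤ × ℤ)).next c) = 0)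
    (h0 : S.complex.liftCycles y _ rfl hy ≫ S.complex.homologyπ c = 0) :
    ∃ (T' : A) (π : T' ⟶ T) (_ : Epi π) (z : T' ⟶ S.E a),
      π ≫ y = z ≫ S.k a b hab ≫ S.j b c hbc := by
  have hac : (ComplexShape.up' (⟨r, 1 - r⟩ : ℤ × ℤ)).Rel a c := by
    change a + (r, 1 - r) = c
    rw [← hbc, ← hab]; ext <;> simp
  obtain ⟨T', π, _, z, hz⟩ :=
    (S.complex.comp_homologyπ_eq_zero_iff_up_to_refinements a c
      ((ComplexShape.up' (⟨r, 1 - r⟩ : ℤ × ℤ)).prev_eq' hac) _).1 h0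
  refine ⟨T', π, inferInstance, z, ?_⟩
  rw [← S.complex_d hab hbc, ← S.complex.toCycles_i, ← Category.assoc, ← hz, Category.assoc,
    HomologicalComplex.liftCycles_i]

/-- The derived couple: `D' = i(D)`, `E' = H(E, j ∘ k)`, `i'` is the restriction of `i`,
`j' (i x) = [j x]` and `k' [y] = k y`. -/
def derive (S : ExactCouple A r) {r' : ℤ} (hr : r + 1 = r') : ExactCouple A r' where
  D := S.derD
  E a := S.complex.homology a
  i a b h := S.derι a ≫ S.derπ a b h
  j a b h := S.derj hr a b h
  k a b h := S.derk a b h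
  zero_ij a b c hab hbc := by
    rw [Category.assoc, S.derπ_derj hr a b c hab hbc (by
      rw [← hbc, ← hab, ← hr]; ext <;> simp <;> ring), jHom, ← Category.assoc,
      HomologicalComplex.comp_liftCycles]
    apply S.complex.liftCycles_homologyπ_eq_zero_of_boundary (i' := c) _ _ _ 0
    rw [zero_comp, derι_j]
  zero_jk a b c hab hbc := by
    rw [← cancel_epi (S.derπ (a + (1, -1)) a (by ext <;> simp)), ← Category.assoc,
      S.derπ_derj hr _ _ _ _ _ (by rw [← hab, ← hr]; ext <;> simp <;> ring), jHom_derk, comp_zero]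
  zero_ki a b c hab hbc := by
    rw [← cancel_epi (S.complex.homologyπ a), ← Category.assoc, homologyπ_derk, ← Category.assoc,
      cyclesk_derι, Category.assoc, k_derπ, comp_zero, comp_zero]
  exact_ij a b c hab hbc := by
    rw [ShortComplex.exact_iff_exact_up_to_refinements]
    intro T (x : T ⟶ S.derD b) (hx : x ≫ S.derj hr b c hbc = 0)
    have h1 : b + (1, -1) + (-1, 1) = b := by ext <;> simp
    have h2 : b + (1, -1) + (r - 1, 1 - r) = c := by
      rw [← hbc, ← hr]; ext <;> simp <;> ring
    obtain ⟨T₁, π₁, _, y, hy⟩ := surjective_up_to_refinements_of_epi (S.derπ _ b h1) x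
    have h3 : S.complex.liftCycles (y ≫ S.j _ c h2) _ rfl (by
        rw [Category.assoc, S.j_d, comp_zero]) ≫ S.complex.homologyπ c = 0 := by
      rw [← S.complex.comp_liftCycles, Category.assoc]
      change y ≫ S.jHom _ _ h2 = 0
      rw [← S.derπ_derj hr _ b c h1 hbc h2, ← Category.assoc, ← hy, Category.assoc, hx, comp_zero]
    have h4 : b + (0, -1) + (1, 0) = b + (1, -1) := by ext <;> simp
    obtain ⟨T₂, π₂, _, z, hz⟩ := S.homology_zero h4 h2 _ _ h3
    obtain ⟨T₃, π₃, _, t, ht⟩ := S.lift_ij (a := a + (1, -1)) (by rw [← hab]; ext <;> simp) h2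
      (π₂ ≫ y - z ≫ S.k _ _ h4) (by
        rw [Preadditive.sub_comp, Category.assoc, hz, Category.assoc, sub_self])
    refine ⟨T₃, π₃ ≫ π₂ ≫ π₁, inferInstance, t ≫ S.derπ _ a (by ext <;> simp), ?_⟩
    change (π₃ ≫ π₂ ≫ π₁) ≫ x = (t ≫ S.derπ _ a _) ≫ S.derι a ≫ S.derπ a b hab
    have h5 : (π₃ ≫ (π₂ ≫ y - z ≫ S.k _ _ h4)) ≫ S.derπ _ b h1 =
        (π₃ ≫ π₂ ≫ y) ≫ S.derπ _ b h1 := by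
      rw [Category.assoc, Preadditive.sub_comp, Category.assoc, Category.assoc, k_derπ, comp_zero,
        sub_zero, Category.assoc, Category.assoc]
    rw [Category.assoc, Category.assoc, hy, ← Category.assoc π₂, ← Category.assoc π₃, ← h5, ht,
      Category.assoc, Category.assoc, ← Category.assoc (S.derπ _ _ _) (S.derι _), derπ_derι]
    congr 1
    exact S.i_derπ _ _ _ _ _ _ _ _
  exact_jk a b c hab hbc := by
    rw [ShortComplex.exact_iff_exact_up_to_refinements]
    intro T (x : T ⟶ S.complex.homology b) (hx : x ≫ S.derk b c hbc = 0)
    have h1 : a + (1, -1) + (-1, 1) = a := by ext <;> simp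
    have h2 : a + (1, -1) + (r - 1, 1 - r) = b := by
      rw [← hab, ← hr]; ext <;> simp <;> ring
    obtain ⟨T₁, π₁, _, y, hy, hy'⟩ := S.homology_lift x
    obtain ⟨T₂, π₂, _, t, ht⟩ := S.lift_jk h2 hbc y (by
      have h3 : (π₁ ≫ x) ≫ S.derk b c hbc ≫ S.derι c = 0 := by
        rw [Category.assoc, ← Category.assoc x, hx, zero_comp, comp_zero]
      rwa [hy', Category.assoc, ← Category.assoc (S.complex.homologyπ b), homologyπ_derk,
        cyclesk_derι, ← Category.assoc, HomologicalComplex.liftCycles_i] at h3)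
    refine ⟨T₂, π₂ ≫ π₁, inferInstance, t ≫ S.derπ _ a h1, ?_⟩
    change (π₂ ≫ π₁) ≫ x = (t ≫ S.derπ _ a h1) ≫ S.derj hr a b hab
    rw [Category.assoc, hy', Category.assoc, S.derπ_derj hr _ a b h1 hab h2, jHom, ← Category.assoc,
      ← Category.assoc, HomologicalComplex.comp_liftCycles, HomologicalComplex.comp_liftCycles]
    congr 2
  exact_ki a b c hab hbc := by
    rw [ShortComplex.exact_iff_exact_up_to_refinements]
    intro T (x : T ⟶ S.derD b) (hx : x ≫ S.derι b ≫ S.derπ b c hbc = 0)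
    obtain ⟨T₁, π₁, _, y, hy⟩ := S.lift_ki hab hbc (x ≫ S.derι b) (by
      rw [← derπ_derι, ← Category.assoc, Category.assoc x, hx, zero_comp])
    have h1 : y ≫ S.complex.d a ((ComplexShape.up' (⟨r, 1 - r⟩ : ℤ × ℤ)).next a) = 0 := by
      rw [(ComplexShape.up' (⟨r, 1 - r⟩ : ℤ × ℤ)).next_eq' (j := a + (r, 1 - r)) rfl,
        S.complex_d hab (by rw [← hab]; ext <;> simp), ← Category.assoc, ← hy, Category.assoc,
        Category.assoc, derι_j, comp_zero, comp_zero]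
    refine ⟨T₁, π₁, inferInstance, S.complex.liftCycles y _ rfl h1 ≫ S.complex.homologyπ a, ?_⟩
    change π₁ ≫ x = (S.complex.liftCycles y _ rfl h1 ≫ S.complex.homologyπ a) ≫ S.derk a b hab
    rw [← cancel_mono (S.derι b), Category.assoc, hy, Category.assoc, Category.assoc,
      ← Category.assoc (S.complex.homologyπ a), homologyπ_derk, cyclesk_derι,
      ← Category.assoc, HomologicalComplex.liftCycles_i]

section Functoriality

variable {S T : ExactCouple A r} (f : CoupleData.Hom S.toCoupleData T.toCoupleData)

/-- The morphism induced on `D'`. -/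
def derDMap (a : ℤ × ℤ) : S.derD a ⟶ T.derD a :=
  imgMap (f.hD _) (f.hD a) (f.comm_i _ _ _).symm

lemma derDMap_derι (a : ℤ × ℤ) : derDMap f a ≫ T.derι a = S.derι a ≫ f.hD a := imgMap_ι _ _ _

lemma derπ_derDMap (a b : ℤ × ℤ) (h : a + (-1, 1) = b) :
    S.derπ a b h ≫ derDMap f b = f.hD a ≫ T.derπ a b h := by
  rw [← cancel_mono (T.derι b), Category.assoc, derDMap_derι, Category.assoc, derπ_derι,
    ← Category.assoc, derπ_derι, f.comm_i]

lemma jHom_map (a b : ℤ × ℤ) (h : a + (r - 1, 1 - r) = b) :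
    S.jHom a b h ≫ HomologicalComplex.homologyMap (complexMap f) b = f.hD a ≫ T.jHom a b h := by
  rw [jHom, jHom, Category.assoc, HomologicalComplex.homologyπ_naturality, ← Category.assoc,
    ← Category.assoc]
  congr 1
  rw [← cancel_mono (T.complex.iCycles b), Category.assoc, HomologicalComplex.cyclesMap_i,
    ← Category.assoc, HomologicalComplex.liftCycles_i, Category.assoc,
    HomologicalComplex.liftCycles_i]
  exact f.comm_j a b h

/-- The morphism of derived couples induced by a morphism of exact couples. -/
def deriveMap {r' : ℤ} (hr : r + 1 = r') :
    CoupleData.Hom (S.derive hr).toCoupleData (T.derive hr).toCoupleData where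
  hD a := derDMap f a
  hE a := HomologicalComplex.homologyMap (complexMap f) a
  comm_i a b h := by
    change (S.derι a ≫ S.derπ a b h) ≫ derDMap f b = derDMap f a ≫ T.derι a ≫ T.derπ a b h
    rw [Category.assoc, derπ_derDMap, ← Category.assoc, ← derDMap_derι, Category.assoc]
  comm_j a b h := by
    change S.derj hr a b h ≫ HomologicalComplex.homologyMap (complexMap f) b =
      derDMap f a ≫ T.derj hr a b h
    have h1 : a + (1, -1) + (-1, 1) = a := by ext <;> simp
    have h2 : a + (1, -1) + (r - 1, 1 - r) = b := by
      rw [← h, ← hr]; ext <;> simp <;> ring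
    rw [← cancel_epi (S.derπ _ a h1), ← Category.assoc, S.derπ_derj hr _ a b h1 h h2, jHom_map,
      ← Category.assoc, derπ_derDMap, Category.assoc, T.derπ_derj hr _ a b h1 h h2]
  comm_k a b h := by
    change S.derk a b h ≫ derDMap f b =
      HomologicalComplex.homologyMap (complexMap f) a ≫ T.derk a b h
    rw [← cancel_epi (S.complex.homologyπ a), ← Category.assoc, homologyπ_derk,
      ← Category.assoc, HomologicalComplex.homologyπ_naturality, Category.assoc, homologyπ_derk,
      ← cancel_mono (T.derι b), Category.assoc, derDMap_derι, ← Category.assoc, cyclesk_derι,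
      Category.assoc, Category.assoc, cyclesk_derι, f.comm_k]
    rw [← Category.assoc, ← Category.assoc]
    exact congrArg (· ≫ T.k a b h) (HomologicalComplex.cyclesMap_i (complexMap f) a).symm

end Functoriality

/-- The functor sending an exact couple to its derived couple. -/
def deriveFunctor (A : Type u') [Category.{v'} A] [Abelian A] {r r' : ℤ} (hr : r + 1 = r') :
    ExactCouple A r ⥤ ExactCouple A r' where
  obj S := S.derive hr
  map f := deriveMap f hr
  map_id S := by
    refine CoupleData.Hom.ext (funext fun a => ?_) (funext fun a => ?_)
    · change imgMap (𝟙 _) (𝟙 _) _ = 𝟙 _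
      apply img_ext
      rw [imgMap_ι, Category.id_comp, Category.comp_id]
    · exact HomologicalComplex.homologyMap_id S.complex a
  map_comp {S T U} f g := by
    refine CoupleData.Hom.ext (funext fun a => ?_) (funext fun a => ?_)
    · exact (imgMap_comp _ _ _ _ _ _).symm
    · exact HomologicalComplex.homologyMap_comp (complexMap f) (complexMap g) a

/-- The functor `S ↦ E(p, q)`. -/
def evalE (A : Type u') [Category.{v'} A] [Abelian A] (r : ℤ) (a : ℤ × ℤ) : ExactCouple A r ⥤ A where
  obj S := S.E a
  map f := CoupleData.Hom.hE f a
  map_id _ := rfl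
  map_comp _ _ := rfl

/-- The functor `S ↦ D(p, q)`. -/
def evalD (A : Type u') [Category.{v'} A] [Abelian A] (r : ℤ) (a : ℤ × ℤ) : ExactCouple A r ⥤ A where
  obj S := S.D a
  map f := CoupleData.Hom.hD f a
  map_id _ := rfl
  map_comp _ _ := rfl

/-- The inclusion `D' ⟶ D`, as a natural transformation. -/
def deriveι (A : Type u') [Category.{v'} A] [Abelian A] {r r' : ℤ} (hr : r + 1 = r') (a : ℤ × ℤ) :
    deriveFunctor A hr ⋙ evalD A r' a ⟶ evalD A r a where
  app S := S.derι a
  naturality _ _ f := derDMap_derι f a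

/-- The functor `S ↦ (E, j ∘ k)`. -/
def complexFunctor (A : Type u') [Category.{v'} A] [Abelian A] (r : ℤ) :
    ExactCouple A r ⥤ HomologicalComplex A (ComplexShape.up' (⟨r, 1 - r⟩ : ℤ × ℤ)) where
  obj S := S.complex
  map f := complexMap f
  map_id _ := rfl
  map_comp _ _ := rfl

section Iteration

variable (A : Type u') [Category.{v'} A] [Abelian A] {r₀ : ℤ}

/-- The identity functor, for equal indices `r₀ = r`. -/
def castFunctor {r : ℤ} (h : r₀ = r) : ExactCouple A r₀ ⥤ ExactCouple A r := h ▸ 𝟭 _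

/-- The `n`-th derived couple. -/
def iter : ∀ (n : ℕ) (r : ℤ), r₀ + n = r → (ExactCouple A r₀ ⥤ ExactCouple A r)
  | 0, _, h => castFunctor A (by simpa using h)
  | n + 1, r, h => iter n (r - 1) (by push_cast at h; lia) ⋙
      deriveFunctor A (sub_add_cancel r 1)

lemma iter_succ {n n' : ℕ} (hn : n + 1 = n') {r r' : ℤ} (hr : r + 1 = r') (h : r₀ + n = r)
    (h' : r₀ + n' = r') : iter A n' r' h' = iter A n r h ⋙ deriveFunctor A hr := by
  subst hn
  obtain rfl : r = r' - 1 := by lia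
  rfl

/-- The inclusion of `D` of the `n`-th derived couple into `D`. -/
def iterι : ∀ (n : ℕ) (r : ℤ) (h : r₀ + n = r) (a : ℤ × ℤ), iter A n r h ⋙ evalD A r a ⟶ evalD A r₀ a
  | 0, r, h, a => eqToHom (by
      obtain rfl : r₀ = r := by simpa using h
      rfl)
  | n + 1, r, h, a =>
    show (iter A n (r - 1) (by push_cast at h; lia) ⋙ deriveFunctor A (sub_add_cancel r 1)) ⋙
        evalD A r a ⟶ evalD A r₀ a from
      (Functor.associator _ _ _).hom ≫ Functor.whiskerLeft _ (deriveι A (sub_add_cancel r 1) a) ≫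
        iterι n (r - 1) (by push_cast at h; lia) a

/-- The couple on the `r`-th page. -/
def couple (r : ℤ) (hr : r₀ ≤ r) : ExactCouple A r₀ ⥤ ExactCouple A r :=
  iter A (r - r₀).toNat r (by lia)

/-- The inclusion `D_r ⟶ D_{r₀}`. -/
def coupleι (r : ℤ) (hr : r₀ ≤ r) (a : ℤ × ℤ) : couple A r hr ⋙ evalD A r a ⟶ evalD A r₀ a :=
  iterι A (r - r₀).toNat r (by lia) a

/-- The identification of the couple on the next page with the derived couple. -/
def coupleSucc (r r' : ℤ) (hrr' : r + 1 = r') (hr : r₀ ≤ r) :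
    couple A r hr ⋙ deriveFunctor A hrr' ≅ couple A r' (hr.trans (by lia)) :=
  eqToIso (iter_succ A (by lia) hrr' _ _).symm

/-- The spectral sequence of an exact couple. -/
def spectralSequence (r₀ : ℤ) : ExactCouple A r₀ ⥤ CohomologicalSpectralSequence A r₀ where
  obj S :=
    { page r hr := ((couple A r hr).obj S).complex
      iso r r' pq hrr' hr := (evalE A r' pq).mapIso ((coupleSucc A r r' hrr' hr).app S) }
  map {S T} f :=
    { hom r hr := complexMap ((couple A r hr).map f)
      comm r r' pq hrr' hr :=
        (congrArg (evalE A r' pq).map ((coupleSucc A r r' hrr' hr).hom.naturality f)) }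
  map_id S := by
    refine SpectralSequence.Hom.ext (funext fun r => funext fun hr => ?_)
    exact congrArg (complexFunctor A r).map ((couple A r hr).map_id S)
  map_comp f g := by
    refine SpectralSequence.Hom.ext (funext fun r => funext fun hr => ?_)
    exact congrArg (complexFunctor A r).map ((couple A r hr).map_comp f g)

end Iteration

end ExactCouple

variable (A)

/-- Forgetting the pages before the `r₁`-th one. -/
def restrictPages (r₀ r₁ : ℤ) (h : r₀ ≤ r₁) :
    CohomologicalSpectralSequence A r₀ ⥤ CohomologicalSpectralSequence A r₁ where
  obj E :=
    { page r hr := E.page r (h.trans hr)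
      iso r r' pq hrr' hr := E.iso r r' pq hrr' (h.trans hr) }
  map f :=
    { hom r hr := f.hom r (h.trans hr)
      comm r r' pq hrr' hr := f.comm r r' pq hrr' (h.trans hr) }

end Couples

section Cohomological

variable {C : Type u} [Category.{v} C] [Preadditive C] [HasZeroObject C] [HasShift C ℤ]
  [∀ n : ℤ, (shiftFunctor C n).Additive] [Pretriangulated C]
  {A : Type u'} [Category.{v'} A] [Abelian A]

open scoped CategoryTheory.Pretriangulated.Opposite in
variable (C A) in
/-- The property of being a cohomological functor. -/
def isCohomological : ObjectProperty (Cᵒᵖ ⥤ A) := fun H => H.IsHomological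

variable (C A) in
/-- The category of cohomological functors `Cᵒᵖ ⥤ A`. -/
abbrev Coh := (isCohomological C A).FullSubcategory

/-- Exactness of `H W ⟶ H V ⟶ H U`, for `U ⟶ V ⟶ W`. -/
def ExactAt (H : Cᵒᵖ ⥤ A) {U V W : C} (f : U ⟶ V) (g : V ⟶ W) : Prop :=
  ∃ z : H.map g.op ≫ H.map f.op = 0, (ShortComplex.mk _ _ z).Exact

open scoped CategoryTheory.Pretriangulated.Opposite in
lemma exactAt_of_dist {H : Cᵒᵖ ⥤ A} (hH : isCohomological C A H) {U V W : C} {f : U ⟶ V}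
    {g : V ⟶ W} {h : W ⟶ U⟦(1 : ℤ)⟧} (hT : Triangle.mk f g h ∈ distTriang C) :
    ExactAt H f g := by
  have : H.IsHomological := hH
  exact ⟨_, H.map_distinguished_op_exact _ hT⟩

lemma ExactAt.of_iso {H : Cᵒᵖ ⥤ A} {U V W U' V' W' : C} {f : U ⟶ V} {g : V ⟶ W} {f' : U' ⟶ V'}
    {g' : V' ⟶ W'} (h : ExactAt H f g) (eU : U ≅ U') (eV : V ≅ V') (eW : W ≅ W')
    (h₁ : f ≫ eV.hom = eU.hom ≫ f') (h₂ : g ≫ eW.hom = eV.hom ≫ g') : ExactAt H f' g' := by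
  obtain ⟨z, hz⟩ := h
  have hf : f' = eU.inv ≫ f ≫ eV.hom := by rw [h₁, eU.inv_hom_id_assoc]
  have hg : g' = eV.inv ≫ g ≫ eW.hom := by rw [h₂, eV.inv_hom_id_assoc]
  have z' : H.map g'.op ≫ H.map f'.op = 0 := by
    simp only [hf, hg, op_comp, H.map_comp, Category.assoc]
    have h3 : H.map eV.inv.op ≫ H.map eV.hom.op = 𝟙 _ := by
      rw [← H.map_comp, ← op_comp, eV.hom_inv_id, op_id, CategoryTheory.Functor.map_id]
    rw [← Category.assoc (H.map eV.inv.op), h3, Category.id_comp, ← Category.assoc (H.map g.op), z,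
      zero_comp, comp_zero]
  refine ⟨z', (ShortComplex.exact_iff_of_iso (ShortComplex.isoMk (H.mapIso eW.op) (H.mapIso eV.op)
    (H.mapIso eU.op) ?_ ?_)).2 hz⟩
  · change H.map eW.hom.op ≫ H.map g.op = H.map g'.op ≫ H.map eV.hom.op
    rw [← H.map_comp, ← H.map_comp, ← op_comp, ← op_comp, h₂]
  · change H.map eV.hom.op ≫ H.map f.op = H.map f'.op ≫ H.map eU.hom.op
    rw [← H.map_comp, ← H.map_comp, ← op_comp, ← op_comp, h₁]

lemma ExactAt.neg {H : Cᵒᵖ ⥤ A} {U V W : C} {f : U ⟶ V} {g : V ⟶ W} (h : ExactAt H f (-g)) :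
    ExactAt H f g :=
  h.of_iso (Iso.refl _) (Iso.refl _)
    ⟨-𝟙 W, -𝟙 W, by simp, by simp⟩ (by simp) (by simp)

lemma exactAt_shift {H : Cᵒᵖ ⥤ A} (hH : isCohomological C A H) {U V W : C} {f : U ⟶ V}
    {g : V ⟶ W} {h : W ⟶ U⟦(1 : ℤ)⟧} (hT : Triangle.mk f g h ∈ distTriang C) (m n : ℤ) :
    ExactAt H (f⟦m⟧'⟦n⟧') (g⟦m⟧'⟦n⟧') :=
  exactAt_of_dist hH (shift_dist' (shift_dist' hT m) n)

lemma shIso_trans (X : C) {a b c d e f : ℤ} (h : a + b = c + d) (h' : c + d = e + f) :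
    (shIso a b c d h).hom.app X ≫ (shIso c d e f h').hom.app X =
      (shIso a b e f (h.trans h')).hom.app X := by
  have key : ∀ (s t : ℤ) (h₁ : a + b = s) (h₂ : c + d = s) (h₃ : c + d = t) (h₄ : e + f = t)
      (h₅ : e + f = s),
      ((shiftFunctorAdd' C a b s h₁).inv.app X ≫ (shiftFunctorAdd' C c d s h₂).hom.app X) ≫
        ((shiftFunctorAdd' C c d t h₃).inv.app X ≫ (shiftFunctorAdd' C e f t h₄).hom.app X) =
      (shiftFunctorAdd' C a b s h₁).inv.app X ≫ (shiftFunctorAdd' C e f s h₅).hom.app X := by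
    intro s t h₁ h₂ h₃ h₄ h₅
    obtain rfl : s = t := h₂.symm.trans h₃
    simp
  exact key _ _ rfl h.symm rfl h'.symm (h.trans h').symm

lemma shIso_refl (X : C) (a b : ℤ) (h : a + b = a + b) :
    (shIso a b a b h).hom.app X = 𝟙 _ :=
  (shiftFunctorAdd' C a b (a + b) rfl).inv_hom_id_app X

/-- The canonical isomorphism `X[x][y][z] ≅ X[c][d]` for `x + y + z = c + d`. -/
def sh3 (x y z c d : ℤ) (h : x + (y + z) = c + d) :
    shiftFunctor C x ⋙ shiftFunctor C y ⋙ shiftFunctor C z ≅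
      shiftFunctor C c ⋙ shiftFunctor C d :=
  Functor.isoWhiskerLeft _ (shiftFunctorAdd' C y z (y + z) rfl).symm ≪≫
    shIso x (y + z) c d h

lemma sh3_trans (X : C) {x y z c d c' d' : ℤ} (h : x + (y + z) = c + d) (h' : c + d = c' + d') :
    (sh3 x y z c d h).hom.app X ≫ (shIso c d c' d' h').hom.app X =
      (sh3 x y z c' d' (h.trans h')).hom.app X := by
  change (_ ≫ (shIso _ _ _ _ h).hom.app X) ≫ _ = _ ≫ (shIso _ _ _ _ (h.trans h')).hom.app X
  rw [Category.assoc, shIso_trans]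

end Cohomological

section Towers

variable {C : Type u} [Category.{v} C] [Preadditive C] [HasZeroObject C] [HasShift C ℤ]
  [∀ n : ℤ, (shiftFunctor C n).Additive] [Pretriangulated C]

/-- An object `X` together with a weight Postnikov tower for it: distinguished triangles
`Y_p ⟶ Y_{p+1} ⟶ X_p ⟶ Y_p[1]` over `X`, where `Y_p` is a choice of `w_{≥ 1-p} X`. -/
structure Tower (w : WeightStructure C) where
  X : C
  Y : ℤ → C
  /-- `X_p` -/
  Z : ℤ → C
  toX : ∀ p, Y p ⟶ X
  f : ∀ p p' : ℤ, p + 1 = p' → (Y p ⟶ Y p')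
  c : ∀ p p' : ℤ, p + 1 = p' → (Y p' ⟶ Z p)
  γ : ∀ p, Z p ⟶ (Y p)⟦(1 : ℤ)⟧
  comm : ∀ p p' h, f p p' h ≫ toX p' = toX p
  dist : ∀ p p' h, Triangle.mk (f p p' h) (c p p' h) (γ p) ∈ distTriang C
  ge : ∀ p, w.ge (1 - p) (Y p)
  le : ∀ p, ∃ (Q : C) (π : X ⟶ Q) (δ : Q ⟶ (Y p)⟦(1 : ℤ)⟧),
    w.le (-p) Q ∧ Triangle.mk (toX p) π δ ∈ distTriang C

namespace Tower

variable {w : WeightStructure C}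

/-- Morphisms of weight Postnikov towers. -/
@[ext]
structure Hom (P P' : Tower w) where
  g : P.X ⟶ P'.X
  y : ∀ p, P.Y p ⟶ P'.Y p
  z : ∀ p, P.Z p ⟶ P'.Z p
  comm_toX : ∀ p, P.toX p ≫ g = y p ≫ P'.toX p
  comm_f : ∀ p p' h, P.f p p' h ≫ y p' = y p ≫ P'.f p p' h
  comm_c : ∀ p p' h, P.c p p' h ≫ z p = y p' ≫ P'.c p p' h
  comm_γ : ∀ p, P.γ p ≫ (y p)⟦(1 : ℤ)⟧' = z p ≫ P'.γ p

instance : Category (Tower w) where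
  Hom := Hom
  id P :=
    { g := 𝟙 _
      y p := 𝟙 _
      z p := 𝟙 _
      comm_toX := by simp
      comm_f := by simp
      comm_c := by simp
      comm_γ := by simp }
  comp F G :=
    { g := F.g ≫ G.g
      y p := F.y p ≫ G.y p
      z p := F.z p ≫ G.z p
      comm_toX p := by rw [← Category.assoc, F.comm_toX, Category.assoc, G.comm_toX, Category.assoc]
      comm_f p p' h := by
        rw [← Category.assoc, F.comm_f, Category.assoc, G.comm_f, Category.assoc]
      comm_c p p' h := by
        rw [← Category.assoc, F.comm_c, Category.assoc, G.comm_c, Category.assoc]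
      comm_γ p := by
        rw [Functor.map_comp, ← Category.assoc, F.comm_γ, Category.assoc, G.comm_γ,
          Category.assoc] }
  id_comp F := Hom.ext (Category.id_comp _) (funext fun _ => Category.id_comp _)
    (funext fun _ => Category.id_comp _)
  comp_id F := Hom.ext (Category.comp_id _) (funext fun _ => Category.comp_id _)
    (funext fun _ => Category.comp_id _)
  assoc F G K := Hom.ext (Category.assoc _ _ _) (funext fun _ => Category.assoc _ _ _)
    (funext fun _ => Category.assoc _ _ _)

variable (w)

/-- The functor sending a tower for `X` to `X`. -/
def forget : Tower w ⥤ C where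
  obj P := P.X
  map F := Hom.g F
  map_id _ := rfl
  map_comp _ _ := rfl

/-- The functor sending a tower to `Y_p`. -/
def evalY (p : ℤ) : Tower w ⥤ C where
  obj P := P.Y p
  map F := Hom.y F p
  map_id _ := rfl
  map_comp _ _ := rfl

/-- The functor sending a tower to `X_p`. -/
def evalZ (p : ℤ) : Tower w ⥤ C where
  obj P := P.Z p
  map F := Hom.z F p
  map_id _ := rfl
  map_comp _ _ := rfl

/-- The functor sending a tower to `X^{-p} = X_p[-p]`. -/
def factor (p : ℤ) : Tower w ⥤ C := evalZ w p ⋙ shiftFunctor C (-p)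

variable {w} (P : Tower w)

/-- The morphism `X^{-p-1} ⟶ X^{-p}`: the composition `X_{p+1} ⟶ Y_{p+1}[1] ⟶ X_p[1]`, shifted by
`-p-1`. -/
def weightD (p p' : ℤ) (h : p + 1 = p') : (factor w p').obj P ⟶ (factor w p).obj P :=
  (P.γ p' ≫ (P.c p p' h)⟦(1 : ℤ)⟧')⟦-p'⟧' ≫
    (shiftFunctorAdd' C 1 (-p') (-p) (by lia)).inv.app (P.Z p)

/-- The morphism `X_p ⟶ Y_p[1]`, with two names of the same index. -/
def γ' (p p₀ : ℤ) (h : p₀ = p) : P.Z p ⟶ (P.Y p₀)⟦(1 : ℤ)⟧ :=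
  P.γ p ≫ eqToHom (by rw [h])

lemma comm_γ' {P P' : Tower w} (F : Hom P P') (p p₀ : ℤ) (h : p₀ = p) :
    P.γ' p p₀ h ≫ (F.y p₀)⟦(1 : ℤ)⟧' = F.z p ≫ P'.γ' p p₀ h := by
  subst h
  simpa [γ'] using F.comm_γ p₀

lemma dist' (p₀ p p' : ℤ) (h₀ : p₀ + 1 = p') (h : p + 1 = p') (h' : p₀ = p) :
    Triangle.mk (P.f p₀ p' h₀) (P.c p p' h) (P.γ' p p₀ h') ∈ distTriang C := by
  subst h'
  simpa [γ'] using P.dist p₀ p' h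

end Tower

end Towers

section TowerCouple

variable {C : Type u} [Category.{v} C] [Preadditive C] [HasZeroObject C] [HasShift C ℤ]
  [∀ n : ℤ, (shiftFunctor C n).Additive] [Pretriangulated C]
  {A : Type u'} [Category.{v'} A] [Abelian A] {w : WeightStructure C}

namespace Tower

variable (P : Tower w)

/-- `Y_p[1-p][-q]`, so that `D_1^{pq} = H^q(X^{w ≥ 1-p})` is the value of `H` at this object. -/
abbrev objD (a : ℤ × ℤ) : C := (P.Y a.1)⟦1 - a.1⟧⟦-a.2⟧

/-- `X_p[-p][-q]`, so that `E_1^{pq} = H^q(X^{-p})` is the value of `H` at this object. -/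
abbrev objE (a : ℤ × ℤ) : C := (P.Z a.1)⟦-a.1⟧⟦-a.2⟧

/-- The morphism inducing `i`; it comes from `Y_{p-1} ⟶ Y_p`. -/
def homI (a b : ℤ × ℤ) (h : a + (-1, 1) = b) : P.objD b ⟶ P.objD a :=
  (P.f b.1 a.1 (by rw [← h]; simp))⟦1 - b.1⟧'⟦-b.2⟧' ≫
    (shIso (1 - b.1) (-b.2) (1 - a.1) (-a.2) (by rw [← h]; simp; ring)).hom.app (P.Y a.1)

/-- The morphism inducing `j`; it comes from `X_p ⟶ Y_p[1]`. -/
def homJ (a b : ℤ × ℤ) (h : a + (1 - 1, 1 - 1) = b) : P.objE b ⟶ P.objD a :=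
  (P.γ' b.1 a.1 (by rw [← h]; simp))⟦-b.1⟧'⟦-b.2⟧' ≫
    (sh3 1 (-b.1) (-b.2) (1 - a.1) (-a.2) (by rw [← h]; simp; ring)).hom.app (P.Y a.1)

/-- The morphism inducing `k`; it comes from `Y_{p+1} ⟶ X_p`. -/
def homK (a b : ℤ × ℤ) (h : a + (1, 0) = b) : P.objD b ⟶ P.objE a :=
  (shIso (1 - b.1) (-b.2) (-a.1) (-a.2) (by rw [← h]; simp)).hom.app (P.Y b.1) ≫
    (P.c a.1 b.1 (by rw [← h]; simp))⟦-a.1⟧'⟦-a.2⟧'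

lemma exact_ki {H : Cᵒᵖ ⥤ A} (hH : isCohomological C A H) (a b c : ℤ × ℤ) (hab : a + (1, 0) = b)
    (hbc : b + (-1, 1) = c) : ExactAt H (P.homI b c hbc) (P.homK a b hab) := by
  have h₁ : c.1 + 1 = b.1 := by rw [← hbc]; simp
  have h₂ : a.1 + 1 = b.1 := by rw [← hab]; simp
  refine (exactAt_shift hH (P.dist' c.1 a.1 b.1 h₁ h₂ (by lia)) (-a.1) (-a.2)).of_iso
    ((shIso (-a.1) (-a.2) (1 - c.1) (-c.2) (by rw [← hbc, ← hab]; simp; ring)).app _)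
    ((shIso (-a.1) (-a.2) (1 - b.1) (-b.2) (by rw [← hab]; simp)).app _) (Iso.refl _) ?_ ?_
  · have := (shIso (C := C) (-a.1) (-a.2) (1 - c.1) (-c.2) (by rw [← hbc, ← hab]; simp; ring)).hom.naturality
      (P.f c.1 b.1 h₁)
    refine Eq.trans ?_ (Category.assoc _ _ _)
    refine Eq.trans ?_ (congrArg (· ≫ _) this)
    rw [Category.assoc, shIso_trans]
    rfl
  · have h₃ : -a.1 + -a.2 = 1 - b.1 + -b.2 := by rw [← hab]; simp
    change _ ≫ 𝟙 _ = _ ≫ _ ≫ _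
    rw [Category.comp_id, ← Category.assoc]
    change _ = ((shIso _ _ _ _ h₃).hom.app _ ≫ (shIso _ _ _ _ h₃.symm).hom.app _) ≫ _
    rw [shIso_trans, shIso_refl, Category.id_comp]

lemma exact_jk {H : Cᵒᵖ ⥤ A} (hH : isCohomological C A H) (a b c : ℤ × ℤ)
    (hab : a + (1 - 1, 1 - 1) = b) (hbc : b + (1, 0) = c) :
    ExactAt H (P.homK b c hbc) (P.homJ a b hab) := by
  have h₁ : a.1 = b.1 := by rw [← hab]; simp
  have h₂ : b.1 + 1 = c.1 := by rw [← hbc]; simp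
  have hT : Triangle.mk (P.c b.1 c.1 h₂) (P.γ' b.1 a.1 h₁) (-(P.f a.1 c.1 (by lia))⟦(1 : ℤ)⟧')
      ∈ distTriang C :=
    rot_of_distTriang _ (P.dist' a.1 b.1 c.1 (by lia) h₂ h₁)
  refine (exactAt_shift hH hT (-b.1) (-b.2)).of_iso
    ((shIso (-b.1) (-b.2) (1 - c.1) (-c.2) (by rw [← hbc]; simp)).app _) (Iso.refl _)
    ((sh3 1 (-b.1) (-b.2) (1 - a.1) (-a.2) (by rw [← hab]; simp; ring)).app _) ?_ ?_
  · have h₃ : -b.1 + -b.2 = 1 - c.1 + -c.2 := by rw [← hbc]; simp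
    change _ ≫ 𝟙 _ = _ ≫ _ ≫ _
    rw [Category.comp_id, ← Category.assoc]
    change _ = ((shIso _ _ _ _ h₃).hom.app _ ≫ (shIso _ _ _ _ h₃.symm).hom.app _) ≫ _
    rw [shIso_trans, shIso_refl, Category.id_comp]
  · exact (Category.id_comp _).symm

lemma exact_ij {H : Cᵒᵖ ⥤ A} (hH : isCohomological C A H) (a b c : ℤ × ℤ) (hab : a + (-1, 1) = b)
    (hbc : b + (1 - 1, 1 - 1) = c) : ExactAt H (P.homJ b c hbc) (P.homI a b hab) := by
  have h₁ : b.1 = c.1 := by rw [← hbc]; simp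
  have h₂ : b.1 + 1 = a.1 := by rw [← hab]; simp
  have hT : Triangle.mk (P.γ' c.1 b.1 h₁) (-(P.f b.1 a.1 h₂)⟦(1 : ℤ)⟧') (-(P.c c.1 a.1 (by lia))⟦(1 : ℤ)⟧')
      ∈ distTriang C :=
    rot_of_distTriang _ (rot_of_distTriang _ (P.dist' b.1 c.1 a.1 h₂ (by lia) h₁))
  have h0 := exactAt_shift hH hT (-c.1) (-c.2)
  rw [Functor.map_neg, Functor.map_neg] at h0
  refine h0.neg.of_iso (Iso.refl _)
    ((sh3 1 (-c.1) (-c.2) (1 - b.1) (-b.2) (by rw [← hbc]; simp; ring)).app _)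
    ((sh3 1 (-c.1) (-c.2) (1 - a.1) (-a.2) (by rw [← hbc, ← hab]; simp; ring)).app _) ?_ ?_
  · exact (Category.id_comp _).symm
  · have := (sh3 (C := C) 1 (-c.1) (-c.2) (1 - b.1) (-b.2) (by
      rw [← hbc]; simp; ring)).hom.naturality (P.f b.1 a.1 h₂)
    refine Eq.trans ?_ (Category.assoc _ _ _)
    refine Eq.trans ?_ (congrArg (· ≫ _) this)
    rw [Category.assoc, sh3_trans]
    rfl

/-- The exact couple with `E_1^{pq} = H^q(X^{-p})`, `D_1^{pq} = H^q(X^{w ≥ 1-p})`. -/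
def exactCouple {H : Cᵒᵖ ⥤ A} (hH : isCohomological C A H) : ExactCouple A 1 where
  D a := H.obj (op (P.objD a))
  E a := H.obj (op (P.objE a))
  i a b h := H.map (P.homI a b h).op
  j a b h := H.map (P.homJ a b h).op
  k a b h := H.map (P.homK a b h).op
  zero_ij a b c hab hbc := (P.exact_ij hH a b c hab hbc).1
  zero_jk a b c hab hbc := (P.exact_jk hH a b c hab hbc).1
  zero_ki a b c hab hbc := (P.exact_ki hH a b c hab hbc).1
  exact_ij a b c hab hbc := (P.exact_ij hH a b c hab hbc).2
  exact_jk a b c hab hbc := (P.exact_jk hH a b c hab hbc).2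
  exact_ki a b c hab hbc := (P.exact_ki hH a b c hab hbc).2

variable {P} {P' : Tower w} (F : Hom P P')

lemma homI_naturality (a b : ℤ × ℤ) (h : a + (-1, 1) = b) :
    P.homI a b h ≫ (F.y a.1)⟦1 - a.1⟧'⟦-a.2⟧' =
      (F.y b.1)⟦1 - b.1⟧'⟦-b.2⟧' ≫ P'.homI a b h := by
  have h₁ : b.1 + 1 = a.1 := by rw [← h]; simp
  have h₂ : 1 - b.1 + -b.2 = 1 - a.1 + -a.2 := by rw [← h]; simp; ring
  refine (Category.assoc _ _ _).trans ?_
  refine (congrArg (_ ≫ ·) ((shIso (C := C) _ _ _ _ h₂).hom.naturality (F.y a.1)).symm).trans ?_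
  refine (Category.assoc _ _ _).symm.trans (Eq.trans ?_ (Category.assoc _ _ _))
  refine congrArg (· ≫ _) ?_
  change (P.f b.1 a.1 h₁)⟦_⟧'⟦_⟧' ≫ (F.y a.1)⟦_⟧'⟦_⟧' = (F.y b.1)⟦_⟧'⟦_⟧' ≫ (P'.f b.1 a.1 h₁)⟦_⟧'⟦_⟧'
  rw [← Functor.map_comp, ← Functor.map_comp, F.comm_f, Functor.map_comp, Functor.map_comp]

lemma homJ_naturality (a b : ℤ × ℤ) (h : a + (1 - 1, 1 - 1) = b) :
    P.homJ a b h ≫ (F.y a.1)⟦1 - a.1⟧'⟦-a.2⟧' =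
      (F.z b.1)⟦-b.1⟧'⟦-b.2⟧' ≫ P'.homJ a b h := by
  have h₁ : a.1 = b.1 := by rw [← h]; simp
  have h₂ : 1 + (-b.1 + -b.2) = 1 - a.1 + -a.2 := by rw [← h]; simp; ring
  refine (Category.assoc _ _ _).trans ?_
  refine (congrArg (_ ≫ ·) ((sh3 (C := C) _ _ _ _ _ h₂).hom.naturality (F.y a.1)).symm).trans ?_
  refine (Category.assoc _ _ _).symm.trans (Eq.trans ?_ (Category.assoc _ _ _))
  refine congrArg (· ≫ _) ?_
  change (P.γ' b.1 a.1 h₁)⟦_⟧'⟦_⟧' ≫ ((F.y a.1)⟦(1 : ℤ)⟧')⟦_⟧'⟦_⟧' =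
    (F.z b.1)⟦_⟧'⟦_⟧' ≫ (P'.γ' b.1 a.1 h₁)⟦_⟧'⟦_⟧'
  rw [← Functor.map_comp, ← Functor.map_comp, comm_γ', Functor.map_comp, Functor.map_comp]

lemma homK_naturality (a b : ℤ × ℤ) (h : a + (1, 0) = b) :
    P.homK a b h ≫ (F.z a.1)⟦-a.1⟧'⟦-a.2⟧' =
      (F.y b.1)⟦1 - b.1⟧'⟦-b.2⟧' ≫ P'.homK a b h := by
  have h₁ : a.1 + 1 = b.1 := by rw [← h]; simp
  have h₂ : 1 - b.1 + -b.2 = -a.1 + -a.2 := by rw [← h]; simp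
  refine (Category.assoc _ _ _).trans (Eq.trans ?_ (Category.assoc _ _ _))
  refine Eq.trans ?_ (congrArg (· ≫ _) ((shIso (C := C) _ _ _ _ h₂).hom.naturality (F.y b.1)).symm)
  refine Eq.trans ?_ (Category.assoc _ _ _).symm
  refine congrArg (_ ≫ ·) ?_
  change (P.c a.1 b.1 h₁)⟦_⟧'⟦_⟧' ≫ (F.z a.1)⟦_⟧'⟦_⟧' = (F.y b.1)⟦_⟧'⟦_⟧' ≫ (P'.c a.1 b.1 h₁)⟦_⟧'⟦_⟧'
  rw [← Functor.map_comp, ← Functor.map_comp, F.comm_c, Functor.map_comp, Functor.map_comp]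

end Tower

variable (w A)

/-- The exact couple of a weight Postnikov tower, as a functor of `H` and of the tower. -/
def towerCouple : Coh C A ⥤ (Tower w)ᵒᵖ ⥤ ExactCouple A 1 where
  obj H :=
    { obj P := P.unop.exactCouple H.property
      map {P P'} F := show CoupleData.Hom _ _ from
        { hD a := H.obj.map ((Tower.Hom.y F.unop a.1)⟦1 - a.1⟧'⟦-a.2⟧').op
          hE a := H.obj.map ((Tower.Hom.z F.unop a.1)⟦-a.1⟧'⟦-a.2⟧').op
          comm_i a b h := by
            change H.obj.map _ ≫ H.obj.map _ = H.obj.map _ ≫ H.obj.map _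
            rw [← Functor.map_comp, ← Functor.map_comp, ← op_comp, ← op_comp,
              Tower.homI_naturality]
          comm_j a b h := by
            change H.obj.map _ ≫ H.obj.map _ = H.obj.map _ ≫ H.obj.map _
            rw [← Functor.map_comp, ← Functor.map_comp, ← op_comp, ← op_comp,
              Tower.homJ_naturality]
          comm_k a b h := by
            change H.obj.map _ ≫ H.obj.map _ = H.obj.map _ ≫ H.obj.map _
            rw [← Functor.map_comp, ← Functor.map_comp, ← op_comp, ← op_comp,
              Tower.homK_naturality] }
      map_id P := by
        refine CoupleData.Hom.ext (funext fun a => ?_) (funext fun a => ?_)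
        · exact (((Tower.evalY w a.1) ⋙ shiftFunctor C _ ⋙ shiftFunctor C _).op ⋙ H.obj).map_id P
        · exact (((Tower.evalZ w a.1) ⋙ shiftFunctor C _ ⋙ shiftFunctor C _).op ⋙ H.obj).map_id P
      map_comp F G := by
        refine CoupleData.Hom.ext (funext fun a => ?_) (funext fun a => ?_)
        · exact (((Tower.evalY w a.1) ⋙ shiftFunctor C _ ⋙ shiftFunctor C _).op ⋙ H.obj).map_comp F G
        · exact (((Tower.evalZ w a.1) ⋙ shiftFunctor C _ ⋙ shiftFunctor C _).op ⋙ H.obj).map_comp F G }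
  map {H H'} α :=
    { app P := show CoupleData.Hom _ _ from
        { hD a := α.hom.app _
          hE a := α.hom.app _
          comm_i a b h := α.hom.naturality _
          comm_j a b h := α.hom.naturality _
          comm_k a b h := α.hom.naturality _ }
      naturality P P' F := by
        refine CoupleData.Hom.ext (funext fun a => ?_) (funext fun a => ?_)
        · exact α.hom.naturality _
        · exact α.hom.naturality _ }
  map_id _ := rfl
  map_comp _ _ := rfl

/-- The weight spectral sequence `T(H, X)`, as a functor of `H` and of the tower. -/
def weightSS : Coh C A ⥤ (Tower w)ᵒᵖ ⥤ CohomologicalSpectralSequence A 1 :=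
  towerCouple A w ⋙ (Functor.whiskeringRight _ _ _).obj (ExactCouple.spectralSequence A 1)

end TowerCouple

section VirtualCouple

variable {C : Type u} [Category.{v} C] [Preadditive C] [HasZeroObject C] [HasShift C ℤ]
  [∀ n : ℤ, (shiftFunctor C n).Additive] [Pretriangulated C]

variable (C) in
/-- The canonical transformation `H (X[c]) ⟶ H (X[a][b])` for `a + b = c`. -/
def precompAdd (A : Type u') [Category.{v'} A] [Abelian A] (a b c : ℤ) (h : a + b = c) :
    precomp C A c ⟶ precomp C A b ⋙ precomp C A a where
  app H :=
    { app X := H.map ((shiftFunctorAdd' C a b c h).inv.app X.unop).op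
      naturality X Y g := by
        change H.map _ ≫ H.map _ = H.map _ ≫ H.map _
        rw [← H.map_comp, ← H.map_comp]
        congr 1
        exact congrArg Quiver.Hom.op ((shiftFunctorAdd' C a b c h).inv.naturality g.unop).symm }
  naturality H H' α := by
    ext X
    exact (α.naturality _).symm

/-- Assembling natural families of couples. -/
def coupleOfNat {𝓗 : Type*} [Category* 𝓗] {𝓧 : Type*} [Category* 𝓧]
    {A : Type u'} [Category.{v'} A] [Abelian A] {r : ℤ}
    (D E : ℤ × ℤ → (𝓗 ⥤ 𝓧 ⥤ A))
    (i : ∀ a b : ℤ × ℤ, a + (-1, 1) = b → (D a ⟶ D b))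
    (j : ∀ a b : ℤ × ℤ, a + (r - 1, 1 - r) = b → (D a ⟶ E b))
    (k : ∀ a b : ℤ × ℤ, a + (1, 0) = b → (E a ⟶ D b)) : 𝓗 ⥤ 𝓧 ⥤ CoupleData A r where
  obj H :=
    { obj X :=
        { D a := ((D a).obj H).obj X
          E a := ((E a).obj H).obj X
          i a b h := ((i a b h).app H).app X
          j a b h := ((j a b h).app H).app X
          k a b h := ((k a b h).app H).app X }
      map g := show CoupleData.Hom _ _ from
        { hD a := ((D a).obj H).map g
          hE a := ((E a).obj H).map g
          comm_i a b h := (((i a b h).app H).naturality g).symm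
          comm_j a b h := (((j a b h).app H).naturality g).symm
          comm_k a b h := (((k a b h).app H).naturality g).symm }
      map_id X := CoupleData.Hom.ext (funext fun a => ((D a).obj H).map_id X)
        (funext fun a => ((E a).obj H).map_id X)
      map_comp f g := CoupleData.Hom.ext (funext fun a => ((D a).obj H).map_comp f g)
        (funext fun a => ((E a).obj H).map_comp f g) }
  map {H H'} α :=
    { app X := show CoupleData.Hom _ _ from
        { hD a := ((D a).map α).app X
          hE a := ((E a).map α).app X
          comm_i a b h := (congrArg (fun t => t.app X) ((i a b h).naturality α)).symm
          comm_j a b h := (congrArg (fun t => t.app X) ((j a b h).naturality α)).symm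
          comm_k a b h := (congrArg (fun t => t.app X) ((k a b h).naturality α)).symm }
      naturality X Y g := CoupleData.Hom.ext (funext fun a => ((D a).map α).naturality g)
        (funext fun a => ((E a).map α).naturality g) }
  map_id H := by
    ext X
    exact CoupleData.Hom.ext (funext fun a => congrArg (fun t => t.app X) ((D a).map_id H))
      (funext fun a => congrArg (fun t => t.app X) ((E a).map_id H))
  map_comp α β := by
    ext X
    exact CoupleData.Hom.ext (funext fun a => congrArg (fun t => t.app X) ((D a).map_comp α β))
      (funext fun a => congrArg (fun t => t.app X) ((E a).map_comp α β))

namespace WeightStructure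

variable (w : WeightStructure C) (A : Type u') [Category.{v'} A] [Abelian A]

/-- `H ↦ H^{τ = k}`, where `H^{τ = k}(X) = (τ_{≥ 0} τ_{≤ 0} H)(X[k])`. -/
def tauEq (k : ℤ) : (Cᵒᵖ ⥤ A) ⥤ (Cᵒᵖ ⥤ A) := w.tauLE A 0 ⋙ w.tauGE A 0 ⋙ precomp C A k

/-- `D_2'^{pq}(X) = (τ_{≥ q} H)^q (X[1-p])`. -/
def virtD (a : ℤ × ℤ) : (Cᵒᵖ ⥤ A) ⥤ (Cᵒᵖ ⥤ A) :=
  w.tauGE A a.2 ⋙ coh C A a.2 ⋙ precomp C A (1 - a.1)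

/-- `E_2'^{pq} = (H^q)^{τ = -p}`. -/
def virtE (a : ℤ × ℤ) : (Cᵒᵖ ⥤ A) ⥤ (Cᵒᵖ ⥤ A) := coh C A a.2 ⋙ w.tauEq A (-a.1)

/-- `i' : (τ_{≥ q} H)^q (X[1-p]) ⟶ (τ_{≥ q+1} H)^{q+1} (X[2-p])`, induced by
`τ_{≥ q} H ⟶ τ_{≥ q+1} H`. -/
def virtI (a b : ℤ × ℤ) (h : a + (-1, 1) = b) : w.virtD A a ⟶ w.virtD A b :=
  Functor.whiskerRight (w.tauGETrans A a.2 b.2 (by rw [← h]; simp))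
      (precomp C A (-a.2) ⋙ precomp C A (1 - a.1)) ≫
    Functor.whiskerLeft (w.tauGE A b.2)
      (shTrans C A (1 - a.1) (-a.2) (1 - b.1) (-b.2) (by rw [← h]; simp; ring))

/-- `j' : (τ_{≥ q} H)^q (X[1-p]) ⟶ (H^{q-1})^{τ = -p-1} (X)`. It is the composition of the connecting
morphism `(τ_{≥ q} H)(Y[1]) ⟶ (τ_{≤ q-1} H)(Y)` for `Y = X[-p-1][1-q]`, the identification
`(τ_{≤ q-1} H)(X[-p-1][1-q]) ≅ (τ_{≤ 0} H^{q-1})(X[-p-1])` and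
`τ_{≤ 0} H^{q-1} ⟶ τ_{≥ 0} τ_{≤ 0} H^{q-1}`. -/
def virtJ (a b : ℤ × ℤ) (h : a + (2 - 1, 1 - 2) = b) : w.virtD A a ⟶ w.virtE A b :=
  Functor.whiskerLeft (w.tauGE A a.2)
      (shTrans C A (1 - a.1) (-a.2) (-b.1) (1 - b.2) (by rw [← h]; simp; ring) ≫
        Functor.whiskerRight (precompAdd C A (-b.2) 1 (1 - b.2) (by ring))
          (precomp C A (-b.1))) ≫
    Functor.whiskerRight (w.tauδ A b.2 a.2 (by rw [← h]; simp))
      (precomp C A (-b.2) ⋙ precomp C A (-b.1)) ≫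
    Functor.whiskerRight (w.tauLESh A (-b.2) 0 b.2 (by ring) ≫
      Functor.whiskerLeft (precomp C A (-b.2) ⋙ w.tauLE A 0) (w.tauGEπ A 0)) (precomp C A (-b.1))

/-- `k' : (H^q)^{τ = -p} (X) ⟶ (τ_{≥ q} H)^q (X[-p])`. It is the composition of
`τ_{≥ 0} τ_{≤ 0} H^q ⟶ τ_{≥ 0} H^q` with the identification
`(τ_{≥ 0} H^q)(X[-p]) ≅ (τ_{≥ q} H)^q (X[-p])`. -/
def virtK (a b : ℤ × ℤ) (h : a + (1, 0) = b) : w.virtE A a ⟶ w.virtD A b :=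
  Functor.whiskerRight (Functor.whiskerLeft (coh C A a.2)
      (Functor.whiskerRight (w.tauLEι A 0) (w.tauGE A 0)) ≫
        w.tauGESh A (-a.2) 0 b.2 (by rw [← h]; simp)) (precomp C A (-a.1)) ≫
    Functor.whiskerLeft (w.tauGE A b.2)
      (shTrans C A (-a.1) (-a.2) (1 - b.1) (-b.2) (by rw [← h]; simp))

/-- The couple `(D_2', E_2')` built from the virtual `t`-truncations of `H`, as a functor of `H` and
`X`. -/
def virtCouple : (Cᵒᵖ ⥤ A) ⥤ (Cᵒᵖ ⥤ CoupleData A 2) :=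
  coupleOfNat (w.virtD A) (w.virtE A) (w.virtI A) (w.virtJ A) (w.virtK A)

end WeightStructure

end VirtualCouple

section Kernels

variable {A : Type u'} [Category.{v'} A] [Abelian A]

lemma kerMap_id {X Y : A} {f : X ⟶ Y} {u : X ⟶ X} {v : Y ⟶ Y} {h : f ≫ v = u ≫ f} (hu : u = 𝟙 X) :
    kernel.map f f u v h = 𝟙 _ := by
  subst hu
  rw [← cancel_mono (kernel.ι f), kernel.lift_ι, Category.id_comp, Category.comp_id]

lemma kerMap_comp {X Y X' Y' X'' Y'' : A} {f : X ⟶ Y} {f' : X' ⟶ Y'} {f'' : X'' ⟶ Y''}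
    {u : X ⟶ X'} {v : Y ⟶ Y'} {h : f ≫ v = u ≫ f'} {u' : X' ⟶ X''} {v' : Y' ⟶ Y''}
    {h' : f' ≫ v' = u' ≫ f''} {u'' : X ⟶ X''} {v'' : Y ⟶ Y''} {h'' : f ≫ v'' = u'' ≫ f''}
    (hu : u'' = u ≫ u') :
    kernel.map f f'' u'' v'' h'' = kernel.map f f' u v h ≫ kernel.map f' f'' u' v' h' := by
  subst hu
  rw [← cancel_mono (kernel.ι f''), Category.assoc, kernel.lift_ι, kernel.lift_ι, ← Category.assoc,
    ← Category.assoc, kernel.lift_ι]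

lemma kerMap_comp_eq {X Y X₁ Y₁ X₂ Y₂ X' Y' : A} {f : X ⟶ Y} {f₁ : X₁ ⟶ Y₁} {f₂ : X₂ ⟶ Y₂}
    {f' : X' ⟶ Y'} {u₁ : X ⟶ X₁} {v₁ : Y ⟶ Y₁} {h₁ : f ≫ v₁ = u₁ ≫ f₁} {u₁' : X₁ ⟶ X'}
    {v₁' : Y₁ ⟶ Y'} {h₁' : f₁ ≫ v₁' = u₁' ≫ f'} {u₂ : X ⟶ X₂} {v₂ : Y ⟶ Y₂}
    {h₂ : f ≫ v₂ = u₂ ≫ f₂} {u₂' : X₂ ⟶ X'} {v₂' : Y₂ ⟶ Y'} {h₂' : f₂ ≫ v₂' = u₂' ≫ f'}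
    (h : u₁ ≫ u₁' = u₂ ≫ u₂') :
    kernel.map f f₁ u₁ v₁ h₁ ≫ kernel.map f₁ f' u₁' v₁' h₁' =
      kernel.map f f₂ u₂ v₂ h₂ ≫ kernel.map f₂ f' u₂' v₂' h₂' := by
  rw [← cancel_mono (kernel.ι f'), Category.assoc, Category.assoc, kernel.lift_ι, kernel.lift_ι,
    ← Category.assoc, ← Category.assoc, kernel.lift_ι, kernel.lift_ι, Category.assoc,
    Category.assoc, h]

lemma cokMap_id {X Y : A} {f : X ⟶ Y} {u : X ⟶ X} {v : Y ⟶ Y} {h : f ≫ v = u ≫ f} (hv : v = 𝟙 Y) :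
    cokernel.map f f u v h = 𝟙 _ := by
  subst hv
  rw [← cancel_epi (cokernel.π f), cokernel.π_desc, Category.id_comp, Category.comp_id]

lemma cokMap_comp {X Y X' Y' X'' Y'' : A} {f : X ⟶ Y} {f' : X' ⟶ Y'} {f'' : X'' ⟶ Y''}
    {u : X ⟶ X'} {v : Y ⟶ Y'} {h : f ≫ v = u ≫ f'} {u' : X' ⟶ X''} {v' : Y' ⟶ Y''}
    {h' : f' ≫ v' = u' ≫ f''} {u'' : X ⟶ X''} {v'' : Y ⟶ Y''} {h'' : f ≫ v'' = u'' ≫ f''}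
    (hv : v'' = v ≫ v') :
    cokernel.map f f'' u'' v'' h'' = cokernel.map f f' u v h ≫ cokernel.map f' f'' u' v' h' := by
  subst hv
  rw [← cancel_epi (cokernel.π f), ← Category.assoc, cokernel.π_desc, cokernel.π_desc,
    Category.assoc, Category.assoc, cokernel.π_desc]

lemma cokMap_comp_eq {X Y X₁ Y₁ X₂ Y₂ X' Y' : A} {f : X ⟶ Y} {f₁ : X₁ ⟶ Y₁} {f₂ : X₂ ⟶ Y₂}
    {f' : X' ⟶ Y'} {u₁ : X ⟶ X₁} {v₁ : Y ⟶ Y₁} {h₁ : f ≫ v₁ = u₁ ≫ f₁} {u₁' : X₁ ⟶ X'}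
    {v₁' : Y₁ ⟶ Y'} {h₁' : f₁ ≫ v₁' = u₁' ≫ f'} {u₂ : X ⟶ X₂} {v₂ : Y ⟶ Y₂}
    {h₂ : f ≫ v₂ = u₂ ≫ f₂} {u₂' : X₂ ⟶ X'} {v₂' : Y₂ ⟶ Y'} {h₂' : f₂ ≫ v₂' = u₂' ≫ f'}
    (h : v₁ ≫ v₁' = v₂ ≫ v₂') :
    cokernel.map f f₁ u₁ v₁ h₁ ≫ cokernel.map f₁ f' u₁' v₁' h₁' =
      cokernel.map f f₂ u₂ v₂ h₂ ≫ cokernel.map f₂ f' u₂' v₂' h₂' := by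
  rw [← cancel_epi (cokernel.π f), ← Category.assoc, ← Category.assoc, cokernel.π_desc,
    cokernel.π_desc, Category.assoc, Category.assoc, cokernel.π_desc, cokernel.π_desc,
    ← Category.assoc, ← Category.assoc, h]

end Kernels

section Filtration

variable {C : Type u} [Category.{v} C] [Preadditive C] [HasZeroObject C] [HasShift C ℤ]
  [∀ n : ℤ, (shiftFunctor C n).Additive] [Pretriangulated C]
  {A : Type u'} [Category.{v'} A] [Abelian A] {w : WeightStructure C}

/-- `(W^k G)(X) = Im (G (w_{≤ k} X) ⟶ G (X))`. -/
def WeightDec.W {k : ℤ} {X : C} (D : WeightDec w k X) (G : Cᵒᵖ ⥤ A) : Subobject (G.obj (op X)) :=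
  imageSubobject (G.map D.π.op)

/-- The step `F^p G(X) = Ker (G (X) ⟶ G (Y_p))` of the filtration on `G(X)` given by a tower. -/
def Tower.filSub (P : Tower w) (G : Cᵒᵖ ⥤ A) (p : ℤ) : Subobject (G.obj (op P.X)) :=
  kernelSubobject (G.map (P.toX p).op)

lemma Tower.toX_nat {P P' : Tower w} (F : Tower.Hom P P') (G : Cᵒᵖ ⥤ A) (p : ℤ) :
    G.map (P'.toX p).op ≫ G.map (F.y p).op = G.map F.g.op ≫ G.map (P.toX p).op := by
  rw [← G.map_comp, ← G.map_comp, ← op_comp, ← op_comp, F.comm_toX]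

lemma Tower.toX_step (P : Tower w) (G : Cᵒᵖ ⥤ A) (p p' : ℤ) (h : p + 1 = p') :
    G.map (P.toX p').op ≫ G.map (P.f p p' h).op = 𝟙 _ ≫ G.map (P.toX p).op := by
  rw [← G.map_comp, ← op_comp, P.comm, Category.id_comp]

variable (w A)

/-- `F^p G(X)`, as a functor of `G` and of the tower. -/
def fil (p : ℤ) : (Cᵒᵖ ⥤ A) ⥤ (Tower w)ᵒᵖ ⥤ A where
  obj G :=
    { obj P := kernel (G.map (P.unop.toX p).op)
      map {P P'} F := kernel.map _ _ (G.map (Tower.Hom.g F.unop).op) (G.map (Tower.Hom.y F.unop p).op)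
        (Tower.toX_nat F.unop G p)
      map_id P := kerMap_id (G.map_id (op P.unop.X))
      map_comp F F' :=
        kerMap_comp (G.map_comp (Tower.Hom.g F.unop).op (Tower.Hom.g F'.unop).op) }
  map {G G'} α :=
    { app P := kernel.map _ _ (α.app _) (α.app _) (α.naturality _)
      naturality P P' F := kerMap_comp_eq (h₁ := Tower.toX_nat F.unop G p)
        (h₂' := Tower.toX_nat F.unop G' p) (α.naturality _) }
  map_id G := by
    ext1; ext1 P
    exact kerMap_id (h := (𝟙 G : G ⟶ G).naturality (P.unop.toX p).op) rfl
  map_comp α β := by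
    ext1; ext1 P
    exact kerMap_comp (h := α.naturality (P.unop.toX p).op) (h' := β.naturality (P.unop.toX p).op)
      (h'' := (α ≫ β).naturality (P.unop.toX p).op) rfl

/-- The inclusion `F^{p+1} G(X) ⟶ F^p G(X)`. -/
def filStep (p p' : ℤ) (h : p + 1 = p') : fil A w p' ⟶ fil A w p where
  app G :=
    { app P := kernel.map _ _ (𝟙 _) (G.map (P.unop.f p p' h).op)
        (P.unop.toX_step G p p' h)
      naturality P P' F := kerMap_comp_eq (h₁ := Tower.toX_nat F.unop G p')
        (h₂' := Tower.toX_nat F.unop G p)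
        ((Category.comp_id _).trans (Category.id_comp _).symm) }
  naturality G G' α := by
    ext1; ext1 P
    exact kerMap_comp_eq (h₁ := α.naturality (P.unop.toX p').op)
      (h₁' := P.unop.toX_step G' p p' h) (h₂ := P.unop.toX_step G p p' h)
      (h₂' := α.naturality (P.unop.toX p).op) ((Category.comp_id _).trans (Category.id_comp _).symm)

/-- `F^p G(X) / F^{p+1} G(X)`, as a functor of `G` and of the tower. -/
def gr (p : ℤ) : (Cᵒᵖ ⥤ A) ⥤ (Tower w)ᵒᵖ ⥤ A where
  obj G :=
    { obj P := cokernel (((filStep A w p (p + 1) rfl).app G).app P)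
      map {P P'} F := cokernel.map _ _ (((fil A w (p + 1)).obj G).map F) (((fil A w p).obj G).map F)
        (((filStep A w p (p + 1) rfl).app G).naturality F).symm
      map_id P := cokMap_id (((fil A w p).obj G).map_id P)
      map_comp F F' := cokMap_comp (((fil A w p).obj G).map_comp F F') }
  map {G G'} α :=
    { app P := cokernel.map _ _ (((fil A w (p + 1)).map α).app P) (((fil A w p).map α).app P)
        (congrArg (fun t => t.app P) ((filStep A w p (p + 1) rfl).naturality α)).symm
      naturality P P' F := cokMap_comp_eq
        (h₁ := (((filStep A w p (p + 1) rfl).app G).naturality F).symm)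
        (h₂' := (((filStep A w p (p + 1) rfl).app G').naturality F).symm) (((fil A w p).map α).naturality F) }
  map_id G := by
    ext1; ext1 P
    exact cokMap_id
      (h := (congrArg (fun t => t.app P) ((filStep A w p (p + 1) rfl).naturality (𝟙 G))).symm)
      (congrArg (fun t => t.app P) ((fil A w p).map_id G))
  map_comp α β := by
    ext1; ext1 P
    exact cokMap_comp
      (h := (congrArg (fun t => t.app P) ((filStep A w p (p + 1) rfl).naturality α)).symm)
      (h' := (congrArg (fun t => t.app P) ((filStep A w p (p + 1) rfl).naturality β)).symm)
      (h'' := (congrArg (fun t => t.app P) ((filStep A w p (p + 1) rfl).naturality (α ≫ β))).symm)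
      (congrArg (fun t => t.app P) ((fil A w p).map_comp α β))

variable {A w}

/-- The monomorphism `F^p H^{p+q}(X) / F^{p+1} H^{p+q}(X) ⟶ H^{p+q}(Y_{p+1}) ≅ D_1^{p+1,q}` induced by
`Y_{p+1} ⟶ X`. -/
def grToD (H : Coh C A) (P : Tower w) (p q : ℤ) :
    ((gr A w p).obj ((coh C A (p + q)).obj H.obj)).obj (op P) ⟶
      (((towerCouple A w).obj H).obj (op P)).D (p + 1, q) :=
  cokernel.desc (((filStep A w p (p + 1) rfl).app ((coh C A (p + q)).obj H.obj)).app (op P))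
    (kernel.ι (((coh C A (p + q)).obj H.obj).map (P.toX p).op) ≫
      ((coh C A (p + q)).obj H.obj).map (P.toX (p + 1)).op ≫
      H.obj.map ((shiftFunctorAdd' C (1 - (p + 1)) (-q) (-(p + q)) (by ring)).inv.app
        (P.Y (p + 1))).op) (by
    refine (Category.assoc _ _ _).symm.trans ?_
    refine (congrArg (· ≫ _) ((kernel.lift_ι _ _ _).trans (Category.comp_id _))).trans ?_
    refine (Category.assoc _ _ _).symm.trans ?_
    exact (congrArg (· ≫ _) (kernel.condition _)).trans zero_comp)

end Filtration

end WeightSS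

end

open WeightSS

/-! Everything is reduced to comparing morphisms in the triangulated category. An object `M` of an
abelian category given with an epimorphism from `U` and a monomorphism to `V` is determined by the
composite `U ⟶ V`. Hence two bifunctors presented with the same `U`, `V` and the same composites are
isomorphic, and naturality in `H` and in the tower is read off from the composites as well
(`exists_natIso_of_presentation`).

On the side of the couples: the `n`-th derived couple has `D` equal to the image of `i^n` and `E`
equal to `k⁻¹(Im i^n) / j(Ker i^n)` (`ExactCouple.Derived`). For the couple of a tower, put `G =
H(-[-p][-q])` and let `Y_b / Y_a` be a cone of `Y_a ⟶ Y_b`. A chase with cones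
(`HalfExact.lift_of_cone`, `HalfExact.ker_of_cone`) shows that the term `E` of index `(p, q)` is the
image of `G(Y_{p+1+n} / Y_p) ⟶ G(Y_{p+1} / Y_{p-n})`, induced by `Y_{p+1} / Y_{p-n} ⟶ X_p ⟶
Y_{p+1+n} / Y_p` (`Tower.exists_presentation`). The page is `r = n + 1`.

On the side of the truncations: a virtual truncation is an image by definition, and the image may be
computed with other choices of weight truncations (`epi_leIn_of_choice` and its companions). Now
`Y_b / Y_a` is a choice of `w_{≤ -a} Y_b`, and it behaves like `w_{≥ 1-b}` of `X / Y_a`. Virtual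
truncations of half exact functors are half exact (`tauLE_halfExact`, `tauGE_halfExact`), and for
half exact `K` the graded piece `F^p K / F^{p+1} K` is the image of `K(X / Y_p) ⟶ K(Y_{p+1})`.
Unwinding this for `K = τ_{[l,m]} G`, and similarly unwinding `τ_{≥ 0} τ_{≤ 0}`, gives the very
presentation found for `E`. All identities of morphisms come from one principle: a morphism from an
object of weight `≥ a` to `w_{≥ l} X` is determined by its composite to `X` as soon as `l < a`, and
dually for `w_{≤ l}`.

For the second couple, `D` is treated in the same way. The isomorphisms commute with `i` and `k`,
but with `j` only up to `(-1)^{p+q}`, the sign created by shifting distinguished triangles;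
rescaling the components removes it (`nonempty_iso_of_sign`). As the virtual couple depends on `X`
alone, it inherits exactness from any tower, and its spectral sequence is the required functor `T₂`.

Finally, `F^{-k} G(X)` is the kernel of restriction to a choice of `w_{≥ k+1} X`, hence the image of
`G(w_{≤ k} X)`. If `X` is bounded, then `Y_a ⟶ Y_b` factors through `X` once `b - a` is large. This
kills `j` of the late derived couples, so that `k` becomes injective with image the graded piece. -/

noncomputable section

namespace WeightSS

/-! ### Objects and bifunctors determined by a presentation as an image -/

section Presentations

variable {𝓗 : Type*} [Category* 𝓗] {𝓧 : Type*} [Category* 𝓧] {A : Type u'} [Category.{v'} A] [Abelian A]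

/-- Two objects presented as the image of the same morphism are isomorphic. -/
lemma exists_iso_of_presentation {M N U V : A} (u : U ⟶ M) (u' : U ⟶ N) (v : M ⟶ V) (v' : N ⟶ V)
    [Epi u] [Epi u'] [Mono v] [Mono v'] (h : u ≫ v = u' ≫ v') :
    ∃ e : M ≅ N, u ≫ e.hom = u' ∧ e.hom ≫ v' = v := by
  have h₁ : kernel.ι u ≫ u' = 0 := by
    rw [← cancel_mono v', Category.assoc, ← h, kernel.condition_assoc, zero_comp, zero_comp]
  have h₂ : kernel.ι u' ≫ u = 0 := by
    rw [← cancel_mono v, Category.assoc, h, kernel.condition_assoc, zero_comp, zero_comp]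
  have e₁ : u ≫ Abelian.epiDesc u u' h₁ = u' := Abelian.comp_epiDesc _ _ _
  have e₂ : u' ≫ Abelian.epiDesc u' u h₂ = u := Abelian.comp_epiDesc _ _ _
  refine ⟨⟨Abelian.epiDesc u u' h₁, Abelian.epiDesc u' u h₂, ?_, ?_⟩, e₁, ?_⟩
  · rw [← cancel_epi u, ← Category.assoc, e₁, e₂, Category.comp_id]
  · rw [← cancel_epi u', ← Category.assoc, e₂, e₁, Category.comp_id]
  · rw [← cancel_epi u, ← Category.assoc, e₁, h]

/-- Two bifunctors whose values are presented as images of the same morphisms, compatibly with the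
functorialities, are isomorphic. -/
lemma exists_natIso_of_presentation (M N : 𝓗 ⥤ 𝓧 ⥤ A) (U V : 𝓗 → 𝓧 → A)
    (u : ∀ H X, U H X ⟶ (M.obj H).obj X) (u' : ∀ H X, U H X ⟶ (N.obj H).obj X)
    (v : ∀ H X, (M.obj H).obj X ⟶ V H X) (v' : ∀ H X, (N.obj H).obj X ⟶ V H X)
    (hu : ∀ H X, Epi (u H X)) (hu' : ∀ H X, Epi (u' H X))
    (hv : ∀ H X, Mono (v H X)) (hv' : ∀ H X, Mono (v' H X))
    (h : ∀ {H H' : 𝓗} (α : H ⟶ H') {X X' : 𝓧} (f : X ⟶ X'),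
      u H X ≫ (M.map α).app X ≫ (M.obj H').map f ≫ v H' X' =
        u' H X ≫ (N.map α).app X ≫ (N.obj H').map f ≫ v' H' X') :
    ∃ e : M ≅ N, ∀ H X, u H X ≫ (e.hom.app H).app X = u' H X ∧
      (e.hom.app H).app X ≫ v' H X = v H X := by
  choose e he₁ he₂ using fun H X => exists_iso_of_presentation (u H X) (u' H X) (v H X) (v' H X)
    (by simpa using h (𝟙 H) (𝟙 X))
  -- The hypothesis treats both variables at once; with an identity in one variable it becomes
  -- naturality in the other, tested against the epimorphism `u` and the monomorphism `v'`.
  have n₁ : ∀ (H : 𝓗) {X X' : 𝓧} (f : X ⟶ X'),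
      (M.obj H).map f ≫ (e H X').hom = (e H X).hom ≫ (N.obj H).map f := fun H X X' f => by
    rw [← cancel_epi (u H X), ← cancel_mono (v' H X'), Category.assoc, Category.assoc, he₂,
      ← Category.assoc (u H X) (e H X).hom, he₁]
    simpa using h (𝟙 H) f
  have n₂ : ∀ {H H' : 𝓗} (α : H ⟶ H') (X : 𝓧),
      (M.map α).app X ≫ (e H' X).hom = (e H X).hom ≫ (N.map α).app X := fun {H H'} α X => by
    rw [← cancel_epi (u H X), ← cancel_mono (v' H' X), Category.assoc, Category.assoc, he₂,
      ← Category.assoc (u H X) (e H X).hom, he₁]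
    simpa using h α (𝟙 X)
  refine ⟨NatIso.ofComponents (fun H => NatIso.ofComponents (fun X => e H X) (n₁ H)) ?_,
    fun H X => ⟨he₁ H X, he₂ H X⟩⟩
  intro H H' α
  ext X
  exact n₂ α X

lemma epi_of_refinements {M U : A} (u : U ⟶ M)
    (h : ∀ {T : A} (z : T ⟶ M), ∃ (T' : A) (π : T' ⟶ T) (_ : Epi π) (y : T' ⟶ U), π ≫ z = y ≫ u) :
    Epi u := by
  obtain ⟨T, π, _, y, hy⟩ := h (𝟙 M)
  rw [Category.comp_id] at hy
  have : Epi (y ≫ u) := hy ▸ inferInstance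
  exact epi_of_epi y u

lemma eq_zero_of_refinement {T' T M : A} {π : T' ⟶ T} (hπ : Epi π) {z : T ⟶ M} (h : π ≫ z = 0) :
    z = 0 := by
  rw [← cancel_epi π, h, comp_zero]

end Presentations

/-! ### Explicit description of iterated derived couples -/

namespace ExactCouple

variable {r r' : ℤ} {A : Type u'} [Category.{v'} A] [Abelian A]

/-- The iterate `i^n`. -/
def iPow (S : ExactCouple A r) : ∀ (n : ℕ) (a b : ℤ × ℤ), a + (-(n : ℤ), (n : ℤ)) = b →
    (S.D a ⟶ S.D b)
  | 0, a, b, h => eqToHom (congrArg S.D (by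
      rw [← h]; ext <;> simp))
  | n + 1, a, b, h => iPow S n a (b + (1, -1)) (by
      rw [← h]; ext <;> push_cast <;> simp <;> ring) ≫ S.i (b + (1, -1)) b (by ext <;> simp)

lemma iPow_zero (S : ExactCouple A r) (a : ℤ × ℤ) (h : a + (-((0 : ℕ) : ℤ), ((0 : ℕ) : ℤ)) = a) :
    S.iPow 0 a a h = 𝟙 _ := rfl

lemma iPow_succ (S : ExactCouple A r) (n : ℕ) (a b c : ℤ × ℤ)
    (h : a + (-((n + 1 : ℕ) : ℤ), ((n + 1 : ℕ) : ℤ)) = b)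
    (h₁ : a + (-(n : ℤ), (n : ℤ)) = c) (h₂ : c + (-1, 1) = b) :
    S.iPow (n + 1) a b h = S.iPow n a c h₁ ≫ S.i c b h₂ := by
  obtain rfl : c = b + (1, -1) := by rw [← h₂]; ext <;> simp
  rfl

/-- The recursion splits off the last factor `i`. Splitting off the first one is needed to see
`i^{n+1} t` as `i^n (i t)`. -/
lemma iPow_succ' (S : ExactCouple A r) (n : ℕ) (a b c : ℤ × ℤ)
    (h : a + (-((n + 1 : ℕ) : ℤ), ((n + 1 : ℕ) : ℤ)) = b)
    (h₁ : c + (-(n : ℤ), (n : ℤ)) = b) (h₂ : a + (-1, 1) = c) :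
    S.iPow (n + 1) a b h = S.i a c h₂ ≫ S.iPow n c b h₁ := by
  induction n generalizing b with
  | zero =>
    obtain rfl : c = b := by rw [← h₁]; ext <;> simp
    rw [S.iPow_succ 0 a c a h (by ext <;> simp) h₂, iPow_zero, iPow_zero, Category.id_comp,
      Category.comp_id]
  | succ n ih =>
    have e₁ : b + (1, -1) + (-1, 1) = b := by ext <;> simp
    have e₂ : c + (-(n : ℤ), (n : ℤ)) = b + (1, -1) := by
      rw [← h₁]; ext <;> push_cast <;> simp <;> ring
    have e₃ : a + (-((n + 1 : ℕ) : ℤ), ((n + 1 : ℕ) : ℤ)) = b + (1, -1) := by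
      rw [← e₂, ← h₂]; ext <;> push_cast <;> simp <;> ring
    rw [S.iPow_succ (n + 1) a b _ h e₃ e₁, ih _ e₃ e₂, S.iPow_succ n c b _ h₁ e₂ e₁, Category.assoc]

lemma iPow_one (S : ExactCouple A r) (a b : ℤ × ℤ) (h : a + (-((1 : ℕ) : ℤ), ((1 : ℕ) : ℤ)) = b)
    (h' : a + (-1, 1) = b) : S.iPow 1 a b h = S.i a b h' := by
  rw [S.iPow_succ 0 a b a h (by ext <;> simp) h', iPow_zero, Category.id_comp]

/-- The data exhibiting `S'` as the `n`-th derived couple of `S`: `D'` is the image of `i^n`, and `E'`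
is the quotient of `Z = k⁻¹(Im i^n)` by `j (Ker i^n)`. -/
structure Derived (n : ℕ) (S : ExactCouple A r) (S' : ExactCouple A r') where
  ι : ∀ a, S'.D a ⟶ S.D a
  Z : ℤ × ℤ → A
  inc : ∀ a, Z a ⟶ S.E a
  cls : ∀ a, Z a ⟶ S'.E a
  mono_ι : ∀ a, Mono (ι a)
  mono_inc : ∀ a, Mono (inc a)
  epi_cls : ∀ a, Epi (cls a)
  i_ι : ∀ a b h, S'.i a b h ≫ ι b = ι a ≫ S.i a b h
  -- The corestriction of `i^n` to its image. The condition on `j` is the formula `j'(i^n x) = [j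
  -- x]`; it includes that `j x` lies in `Z`.
  exists_π : ∀ (a b : ℤ × ℤ) (h : a + (-(n : ℤ), (n : ℤ)) = b), ∃ π : S.D a ⟶ S'.D b,
    Epi π ∧ π ≫ ι b = S.iPow n a b h ∧ ∀ (c : ℤ × ℤ) (hac : a + (r - 1, 1 - r) = c)
      (hbc : b + (r' - 1, 1 - r') = c), ∃ y : S.D a ⟶ Z c, y ≫ inc c = S.j a c hac ∧
        y ≫ cls c = π ≫ S'.j b c hbc
  cls_k : ∀ a b h, cls a ≫ S'.k a b h ≫ ι b = inc a ≫ S.k a b h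
  exists_lift : ∀ {T : A} {a b c : ℤ × ℤ} (hab : a + (1, 0) = b) (hcb : c + (-(n : ℤ), (n : ℤ)) = b)
    (x : T ⟶ S.E a) (t : T ⟶ S.D c), x ≫ S.k a b hab = t ≫ S.iPow n c b hcb →
      ∃ y : T ⟶ Z a, y ≫ inc a = x
  -- With the next field: the kernel of `Z ⟶ E'` is `j (Ker i^n)`, expressed through generalized
  -- elements up to refinement.
  ker_cls : ∀ {T : A} {a b c : ℤ × ℤ} (hab : a + (r - 1, 1 - r) = b)
    (hac : a + (-(n : ℤ), (n : ℤ)) = c) (y : T ⟶ Z b), y ≫ cls b = 0 →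
      ∃ (T' : A) (π : T' ⟶ T) (_ : Epi π) (u : T' ⟶ S.D a),
        π ≫ y ≫ inc b = u ≫ S.j a b hab ∧ u ≫ S.iPow n a c hac = 0
  cls_eq_zero : ∀ {T : A} {a b c : ℤ × ℤ} (hab : a + (r - 1, 1 - r) = b)
    (hac : a + (-(n : ℤ), (n : ℤ)) = c) (y : T ⟶ Z b) (u : T ⟶ S.D a),
      y ≫ inc b = u ≫ S.j a b hab → u ≫ S.iPow n a c hac = 0 → y ≫ cls b = 0

attribute [instance] Derived.mono_ι Derived.mono_inc Derived.epi_cls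

namespace Derived

/-- A couple is its own `0`-th derived couple. -/
def refl (S : ExactCouple A r) : Derived 0 S S where
  ι a := 𝟙 _
  Z a := S.E a
  inc a := 𝟙 _
  cls a := 𝟙 _
  mono_ι a := inferInstance
  mono_inc a := inferInstance
  epi_cls a := inferInstance
  i_ι a b h := by simp
  exists_π a b h := by
    obtain rfl : a = b := by rw [← h]; ext <;> simp
    exact ⟨𝟙 _, inferInstance, by simp [iPow_zero], fun c hac hbc => ⟨S.j a c hac, by simp, by simp⟩⟩
  cls_k a b h := by simp
  exists_lift hab hcb x t h := ⟨x, by simp⟩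
  ker_cls {T a b c} hab hac y hy := by
    rw [Category.comp_id] at hy
    exact ⟨T, 𝟙 _, inferInstance, 0, by simp [hy], by simp⟩
  cls_eq_zero {T a b c} hab hac y u h₁ h₂ := by
    obtain rfl : a = c := by rw [← hac]; ext <;> simp
    rw [iPow_zero, Category.comp_id] at h₂
    rw [h₁, h₂, zero_comp]

/-- By exactness an element `u` with `i u = 0` is locally `k z`, so `j u = j (k z)` is a boundary.
-/
lemma cls_eq_zero_of_refinement {S : ExactCouple A r} {T : A} {a b c : ℤ × ℤ} (hab : a + (r - 1, 1 - r) = b)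
    (hac : a + (-1, 1) = c) (y : T ⟶ S.complex.cycles b) (u : T ⟶ S.D a)
    (h₁ : y ≫ S.complex.iCycles b = u ≫ S.j a b hab) (h₂ : u ≫ S.i a c hac = 0) :
    y ≫ S.complex.homologyπ b = 0 := by
  have e₁ : a + (-1, 0) + (1, 0) = a := by ext <;> simp
  obtain ⟨T', π, _, z, hz⟩ := S.lift_ki e₁ hac u h₂
  rw [S.complex.comp_homologyπ_eq_zero_iff_up_to_refinements (a + (-1, 0)) b
    ((ComplexShape.up' (⟨r, 1 - r⟩ : ℤ × ℤ)).prev_eq' (by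
      change a + (-1, 0) + (r, 1 - r) = b
      rw [← hab]; ext <;> simp <;> ring))]
  refine ⟨T', π, inferInstance, z, ?_⟩
  rw [← cancel_mono (S.complex.iCycles b), Category.assoc, Category.assoc,
    HomologicalComplex.toCycles_i, S.complex_d e₁ hab, h₁, ← Category.assoc, hz, Category.assoc]

/-- A boundary is locally `j (k z)`, and `u = k z` is killed by `i`. -/
lemma ker_homologyπ {S : ExactCouple A r} {T : A} {a b c : ℤ × ℤ} (hab : a + (r - 1, 1 - r) = b)
    (hac : a + (-1, 1) = c) (y : T ⟶ S.complex.cycles b) (hy : y ≫ S.complex.homologyπ b = 0) :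
    ∃ (T' : A) (π : T' ⟶ T) (_ : Epi π) (u : T' ⟶ S.D a),
        π ≫ y ≫ S.complex.iCycles b = u ≫ S.j a b hab ∧ u ≫ S.i a c hac = 0 := by
  have e₁ : a + (-1, 0) + (1, 0) = a := by ext <;> simp
  obtain ⟨T', π, hπ, z, hz⟩ := (S.complex.comp_homologyπ_eq_zero_iff_up_to_refinements (a + (-1, 0)) b
    ((ComplexShape.up' (⟨r, 1 - r⟩ : ℤ × ℤ)).prev_eq' (by
      change a + (-1, 0) + (r, 1 - r) = b
      rw [← hab]; ext <;> simp <;> ring)) y).1 hy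
  refine ⟨T', π, hπ, z ≫ S.k _ _ e₁, ?_, ?_⟩
  · rw [← Category.assoc, hz, Category.assoc, HomologicalComplex.toCycles_i, S.complex_d e₁ hab,
      Category.assoc]
  · rw [Category.assoc, S.zero_ki, comp_zero]

/-- If `k x = i t`, then `d x = j (k x) = j (i t) = 0`. -/
lemma exists_cycles_lift {S : ExactCouple A r} {T : A} {a b c : ℤ × ℤ} (hab : a + (1, 0) = b)
    (hcb : c + (-1, 1) = b) (x : T ⟶ S.E a) (t : T ⟶ S.D c) (h : x ≫ S.k a b hab = t ≫ S.i c b hcb) :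
    ∃ y : T ⟶ S.complex.cycles a, y ≫ S.complex.iCycles a = x := by
  have h₃ : x ≫ S.complex.d a ((ComplexShape.up' (⟨r, 1 - r⟩ : ℤ × ℤ)).next a) = 0 := by
    rw [(ComplexShape.up' (⟨r, 1 - r⟩ : ℤ × ℤ)).next_eq' (j := a + (r, 1 - r)) rfl,
      S.complex_d hab (by rw [← hab]; ext <;> simp), ← Category.assoc,
      h, Category.assoc, S.zero_ij, comp_zero]
  exact ⟨S.complex.liftCycles x _ rfl h₃, S.complex.liftCycles_i _ _ _ _⟩

/-- The derived couple is the first derived couple. -/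
def derive (S : ExactCouple A r) {r' : ℤ} (hr : r + 1 = r') : Derived 1 S (S.derive hr) where
  ι a := S.derι a
  Z a := S.complex.cycles a
  inc a := S.complex.iCycles a
  cls a := S.complex.homologyπ a
  mono_ι a := inferInstanceAs (Mono (S.derι a))
  mono_inc a := inferInstance
  epi_cls a := inferInstanceAs (Epi (S.complex.homologyπ a))
  i_ι a b h := by
    have : (S.derι a ≫ S.derπ a b h) ≫ S.derι b = S.derι a ≫ S.i a b h := by
      rw [Category.assoc, derπ_derι]
    exact this
  exists_π a b h := by
    have e₁ : a + (-1, 1) = b := by rw [← h]; ext <;> simp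
    refine ⟨S.derπ a b e₁, inferInstanceAs (Epi (S.derπ a b e₁)), ?_, fun c hac hbc => ?_⟩
    · rw [S.iPow_one a b h e₁]
      exact S.derπ_derι a b e₁
    · exact ⟨S.complex.liftCycles (S.j a c hac) _ rfl (S.j_d a c _ hac),
        S.complex.liftCycles_i _ _ _ _, (S.derπ_derj hr a b c e₁ hbc hac).symm⟩
  cls_k a b h := by
    have : S.complex.homologyπ a ≫ S.derk a b h ≫ S.derι b = S.complex.iCycles a ≫ S.k a b h := by
      rw [← Category.assoc, homologyπ_derk, cyclesk_derι]
    exact this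
  exists_lift {T a b c} hab hcb x t h := by
    have e₁ : c + (-1, 1) = b := by rw [← hcb]; ext <;> simp
    rw [S.iPow_one c b hcb e₁] at h
    exact exists_cycles_lift hab e₁ x t h
  ker_cls {T a b c} hab hac y hy := by
    have e₁ : a + (-1, 1) = c := by rw [← hac]; ext <;> simp
    rw [S.iPow_one a c hac e₁]
    exact ker_homologyπ hab e₁ y hy
  cls_eq_zero {T a b c} hab hac y u h₁ h₂ := by
    have e₁ : a + (-1, 1) = c := by rw [← hac]; ext <;> simp
    rw [S.iPow_one a c hac e₁] at h₂
    exact cls_eq_zero_of_refinement hab e₁ y u h₁ h₂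

/-- The derived couple of the `n`-th derived couple is the `(n+1)`-st derived couple. -/
def succ {n : ℕ} {S : ExactCouple A r} {S' : ExactCouple A r'} (R : Derived n S S') {r'' : ℤ}
    (hr : r + n = r') {S'' : ExactCouple A r''} (R' : Derived 1 S' S'') : Derived (n + 1) S S'' where
  ι a := R'.ι a ≫ R.ι a
  -- The elements of the old `Z` whose class in `E'` is a cycle of the next couple; as a subobject
  -- of `E` this is `k⁻¹(Im i^{n+1})`.
  Z a := pullback (R.cls a) (R'.inc a)
  inc a := pullback.fst _ _ ≫ R.inc a
  cls a := pullback.snd _ _ ≫ R'.cls a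
  mono_ι a := inferInstance
  mono_inc a := inferInstance
  epi_cls a := inferInstance
  i_ι a b h := by
    rw [← Category.assoc, R'.i_ι, Category.assoc, Category.assoc, R.i_ι]
  exists_π a b h := by
    have e₁ : b + (1, -1) + (-1, 1) = b := by ext <;> simp
    have e₂ : a + (-(n : ℤ), (n : ℤ)) = b + (1, -1) := by
      rw [← h]; ext <;> push_cast <;> simp <;> ring
    obtain ⟨π, hπ, h₁, h₂⟩ := R.exists_π a _ e₂
    obtain ⟨π', hπ', h₁', h₂'⟩ := R'.exists_π (b + (1, -1)) b (by exact_mod_cast e₁)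
    refine ⟨π ≫ π', epi_comp _ _, ?_, ?_⟩
    · rw [Category.assoc, ← Category.assoc π', h₁', S'.iPow_one _ _ _ e₁, R.i_ι,
        S.iPow_succ n a b _ h e₂ e₁, ← Category.assoc, h₁]
    · intro c hac hbc
      have e₃ : b + (1, -1) + (r' - 1, 1 - r') = c := by
        rw [← hac, ← e₂, ← hr]; ext <;> simp <;> ring
      obtain ⟨y, hy₁, hy₂⟩ := h₂ c hac e₃
      obtain ⟨y', hy₁', hy₂'⟩ := h₂' c e₃ hbc
      refine ⟨pullback.lift y (π ≫ y') ?_, ?_, ?_⟩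
      · rw [Category.assoc, hy₁', hy₂]
      · rw [← Category.assoc, pullback.lift_fst, hy₁]
      · rw [← Category.assoc, pullback.lift_snd, Category.assoc, hy₂', Category.assoc]
  cls_k a b h := by
    rw [Category.assoc, ← Category.assoc (S''.k a b h), ← Category.assoc (R'.cls a), R'.cls_k,
      Category.assoc, ← Category.assoc, ← pullback.condition, Category.assoc, R.cls_k,
      Category.assoc]
  exists_lift {T a b c} hab hcb x t h := by
    have e₁ : b + (1, -1) + (-1, 1) = b := by ext <;> simp
    have e₂ : c + (-(n : ℤ), (n : ℤ)) = b + (1, -1) := by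
      rw [← hcb]; ext <;> push_cast <;> simp <;> ring
    have e₃ : c + (-1, 1) + (-(n : ℤ), (n : ℤ)) = b := by
      rw [← hcb]; ext <;> push_cast <;> simp <;> ring
    -- Reading `i^{n+1} t` as `i^n (i t)` puts `x` into the old `Z`; reading it as `i (i^n t)` shows
    -- that `k'` of the class of `x` lies in the image of `i'`.
    obtain ⟨y, hy⟩ := R.exists_lift hab e₃ x (t ≫ S.i _ _ rfl) (by
      rw [h, S.iPow_succ' n c b _ hcb e₃ rfl, Category.assoc])
    obtain ⟨π, hπ, h₁, -⟩ := R.exists_π c _ e₂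
    have h₂ : (y ≫ R.cls a) ≫ S'.k a b hab = (t ≫ π) ≫ S'.iPow 1 _ b (by exact_mod_cast e₁) := by
      rw [← cancel_mono (R.ι b), S'.iPow_one _ _ _ e₁]
      simp only [Category.assoc]
      rw [R.cls_k, R.i_ι, ← Category.assoc, hy, h, S.iPow_succ n c b _ hcb e₂ e₁, ← h₁,
        Category.assoc]
    obtain ⟨y', hy'⟩ := R'.exists_lift hab _ _ _ h₂
    refine ⟨pullback.lift y y' hy'.symm, ?_⟩
    rw [← Category.assoc, pullback.lift_fst, hy]
  ker_cls {T a b c} hab hac y hy := by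
    have e₁ : c + (1, -1) + (-1, 1) = c := by ext <;> simp
    have e₂ : a + (-(n : ℤ), (n : ℤ)) = c + (1, -1) := by
      rw [← hac]; ext <;> push_cast <;> simp <;> ring
    have e₃ : c + (1, -1) + (r' - 1, 1 - r') = b := by
      rw [← hab, ← e₂, ← hr]; ext <;> simp <;> ring
    obtain ⟨π, hπ, h₁, h₂⟩ := R.exists_π a _ e₂
    obtain ⟨y₁, hy₁, hy₁'⟩ := h₂ b hab e₃
    obtain ⟨T₁, π₁, _, u₁, hu₁, hu₁'⟩ := R'.ker_cls e₃ (c := c) (by exact_mod_cast e₁)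
      (y ≫ pullback.snd _ _) (by rw [Category.assoc, hy])
    obtain ⟨T₂, π₂, _, t, ht⟩ := surjective_up_to_refinements_of_epi π u₁
    -- In `E'` the class of `y` is `j' u₁`, and `u₁` is locally the image of `t`. Subtracting the
    -- lift of `j t` leaves an element with zero class, that is `j u₂` with `i^n u₂ = 0`; hence `t +
    -- u₂` is the required element, killed by `i^{n+1}`.
    obtain ⟨T₃, π₃, _, u₂, hu₂, hu₂'⟩ := R.ker_cls hab e₂
      (π₂ ≫ π₁ ≫ y ≫ pullback.fst _ _ - t ≫ y₁) (by
        rw [Preadditive.sub_comp]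
        simp only [Category.assoc]
        rw [pullback.condition, hy₁', ← Category.assoc t, ← ht, Category.assoc]
        simp only [Category.assoc] at hu₁
        rw [hu₁, sub_self])
    refine ⟨T₃, π₃ ≫ π₂ ≫ π₁, inferInstance, π₃ ≫ t + u₂, ?_, ?_⟩
    · rw [Preadditive.add_comp, ← hu₂]
      simp [hy₁]
    · rw [S.iPow_succ n a c _ hac e₂ e₁, Preadditive.add_comp, ← Category.assoc u₂, hu₂', zero_comp,
        add_zero, ← h₁, Category.assoc, Category.assoc, ← R.i_ι _ _ e₁, ← Category.assoc t, ← ht]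
      rw [S'.iPow_one _ _ _ e₁] at hu₁'
      rw [Category.assoc, ← Category.assoc u₁, hu₁', zero_comp, comp_zero, comp_zero]
  cls_eq_zero {T a b c} hab hac y u hy hu := by
    have e₁ : c + (1, -1) + (-1, 1) = c := by ext <;> simp
    have e₂ : a + (-(n : ℤ), (n : ℤ)) = c + (1, -1) := by
      rw [← hac]; ext <;> push_cast <;> simp <;> ring
    have e₃ : c + (1, -1) + (r' - 1, 1 - r') = b := by
      rw [← hab, ← e₂, ← hr]; ext <;> simp <;> ring
    obtain ⟨π, hπ, h₁, h₂⟩ := R.exists_π a _ e₂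
    obtain ⟨y₁, hy₁, hy₁'⟩ := h₂ b hab e₃
    rw [← Category.assoc]
    refine R'.cls_eq_zero e₃ (c := c) (by exact_mod_cast e₁) _ (u ≫ π) ?_ ?_
    · have h₃ : y ≫ pullback.fst _ _ = u ≫ y₁ := by
        rw [← cancel_mono (R.inc b), Category.assoc, hy, Category.assoc, hy₁]
      rw [Category.assoc, ← pullback.condition, ← Category.assoc, h₃, Category.assoc, hy₁',
        Category.assoc]
    · rw [S'.iPow_one _ _ _ e₁, ← cancel_mono (R.ι c), Category.assoc, Category.assoc, R.i_ι,
        ← Category.assoc π, h₁, ← S.iPow_succ n a c _ hac e₂ e₁, hu, zero_comp]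

/-- Compatibility of the data with morphisms of couples. -/
structure Compat {n : ℕ} {S T : ExactCouple A r} {S' T' : ExactCouple A r'} (R : Derived n S S')
    (Q : Derived n T T') (f : CoupleData.Hom S.toCoupleData T.toCoupleData)
    (f' : CoupleData.Hom S'.toCoupleData T'.toCoupleData) : Prop where
  exists_map : ∀ a, ∃ ζ : R.Z a ⟶ Q.Z a, ζ ≫ Q.inc a = R.inc a ≫ f.hE a ∧
    ζ ≫ Q.cls a = R.cls a ≫ f'.hE a

lemma Compat.refl {S T : ExactCouple A r} (f : CoupleData.Hom S.toCoupleData T.toCoupleData) :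
    Compat (Derived.refl S) (Derived.refl T) f f :=
  ⟨fun a => ⟨f.hE a, by simp [Derived.refl], by simp [Derived.refl]⟩⟩

lemma Compat.derive {S T : ExactCouple A r} (f : CoupleData.Hom S.toCoupleData T.toCoupleData)
    (hr : r + 1 = r') : Compat (Derived.derive S hr) (Derived.derive T hr) f (deriveMap f hr) :=
  ⟨fun a => ⟨HomologicalComplex.cyclesMap (complexMap f) a,
    HomologicalComplex.cyclesMap_i (complexMap f) a,
    (HomologicalComplex.homologyπ_naturality (complexMap f) a).symm⟩⟩

lemma Compat.succ {n : ℕ} {S T : ExactCouple A r} {S' T' : ExactCouple A r'} {r'' : ℤ}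
    {S'' T'' : ExactCouple A r''} {R : Derived n S S'} {Q : Derived n T T'}
    {f : CoupleData.Hom S.toCoupleData T.toCoupleData}
    {f' : CoupleData.Hom S'.toCoupleData T'.toCoupleData}
    {f'' : CoupleData.Hom S''.toCoupleData T''.toCoupleData} (h : Compat R Q f f')
    (hr : r + n = r') {R' : Derived 1 S' S''} {Q' : Derived 1 T' T''} (h' : Compat R' Q' f' f'') :
    Compat (R.succ hr R') (Q.succ hr Q') f f'' := by
  refine ⟨fun a => ?_⟩
  obtain ⟨ζ, h₁, h₂⟩ := h.exists_map a
  obtain ⟨ζ', h₁', h₂'⟩ := h'.exists_map a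
  refine ⟨pullback.map _ _ _ _ ζ ζ' (f'.hE a) h₂.symm h₁'.symm, ?_, ?_⟩
  · change pullback.map _ _ _ _ ζ ζ' (f'.hE a) h₂.symm h₁'.symm ≫ pullback.fst _ _ ≫ Q.inc a =
      (pullback.fst _ _ ≫ R.inc a) ≫ f.hE a
    rw [← Category.assoc, pullback.lift_fst, Category.assoc, h₁, Category.assoc]
  · change pullback.map _ _ _ _ ζ ζ' (f'.hE a) h₂.symm h₁'.symm ≫ pullback.snd _ _ ≫ Q'.cls a =
      (pullback.snd _ _ ≫ R'.cls a) ≫ f''.hE a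
    rw [← Category.assoc, pullback.lift_snd, Category.assoc, h₂', Category.assoc]

/-- The data exhibiting `iter A n r h` as the `n`-th derived couple. -/
def iter (S : ExactCouple A r) : ∀ (n : ℕ) (r' : ℤ) (h : r + n = r'),
    Derived n S ((ExactCouple.iter A n r' h).obj S)
  | 0, r', h => by
      obtain rfl : r = r' := by simpa using h
      exact Derived.refl S
  | n + 1, r', h => (iter S n (r' - 1) (by push_cast at h; lia)).succ (by push_cast at h; lia)
      (Derived.derive _ (sub_add_cancel r' 1))

/-- Links the inclusions in the derived data with those that occur in the statement of convergence.
-/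
lemma iter_ι (S : ExactCouple A r) (n : ℕ) (r' : ℤ) (h : r + n = r') (a : ℤ × ℤ) :
    (iter S n r' h).ι a = (iterι A n r' h a).app S := by
  induction n generalizing r' with
  | zero =>
    obtain rfl : r = r' := by simpa using h
    rfl
  | succ n ih =>
    have : (iter S (n + 1) r' h).ι a = derι _ a ≫ (iter S n (r' - 1) (by push_cast at h; lia)).ι a :=
      rfl
    rw [this, ih]
    exact (Category.id_comp _).symm

lemma Compat.iter {S T : ExactCouple A r} (f : S ⟶ T) (n : ℕ) (r' : ℤ) (h : r + n = r') :
    Compat (Derived.iter S n r' h) (Derived.iter T n r' h) f ((ExactCouple.iter A n r' h).map f) := by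
  induction n generalizing r' with
  | zero =>
    obtain rfl : r = r' := by simpa using h
    exact Compat.refl f
  | succ n ih => exact (ih (r' - 1) _).succ _ (Compat.derive _ _)

end Derived

end ExactCouple

end WeightSS

end

noncomputable section

namespace WeightSS

/-! ### Later pages as the spectral sequence of the derived couple -/

namespace ExactCouple

variable {A : Type u'} [Category.{v'} A] [Abelian A] {r r' : ℤ}

variable (A) in
-- `iter` performs the new derivation last, whereas dropping the first page requires one to be
-- performed first. The two orders give equal functors, not merely isomorphic ones.
lemma iter_derive {r₀ r₁ : ℤ} (h₁ : r₀ + 1 = r₁) (n : ℕ) (r : ℤ) (h : r₀ + (n + 1 : ℕ) = r)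
    (h' : r₁ + n = r) : iter A (n + 1) r h = deriveFunctor A h₁ ⋙ iter A n r h' := by
  induction n generalizing r with
  | zero =>
    obtain rfl : r₁ = r := by simpa using h'
    obtain rfl : r₀ = r₁ - 1 := by lia
    rfl
  | succ n ih =>
    have e := ih (r - 1) (by push_cast at h ⊢; lia) (by push_cast at h'; lia)
    exact congrArg (· ⋙ deriveFunctor A (sub_add_cancel r 1)) e

variable (A) in
lemma couple_derive {r₀ r₁ : ℤ} (h₁ : r₀ + 1 = r₁) (r : ℤ) (h : r₀ ≤ r) (h' : r₁ ≤ r) :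
    couple A r h = deriveFunctor A h₁ ⋙ couple A r h' := by
  have key : ∀ (n m : ℕ) (hn : n = m + 1) (hn' : r₀ + n = r) (hm : r₁ + m = r),
      iter A n r hn' = deriveFunctor A h₁ ⋙ iter A m r hm := by
    intro n m hn hn' hm
    subst hn
    exact iter_derive A h₁ m r hn' hm
  exact key _ _ (by lia) _ _

lemma coupleSucc_hom_app {r₀ : ℤ} (S : ExactCouple A r₀) (r r' : ℤ) (hrr' : r + 1 = r') (hr : r₀ ≤ r)
    (hr' : r₀ ≤ r') : (coupleSucc A r r' hrr' hr).hom.app S =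
      eqToHom (Functor.congr_obj (iter_succ A (by lia) hrr' (by lia) (by lia)).symm S :
        (deriveFunctor A hrr').obj ((couple A r hr).obj S) = (couple A r' hr').obj S) := by
  exact eqToHom_app (iter_succ A (by lia) hrr' (by lia) (by lia)).symm S

variable (A) in
/-- The pages of a spectral sequence of an exact couple from the second one on are those of the
spectral sequence of the derived couple. -/
def spectralSequenceDerive {r₀ r₁ : ℤ} (h₁ : r₀ + 1 = r₁) :
    spectralSequence A r₀ ⋙ restrictPages A r₀ r₁ (by lia) ≅
      deriveFunctor A h₁ ⋙ spectralSequence A r₁ := by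
  -- Since the functors giving the couples are equal, the comparison maps are transports along
  -- `couple_derive`. The maps between consecutive pages are transports too, so each compatibility
  -- is an equality of composites of `eqToHom`.
  refine NatIso.ofComponents (fun S => ⟨⟨fun r hr => complexMap
      (eqToHom (Functor.congr_obj (couple_derive A h₁ r (by lia) hr) S)), ?_⟩, ⟨fun r hr => complexMap
      (eqToHom (Functor.congr_obj (couple_derive A h₁ r (by lia) hr) S).symm), ?_⟩, ?_, ?_⟩) ?_
  · intro r r' pq hrr' hr
    have hr' : r₀ ≤ r := by lia
    have : (deriveFunctor A hrr').map
        (eqToHom (Functor.congr_obj (couple_derive A h₁ r (by lia) hr) S)) ≫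
          (coupleSucc A r r' hrr' hr).hom.app (S.derive h₁) =
        (coupleSucc A r r' hrr' hr').hom.app S ≫
          eqToHom (Functor.congr_obj (couple_derive A h₁ r' (by lia) (by lia)) S) := by
      rw [coupleSucc_hom_app _ r r' hrr' _ (by lia), coupleSucc_hom_app _ r r' hrr' _ (by lia),
        eqToHom_map]
      exact (eqToHom_trans _ _).trans (eqToHom_trans _ _).symm
    exact congrArg (evalE A r' pq).map this
  · intro r r' pq hrr' hr
    have hr' : r₀ ≤ r := by lia
    have : (deriveFunctor A hrr').map
        (eqToHom (Functor.congr_obj (couple_derive A h₁ r (by lia) hr) S).symm) ≫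
          (coupleSucc A r r' hrr' hr').hom.app S =
        (coupleSucc A r r' hrr' hr).hom.app (S.derive h₁) ≫
          eqToHom (Functor.congr_obj (couple_derive A h₁ r' (by lia) (by lia)) S).symm := by
      rw [coupleSucc_hom_app _ r r' hrr' _ (by lia), coupleSucc_hom_app _ r r' hrr' _ (by lia),
        eqToHom_map]
      exact (eqToHom_trans _ _).trans (eqToHom_trans _ _).symm
    exact congrArg (evalE A r' pq).map this
  · refine SpectralSequence.Hom.ext (funext fun r => funext fun hr => ?_)
    exact (congrArg (complexFunctor A r).map (eqToHom_trans _ _)).trans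
      ((complexFunctor A r).map_id _)
  · refine SpectralSequence.Hom.ext (funext fun r => funext fun hr => ?_)
    exact (congrArg (complexFunctor A r).map (eqToHom_trans _ _)).trans
      ((complexFunctor A r).map_id _)
  · intro S T f
    refine SpectralSequence.Hom.ext (funext fun r => funext fun hr => ?_)
    have : (couple A r (by lia)).map f ≫
        eqToHom (Functor.congr_obj (couple_derive A h₁ r (by lia) hr) T) =
      eqToHom (Functor.congr_obj (couple_derive A h₁ r (by lia) hr) S) ≫
        (deriveFunctor A h₁ ⋙ couple A r hr).map f := by
      rw [Functor.congr_hom (couple_derive A h₁ r (by lia) hr) f]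
      simp
    exact congrArg (complexFunctor A r).map this

/-- A couple isomorphic to an exact couple is exact. -/
lemma exact_of_iso (S : ExactCouple A r) (T : CoupleData A r)
    (e : S.toCoupleData ≅ T) : ∃ T' : ExactCouple A r, T'.toCoupleData = T := by
  have hD : ∀ a, CoupleData.Hom.hD e.hom a ≫ CoupleData.Hom.hD e.inv a = 𝟙 _ := fun a =>
    congrArg (fun t => CoupleData.Hom.hD t a) e.hom_inv_id
  have hD' : ∀ a, CoupleData.Hom.hD e.inv a ≫ CoupleData.Hom.hD e.hom a = 𝟙 _ := fun a =>
    congrArg (fun t => CoupleData.Hom.hD t a) e.inv_hom_id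
  have hE : ∀ a, CoupleData.Hom.hE e.hom a ≫ CoupleData.Hom.hE e.inv a = 𝟙 _ := fun a =>
    congrArg (fun t => CoupleData.Hom.hE t a) e.hom_inv_id
  have hE' : ∀ a, CoupleData.Hom.hE e.inv a ≫ CoupleData.Hom.hE e.hom a = 𝟙 _ := fun a =>
    congrArg (fun t => CoupleData.Hom.hE t a) e.inv_hom_id
  let eD : ∀ a, S.D a ≅ T.D a := fun a => ⟨_, _, hD a, hD' a⟩
  let eE : ∀ a, S.E a ≅ T.E a := fun a => ⟨_, _, hE a, hE' a⟩
  have ci : ∀ a b h, (eD a).hom ≫ T.i a b h = S.i a b h ≫ (eD b).hom := fun a b h =>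
    (CoupleData.Hom.comm_i e.hom a b h).symm
  have cj : ∀ a b h, (eD a).hom ≫ T.j a b h = S.j a b h ≫ (eE b).hom := fun a b h =>
    (CoupleData.Hom.comm_j e.hom a b h).symm
  have ck : ∀ a b h, (eE a).hom ≫ T.k a b h = S.k a b h ≫ (eD b).hom := fun a b h =>
    (CoupleData.Hom.comm_k e.hom a b h).symm
  have key : ∀ {X Y Z X' Y' Z' : A} {f : X ⟶ Y} {g : Y ⟶ Z} {f' : X' ⟶ Y'} {g' : Y' ⟶ Z'}
      (a : X ≅ X') (b : Y ≅ Y') (c : Z ≅ Z') (_ : a.hom ≫ f' = f ≫ b.hom)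
      (_ : b.hom ≫ g' = g ≫ c.hom) (z : f ≫ g = 0), (ShortComplex.mk f g z).Exact →
      ∃ z' : f' ≫ g' = 0, (ShortComplex.mk f' g' z').Exact := by
    intro X Y Z X' Y' Z' f g f' g' a b c h₁ h₂ z hz
    have z' : f' ≫ g' = 0 := by
      rw [← cancel_epi a.hom, ← Category.assoc, h₁, Category.assoc, h₂, ← Category.assoc, z,
        zero_comp, comp_zero]
    exact ⟨z', (ShortComplex.exact_iff_of_iso (ShortComplex.isoMk a b c h₁ h₂)).1 hz⟩
  have h₁ := fun a b c hab hbc => key (eD a) (eD b) (eE c) (ci a b hab) (cj b c hbc) _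
    (S.exact_ij a b c hab hbc)
  have h₂ := fun a b c hab hbc => key (eD a) (eE b) (eD c) (cj a b hab) (ck b c hbc) _
    (S.exact_jk a b c hab hbc)
  have h₃ := fun a b c hab hbc => key (eE a) (eD b) (eD c) (ck a b hab) (ci b c hbc) _
    (S.exact_ki a b c hab hbc)
  exact ⟨⟨T, fun a b c hab hbc => (h₁ a b c hab hbc).1, fun a b c hab hbc => (h₂ a b c hab hbc).1,
    fun a b c hab hbc => (h₃ a b c hab hbc).1, fun a b c hab hbc => (h₁ a b c hab hbc).2,
    fun a b c hab hbc => (h₂ a b c hab hbc).2, fun a b c hab hbc => (h₃ a b c hab hbc).2⟩, rfl⟩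

end ExactCouple

/-! ### Functors with values in couples -/

section Families

variable {𝓗 : Type*} [Category* 𝓗] {𝓧 : Type*} [Category* 𝓧] {A : Type u'} [Category.{v'} A] [Abelian A]
  {r : ℤ}

/-- A functor to couples all of whose values are exact lifts to exact couples. -/
lemma exists_exact_lift (W : 𝓗 ⥤ 𝓧 ⥤ CoupleData A r)
    (h : ∀ H X, ∃ T : ExactCouple A r, T.toCoupleData = (W.obj H).obj X) :
    ∃ W' : 𝓗 ⥤ 𝓧 ⥤ ExactCouple A r,
      W' ⋙ (Functor.whiskeringRight _ _ _).obj (ExactCouple.forget A r) = W := by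
  -- The data are literally those of `W`, and only the exactness properties are transported; this is
  -- why the final equality of functors holds by `rfl`.
  let T : 𝓗 → 𝓧 → ExactCouple A r := fun H X =>
    { toCoupleData := (W.obj H).obj X
      zero_ij := by obtain ⟨T, hT⟩ := h H X; rw [← hT]; exact T.zero_ij
      zero_jk := by obtain ⟨T, hT⟩ := h H X; rw [← hT]; exact T.zero_jk
      zero_ki := by obtain ⟨T, hT⟩ := h H X; rw [← hT]; exact T.zero_ki
      exact_ij := by
        have : ∀ S : CoupleData A r, (∃ T : ExactCouple A r, T.toCoupleData = S) →
            ∀ a b c hab hbc (z : S.i a b hab ≫ S.j b c hbc = 0), (ShortComplex.mk _ _ z).Exact := by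
          rintro S ⟨T, rfl⟩ a b c hab hbc z
          exact T.exact_ij a b c hab hbc
        exact fun a b c hab hbc => this _ (h H X) a b c hab hbc _
      exact_jk := by
        have : ∀ S : CoupleData A r, (∃ T : ExactCouple A r, T.toCoupleData = S) →
            ∀ a b c hab hbc (z : S.j a b hab ≫ S.k b c hbc = 0), (ShortComplex.mk _ _ z).Exact := by
          rintro S ⟨T, rfl⟩ a b c hab hbc z
          exact T.exact_jk a b c hab hbc
        exact fun a b c hab hbc => this _ (h H X) a b c hab hbc _
      exact_ki := by
        have : ∀ S : CoupleData A r, (∃ T : ExactCouple A r, T.toCoupleData = S) →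
            ∀ a b c hab hbc (z : S.k a b hab ≫ S.i b c hbc = 0), (ShortComplex.mk _ _ z).Exact := by
          rintro S ⟨T, rfl⟩ a b c hab hbc z
          exact T.exact_ki a b c hab hbc
        exact fun a b c hab hbc => this _ (h H X) a b c hab hbc _ }
  exact ⟨
    { obj H :=
        { obj X := T H X
          map f := (W.obj H).map f
          map_id X := (W.obj H).map_id X
          map_comp f g := (W.obj H).map_comp f g }
      map α :=
        { app X := (W.map α).app X
          naturality X Y f := (W.map α).naturality f }
      map_id H := by ext X; exact congrArg (fun t => t.app X) (W.map_id H)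
      map_comp α β := by ext X; exact congrArg (fun t => t.app X) (W.map_comp α β) }, rfl⟩

/-- The functor forgetting exactness reflects isomorphisms of functors. -/
def exactIsoOfForget (F G : 𝓗 ⥤ 𝓧 ⥤ ExactCouple A r)
    (e : F ⋙ (Functor.whiskeringRight _ _ _).obj (ExactCouple.forget A r) ≅
      G ⋙ (Functor.whiskeringRight _ _ _).obj (ExactCouple.forget A r)) : F ≅ G :=
  NatIso.ofComponents (fun H => NatIso.ofComponents (fun X =>
    { hom := (e.hom.app H).app X
      inv := (e.inv.app H).app X
      hom_inv_id := congrArg (fun t => (t.app H).app X) e.hom_inv_id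
      inv_hom_id := congrArg (fun t => (t.app H).app X) e.inv_hom_id })
      (fun {X Y} f => (e.hom.app H).naturality f))
    (fun {H H'} α => by
      ext X
      exact congrArg (fun t => t.app X) (e.hom.naturality α))

/-- Isomorphisms of functors to couples, from their components. -/
def coupleIsoOfComponents (F G : 𝓗 ⥤ 𝓧 ⥤ CoupleData A r)
    (eD : ∀ a H X, ((F.obj H).obj X).D a ≅ ((G.obj H).obj X).D a)
    (eE : ∀ a H X, ((F.obj H).obj X).E a ≅ ((G.obj H).obj X).E a)
    (hi : ∀ H X a b h, ((F.obj H).obj X).i a b h ≫ (eD b H X).hom =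
      (eD a H X).hom ≫ ((G.obj H).obj X).i a b h)
    (hj : ∀ H X a b h, ((F.obj H).obj X).j a b h ≫ (eE b H X).hom =
      (eD a H X).hom ≫ ((G.obj H).obj X).j a b h)
    (hk : ∀ H X a b h, ((F.obj H).obj X).k a b h ≫ (eD b H X).hom =
      (eE a H X).hom ≫ ((G.obj H).obj X).k a b h)
    (nD : ∀ a H {X Y : 𝓧} (f : X ⟶ Y), CoupleData.Hom.hD ((F.obj H).map f) a ≫ (eD a H Y).hom =
      (eD a H X).hom ≫ CoupleData.Hom.hD ((G.obj H).map f) a)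
    (nE : ∀ a H {X Y : 𝓧} (f : X ⟶ Y), CoupleData.Hom.hE ((F.obj H).map f) a ≫ (eE a H Y).hom =
      (eE a H X).hom ≫ CoupleData.Hom.hE ((G.obj H).map f) a)
    (mD : ∀ a {H H' : 𝓗} (α : H ⟶ H') X, CoupleData.Hom.hD ((F.map α).app X) a ≫ (eD a H' X).hom =
      (eD a H X).hom ≫ CoupleData.Hom.hD ((G.map α).app X) a)
    (mE : ∀ a {H H' : 𝓗} (α : H ⟶ H') X, CoupleData.Hom.hE ((F.map α).app X) a ≫ (eE a H' X).hom =
      (eE a H X).hom ≫ CoupleData.Hom.hE ((G.map α).app X) a) : F ≅ G :=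
  NatIso.ofComponents (fun H => NatIso.ofComponents (fun X =>
    { hom := show CoupleData.Hom _ _ from
        ⟨fun a => (eD a H X).hom, fun a => (eE a H X).hom, hi H X, hj H X, hk H X⟩
      inv := show CoupleData.Hom _ _ from
        ⟨fun a => (eD a H X).inv, fun a => (eE a H X).inv,
          fun a b h => by rw [Iso.eq_inv_comp, ← Category.assoc, ← hi]; simp,
          fun a b h => by rw [Iso.eq_inv_comp, ← Category.assoc, ← hj]; simp,
          fun a b h => by rw [Iso.eq_inv_comp, ← Category.assoc, ← hk]; simp⟩
      hom_inv_id := CoupleData.Hom.ext (funext fun a => (eD a H X).hom_inv_id)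
        (funext fun a => (eE a H X).hom_inv_id)
      inv_hom_id := CoupleData.Hom.ext (funext fun a => (eD a H X).inv_hom_id)
        (funext fun a => (eE a H X).inv_hom_id) })
      (fun {X Y} f => CoupleData.Hom.ext (funext fun a => nD a H f) (funext fun a => nE a H f)))
    (fun {H H'} α => by
      ext X
      exact CoupleData.Hom.ext (funext fun a => mD a α X) (funext fun a => mE a α X))

end Families

end WeightSS

end

noncomputable section

namespace WeightSS

/-! ### Weight classes characterized by orthogonality -/

section Weight

variable {C : Type u} [Category.{v} C] [Preadditive C] [HasZeroObject C] [HasShift C ℤ]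
  [∀ n : ℤ, (shiftFunctor C n).Additive] [Pretriangulated C]

namespace WeightStructure

variable (w : WeightStructure C)

lemma ge_mono {k k' : ℤ} (h : k' ≤ k) {X : C} (hX : w.ge k X) : w.ge k' X := by
  obtain ⟨n, rfl⟩ := Int.le.dest h
  clear h
  induction n with
  | zero => simpa using hX
  | succ n ih =>
    refine ih (w.ge₀_of_iso ((shiftFunctorAdd' C (k' + (n + 1 : ℕ)) (-1) (k' + n) (by
      push_cast; ring)).app X).symm (w.ge₀_shift _ hX))

lemma le_of_retract {k : ℤ} {X Y : C} (r : Retract X Y) (h : w.le k Y) : w.le k X :=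
  w.le₀_retract.of_retract (r.map (shiftFunctor C k)) h

lemma ge_of_retract {k : ℤ} {X Y : C} (r : Retract X Y) (h : w.ge k Y) : w.ge k X :=
  w.ge₀_retract.of_retract (r.map (shiftFunctor C k)) h

/-- As `w_{≥ k+1} X ⟶ X` vanishes, the identity of `X` factors through `X ⟶ w_{≤ k} X`, and `X` is a
retract of `w_{≤ k} X`. -/
lemma le_of_hom_eq_zero {k : ℤ} {X : C} (h : ∀ T : C, w.ge (k + 1) T → ∀ f : T ⟶ X, f = 0) :
    w.le k X := by
  obtain ⟨s, hs⟩ := Triangle.yoneda_exact₂ _ (w.dec k X).dist (𝟙 X) (by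
    change (w.dec k X).ι ≫ _ = 0
    rw [h _ (w.dec k X).ge (w.dec k X).ι, zero_comp])
  exact w.le_of_retract ⟨_, s, hs.symm⟩ (w.dec k X).le

lemma ge_of_hom_eq_zero {k : ℤ} {X : C} (h : ∀ T : C, w.le (k - 1) T → ∀ f : X ⟶ T, f = 0) :
    w.ge k X := by
  obtain ⟨s, hs⟩ := Triangle.coyoneda_exact₂ _ (w.dec (k - 1) X).dist (𝟙 X) (by
    change _ ≫ (w.dec (k - 1) X).π = 0
    rw [h _ (w.dec (k - 1) X).le (w.dec (k - 1) X).π, comp_zero])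
  exact w.ge_of_retract ⟨s, _, hs.symm⟩ (w.ge_geObj k X)

/-- A class defined by vanishing of morphisms is stable under extensions. -/
lemma le_of_dist {k : ℤ} {U V W : C} {f : U ⟶ V} {g : V ⟶ W} {h : W ⟶ U⟦(1 : ℤ)⟧}
    (hT : Triangle.mk f g h ∈ distTriang C) (hU : w.le k U) (hW : w.le k W) : w.le k V := by
  refine w.le_of_hom_eq_zero fun T hT' t => ?_
  obtain ⟨s, hs⟩ := Triangle.coyoneda_exact₂ _ hT t (w.hom_eq_zero (by lia) hT' hW _)
  rw [hs, w.hom_eq_zero (by lia) hT' hU s]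
  exact zero_comp

lemma ge_of_dist {k : ℤ} {U V W : C} {f : U ⟶ V} {g : V ⟶ W} {h : W ⟶ U⟦(1 : ℤ)⟧}
    (hT : Triangle.mk f g h ∈ distTriang C) (hU : w.ge k U) (hW : w.ge k W) : w.ge k V := by
  refine w.ge_of_hom_eq_zero fun T hT' t => ?_
  obtain ⟨s, hs⟩ := Triangle.yoneda_exact₂ _ hT t (w.hom_eq_zero (by lia) hU hT' _)
  rw [hs, w.hom_eq_zero (by lia) hW hT' s]
  exact comp_zero

end WeightStructure

end Weight

/-! ### Half exact contravariant functors -/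

section HalfExact

variable {C : Type u} [Category.{v} C] [Preadditive C] [HasZeroObject C] [HasShift C ℤ]
  [∀ n : ℤ, (shiftFunctor C n).Additive] [Pretriangulated C]
  {A : Type u'} [Category.{v'} A] [Abelian A]

/-- Exactness of `G W ⟶ G V ⟶ G U` for all distinguished triangles `U ⟶ V ⟶ W ⟶ U[1]`. -/
def HalfExact (G : Cᵒᵖ ⥤ A) : Prop :=
  ∀ ⦃U V W : C⦄ ⦃f : U ⟶ V⦄ ⦃g : V ⟶ W⦄ ⦃h : W ⟶ U⟦(1 : ℤ)⟧⦄,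
    Triangle.mk f g h ∈ distTriang C → ExactAt G f g

lemma isCohomological.halfExact {G : Cᵒᵖ ⥤ A} (hG : isCohomological C A G) : HalfExact G :=
  fun _ _ _ _ _ _ hT => exactAt_of_dist hG hT

namespace HalfExact

variable {G : Cᵒᵖ ⥤ A} (hG : HalfExact G)

include hG

/-- Additivity is not part of half exactness. In a triangle starting with the identity of `X`, the
morphism `X ⟶ Z` is zero and exactness makes `G` kill it; every zero morphism out of `X` factors
through this one. -/
lemma map_zero (X Y : C) : G.map (0 : X ⟶ Y).op = 0 := by
  obtain ⟨Z, g, h, hT⟩ := distinguished_cocone_triangle (𝟙 X)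
  obtain ⟨z, -⟩ := hG hT
  have hg : g = 0 := (Category.id_comp g).symm.trans (comp_distTriang_mor_zero₁₂ _ hT)
  rw [op_id, CategoryTheory.Functor.map_id, Category.comp_id, hg] at z
  rw [← comp_zero (f := (0 : X ⟶ Z)) (Z := Y), op_comp, G.map_comp, z, comp_zero]

lemma lift {U V W : C} {f : U ⟶ V} {g : V ⟶ W} {h : W ⟶ U⟦(1 : ℤ)⟧}
    (hT : Triangle.mk f g h ∈ distTriang C) {T : A} (x : T ⟶ G.obj (op V))
    (hx : x ≫ G.map f.op = 0) :
    ∃ (T' : A) (π : T' ⟶ T) (_ : Epi π) (y : T' ⟶ G.obj (op W)), π ≫ x = y ≫ G.map g.op := by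
  obtain ⟨z, hz⟩ := hG hT
  exact hz.exact_up_to_refinements x hx

lemma precomp (n : ℤ) : HalfExact ((WeightSS.precomp C A n).obj G) := by
  intro U V W f g h hT
  exact hG (shift_dist' hT n)

end HalfExact

end HalfExact

/-! ### Virtual truncations: independence of choices and half exactness -/

section VirtualTruncation

variable {C : Type u} [Category.{v} C] [Preadditive C] [HasZeroObject C] [HasShift C ℤ]
  [∀ n : ℤ, (shiftFunctor C n).Additive] [Pretriangulated C]
  {A : Type u'} [Category.{v'} A] [Abelian A]

namespace WeightStructure

variable (w : WeightStructure C)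

/-- The epimorphism `G (w_{≤ k} X) ⟶ τ_{≤ k} G (X)`. -/
def leIn (k : ℤ) (G : Cᵒᵖ ⥤ A) (X : C) :
    G.obj (op (w.leObj k X)) ⟶ ((w.tauLE A k).obj G).obj (op X) :=
  factorThruImage (G.map (w.leMap (𝟙 X) (by lia : k ≤ k + 1)).op)

/-- The monomorphism `τ_{≤ k} G (X) ⟶ G (w_{≤ k+1} X)`. -/
def leOut (k : ℤ) (G : Cᵒᵖ ⥤ A) (X : C) :
    ((w.tauLE A k).obj G).obj (op X) ⟶ G.obj (op (w.leObj (k + 1) X)) :=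
  image.ι (G.map (w.leMap (𝟙 X) (by lia : k ≤ k + 1)).op)

/-- The epimorphism `G (w_{≥ k-1} X) ⟶ τ_{≥ k} G (X)`. -/
def geIn (k : ℤ) (G : Cᵒᵖ ⥤ A) (X : C) :
    G.obj (op (w.geObj (k - 1) X)) ⟶ ((w.tauGE A k).obj G).obj (op X) :=
  factorThruImage (G.map (w.geMap (𝟙 X) (by lia : k - 1 ≤ k)).op)

/-- The monomorphism `τ_{≥ k} G (X) ⟶ G (w_{≥ k} X)`. -/
def geOut (k : ℤ) (G : Cᵒᵖ ⥤ A) (X : C) :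
    ((w.tauGE A k).obj G).obj (op X) ⟶ G.obj (op (w.geObj k X)) :=
  image.ι (G.map (w.geMap (𝟙 X) (by lia : k - 1 ≤ k)).op)

instance (k : ℤ) (G : Cᵒᵖ ⥤ A) (X : C) : Epi (w.leIn k G X) :=
  inferInstanceAs (Epi (factorThruImage _))

instance (k : ℤ) (G : Cᵒᵖ ⥤ A) (X : C) : Mono (w.leOut k G X) :=
  inferInstanceAs (Mono (image.ι _))

instance (k : ℤ) (G : Cᵒᵖ ⥤ A) (X : C) : Epi (w.geIn k G X) :=
  inferInstanceAs (Epi (factorThruImage _))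

instance (k : ℤ) (G : Cᵒᵖ ⥤ A) (X : C) : Mono (w.geOut k G X) :=
  inferInstanceAs (Mono (image.ι _))

lemma leIn_leOut (k : ℤ) (G : Cᵒᵖ ⥤ A) (X : C) :
    w.leIn k G X ≫ w.leOut k G X = G.map (w.leMap (𝟙 X) (by lia : k ≤ k + 1)).op :=
  image.fac _

lemma geIn_geOut (k : ℤ) (G : Cᵒᵖ ⥤ A) (X : C) :
    w.geIn k G X ≫ w.geOut k G X = G.map (w.geMap (𝟙 X) (by lia : k - 1 ≤ k)).op :=
  image.fac _

lemma map_leOut (k : ℤ) (G : Cᵒᵖ ⥤ A) {X Y : C} (g : X ⟶ Y) :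
    ((w.tauLE A k).obj G).map g.op ≫ w.leOut k G X =
      w.leOut k G Y ≫ G.map (w.leMap g le_rfl).op :=
  imgMap_ι _ _ _

lemma map_geOut (k : ℤ) (G : Cᵒᵖ ⥤ A) {X Y : C} (g : X ⟶ Y) :
    ((w.tauGE A k).obj G).map g.op ≫ w.geOut k G X =
      w.geOut k G Y ≫ G.map (w.geMap g le_rfl).op :=
  imgMap_ι _ _ _

lemma leIn_app (k : ℤ) {G G' : Cᵒᵖ ⥤ A} (α : G ⟶ G') (X : C) :
    w.leIn k G X ≫ ((w.tauLE A k).map α).app (op X) = α.app _ ≫ w.leIn k G' X :=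
  fac_imgMap _ _ _

lemma geIn_app (k : ℤ) {G G' : Cᵒᵖ ⥤ A} (α : G ⟶ G') (X : C) :
    w.geIn k G X ≫ ((w.tauGE A k).map α).app (op X) = α.app _ ≫ w.geIn k G' X :=
  fac_imgMap _ _ _

lemma tauLEι_app (k : ℤ) (G : Cᵒᵖ ⥤ A) (X : C) :
    ((w.tauLEι A k).app G).app (op X) = w.leOut k G X ≫ G.map (w.leπ (k + 1) X).op :=
  rfl

lemma tauGEπ_app (k : ℤ) (G : Cᵒᵖ ⥤ A) (X : C) :
    ((w.tauGEπ A k).app G).app (op X) = G.map (w.geι (k - 1) X).op ≫ w.geIn k G X :=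
  rfl

lemma tauGETrans_geOut (k k' : ℤ) (h : k ≤ k') (G : Cᵒᵖ ⥤ A) (X : C) :
    ((w.tauGETrans A k k' h).app G).app (op X) ≫ w.geOut k' G X =
      w.geOut k G X ≫ G.map (w.geMap (𝟙 X) h).op :=
  imgMap_ι _ _ _

lemma tauδ_leOut (k k' : ℤ) (h : k + 1 = k') (G : Cᵒᵖ ⥤ A) (X : C) :
    ((w.tauδ (A := A) k k' h).app G).app (op X) ≫ w.leOut k G X =
      w.geOut k' G (X⟦(1 : ℤ)⟧) ≫ G.map (w.bd (k + 1) k' (by lia) X).op :=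
  imgMap_ι _ _ _

lemma tauLESh_leOut (n k k' : ℤ) (h : k' + n = k) (G : Cᵒᵖ ⥤ A) (X : C) :
    ((w.tauLESh (A := A) n k k' h).app G).app (op X) ≫ w.leOut k ((precomp C A n).obj G) X =
      w.leOut k' G (X⟦n⟧) ≫ G.map (w.leSh n (k + 1) (k' + 1) (by lia) X).op :=
  imgMap_ι _ _ _

lemma tauGESh_geOut (n k k' : ℤ) (h : k' + n = k) (G : Cᵒᵖ ⥤ A) (X : C) :
    ((w.tauGESh (A := A) n k k' h).app G).app (op X) ≫ w.geOut k' G (X⟦n⟧) =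
      w.geOut k ((precomp C A n).obj G) X ≫ G.map (w.geSh n k k' (by lia) X).op :=
  imgMap_ι _ _ _

lemma leIn_map_leOut (k : ℤ) (G : Cᵒᵖ ⥤ A) {X Y : C} (g : X ⟶ Y) :
    w.leIn k G Y ≫ ((w.tauLE A k).obj G).map g.op ≫ w.leOut k G X =
      G.map (w.leMap g (by lia : k ≤ k + 1)).op := by
  rw [map_leOut, ← Category.assoc, leIn_leOut, ← G.map_comp, ← op_comp,
    w.leMap_comp _ _ _ _ (by lia) g (by simp)]

lemma geIn_map_geOut (k : ℤ) (G : Cᵒᵖ ⥤ A) {X Y : C} (g : X ⟶ Y) :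
    w.geIn k G Y ≫ ((w.tauGE A k).obj G).map g.op ≫ w.geOut k G X =
      G.map (w.geMap g (by lia : k - 1 ≤ k)).op := by
  rw [map_geOut, ← Category.assoc, geIn_geOut, ← G.map_comp, ← op_comp,
    w.geMap_comp _ _ _ _ (by lia) g (by simp)]

/-- Allows `Q` to replace the chosen `w_{≤ k} X` in the presentation of `τ_{≤ k} G`. The
endomorphism `a ≫ b` of `w_{≤ k} X` need not be the identity, but it becomes invisible after
composition with `w_{≤ k+1} X ⟶ w_{≤ k} X`, where uniqueness is available. The three companions
below work in the same way. -/
lemma epi_leIn_of_choice (k : ℤ) (G : Cᵒᵖ ⥤ A) {X Q : C} (a : w.leObj k X ⟶ Q) (b : Q ⟶ w.leObj k X)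
    (h : w.leπ k X ≫ a ≫ b = w.leπ k X) : Epi (G.map a.op ≫ w.leIn k G X) := by
  have : G.map b.op ≫ G.map a.op ≫ w.leIn k G X = w.leIn k G X := by
    rw [← cancel_mono (w.leOut k G X), Category.assoc, Category.assoc, leIn_leOut, ← G.map_comp,
      ← G.map_comp, ← op_comp, ← op_comp]
    congr 2
    apply w.leObj_ext (w.le_leObj k X) (by lia)
    rw [← Category.assoc, ← Category.assoc, leπ_leMap, Category.id_comp, Category.assoc, h]
  exact epi_of_epi_fac this

lemma mono_leOut_of_choice (k : ℤ) (G : Cᵒᵖ ⥤ A) {X Q : C} (b : Q ⟶ w.leObj (k + 1) X)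
    (a : w.leObj (k + 1) X ⟶ Q) (h : w.leπ (k + 1) X ≫ a ≫ b = w.leπ (k + 1) X) :
    Mono (w.leOut k G X ≫ G.map b.op) := by
  have : (w.leOut k G X ≫ G.map b.op) ≫ G.map a.op = w.leOut k G X := by
    rw [← cancel_epi (w.leIn k G X), ← Category.assoc, ← Category.assoc, leIn_leOut, ← G.map_comp,
      ← G.map_comp, ← op_comp, ← op_comp]
    congr 2
    apply w.leObj_ext (w.le_leObj k X) (by lia)
    rw [← Category.assoc a, ← Category.assoc, h]
  exact mono_of_mono_fac this

lemma epi_geIn_of_choice (k : ℤ) (G : Cᵒᵖ ⥤ A) {X Q : C} (a : w.geObj (k - 1) X ⟶ Q)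
    (b : Q ⟶ w.geObj (k - 1) X) (h : a ≫ b ≫ w.geι (k - 1) X = w.geι (k - 1) X) :
    Epi (G.map a.op ≫ w.geIn k G X) := by
  have : G.map b.op ≫ G.map a.op ≫ w.geIn k G X = w.geIn k G X := by
    rw [← cancel_mono (w.geOut k G X), Category.assoc, Category.assoc, geIn_geOut, ← G.map_comp,
      ← G.map_comp, ← op_comp, ← op_comp]
    congr 2
    apply w.geObj_ext (w.ge_geObj k X) (by lia)
    rw [Category.assoc, Category.assoc, h]
  exact epi_of_epi_fac this

lemma mono_geOut_of_choice (k : ℤ) (G : Cᵒᵖ ⥤ A) {X Q : C} (b : Q ⟶ w.geObj k X)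
    (a : w.geObj k X ⟶ Q) (h : a ≫ b ≫ w.geι k X = w.geι k X) :
    Mono (w.geOut k G X ≫ G.map b.op) := by
  have : (w.geOut k G X ≫ G.map b.op) ≫ G.map a.op = w.geOut k G X := by
    rw [← cancel_epi (w.geIn k G X), ← Category.assoc, ← Category.assoc, geIn_geOut, ← G.map_comp,
      ← G.map_comp, ← op_comp, ← op_comp]
    congr 2
    apply w.geObj_ext (w.ge_geObj k X) (by lia)
    rw [Category.assoc, Category.assoc, geMap_geι, Category.comp_id, h]
  exact mono_of_mono_fac this

variable {G : Cᵒᵖ ⥤ A}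

lemma tauLE_map_zero (hG : HalfExact G) (k : ℤ) (X Y : C) :
    ((w.tauLE A k).obj G).map (0 : X ⟶ Y).op = 0 := by
  rw [← cancel_epi (w.leIn k G Y), ← cancel_mono (w.leOut k G X), Category.assoc, leIn_map_leOut,
    comp_zero, zero_comp, ← hG.map_zero]
  congr 2
  apply w.leObj_ext (w.le_leObj k Y) (by lia)
  rw [leπ_leMap, zero_comp, comp_zero]

lemma tauGE_map_zero (hG : HalfExact G) (k : ℤ) (X Y : C) :
    ((w.tauGE A k).obj G).map (0 : X ⟶ Y).op = 0 := by
  rw [← cancel_epi (w.geIn k G Y), ← cancel_mono (w.geOut k G X), Category.assoc, geIn_map_geOut,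
    comp_zero, zero_comp, ← hG.map_zero]
  congr 2
  apply w.geObj_ext (w.ge_geObj k X) (by lia)
  rw [geMap_geι, zero_comp, comp_zero]

/-- An element of `τ_{≤ k} G (V)` that dies on `U` is lifted to `G (w_{≤ k} V)`, where its
restriction to `w_{≤ k+1} U` is zero. It therefore comes from the cone `N` of `w_{≤ k+1} U ⟶ w_{≤ k}
V`; as `N` has weight `≤ k`, the induced morphism `W ⟶ N` extends over `w_{≤ k} W`. -/
lemma tauLE_halfExact (hG : HalfExact G) (k : ℤ) : HalfExact ((w.tauLE A k).obj G) := by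
  intro U V W f g h hT
  have hfg : f ≫ g = 0 := comp_distTriang_mor_zero₁₂ _ hT
  refine ⟨by rw [← Functor.map_comp, ← op_comp, hfg, w.tauLE_map_zero hG], ?_⟩
  rw [ShortComplex.exact_iff_exact_up_to_refinements]
  intro T x hx
  change T ⟶ ((w.tauLE A k).obj G).obj (op V) at x
  change x ≫ ((w.tauLE A k).obj G).map f.op = 0 at hx
  obtain ⟨T₁, π₁, _, x', hx'⟩ := surjective_up_to_refinements_of_epi (w.leIn k G V) x
  have h₁ : x' ≫ G.map (w.leMap f (by lia : k ≤ k + 1)).op = 0 := by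
    rw [← leIn_map_leOut, ← Category.assoc, ← hx', Category.assoc, ← Category.assoc x, hx,
      zero_comp, comp_zero]
  obtain ⟨N, n, d, hN⟩ := distinguished_cocone_triangle (w.leMap f (by lia : k ≤ k + 1))
  obtain ⟨T₂, π₂, _, y, hy⟩ := hG.lift hN x' h₁
  -- `N` is an extension of `(w_{≤ k+1} U)[1]` by `w_{≤ k} V`; the shift brings the first of these
  -- to weight `≤ k`.
  have hNle : w.le k N := w.le_of_dist (rot_of_distTriang _ hN) (w.le_leObj k V)
    (w.le_shift (by lia) (w.le_leObj (k + 1) U))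
  obtain ⟨t, ht, -⟩ : ∃ t : W ⟶ N, g ≫ t = w.leπ k V ≫ n ∧
      h ≫ (w.leπ (k + 1) U)⟦(1 : ℤ)⟧' = t ≫ d :=
    complete_distinguished_triangle_morphism _ _ hT hN (w.leπ (k + 1) U) (w.leπ k V)
      (w.leπ_leMap f (by lia)).symm
  obtain ⟨s, hs⟩ := (w.dec k W).exists_desc hNle le_rfl t
  change w.leπ k W ≫ s = t at hs
  refine ⟨T₂, π₂ ≫ π₁, inferInstance, y ≫ G.map s.op ≫ w.leIn k G W, ?_⟩
  change (π₂ ≫ π₁) ≫ x = (y ≫ G.map s.op ≫ w.leIn k G W) ≫ ((w.tauLE A k).obj G).map g.op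
  rw [← cancel_mono (w.leOut k G V)]
  simp only [Category.assoc]
  rw [leIn_map_leOut, ← Category.assoc π₁, hx', Category.assoc, leIn_leOut, ← Category.assoc, hy,
    Category.assoc, ← G.map_comp, ← G.map_comp, ← op_comp, ← op_comp]
  congr 3
  apply w.leObj_ext hNle (by lia)
  rw [← Category.assoc, ← Category.assoc, leπ_leMap, leπ_leMap, Category.id_comp, Category.assoc, hs,
    ht]

/-- Now the cone `N` of `w_{≥ k} U ⟶ w_{≥ k-1} V` maps to `W`, and a morphism `w_{≥ k-1} W ⟶ N` over
`W` is needed. A bound on the weights of `N` would not provide it. Instead, `N ⟶ W` is shown to have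
the lifting property of `w_{≥ k-1} W`: lifts exist from weight `≥ k-1` and are unique from weight `≥
k`. -/
lemma tauGE_halfExact (hG : HalfExact G) (k : ℤ) : HalfExact ((w.tauGE A k).obj G) := by
  intro U V W f g h hT
  have hfg : f ≫ g = 0 := comp_distTriang_mor_zero₁₂ _ hT
  refine ⟨by rw [← Functor.map_comp, ← op_comp, hfg, w.tauGE_map_zero hG], ?_⟩
  rw [ShortComplex.exact_iff_exact_up_to_refinements]
  intro T x hx
  change T ⟶ ((w.tauGE A k).obj G).obj (op V) at x
  change x ≫ ((w.tauGE A k).obj G).map f.op = 0 at hx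
  obtain ⟨T₁, π₁, _, x', hx'⟩ := surjective_up_to_refinements_of_epi (w.geIn k G V) x
  have h₁ : x' ≫ G.map (w.geMap f (by lia : k - 1 ≤ k)).op = 0 := by
    rw [← geIn_map_geOut, ← Category.assoc, ← hx', Category.assoc, ← Category.assoc x, hx,
      zero_comp, comp_zero]
  obtain ⟨N, n, d, hN⟩ := distinguished_cocone_triangle (w.geMap f (by lia : k - 1 ≤ k))
  have hmn : w.geMap f (by lia : k - 1 ≤ k) ≫ n = 0 := comp_distTriang_mor_zero₁₂ _ hN
  obtain ⟨T₂, π₂, _, y, hy⟩ := hG.lift hN x' h₁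
  obtain ⟨t, ht, ht'⟩ : ∃ t : N ⟶ W, n ≫ t = w.geι (k - 1) V ≫ g ∧
      d ≫ (w.geι k U)⟦(1 : ℤ)⟧' = t ≫ h :=
    complete_distinguished_triangle_morphism _ _ hN hT (w.geι k U) (w.geι (k - 1) V)
      (w.geMap_geι f (by lia))
  -- After the shift by one, the first vertices are choices of `w_{≥ k-1} (U[1])` and `w_{≥ k-2}
  -- (V[1])`. For a source of weight `≥ k-1`, lifts to the former exist and lifts to the latter are
  -- unique.
  let DU : WeightDec w (k - 2) (U⟦(1 : ℤ)⟧) := (w.dec (k - 1) U).shift 1 (k - 2) (by lia)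
  let DV : WeightDec w (k - 3) (V⟦(1 : ℤ)⟧) := (w.dec (k - 1 - 1) V).shift 1 (k - 3) (by lia)
  have hhf : h ≫ f⟦(1 : ℤ)⟧' = 0 := comp_distTriang_mor_zero₃₁ _ hT
  -- morphisms from objects of weight `≥ k - 1` to `W` lift to `N`
  have hlift : ∀ {B : C} (hB : w.ge (k - 1) B) (b : B ⟶ W), ∃ b' : B ⟶ N, b' ≫ t = b := by
    intro B hB b
    obtain ⟨b₁, hb₁⟩ : ∃ b₁ : B ⟶ (w.geObj k U)⟦(1 : ℤ)⟧, b₁ ≫ (w.geι k U)⟦(1 : ℤ)⟧' = b ≫ h :=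
      DU.exists_lift hB (by lia) (b ≫ h)
    have hb₂ : b₁ ≫ (w.geMap f (by lia : k - 1 ≤ k))⟦(1 : ℤ)⟧' = 0 := by
      apply DV.lift_unique hB (by lia)
      change (b₁ ≫ (w.geMap f (by lia : k - 1 ≤ k))⟦(1 : ℤ)⟧') ≫ (w.geι (k - 1) V)⟦(1 : ℤ)⟧' =
        0 ≫ (w.geι (k - 1) V)⟦(1 : ℤ)⟧'
      rw [Category.assoc, ← Functor.map_comp, geMap_geι, Functor.map_comp, ← Category.assoc, hb₁,
        zero_comp, Category.assoc, hhf, comp_zero]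
    obtain ⟨b₃, hb₃⟩ : ∃ b₃ : B ⟶ N, b₁ = b₃ ≫ d :=
      Triangle.coyoneda_exact₁ _ hN b₁ hb₂
    -- The provisional lift `b₃` has the correct image in `U[1]`, so the error comes from `V`; it
    -- lifts to `w_{≥ k-1} V` and is absorbed by `n`.
    obtain ⟨b₄, hb₄⟩ : ∃ b₄ : B ⟶ V, b - b₃ ≫ t = b₄ ≫ g :=
      Triangle.coyoneda_exact₃ _ hT (b - b₃ ≫ t) (by
        change (b - b₃ ≫ t) ≫ h = 0
        rw [Preadditive.sub_comp, Category.assoc, ← ht', ← Category.assoc, ← hb₃, hb₁, sub_self])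
    obtain ⟨b₅, hb₅⟩ := (w.dec (k - 1 - 1) V).exists_lift hB (by lia) b₄
    change b₅ ≫ w.geι (k - 1) V = b₄ at hb₅
    refine ⟨b₃ + b₅ ≫ n, ?_⟩
    rw [Preadditive.add_comp, Category.assoc, ht, ← Category.assoc, hb₅, ← hb₄, add_sub_cancel]
  -- morphisms from objects of weight `≥ k` to `N` are determined by their composition to `W`
  have huniq : ∀ {B : C} (hB : w.ge k B) (b : B ⟶ N), b ≫ t = 0 → b = 0 := by
    intro B hB b hb
    have hb₁ : b ≫ d = 0 := by
      apply DU.lift_unique hB (by lia)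
      change (b ≫ d) ≫ (w.geι k U)⟦(1 : ℤ)⟧' = 0 ≫ _
      rw [Category.assoc, ht', ← Category.assoc, hb, zero_comp, zero_comp]
    obtain ⟨e, he⟩ : ∃ e : B ⟶ w.geObj (k - 1) V, b = e ≫ n := Triangle.coyoneda_exact₃ _ hN b hb₁
    obtain ⟨e₁, he₁⟩ : ∃ e₁ : B ⟶ U, e ≫ w.geι (k - 1) V = e₁ ≫ f :=
      Triangle.coyoneda_exact₂ _ hT (e ≫ w.geι (k - 1) V) (by
        change (e ≫ w.geι (k - 1) V) ≫ g = 0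
        rw [Category.assoc, ← ht, ← Category.assoc, ← he, hb])
    obtain ⟨e₂, he₂⟩ := (w.dec (k - 1) U).exists_lift hB (by lia) e₁
    change e₂ ≫ w.geι k U = e₁ at he₂
    have he₃ : e = e₂ ≫ w.geMap f (by lia : k - 1 ≤ k) := by
      apply w.geObj_ext hB (by lia)
      rw [he₁, Category.assoc, geMap_geι, ← he₂, Category.assoc]
    rw [he, he₃, Category.assoc, hmn, comp_zero]
  obtain ⟨s, hs⟩ := hlift (w.ge_geObj (k - 1) W) (w.geι (k - 1) W)
  refine ⟨T₂, π₂ ≫ π₁, inferInstance, y ≫ G.map s.op ≫ w.geIn k G W, ?_⟩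
  change (π₂ ≫ π₁) ≫ x = (y ≫ G.map s.op ≫ w.geIn k G W) ≫ ((w.tauGE A k).obj G).map g.op
  rw [← cancel_mono (w.geOut k G V)]
  simp only [Category.assoc]
  rw [geIn_map_geOut, ← Category.assoc π₁, hx', Category.assoc, geIn_geOut, ← Category.assoc, hy,
    Category.assoc, ← G.map_comp, ← G.map_comp, ← op_comp, ← op_comp]
  congr 3
  rw [← sub_eq_zero]
  refine huniq (w.ge_geObj k V) _ ?_
  rw [Preadditive.sub_comp, Category.assoc, Category.assoc, ht, hs, geMap_geι, ← Category.assoc,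
    geMap_geι, Category.comp_id, sub_self]

end WeightStructure

end VirtualTruncation

end WeightSS

end

noncomputable section

namespace WeightSS

/-! ### Weight Postnikov towers and the subquotients `Y_b / Y_a` -/

namespace Tower

variable {C : Type u} [Category.{v} C] [Preadditive C] [HasZeroObject C] [HasShift C ℤ]
  [∀ n : ℤ, (shiftFunctor C n).Additive] [Pretriangulated C] {w : WeightStructure C}

section Basic

variable (P : Tower w)

/-- The object `X / Y_p`. -/
def Qx (p : ℤ) : C := (P.le p).choose

/-- The morphism `X ⟶ X / Y_p`. -/
def πx (p : ℤ) : P.X ⟶ P.Qx p := (P.le p).choose_spec.choose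

/-- The morphism `X / Y_p ⟶ Y_p[1]`. -/
def δx (p : ℤ) : P.Qx p ⟶ (P.Y p)⟦(1 : ℤ)⟧ := (P.le p).choose_spec.choose_spec.choose

lemma le_Qx (p : ℤ) : w.le (-p) (P.Qx p) := (P.le p).choose_spec.choose_spec.choose_spec.1

lemma dist_x (p : ℤ) : Triangle.mk (P.toX p) (P.πx p) (P.δx p) ∈ distTriang C :=
  (P.le p).choose_spec.choose_spec.choose_spec.2

/-- The weight decomposition of `X` given by `Y_p ⟶ X`. -/
abbrev decX (p : ℤ) : WeightDec w (-p) P.X where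
  P := P.Y p
  Q := P.Qx p
  ι := P.toX p
  π := P.πx p
  δ := P.δx p
  ge := by
    have := P.ge p
    rwa [sub_eq_neg_add] at this
  le := P.le_Qx p
  dist := P.dist_x p

lemma exists_lift {a p : ℤ} {T : C} (hT : w.ge a T) (h : 1 - p ≤ a) (t : T ⟶ P.X) :
    ∃ t' : T ⟶ P.Y p, t' ≫ P.toX p = t :=
  (P.decX p).exists_lift hT (by lia) t

lemma lift_unique {a p : ℤ} {T : C} (hT : w.ge a T) (h : 1 - p < a) {t t' : T ⟶ P.Y p}
    (ht : t ≫ P.toX p = t' ≫ P.toX p) : t = t' :=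
  (P.decX p).lift_unique hT (by lia) ht

/-- The morphism `Y_a ⟶ Y_b` over `X` for `a < b`. -/
def ft (a b : ℤ) (h : a < b) : P.Y a ⟶ P.Y b :=
  (P.exists_lift (p := b) (P.ge a) (by lia) (P.toX a)).choose

lemma ft_toX (a b : ℤ) (h : a < b) : P.ft a b h ≫ P.toX b = P.toX a :=
  (P.exists_lift (p := b) (P.ge a) (by lia) (P.toX a)).choose_spec

/-- For `a < b` there is only one morphism `Y_a ⟶ Y_b` over `X`, so the chosen one agrees with the
structure morphisms and their composites. -/
lemma f_eq_ft (a b : ℤ) (h : a + 1 = b) : P.f a b h = P.ft a b (by lia) := by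
  apply P.lift_unique (P.ge a) (by lia)
  rw [P.comm, ft_toX]

lemma ft_ft (a b c : ℤ) (h : a < b) (h' : b < c) :
    P.ft a b h ≫ P.ft b c h' = P.ft a c (h.trans h') := by
  apply P.lift_unique (P.ge a) (by lia)
  rw [Category.assoc, ft_toX, ft_toX, ft_toX]

/-- By orthogonality. A morphism from `T` of weight `≥ 1-a` to the cone vanishes in `Y_a[1]`,
because it does so in `X[1]`. Hence it comes from `Y_b`; its image in `X` lifts to `Y_a`, and by
uniqueness the morphism to `Y_b` factors through `Y_a`. -/
lemma le_cone {a b : ℤ} (h : a < b) {N : C} {n : P.Y b ⟶ N} {d : N ⟶ (P.Y a)⟦(1 : ℤ)⟧}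
    (hN : Triangle.mk (P.ft a b h) n d ∈ distTriang C) : w.le (-a) N := by
  have hd : d ≫ (P.ft a b h)⟦(1 : ℤ)⟧' = 0 := comp_distTriang_mor_zero₃₁ _ hN
  have hn : P.ft a b h ≫ n = 0 := comp_distTriang_mor_zero₁₂ _ hN
  refine w.le_of_hom_eq_zero fun T hT t => ?_
  have h₁ : t ≫ d = 0 := by
    apply ((P.decX a).shift 1 (-a - 1) (by lia)).lift_unique hT (by lia)
    change (t ≫ d) ≫ (P.toX a)⟦(1 : ℤ)⟧' = 0 ≫ _
    rw [← P.ft_toX a b h, Functor.map_comp, Category.assoc, ← Category.assoc d, hd, zero_comp,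
      zero_comp, comp_zero]
  obtain ⟨s, hs⟩ : ∃ s : T ⟶ P.Y b, t = s ≫ n := Triangle.coyoneda_exact₃ _ hN t h₁
  obtain ⟨e, he⟩ := P.exists_lift (p := a) hT (by lia) (s ≫ P.toX b)
  have h₂ : s = e ≫ P.ft a b h := by
    apply P.lift_unique hT (by lia)
    rw [Category.assoc, ft_toX, he]
  rw [hs, h₂, Category.assoc, hn, comp_zero]

/-- The object `Y_b / Y_a`. -/
def quo (a b : ℤ) (h : a < b) : C := (distinguished_cocone_triangle (P.ft a b h)).choose

/-- The morphism `Y_b ⟶ Y_b / Y_a`. -/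
def πy (a b : ℤ) (h : a < b) : P.Y b ⟶ P.quo a b h :=
  (distinguished_cocone_triangle (P.ft a b h)).choose_spec.choose

/-- The morphism `Y_b / Y_a ⟶ Y_a[1]`. -/
def δy (a b : ℤ) (h : a < b) : P.quo a b h ⟶ (P.Y a)⟦(1 : ℤ)⟧ :=
  (distinguished_cocone_triangle (P.ft a b h)).choose_spec.choose_spec.choose

lemma dist_y (a b : ℤ) (h : a < b) :
    Triangle.mk (P.ft a b h) (P.πy a b h) (P.δy a b h) ∈ distTriang C :=
  (distinguished_cocone_triangle (P.ft a b h)).choose_spec.choose_spec.choose_spec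

lemma le_quo (a b : ℤ) (h : a < b) : w.le (-a) (P.quo a b h) := P.le_cone h (P.dist_y a b h)

/-- The weight decomposition of `Y_b` given by `Y_a ⟶ Y_b`. -/
abbrev decY (a b : ℤ) (h : a < b) : WeightDec w (-a) (P.Y b) where
  P := P.Y a
  Q := P.quo a b h
  ι := P.ft a b h
  π := P.πy a b h
  δ := P.δy a b h
  ge := by
    have := P.ge a
    rwa [sub_eq_neg_add] at this
  le := P.le_quo a b h
  dist := P.dist_y a b h

/-- Both `Y_b` and `Y_a[1]` have weight `≥ 1 - b`; for the second this uses `a < b`. -/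
lemma ge_quo (a b : ℤ) (h : a < b) : w.ge (1 - b) (P.quo a b h) :=
  w.ge_of_dist (rot_of_distTriang _ (P.dist_y a b h)) (P.ge b)
    (w.ge_shift (k := 1 - a) (k' := - a) (by lia) (P.ge a) |> w.ge_mono (by lia))

/-- The morphism `Y_b / Y_a ⟶ X / Y_a`. -/
lemma exists_quoToQ (a b : ℤ) (h : a < b) : ∃ q : P.quo a b h ⟶ P.Qx a,
    P.πy a b h ≫ q = P.toX b ≫ P.πx a ∧ q ≫ P.δx a = P.δy a b h := by
  obtain ⟨q, h₁, h₂⟩ : ∃ q : P.quo a b h ⟶ P.Qx a,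
      P.πy a b h ≫ q = P.toX b ≫ P.πx a ∧
        P.δy a b h ≫ (𝟙 (P.Y a))⟦(1 : ℤ)⟧' = q ≫ P.δx a :=
    complete_distinguished_triangle_morphism _ _ (P.dist_y a b h) (P.dist_x a) (𝟙 _) (P.toX b) (by
      change P.ft a b h ≫ P.toX b = 𝟙 _ ≫ P.toX a
      rw [ft_toX, Category.id_comp])
  refine ⟨q, h₁, ?_⟩
  rw [← h₂, CategoryTheory.Functor.map_id, Category.comp_id]

/-- The morphism `Y_b / Y_a ⟶ X / Y_a`. -/
def quoToQ (a b : ℤ) (h : a < b) : P.quo a b h ⟶ P.Qx a := (P.exists_quoToQ a b h).choose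

lemma π_quoToQ (a b : ℤ) (h : a < b) :
    P.πy a b h ≫ P.quoToQ a b h = P.toX b ≫ P.πx a :=
  (P.exists_quoToQ a b h).choose_spec.1

lemma quoToQ_δ (a b : ℤ) (h : a < b) : P.quoToQ a b h ≫ P.δx a = P.δy a b h :=
  (P.exists_quoToQ a b h).choose_spec.2

/-- Morphisms to `X / Y_a` from objects of weight `≥ 1 - b` lift to `Y_b / Y_a`. -/
lemma exists_lift_quo {a b c : ℤ} (h : a < b) {T : C} (hT : w.ge c T) (hc : 1 - b ≤ c)
    (t : T ⟶ P.Qx a) : ∃ t' : T ⟶ P.quo a b h, t' ≫ P.quoToQ a b h = t := by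
  have h₀ : P.δx a ≫ (P.toX a)⟦(1 : ℤ)⟧' = 0 := comp_distTriang_mor_zero₃₁ _ (P.dist_x a)
  -- `Y_b[1]` is a choice of `w_{≥ -b} (X[1])`, so vanishing may be tested in `X[1]`. Thus the
  -- boundary of `t` lifts to `Y_b / Y_a`, and the remaining error comes from `X` and lifts to
  -- `Y_b`.
  have h₁ : (t ≫ P.δx a) ≫ (P.ft a b h)⟦(1 : ℤ)⟧' = 0 := by
    apply ((P.decX b).shift 1 (-b - 1) (by lia)).lift_unique hT (by lia)
    change (_ ≫ _) ≫ (P.toX b)⟦(1 : ℤ)⟧' = 0 ≫ _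
    rw [Category.assoc, ← Functor.map_comp, ft_toX, Category.assoc, h₀, zero_comp, comp_zero]
  obtain ⟨s, hs⟩ : ∃ s : T ⟶ P.quo a b h, t ≫ P.δx a = s ≫ P.δy a b h :=
    Triangle.coyoneda_exact₁ _ (P.dist_y a b h) _ h₁
  obtain ⟨e, he⟩ : ∃ e : T ⟶ P.X, t - s ≫ P.quoToQ a b h = e ≫ P.πx a :=
    Triangle.coyoneda_exact₃ _ (P.dist_x a) (t - s ≫ P.quoToQ a b h) (by
      change (_ - _) ≫ P.δx a = 0
      rw [Preadditive.sub_comp, Category.assoc, quoToQ_δ, hs, sub_self])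
  obtain ⟨e', he'⟩ := P.exists_lift (p := b) hT hc e
  refine ⟨s + e' ≫ P.πy a b h, ?_⟩
  rw [Preadditive.add_comp, Category.assoc, π_quoToQ, ← Category.assoc, he', ← he, add_sub_cancel]

/-- Morphisms to `Y_b / Y_a` from objects of weight `> 1 - b` are determined by their compositions to
`X / Y_a`. -/
lemma quo_lift_unique {a b c : ℤ} (h : a < b) {T : C} (hT : w.ge c T) (hc : 1 - b < c)
    {t t' : T ⟶ P.quo a b h} (ht : t ≫ P.quoToQ a b h = t' ≫ P.quoToQ a b h) : t = t' := by
  have hn : P.ft a b h ≫ P.πy a b h = 0 := comp_distTriang_mor_zero₁₂ _ (P.dist_y a b h)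
  rw [← sub_eq_zero]
  have h₀ : (t - t') ≫ P.quoToQ a b h = 0 := by rw [Preadditive.sub_comp, ht, sub_self]
  -- The difference has zero boundary and comes from `Y_b`. In `X` this morphism factors through
  -- `Y_a`, and strictness of `hc` carries the factorization back to `Y_b`.
  obtain ⟨s, hs⟩ : ∃ s : T ⟶ P.Y b, t - t' = s ≫ P.πy a b h :=
    Triangle.coyoneda_exact₃ _ (P.dist_y a b h) _ (by
      change (t - t') ≫ P.δy a b h = 0
      rw [← quoToQ_δ, ← Category.assoc, h₀, zero_comp])
  obtain ⟨e, he⟩ : ∃ e : T ⟶ P.Y a, s ≫ P.toX b = e ≫ P.toX a :=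
    Triangle.coyoneda_exact₂ _ (P.dist_x a) (s ≫ P.toX b) (by
      change (s ≫ P.toX b) ≫ P.πx a = 0
      rw [Category.assoc, ← P.π_quoToQ a b h, ← Category.assoc, ← hs, h₀])
  have : s = e ≫ P.ft a b h := by
    apply P.lift_unique hT (by lia)
    rw [he, Category.assoc, ft_toX]
  rw [hs, this, Category.assoc, hn, comp_zero]

end Basic

/-- The lifts `Y_p ⟶ Y'_p` involve a choice, but any choice commutes with the transition morphisms,
since morphisms `Y_p ⟶ Y'_{p+1}` are determined over `X'`. The `X_p` follow by completing morphisms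
of triangles. -/
lemma exists_hom {P P' : Tower w} (g : P.X ⟶ P'.X) : ∃ F : Hom P P', F.g = g := by
  choose y hy using fun p => P'.exists_lift (p := p) (P.ge p) le_rfl (P.toX p ≫ g)
  have hf : ∀ p p' h, P.f p p' h ≫ y p' = y p ≫ P'.f p p' h := fun p p' h => by
    apply P'.lift_unique (P.ge p) (by lia)
    rw [Category.assoc, hy, ← Category.assoc, P.comm, Category.assoc, P'.comm, hy]
  have hz : ∀ p, ∃ z : P.Z p ⟶ P'.Z p, P.c p (p + 1) rfl ≫ z = y (p + 1) ≫ P'.c p (p + 1) rfl ∧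
      P.γ p ≫ (y p)⟦(1 : ℤ)⟧' = z ≫ P'.γ p := fun p =>
    complete_distinguished_triangle_morphism _ _ (P.dist p (p + 1) rfl) (P'.dist p (p + 1) rfl)
      (y p) (y (p + 1)) (hf p (p + 1) rfl)
  choose z hz₁ hz₂ using hz
  exact ⟨⟨g, y, z, fun p => (hy p).symm, hf, by rintro p _ rfl; exact hz₁ p, hz₂⟩, rfl⟩

lemma forget_full : (forget w).Full where
  map_surjective g := exists_hom g

variable (w) in
lemma exists_tower (X : C) : ∃ P : Tower w, P.X = X := by
  let f : ∀ p : ℤ, w.geObj (1 - p) X ⟶ w.geObj (1 - (p + 1)) X := fun p => w.geMap (𝟙 X) (by lia)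
  choose Z c γ h using fun p => distinguished_cocone_triangle (f p)
  refine ⟨
    { X := X
      Y p := w.geObj (1 - p) X
      Z := Z
      toX p := w.geι (1 - p) X
      f p p' h := w.geMap (𝟙 X) (by lia)
      c p p' h := eqToHom (by rw [← h]) ≫ c p
      γ := γ
      comm p p' h := by rw [w.geMap_geι, Category.comp_id]
      dist := by
        rintro p _ rfl
        simpa using h p
      ge p := w.ge_geObj (1 - p) X
      le p := ?_ }, rfl⟩
  have := (w.dec (1 - p - 1) X).le
  refine ⟨_, _, _, ?_, (w.dec (1 - p - 1) X).dist⟩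
  rwa [show -p = 1 - p - 1 by ring]

end Tower

/-! ### Diagram chases for cones of a composition -/

section Cones

variable {C : Type u} [Category.{v} C] [Preadditive C] [HasZeroObject C] [HasShift C ℤ]
  [∀ n : ℤ, (shiftFunctor C n).Additive] [Pretriangulated C]
  {A : Type u'} [Category.{v'} A] [Abelian A] {G : Cᵒᵖ ⥤ A} (hG : HalfExact G)
  {X₁ X₂ X₃ Z₁₂ Z₂₃ Z₁₃ : C} {u₁₂ : X₁ ⟶ X₂} {u₂₃ : X₂ ⟶ X₃} {u₁₃ : X₁ ⟶ X₃}
  (comm : u₁₂ ≫ u₂₃ = u₁₃)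

include hG comm

/-- For a morphism of cones `Z₁₂ ⟶ Z₁₃`, the image of `G Z₁₃` in `G Z₁₂` consists of the elements whose
restriction to `X₂` extends to `X₃`. -/
lemma HalfExact.lift_of_cone {v₁₂ : X₂ ⟶ Z₁₂} {w₁₂ : Z₁₂ ⟶ X₁⟦(1 : ℤ)⟧}
    (h₁₂ : Triangle.mk u₁₂ v₁₂ w₁₂ ∈ distTriang C) {v₁₃ : X₃ ⟶ Z₁₃} {w₁₃ : Z₁₃ ⟶ X₁⟦(1 : ℤ)⟧}
    (h₁₃ : Triangle.mk u₁₃ v₁₃ w₁₃ ∈ distTriang C) {m : Z₁₂ ⟶ Z₁₃} (hm₁ : v₁₂ ≫ m = u₂₃ ≫ v₁₃)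
    (hm₂ : m ≫ w₁₃ = w₁₂) {T : A} (x : T ⟶ G.obj (op Z₁₂)) (t : T ⟶ G.obj (op X₃))
    (h : x ≫ G.map v₁₂.op = t ≫ G.map u₂₃.op) :
    ∃ (T' : A) (π : T' ⟶ T) (_ : Epi π) (y : T' ⟶ G.obj (op Z₁₃)), π ≫ x = y ≫ G.map m.op := by
  have e₁ : u₁₂ ≫ v₁₂ = 0 := comp_distTriang_mor_zero₁₂ _ h₁₂
  -- The extension `t` vanishes on `X₁`, so it comes from some `y₀` on `Z₁₃`. Then `x - m^* y₀`
  -- vanishes on `X₂` and comes from `X₁[1]` along `w₁₂`, which factors through `m`.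
  obtain ⟨T₁, π₁, _, y₀, hy₀⟩ := hG.lift h₁₃ t (by
    rw [← comm, op_comp, G.map_comp, ← Category.assoc, ← h, Category.assoc, ← G.map_comp, ← op_comp,
      e₁, hG.map_zero, comp_zero])
  obtain ⟨T₂, π₂, _, z, hz⟩ : ∃ (T₂ : A) (π₂ : T₂ ⟶ T₁) (_ : Epi π₂)
      (z : T₂ ⟶ G.obj (op (X₁⟦(1 : ℤ)⟧))), π₂ ≫ (π₁ ≫ x - y₀ ≫ G.map m.op) = z ≫ G.map w₁₂.op :=
    hG.lift (rot_of_distTriang _ h₁₂) (π₁ ≫ x - y₀ ≫ G.map m.op) (by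
      change (π₁ ≫ x - y₀ ≫ G.map m.op) ≫ G.map v₁₂.op = 0
      rw [Preadditive.sub_comp, Category.assoc, h, Category.assoc, ← G.map_comp, ← op_comp, hm₁,
        op_comp, G.map_comp, ← Category.assoc, hy₀, Category.assoc, sub_self])
  refine ⟨T₂, π₂ ≫ π₁, inferInstance, z ≫ G.map w₁₃.op + π₂ ≫ y₀, ?_⟩
  rw [Preadditive.comp_sub, sub_eq_iff_eq_add] at hz
  rw [Category.assoc, hz, ← hm₂, op_comp, G.map_comp, Preadditive.add_comp, Category.assoc,
    Category.assoc]

/-- For a morphism of cones `Z₁₃ ⟶ Z₂₃`, the kernel of `G Z₂₃ ⟶ G Z₁₃` is the image of the kernel of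
`G X₂[1] ⟶ G X₁[1]`. -/
lemma HalfExact.ker_of_cone {v₂₃ : X₃ ⟶ Z₂₃} {w₂₃ : Z₂₃ ⟶ X₂⟦(1 : ℤ)⟧}
    (h₂₃ : Triangle.mk u₂₃ v₂₃ w₂₃ ∈ distTriang C) {v₁₃ : X₃ ⟶ Z₁₃} {w₁₃ : Z₁₃ ⟶ X₁⟦(1 : ℤ)⟧}
    (h₁₃ : Triangle.mk u₁₃ v₁₃ w₁₃ ∈ distTriang C) {m : Z₁₃ ⟶ Z₂₃} (hm₁ : v₁₃ ≫ m = v₂₃)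
    (hm₂ : m ≫ w₂₃ = w₁₃ ≫ u₁₂⟦(1 : ℤ)⟧') {T : A} (x : T ⟶ G.obj (op Z₂₃))
    (h : x ≫ G.map m.op = 0) :
    ∃ (T' : A) (π : T' ⟶ T) (_ : Epi π) (y : T' ⟶ G.obj (op (X₂⟦(1 : ℤ)⟧))),
      π ≫ x = y ≫ G.map w₂₃.op ∧ y ≫ G.map (u₁₂⟦(1 : ℤ)⟧').op = 0 := by
  have e₁ : w₂₃ ≫ u₂₃⟦(1 : ℤ)⟧' = 0 := comp_distTriang_mor_zero₃₁ _ h₂₃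
  obtain ⟨T₁, π₁, _, y₀, hy₀⟩ : ∃ (T₁ : A) (π₁ : T₁ ⟶ T) (_ : Epi π₁)
      (y₀ : T₁ ⟶ G.obj (op (X₂⟦(1 : ℤ)⟧))), π₁ ≫ x = y₀ ≫ G.map w₂₃.op :=
    hG.lift (rot_of_distTriang _ h₂₃) x (by
      change x ≫ G.map v₂₃.op = 0
      rw [← hm₁, op_comp, G.map_comp, ← Category.assoc, h, zero_comp])
  obtain ⟨T₂, π₂, _, z, hz⟩ : ∃ (T₂ : A) (π₂ : T₂ ⟶ T₁) (_ : Epi π₂)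
      (z : T₂ ⟶ G.obj (op (X₃⟦(1 : ℤ)⟧))),
      π₂ ≫ y₀ ≫ G.map (u₁₂⟦(1 : ℤ)⟧').op = z ≫ G.map (-u₁₃⟦(1 : ℤ)⟧').op :=
    hG.lift (rot_of_distTriang _ (rot_of_distTriang _ h₁₃)) (y₀ ≫ G.map (u₁₂⟦(1 : ℤ)⟧').op) (by
      change (y₀ ≫ G.map (u₁₂⟦(1 : ℤ)⟧').op) ≫ G.map w₁₃.op = 0
      rw [Category.assoc, ← G.map_comp, ← op_comp, ← hm₂, op_comp, G.map_comp, ← Category.assoc,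
        ← hy₀, Category.assoc, h, comp_zero])
  -- The correction by `z` cancels the restriction to `X₁[1]` and does not alter the image in `G
  -- Z₂₃`, since `w₂₃ ≫ u₂₃[1] = 0`. The minus sign is that of the rotated triangle.
  refine ⟨T₂, π₂ ≫ π₁, inferInstance, π₂ ≫ y₀ - z ≫ G.map (-u₂₃⟦(1 : ℤ)⟧').op, ?_, ?_⟩
  · rw [Preadditive.sub_comp, Category.assoc, Category.assoc, Category.assoc, hy₀, ← G.map_comp,
      ← op_comp, Preadditive.comp_neg, e₁, neg_zero, hG.map_zero, comp_zero, sub_zero]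
  · rw [Preadditive.sub_comp, Category.assoc, hz, Category.assoc, ← G.map_comp, ← op_comp,
      Preadditive.comp_neg, ← Functor.map_comp, comm, sub_self]

end Cones

end WeightSS

end

noncomputable section

namespace WeightSS

/-! ### The filtration of a tower and the weight filtration -/

section Filtration

variable {C : Type u} [Category.{v} C] [Preadditive C] [HasZeroObject C] [HasShift C ℤ]
  [∀ n : ℤ, (shiftFunctor C n).Additive] [Pretriangulated C]
  {A : Type u'} [Category.{v'} A] [Abelian A] {w : WeightStructure C}

lemma imageSubobject_epi_comp {X Y Z : A} (e : X ⟶ Y) [Epi e] (f : Y ⟶ Z) :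
    imageSubobject (e ≫ f) = imageSubobject f := by
  have : IsIso (Subobject.ofLE _ _ (imageSubobject_comp_le e f)) := isIso_of_mono_of_epi _
  exact Subobject.eq_of_comm (asIso (Subobject.ofLE _ _ (imageSubobject_comp_le e f))) (by simp)

/-- By exactness the weight filtration is the kernel of restriction to `w_{≥ k+1} X`. The objects
`Y_{-k}` and `D.P` are two choices of it and map to each other over `X`, so the kernels agree. -/
lemma Tower.filSub_eq_W (P : Tower w) {G : Cᵒᵖ ⥤ A} (hG : HalfExact G) (k : ℤ)
    (D : WeightDec w k P.X) : P.filSub G (-k) = D.W G := by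
  obtain ⟨z, hz⟩ := hG D.dist
  have hW : D.W G = kernelSubobject (G.map D.ι.op) :=
    (ShortComplex.exact_iff_image_eq_kernel _).1 hz
  obtain ⟨s, hs⟩ := P.exists_lift (p := -k) D.ge (by lia) D.ι
  obtain ⟨t, ht⟩ := D.exists_lift (P.ge (-k)) (by lia) (P.toX (-k))
  rw [hW, Tower.filSub]
  apply le_antisymm
  · rw [← hs, op_comp, G.map_comp]
    exact kernelSubobject_comp_le _ _
  · refine le_kernelSubobject _ _ ?_
    rw [← ht, op_comp, G.map_comp, ← Category.assoc, kernelSubobject_arrow_comp, zero_comp]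

/-- Precomposing with the epimorphism `leIn` turns the transformation into `G (w_{≤ k} X) ⟶ G (X)`
without changing the image. -/
lemma WeightStructure.image_tauLEι (w : WeightStructure C) (G : Cᵒᵖ ⥤ A) (k : ℤ) (X : C) :
    imageSubobject (((w.tauLEι A k).app G).app (op X)) = (w.dec k X).W G := by
  have h : w.leIn k G X ≫ ((w.tauLEι A k).app G).app (op X) = G.map (w.leπ k X).op := by
    rw [tauLEι_app, ← Category.assoc, leIn_leOut, ← G.map_comp, ← op_comp, leπ_leMap,
      Category.id_comp]
  rw [← imageSubobject_epi_comp (w.leIn k G X), h]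
  rfl

end Filtration

/-! ### The couple of a tower with the shifts normalized -/

section TowerCouple

variable {C : Type u} [Category.{v} C] [Preadditive C] [HasZeroObject C] [HasShift C ℤ]
  [∀ n : ℤ, (shiftFunctor C n).Additive] [Pretriangulated C]
  {A : Type u'} [Category.{v'} A] [Abelian A] {w : WeightStructure C}

/-- The functor `X ↦ H (X[-p][-q])`. -/
abbrev bish (H : Cᵒᵖ ⥤ A) (p q : ℤ) : Cᵒᵖ ⥤ A := (precomp C A (-p)).obj ((coh C A q).obj H)

lemma HalfExact.bish {H : Cᵒᵖ ⥤ A} (hH : HalfExact H) (p q : ℤ) : HalfExact (bish H p q) :=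
  (hH.precomp (-q)).precomp (-p)

namespace Tower

variable (P : Tower w) {H : Cᵒᵖ ⥤ A} (hH : isCohomological C A H) (p q : ℤ)

/-- The identification of `H (Y_a[-p][-q])` with a term of the couple. -/
def toD (a : ℤ × ℤ) (h : 1 - a.1 + -a.2 = -p + -q) :
    (bish H p q).obj (op (P.Y a.1)) ⟶ (P.exactCouple hH).D a :=
  H.map ((shIso (1 - a.1) (-a.2) (-p) (-q) h).hom.app (P.Y a.1)).op

/-- The identification of a term of the couple with `H (Y_a[1][-p][-q])`. -/
def ofD (a : ℤ × ℤ) (h : 1 + (-p + -q) = 1 - a.1 + -a.2) :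
    (P.exactCouple hH).D a ⟶ (bish H p q).obj (op ((P.Y a.1)⟦(1 : ℤ)⟧)) :=
  H.map ((sh3 1 (-p) (-q) (1 - a.1) (-a.2) h).hom.app (P.Y a.1)).op

/-- The identification of `H (X_p[-p][-q])` with a term of the couple. -/
def isoE (a : ℤ × ℤ) : (bish H a.1 a.2).obj (op (P.Z a.1)) ≅ (P.exactCouple hH).E a := Iso.refl _

instance (a : ℤ × ℤ) (h : 1 - a.1 + -a.2 = -p + -q) : IsIso (P.toD hH p q a h) :=
  (H.mapIso ((shIso (1 - a.1) (-a.2) (-p) (-q) h).app (P.Y a.1)).op).isIso_hom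

instance (a : ℤ × ℤ) (h : 1 + (-p + -q) = 1 - a.1 + -a.2) : IsIso (P.ofD hH p q a h) :=
  (H.mapIso ((sh3 1 (-p) (-q) (1 - a.1) (-a.2) h).app (P.Y a.1)).op).isIso_hom

lemma couple_k (a b : ℤ × ℤ) (h : a + (1, 0) = b) (h' : a.1 + 1 = b.1)
    (h'' : 1 - b.1 + -b.2 = -a.1 + -a.2) :
    (P.isoE hH a).hom ≫ (P.exactCouple hH).k a b h =
      (bish H a.1 a.2).map (P.c a.1 b.1 h').op ≫ P.toD hH a.1 a.2 b h'' :=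
  (Category.id_comp _).trans (H.map_comp _ _)

lemma couple_j (a b : ℤ × ℤ) (h : a + (1 - 1, 1 - 1) = b) (h' : a.1 = b.1)
    (h'' : 1 + (-b.1 + -b.2) = 1 - a.1 + -a.2) :
    (P.exactCouple hH).j a b h ≫ (P.isoE hH b).inv =
      P.ofD hH b.1 b.2 a h'' ≫ (bish H b.1 b.2).map (P.γ' b.1 a.1 h').op :=
  (Category.comp_id _).trans (H.map_comp _ _)

lemma toD_i (a b : ℤ × ℤ) (h : a + (-1, 1) = b) (h₁ : 1 - a.1 + -a.2 = -p + -q)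
    (h₂ : 1 - b.1 + -b.2 = -p + -q) (h₃ : b.1 < a.1) :
    P.toD hH p q a h₁ ≫ (P.exactCouple hH).i a b h =
      (bish H p q).map (P.ft b.1 a.1 h₃).op ≫ P.toD hH p q b h₂ := by
  have e : b.1 + 1 = a.1 := by rw [← h]; simp
  rw [← P.f_eq_ft b.1 a.1 e]
  refine (H.map_comp _ _).symm.trans (Eq.trans ?_ (H.map_comp _ _))
  refine congrArg (fun t => H.map (Quiver.Hom.op t)) ?_
  refine (Category.assoc _ _ _).trans ?_
  refine (congrArg (_ ≫ ·) (shIso_trans _ _ h₁)).trans ?_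
  exact (shIso (C := C) (1 - b.1) (-b.2) (-p) (-q) h₂).hom.naturality (P.f b.1 a.1 e)

lemma i_ofD (a b : ℤ × ℤ) (h : a + (-1, 1) = b) (h₁ : 1 + (-p + -q) = 1 - a.1 + -a.2)
    (h₂ : 1 + (-p + -q) = 1 - b.1 + -b.2) (h₃ : b.1 < a.1) :
    (P.exactCouple hH).i a b h ≫ P.ofD hH p q b h₂ =
      P.ofD hH p q a h₁ ≫ (bish H p q).map ((P.ft b.1 a.1 h₃)⟦(1 : ℤ)⟧').op := by
  have e : b.1 + 1 = a.1 := by rw [← h]; simp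
  have e' : 1 - b.1 + -b.2 = 1 - a.1 + -a.2 := by rw [← h]; simp; ring
  rw [← P.f_eq_ft b.1 a.1 e]
  refine (H.map_comp _ _).symm.trans (Eq.trans ?_ (H.map_comp _ _))
  refine congrArg (fun t => H.map (Quiver.Hom.op t)) ?_
  have := (sh3 (C := C) 1 (-p) (-q) (1 - b.1) (-b.2) h₂).hom.naturality (P.f b.1 a.1 e)
  refine (Category.assoc _ _ _).symm.trans ?_
  refine (congrArg (· ≫ _) this.symm).trans ?_
  refine (Category.assoc _ _ _).trans ?_
  exact congrArg (_ ≫ ·) (sh3_trans _ _ e')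

/-- On an antidiagonal all terms `D` are values of one functor at the objects `Y_a`, and there `i^n`
is restriction along `Y_b ⟶ Y_a`. The lemma `iPow_ofD` is the same with `Y_a[1]`, as needed next to
`j`. -/
lemma toD_iPow (n : ℕ) (a b : ℤ × ℤ) (h : a + (-(n : ℤ), (n : ℤ)) = b)
    (h₁ : 1 - a.1 + -a.2 = -p + -q)
    (h₂ : 1 - b.1 + -b.2 = -p + -q) (h₃ : b.1 < a.1) :
    P.toD hH p q a h₁ ≫ (P.exactCouple hH).iPow n a b h =
      (bish H p q).map (P.ft b.1 a.1 h₃).op ≫ P.toD hH p q b h₂ := by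
  induction n generalizing b with
  | zero =>
    obtain rfl : a = b := by rw [← h]; ext <;> simp
    exact absurd h₃ (lt_irrefl _)
  | succ n ih =>
    have e₁ : b + (1, -1) + (-1, 1) = b := by ext <;> simp
    have e₂ : a + (-(n : ℤ), (n : ℤ)) = b + (1, -1) := by
      rw [← h]; ext <;> push_cast <;> simp <;> ring
    rw [(P.exactCouple hH).iPow_succ n a b (b + (1, -1)) h e₂ e₁]
    have e₃ : 1 - (b + (1, -1)).1 + -(b + (1, -1)).2 = -p + -q := by
      rw [← h₂]; simp; ring
    have e₄ : b.1 < (b + (1, -1)).1 := by simp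
    -- `ft` exists only for strict inequalities, so a single step is treated separately.
    rcases n.eq_zero_or_pos with hn | hn
    · subst hn
      obtain rfl : a = b + (1, -1) := by rw [← e₂]; ext <;> simp
      rw [ExactCouple.iPow_zero, Category.id_comp, P.toD_i hH p q _ _ e₁ h₁ h₂ e₄]
    · have e₅ : (b + (1, -1)).1 < a.1 := by rw [← e₂]; simpa using hn
      rw [← Category.assoc, ih _ e₂ e₃ e₅, Category.assoc, P.toD_i hH p q _ _ e₁ e₃ h₂ e₄,
        ← Category.assoc, ← Functor.map_comp, ← op_comp, ft_ft]

lemma iPow_ofD (n : ℕ) (a b : ℤ × ℤ) (h : a + (-(n : ℤ), (n : ℤ)) = b)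
    (h₁ : 1 + (-p + -q) = 1 - a.1 + -a.2)
    (h₂ : 1 + (-p + -q) = 1 - b.1 + -b.2) (h₃ : b.1 < a.1) :
    (P.exactCouple hH).iPow n a b h ≫ P.ofD hH p q b h₂ =
      P.ofD hH p q a h₁ ≫ (bish H p q).map ((P.ft b.1 a.1 h₃)⟦(1 : ℤ)⟧').op := by
  induction n generalizing b with
  | zero =>
    obtain rfl : a = b := by rw [← h]; ext <;> simp
    exact absurd h₃ (lt_irrefl _)
  | succ n ih =>
    have e₁ : b + (1, -1) + (-1, 1) = b := by ext <;> simp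
    have e₂ : a + (-(n : ℤ), (n : ℤ)) = b + (1, -1) := by
      rw [← h]; ext <;> push_cast <;> simp <;> ring
    rw [(P.exactCouple hH).iPow_succ n a b (b + (1, -1)) h e₂ e₁]
    have e₃ : 1 + (-p + -q) = 1 - (b + (1, -1)).1 + -(b + (1, -1)).2 := by
      rw [h₂]; simp; ring
    have e₄ : b.1 < (b + (1, -1)).1 := by simp
    rcases n.eq_zero_or_pos with hn | hn
    · subst hn
      obtain rfl : a = b + (1, -1) := by rw [← e₂]; ext <;> simp
      rw [ExactCouple.iPow_zero, Category.id_comp, P.i_ofD hH p q _ _ e₁ h₁ h₂ e₄]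
    · have e₅ : (b + (1, -1)).1 < a.1 := by rw [← e₂]; simpa using hn
      rw [Category.assoc, P.i_ofD hH p q _ _ e₁ e₃ h₂ e₄, ← Category.assoc, ih _ e₂ e₃ e₅,
        Category.assoc, ← Functor.map_comp, ← op_comp, ← Functor.map_comp, ft_ft]

end Tower

end TowerCouple

end WeightSS

end

noncomputable section

namespace WeightSS

/-! ### The terms `E` of derived couples as images -/

section Presentation

variable {C : Type u} [Category.{v} C] [Preadditive C] [HasZeroObject C] [HasShift C ℤ]
  [∀ n : ℤ, (shiftFunctor C n).Additive] [Pretriangulated C]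
  {A : Type u'} [Category.{v'} A] [Abelian A] {w : WeightStructure C}

namespace Tower

section Maps

variable (P : Tower w)

lemma exists_zToQuo (p p' b : ℤ) (hp : p + 1 = p') (h : p' < b) :
    ∃ m : P.Z p ⟶ P.quo p b (by lia), P.c p p' hp ≫ m = P.ft p' b h ≫ P.πy p b (by lia) ∧
      m ≫ P.δy p b (by lia) = P.γ p := by
  obtain ⟨m, h₁, h₂⟩ : ∃ m : P.Z p ⟶ P.quo p b (by lia),
      P.c p p' hp ≫ m = P.ft p' b h ≫ P.πy p b (by lia) ∧
        P.γ p ≫ (𝟙 (P.Y p))⟦(1 : ℤ)⟧' = m ≫ P.δy p b (by lia) :=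
    complete_distinguished_triangle_morphism _ _ (P.dist p p' hp) (P.dist_y p b (by lia)) (𝟙 _)
      (P.ft p' b h) (by
        change P.f p p' hp ≫ P.ft p' b h = 𝟙 _ ≫ P.ft p b (by lia)
        rw [P.f_eq_ft p p' hp, ft_ft, Category.id_comp])
  exact ⟨m, h₁, by rw [← h₂, CategoryTheory.Functor.map_id, Category.comp_id]⟩

/-- The morphism `X_p ⟶ Y_b / Y_p` for `p + 1 < b`. -/
def zToQuo (p p' b : ℤ) (hp : p + 1 = p') (h : p' < b) : P.Z p ⟶ P.quo p b (by lia) :=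
  (P.exists_zToQuo p p' b hp h).choose

lemma c_zToQuo (p p' b : ℤ) (hp : p + 1 = p') (h : p' < b) :
    P.c p p' hp ≫ P.zToQuo p p' b hp h = P.ft p' b h ≫ P.πy p b (by lia) :=
  (P.exists_zToQuo p p' b hp h).choose_spec.1

lemma zToQuo_δ (p p' b : ℤ) (hp : p + 1 = p') (h : p' < b) :
    P.zToQuo p p' b hp h ≫ P.δy p b (by lia) = P.γ p :=
  (P.exists_zToQuo p p' b hp h).choose_spec.2

lemma exists_quoToZ (a p p' : ℤ) (hp : p + 1 = p') (h : a < p) :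
    ∃ m : P.quo a p' (by lia) ⟶ P.Z p, P.πy a p' (by lia) ≫ m = P.c p p' hp ∧
      m ≫ P.γ p = P.δy a p' (by lia) ≫ (P.ft a p h)⟦(1 : ℤ)⟧' := by
  obtain ⟨m, h₁, h₂⟩ : ∃ m : P.quo a p' (by lia) ⟶ P.Z p,
      P.πy a p' (by lia) ≫ m = 𝟙 _ ≫ P.c p p' hp ∧
        P.δy a p' (by lia) ≫ (P.ft a p h)⟦(1 : ℤ)⟧' = m ≫ P.γ p :=
    complete_distinguished_triangle_morphism _ _ (P.dist_y a p' (by lia)) (P.dist p p' hp)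
      (P.ft a p h) (𝟙 _) (by
        change P.ft a p' (by lia) ≫ 𝟙 _ = P.ft a p h ≫ P.f p p' hp
        rw [P.f_eq_ft p p' hp, ft_ft, Category.comp_id])
  exact ⟨m, by rw [h₁, Category.id_comp], h₂.symm⟩

/-- The morphism `Y_{p+1} / Y_a ⟶ X_p` for `a < p`. -/
def quoToZ (a p p' : ℤ) (hp : p + 1 = p') (h : a < p) : P.quo a p' (by lia) ⟶ P.Z p :=
  (P.exists_quoToZ a p p' hp h).choose

lemma π_quoToZ (a p p' : ℤ) (hp : p + 1 = p') (h : a < p) :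
    P.πy a p' (by lia) ≫ P.quoToZ a p p' hp h = P.c p p' hp :=
  (P.exists_quoToZ a p p' hp h).choose_spec.1

lemma quoToZ_γ (a p p' : ℤ) (hp : p + 1 = p') (h : a < p) :
    P.quoToZ a p p' hp h ≫ P.γ p = P.δy a p' (by lia) ≫ (P.ft a p h)⟦(1 : ℤ)⟧' :=
  (P.exists_quoToZ a p p' hp h).choose_spec.2

lemma γ'_self (p : ℤ) : P.γ' p p rfl = P.γ p := by simp [γ']

lemma dist_ft (p p' : ℤ) (hp : p + 1 = p') :
    Triangle.mk (P.ft p p' (by lia)) (P.c p p' hp) (P.γ p) ∈ distTriang C := by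
  rw [← P.f_eq_ft p p' hp]
  exact P.dist _ _ hp

/-- Morphisms `Y_c / Y_a ⟶ Y'_d / Y'_b` are determined by the compositions `Y_c ⟶ X' / Y'_b` if `a < b`
and `c < d`. -/
lemma quo_hom_ext {P' : Tower w} {a b c d : ℤ} {hac : a < c} {hbd : b < d} (h₁ : a < b) (h₂ : c < d)
    {f g : P.quo a c hac ⟶ P'.quo b d hbd}
    (h : P.πy a c hac ≫ f ≫ P'.quoToQ b d hbd = P.πy a c hac ≫ g ≫ P'.quoToQ b d hbd) : f = g := by
  apply (P.decY a c hac).desc_unique (P'.le_quo b d hbd) (by lia)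
  apply P'.quo_lift_unique hbd (P.ge c) (by lia)
  exact (Category.assoc _ _ _).trans (h.trans (Category.assoc _ _ _).symm)

end Maps

section

variable {H : Cᵒᵖ ⥤ A} (hH : isCohomological C A H) {P : Tower w} {n : ℕ} {r' : ℤ}
  {S' : ExactCouple A r'} (R : ExactCouple.Derived n (P.exactCouple hH) S') (hn : 1 ≤ n)
  (p q p' b d : ℤ)

include hn

/-- The term `E` of a derived couple is the image of `H (Y_{p+1+n} / Y_p) ⟶ H (Y_{p+1} / Y_{p-n})`, up to
shifts. -/
lemma exists_presentation (hp : p + 1 = p') (hb : p + 1 + n = b) (hd : d + n = p) :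
    ∃ (y : (bish H p q).obj (op (P.quo p b (by lia))) ⟶ R.Z (p, q))
      (v : S'.E (p, q) ⟶ (bish H p q).obj (op (P.quo d p' (by lia)))),
      Epi (y ≫ R.cls (p, q)) ∧ Mono v ∧
      y ≫ R.inc (p, q) = (bish H p q).map (P.zToQuo p p' b hp (by lia)).op ≫
        (P.isoE hH (p, q)).hom ∧
      R.cls (p, q) ≫ v = R.inc (p, q) ≫ (P.isoE hH (p, q)).inv ≫
        (bish H p q).map (P.quoToZ d p p' hp (by lia)).op := by
  have hG : HalfExact (bish H p q) := hH.halfExact.bish p q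
  have e₁ : ((p, q) : ℤ × ℤ) + (1, 0) = (p', q) := by rw [← hp]; ext <;> simp
  have e₂ : ((b, q - n) : ℤ × ℤ) + (-(n : ℤ), (n : ℤ)) = (p', q) := by
    rw [← hp, ← hb]; ext <;> simp
  have e₃ : 1 - p' + -q = -p + -q := by lia
  have e₄ : 1 - b + -(q - n) = -p + -q := by lia
  have e₅ : ((p, q) : ℤ × ℤ) + (-(n : ℤ), (n : ℤ)) = (d, q + n) := by
    rw [← hd]; ext <;> simp
  have e₆ : ((p, q) : ℤ × ℤ) + (1 - 1, 1 - 1) = (p, q) := by ext <;> simp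
  have hk := P.couple_k hH (p, q) (p', q) e₁ hp e₃
  have hi := P.toD_iPow hH p q n (b, q - n) (p', q) e₂ e₄ e₃ (by dsimp only; lia)
  have hj := P.couple_j hH (p, q) (p, q) e₆ rfl (by dsimp only; ring)
  rw [γ'_self] at hj
  have hi' := P.iPow_ofD hH p q n (p, q) (d, q + n) e₅ (by dsimp only; ring)
    (by dsimp only; lia) (by dsimp only; lia)
  dsimp only at hk hi hj hi'
  -- Restricted to `Y_{p+1}`, a class on `Y_b / Y_p` extends to `Y_b`; hence its image in `E_1` has
  -- `k` in the image of `i^n` and lies in `Z`.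
  obtain ⟨y, hy⟩ := R.exists_lift e₁ e₂ ((bish H p q).map (P.zToQuo p p' b hp (by lia)).op ≫
      (P.isoE hH (p, q)).hom) ((bish H p q).map (P.πy p b (by lia)).op ≫ P.toD hH p q (b, q - n) e₄) (by
    rw [Category.assoc, hk, ← Category.assoc, ← Functor.map_comp, ← op_comp, c_zToQuo, op_comp,
      Functor.map_comp, Category.assoc, Category.assoc, hi])
  have hjw : (P.exactCouple hH).j (p, q) (p, q) e₆ ≫ (P.isoE hH (p, q)).inv ≫
      (bish H p q).map (P.quoToZ d p p' hp (by lia)).op =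
        (P.exactCouple hH).iPow n (p, q) (d, q + n) e₅ ≫
          P.ofD hH p q (d, q + n) (by dsimp only; lia) ≫ (bish H p q).map (P.δy d p' (by lia)).op := by
    rw [← Category.assoc, hj, Category.assoc, ← Functor.map_comp, ← op_comp, quoToZ_γ, op_comp,
      Functor.map_comp, ← Category.assoc, ← hi', Category.assoc]
  -- Restriction to `Y_{p+1} / Y_d` kills `j (Ker i^n)`, because `Y_{p+1} / Y_d ⟶ X_p ⟶ Y_p[1]`
  -- factors through `Y_d[1] ⟶ Y_p[1]`.
  have hw : kernel.ι (R.cls (p, q)) ≫ R.inc (p, q) ≫ (P.isoE hH (p, q)).inv ≫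
      (bish H p q).map (P.quoToZ d p p' hp (by lia)).op = 0 := by
    obtain ⟨T, π, hπ, u, hu, hu'⟩ := R.ker_cls e₆ e₅ (kernel.ι (R.cls (p, q))) (kernel.condition _)
    apply eq_zero_of_refinement hπ
    rw [reassoc_of% hu, hjw, reassoc_of% hu', zero_comp]
  refine ⟨y, Abelian.epiDesc (R.cls (p, q)) _ hw, ?_, ?_, hy, Abelian.comp_epiDesc _ _ hw⟩
  · apply epi_of_refinements
    intro T z
    obtain ⟨T₁, π₁, _, x, hx⟩ := surjective_up_to_refinements_of_epi (R.cls (p, q)) z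
    -- Any element of `Z` restricts on `Y_{p+1}` to something that locally extends to `Y_b`;
    -- `lift_of_cone` then extends the element to `Y_b / Y_p`.
    obtain ⟨ρ, _, hρ, -⟩ := R.exists_π (b, q - n) (p', q) e₂
    obtain ⟨T₂, π₂, _, s, hs⟩ := surjective_up_to_refinements_of_epi ρ
      (x ≫ R.cls (p, q) ≫ S'.k (p, q) (p', q) e₁)
    have h₁ : (π₂ ≫ x ≫ R.inc (p, q) ≫ (P.isoE hH (p, q)).inv) ≫
        (bish H p q).map (P.c p p' hp).op =
          (s ≫ inv (P.toD hH p q (b, q - n) e₄)) ≫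
            (bish H p q).map (P.ft p' b (by lia)).op := by
      rw [← cancel_mono (P.toD hH p q (p', q) e₃), Category.assoc, ← hk]
      simp only [Category.assoc, Iso.inv_hom_id_assoc]
      rw [← hi, IsIso.inv_hom_id_assoc, ← hρ, ← Category.assoc s, ← hs]
      simp only [Category.assoc]
      rw [R.cls_k]
    obtain ⟨T₃, π₃, _, t, ht⟩ := hG.lift_of_cone (P.ft_ft p p' b (by lia) (by lia))
      (P.dist_ft p p' hp) (P.dist_y p b (by lia)) (P.c_zToQuo p p' b hp (by lia))
      (P.zToQuo_δ p p' b hp (by lia)) _ _ h₁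
    refine ⟨T₃, π₃ ≫ π₂ ≫ π₁, inferInstance, t, ?_⟩
    have h₂ : t ≫ y = π₃ ≫ π₂ ≫ x := by
      rw [← cancel_mono (R.inc (p, q)), Category.assoc, hy, ← Category.assoc, ← ht]
      simp
    rw [← Category.assoc t, h₂]
    simp [hx]
  · refine Preadditive.mono_of_cancel_zero _ fun {T} z hz => ?_
    obtain ⟨T₁, π₁, _, x, hx⟩ := surjective_up_to_refinements_of_epi (R.cls (p, q)) z
    have h₁ : (x ≫ R.inc (p, q) ≫ (P.isoE hH (p, q)).inv) ≫
        (bish H p q).map (P.quoToZ d p p' hp (by lia)).op = 0 := by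
      rw [Category.assoc, Category.assoc, ← Abelian.comp_epiDesc _ _ hw, ← Category.assoc, ← hx, Category.assoc, hz, comp_zero]
    -- An element vanishing on `Y_{p+1} / Y_d` comes from `Y_p[1]`, by a class that vanishes on
    -- `Y_d[1]`. It thus belongs to `j (Ker i^n)`.
    obtain ⟨T₂, π₂, _, s, hs, hs'⟩ := hG.ker_of_cone (P.ft_ft d p p' (by lia) (by lia))
      (P.dist_ft p p' hp) (P.dist_y d p' (by lia)) (P.π_quoToZ d p p' hp (by lia))
      (P.quoToZ_γ d p p' hp (by lia)) _ h₁
    have h₂ := R.cls_eq_zero e₆ e₅ (π₂ ≫ x) (s ≫ inv (P.ofD hH p q (p, q) (by dsimp only; ring))) (by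
      rw [← cancel_mono (P.isoE hH (p, q)).inv]
      simp only [Category.assoc] at hs ⊢
      rw [hs, hj, IsIso.inv_hom_id_assoc]) (by
      rw [← cancel_mono (P.ofD hH p q (d, q + n) (by dsimp only; lia)), Category.assoc, Category.assoc, hi',
        IsIso.inv_hom_id_assoc, hs', zero_comp])
    have : Epi (π₂ ≫ π₁) := inferInstance
    apply eq_zero_of_refinement this
    rw [Category.assoc, hx, ← Category.assoc, h₂]

end

end Tower

end Presentation

end WeightSS

end

noncomputable section

namespace WeightSS

/-! ### Compatibility of the presentation with `k`, `j` and morphisms -/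

section Presentation

variable {C : Type u} [Category.{v} C] [Preadditive C] [HasZeroObject C] [HasShift C ℤ]
  [∀ n : ℤ, (shiftFunctor C n).Additive] [Pretriangulated C]
  {A : Type u'} [Category.{v'} A] [Abelian A] {w : WeightStructure C}

/-- The functoriality of `bish` in `H`. -/
abbrev bishMap {H H' : Cᵒᵖ ⥤ A} (α : H ⟶ H') (p q : ℤ) : bish H p q ⟶ bish H' p q :=
  (precomp C A (-p)).map ((coh C A q).map α)

namespace Tower

section

variable {H : Cᵒᵖ ⥤ A} (hH : isCohomological C A H) {P : Tower w} {n : ℕ} {r' : ℤ}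
  {S' : ExactCouple A r'} (R : ExactCouple.Derived n (P.exactCouple hH) S') (hn : 1 ≤ n)
  {p q p' b d : ℤ}

include hn

lemma presentation_k (hp : p + 1 = p') (hb : p + 1 + n = b)
    {y : (bish H p q).obj (op (P.quo p b (by lia))) ⟶ R.Z (p, q)}
    (hy : y ≫ R.inc (p, q) = (bish H p q).map (P.zToQuo p p' b hp (by lia)).op ≫
      (P.isoE hH (p, q)).hom) (e₁ : ((p, q) : ℤ × ℤ) + (1, 0) = (p', q))
      (e₃ : 1 - p' + -q = -p + -q) :
    (y ≫ R.cls (p, q)) ≫ S'.k (p, q) (p', q) e₁ ≫ R.ι (p', q) =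
      (bish H p q).map (P.ft p' b (by lia) ≫ P.πy p b (by lia)).op ≫ P.toD hH p q (p', q) e₃ := by
  have hk := P.couple_k hH (p, q) (p', q) e₁ hp e₃
  dsimp only at hk
  rw [Category.assoc, R.cls_k, ← Category.assoc, hy, Category.assoc, hk, ← Category.assoc,
    ← Functor.map_comp, ← op_comp, c_zToQuo]

/-- Checked after the epimorphism induced by `i^n`, where `j'(i^n x) = [j x]` and the boundaries of
`X_p` and `Y_{p+1} / Y_d` can be compared. -/
lemma presentation_j (hp : p + 1 = p') (hd : d + n = p)
    {v : S'.E (p, q) ⟶ (bish H p q).obj (op (P.quo d p' (by lia)))}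
    (hv : R.cls (p, q) ≫ v = R.inc (p, q) ≫ (P.isoE hH (p, q)).inv ≫
        (bish H p q).map (P.quoToZ d p p' hp (by lia)).op)
    (e₁ : ((d, q + n) : ℤ × ℤ) + (r' - 1, 1 - r') = (p, q))
    (e₂ : 1 + (-p + -q) = 1 - d + -(q + n)) :
    S'.j (d, q + n) (p, q) e₁ ≫ v = R.ι (d, q + n) ≫ P.ofD hH p q (d, q + n) e₂ ≫
      (bish H p q).map (P.δy d p' (by lia)).op := by
  have e₅ : ((p, q) : ℤ × ℤ) + (-(n : ℤ), (n : ℤ)) = (d, q + n) := by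
    rw [← hd]; ext <;> simp
  have e₆ : ((p, q) : ℤ × ℤ) + (1 - 1, 1 - 1) = (p, q) := by ext <;> simp
  have hj := P.couple_j hH (p, q) (p, q) e₆ rfl (by dsimp only; ring)
  rw [γ'_self] at hj
  have hi' := P.iPow_ofD hH p q n (p, q) (d, q + n) e₅ (by dsimp only; ring)
    (by dsimp only; lia) (by dsimp only; lia)
  dsimp only at hj hi'
  obtain ⟨π, _, hπ, h⟩ := R.exists_π _ _ e₅
  obtain ⟨y, hy, hy'⟩ := h _ e₆ e₁
  rw [← cancel_epi π, ← Category.assoc, ← hy', Category.assoc, hv, ← Category.assoc, hy,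
    ← Category.assoc, hj, ← Category.assoc π, hπ, ← Category.assoc, hi', Category.assoc,
    Category.assoc, ← Functor.map_comp, ← Functor.map_comp, ← op_comp, ← op_comp, quoToZ_γ]

/-- Composed between the two presentations, the map on derived terms is computed by the map on
`E_1`. This is what makes the presentation usable for naturality. -/
lemma presentation_comp {H' : Cᵒᵖ ⥤ A} (hH' : isCohomological C A H') {P' : Tower w}
    {T' : ExactCouple A r'} (Q : ExactCouple.Derived n (P'.exactCouple hH') T')
    {f : CoupleData.Hom (P.exactCouple hH).toCoupleData (P'.exactCouple hH').toCoupleData}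
    {f' : CoupleData.Hom S'.toCoupleData T'.toCoupleData} (hf : R.Compat Q f f')
    (hp : p + 1 = p') (hb : p + 1 + n = b) (hd : d + n = p)
    {y : (bish H p q).obj (op (P.quo p b (by lia))) ⟶ R.Z (p, q)}
    (hy : y ≫ R.inc (p, q) = (bish H p q).map (P.zToQuo p p' b hp (by lia)).op ≫
      (P.isoE hH (p, q)).hom)
    {v : T'.E (p, q) ⟶ (bish H' p q).obj (op (P'.quo d p' (by lia)))}
    (hv : Q.cls (p, q) ≫ v = Q.inc (p, q) ≫ (P'.isoE hH' (p, q)).inv ≫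
        (bish H' p q).map (P'.quoToZ d p p' hp (by lia)).op) :
    (y ≫ R.cls (p, q)) ≫ f'.hE (p, q) ≫ v =
      (bish H p q).map (P.zToQuo p p' b hp (by lia)).op ≫ ((P.isoE hH (p, q)).hom ≫
        f.hE (p, q) ≫ (P'.isoE hH' (p, q)).inv) ≫
          (bish H' p q).map (P'.quoToZ d p p' hp (by lia)).op := by
  obtain ⟨ζ, hζ, hζ'⟩ := hf.exists_map (p, q)
  rw [Category.assoc, ← reassoc_of% hζ', hv, reassoc_of% hζ, reassoc_of% hy]
  simp only [Category.assoc]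

end

end Tower

open Tower in
/-- The presentation of the terms `E` of derived couples, naturally in `H` and in the tower. -/
lemma exists_presentation_E {n : ℕ} (hn : 1 ≤ n) {r' : ℤ}
    (Φ : ExactCouple A 1 ⥤ ExactCouple A r')
    (R : ∀ S, ExactCouple.Derived n S (Φ.obj S))
    (hR : ∀ {S T : ExactCouple A 1} (f : S ⟶ T), (R S).Compat (R T) f (Φ.map f))
    (p q p' b d : ℤ) (hp : p + 1 = p') (hb : p + 1 + n = b) (hd : d + n = p) :
    ∃ (u : ∀ (H : Coh C A) (P : (Tower w)ᵒᵖ), (bish H.obj p q).obj (op (P.unop.quo p b (by lia))) ⟶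
        (Φ.obj (((towerCouple A w).obj H).obj P)).E (p, q))
      (v : ∀ (H : Coh C A) (P : (Tower w)ᵒᵖ), (Φ.obj (((towerCouple A w).obj H).obj P)).E (p, q) ⟶
        (bish H.obj p q).obj (op (P.unop.quo d p' (by lia)))),
      (∀ H P, Epi (u H P)) ∧ (∀ H P, Mono (v H P)) ∧
      (∀ {H H' : Coh C A} (α : H ⟶ H') {P P' : (Tower w)ᵒᵖ} (F : P ⟶ P'),
        u H P ≫ CoupleData.Hom.hE (Φ.map (((towerCouple A w).map α).app P)) (p, q) ≫
          CoupleData.Hom.hE (Φ.map (((towerCouple A w).obj H').map F)) (p, q) ≫ v H' P' =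
        (bishMap α.hom p q).app (op (P.unop.quo p b (by lia))) ≫ (bish H'.obj p q).map
          (P'.unop.quoToZ d p p' hp (by lia) ≫ Hom.z F.unop p ≫
            P.unop.zToQuo p p' b hp (by lia)).op) ∧
      (∀ (H : Coh C A) (P : (Tower w)ᵒᵖ) (e₁ : ((p, q) : ℤ × ℤ) + (1, 0) = (p', q))
        (e₃ : 1 - p' + -q = -p + -q), u H P ≫ (Φ.obj (((towerCouple A w).obj H).obj P)).k (p, q) (p', q) e₁ ≫
          (R _).ι (p', q) =
        (bish H.obj p q).map (P.unop.ft p' b (by lia) ≫ P.unop.πy p b (by lia)).op ≫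
          P.unop.toD H.property p q (p', q) e₃) ∧
      (∀ (H : Coh C A) (P : (Tower w)ᵒᵖ)
        (e₁ : ((d, q + n) : ℤ × ℤ) + (r' - 1, 1 - r') = (p, q))
        (e₂ : 1 + (-p + -q) = 1 - d + -(q + n)),
        (Φ.obj (((towerCouple A w).obj H).obj P)).j (d, q + n) (p, q) e₁ ≫ v H P =
        (R _).ι (d, q + n) ≫ P.unop.ofD H.property p q (d, q + n) e₂ ≫
          (bish H.obj p q).map (P.unop.δy d p' (by lia)).op) := by
  choose y v h₁ h₂ h₃ h₄ using fun (H : Coh C A) (P : (Tower w)ᵒᵖ) =>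
    Tower.exists_presentation H.property (R (((towerCouple A w).obj H).obj P)) hn p q p' b d hp hb hd
  refine ⟨fun H P => y H P ≫ (R _).cls (p, q), v, h₁, h₂, ?_, ?_, ?_⟩
  · intro H H' α P P' F
    have h := Tower.presentation_comp H.property (R (((towerCouple A w).obj H).obj P)) hn H'.property
      (R (((towerCouple A w).obj H').obj P')) (hR (((towerCouple A w).map α).app P ≫
        ((towerCouple A w).obj H').map F)) hp hb hd (h₃ H P) (h₄ H' P')
    rw [Functor.map_comp Φ] at h
    refine (congrArg (_ ≫ ·) (Category.assoc _ _ _).symm).trans (h.trans ?_)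
    have e₂ : (bish H.obj p q).map (P.unop.zToQuo p p' b hp (by lia)).op ≫
        (bishMap α.hom p q).app (op (P.unop.Z p)) =
        (bishMap α.hom p q).app (op (P.unop.quo p b (by lia))) ≫
          (bish H'.obj p q).map (P.unop.zToQuo p p' b hp (by lia)).op :=
      (bishMap α.hom p q).naturality _
    have e₁ : (P.unop.isoE H.property (p, q)).hom ≫
        CoupleData.Hom.hE (((towerCouple A w).map α).app P ≫ ((towerCouple A w).obj H').map F) (p, q) ≫
        (P'.unop.isoE H'.property (p, q)).inv =
        (bishMap α.hom p q).app (op (P.unop.Z p)) ≫ (bish H'.obj p q).map (Hom.z F.unop p).op :=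
      (Category.id_comp _).trans (Category.comp_id _)
    have e₃ := congrArg (fun t => (bish H.obj p q).map (P.unop.zToQuo p p' b hp (by lia)).op ≫ t ≫
      (bish H'.obj p q).map (P'.unop.quoToZ d p p' hp (by lia)).op) e₁
    dsimp only at e₃
    refine e₃.trans ?_
    rw [op_comp, op_comp, Functor.map_comp, Functor.map_comp, Category.assoc, reassoc_of% e₂]
    simp only [Category.assoc]
  · intro H P e₁ e₃
    exact Tower.presentation_k H.property (R (((towerCouple A w).obj H).obj P)) hn hp hb (h₃ H P) e₁ e₃
  · intro H P e₁ e₂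
    exact Tower.presentation_j H.property (R (((towerCouple A w).obj H).obj P)) hn hp hd (h₄ H P) e₁ e₂

end Presentation

end WeightSS

end

noncomputable section

namespace WeightSS

/-! ### Graded pieces of the filtration as images -/

section Graded

variable {C : Type u} [Category.{v} C] [Preadditive C] [HasZeroObject C] [HasShift C ℤ]
  [∀ n : ℤ, (shiftFunctor C n).Additive] [Pretriangulated C]
  {A : Type u'} [Category.{v'} A] [Abelian A] {w : WeightStructure C}

namespace Tower

variable (P : Tower w) (K : Cᵒᵖ ⥤ A) (p : ℤ)

/-- The inclusion `F^p K(X) ⟶ K(X)`. -/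
def filι : ((fil A w p).obj K).obj (op P) ⟶ K.obj (op P.X) := kernel.ι (K.map (P.toX p).op)

/-- The projection `F^p K(X) ⟶ F^p K(X) / F^{p+1} K(X)`. -/
def grπ : ((fil A w p).obj K).obj (op P) ⟶ ((gr A w p).obj K).obj (op P) :=
  cokernel.π (((filStep A w p (p + 1) rfl).app K).app (op P))

instance : Mono (P.filι K p) := inferInstanceAs (Mono (kernel.ι _))

instance : Epi (P.grπ K p) := inferInstanceAs (Epi (cokernel.π _))

lemma filι_map : P.filι K p ≫ K.map (P.toX p).op = 0 := kernel.condition _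

lemma exists_fil_lift {T : A} (x : T ⟶ K.obj (op P.X)) (hx : x ≫ K.map (P.toX p).op = 0) :
    ∃ y : T ⟶ ((fil A w p).obj K).obj (op P), y ≫ P.filι K p = x :=
  ⟨kernel.lift _ x hx, kernel.lift_ι _ _ _⟩

lemma filStep_filι : ((filStep A w p (p + 1) rfl).app K).app (op P) ≫ P.filι K p =
    P.filι K (p + 1) :=
  (kernel.lift_ι _ _ _).trans (Category.comp_id _)

lemma filStep_grπ : ((filStep A w p (p + 1) rfl).app K).app (op P) ≫ P.grπ K p = 0 :=
  cokernel.condition _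

variable {K}

lemma fil_app_filι {K' : Cᵒᵖ ⥤ A} (β : K ⟶ K') :
    ((fil A w p).map β).app (op P) ≫ P.filι K' p = P.filι K p ≫ β.app (op P.X) :=
  kernel.lift_ι _ _ _

lemma grπ_app {K' : Cᵒᵖ ⥤ A} (β : K ⟶ K') :
    P.grπ K p ≫ ((gr A w p).map β).app (op P) = ((fil A w p).map β).app (op P) ≫ P.grπ K' p :=
  cokernel.π_desc _ _ _

variable (K) in
lemma fil_map_filι {P P' : Tower w} (F : P' ⟶ P) :
    ((fil A w p).obj K).map F.op ≫ P'.filι K p = P.filι K p ≫ K.map (Hom.g F).op :=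
  kernel.lift_ι _ _ _

variable (K) in
lemma grπ_map {P P' : Tower w} (F : P' ⟶ P) :
    P.grπ K p ≫ ((gr A w p).obj K).map F.op = ((fil A w p).obj K).map F.op ≫ P'.grπ K p :=
  cokernel.π_desc _ _ _

variable (K) in
lemma exists_grOut : ∃ v : ((gr A w p).obj K).obj (op P) ⟶ K.obj (op (P.Y (p + 1))),
    P.grπ K p ≫ v = P.filι K p ≫ K.map (P.toX (p + 1)).op := by
  refine ⟨cokernel.desc _ (P.filι K p ≫ K.map (P.toX (p + 1)).op) ?_, cokernel.π_desc _ _ _⟩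
  rw [← Category.assoc, filStep_filι, filι_map]

variable (K) in
/-- The morphism `F^p K(X) / F^{p+1} K(X) ⟶ K(Y_{p+1})`. -/
def grOut : ((gr A w p).obj K).obj (op P) ⟶ K.obj (op (P.Y (p + 1))) :=
  (P.exists_grOut K p).choose

lemma grπ_grOut : P.grπ K p ≫ P.grOut K p = P.filι K p ≫ K.map (P.toX (p + 1)).op :=
  (P.exists_grOut K p).choose_spec

/-- An element of `F^p` that vanishes on `Y_{p+1}` lies in `F^{p+1}`; this is the injectivity of
`grOut`. -/
lemma eq_zero_of_grOut {T : A} (x : T ⟶ ((fil A w p).obj K).obj (op P))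
    (hx : x ≫ P.filι K p ≫ K.map (P.toX (p + 1)).op = 0) : x ≫ P.grπ K p = 0 := by
  obtain ⟨y, hy⟩ := P.exists_fil_lift K (p + 1) (x ≫ P.filι K p) (by rw [Category.assoc, hx])
  have : x = y ≫ ((filStep A w p (p + 1) rfl).app K).app (op P) := by
    rw [← cancel_mono (P.filι K p), Category.assoc, filStep_filι, hy]
  rw [this, Category.assoc, filStep_grπ, comp_zero]

instance : Mono (P.grOut K p) := by
  refine Preadditive.mono_of_cancel_zero _ fun {T} z hz => ?_
  obtain ⟨T₁, π₁, h, x, hx⟩ := surjective_up_to_refinements_of_epi (P.grπ K p) z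
  apply eq_zero_of_refinement h
  rw [hx]
  apply P.eq_zero_of_grOut
  rw [← grπ_grOut, ← Category.assoc, ← hx, Category.assoc, hz, comp_zero]

/-- Half exactness at `Y_p ⟶ X ⟶ X / Y_p`: the kernel `F^p K(X)` is the image of `K(X / Y_p)`. -/
lemma exists_grIn (hK : HalfExact K) : ∃ u : K.obj (op (P.Qx p)) ⟶ ((fil A w p).obj K).obj (op P),
    Epi u ∧ u ≫ P.filι K p = K.map (P.πx p).op := by
  obtain ⟨z, hz⟩ := hK (P.dist_x p)
  obtain ⟨u, hu⟩ := P.exists_fil_lift K p (K.map (P.πx p).op) z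
  refine ⟨u, epi_of_refinements _ fun {T} t => ?_, hu⟩
  obtain ⟨T', π, hπ, y, hy⟩ := hK.lift (P.dist_x p) (t ≫ P.filι K p) (by
    rw [Category.assoc, filι_map, comp_zero])
  exact ⟨T', π, hπ, y, by rw [← cancel_mono (P.filι K p), Category.assoc, hy, Category.assoc, hu]⟩

/-- The epimorphism `K(X / Y_p) ⟶ F^p K(X) / F^{p+1} K(X)`. -/
def grIn (hK : HalfExact K) : K.obj (op (P.Qx p)) ⟶ ((gr A w p).obj K).obj (op P) :=
  (P.exists_grIn p hK).choose ≫ P.grπ K p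

instance (hK : HalfExact K) : Epi (P.grIn p hK) := by
  have := (P.exists_grIn p hK).choose_spec.1
  unfold grIn
  infer_instance

/-- The presentation of the graded piece as the image of `K(X / Y_p) ⟶ K(Y_{p+1})`, together with
the functorialities in both variables. -/
lemma grIn_grOut (hK : HalfExact K) {K' : Cᵒᵖ ⥤ A} (β : K ⟶ K') {P P' : Tower w} (F : P' ⟶ P) :
    P.grIn p hK ≫ ((gr A w p).map β).app (op P) ≫ ((gr A w p).obj K').map F.op ≫ P'.grOut K' p =
      β.app (op (P.Qx p)) ≫ K'.map (P'.toX (p + 1) ≫ Hom.g F ≫ P.πx p).op := by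
  have h := (P.exists_grIn p hK).choose_spec.2
  rw [grIn, Category.assoc, reassoc_of% (P.grπ_app p β), reassoc_of% (grπ_map K' p F), grπ_grOut,
    reassoc_of% (fil_map_filι K' p F), reassoc_of% (P.fil_app_filι p β), reassoc_of% h,
    op_comp, op_comp, Functor.map_comp, Functor.map_comp, NatTrans.naturality_assoc, Category.assoc]

end Tower

end Graded

/-! ### Graded pieces of virtual truncations -/

section TruncatedGraded

variable {C : Type u} [Category.{v} C] [Preadditive C] [HasZeroObject C] [HasShift C ℤ]
  [∀ n : ℤ, (shiftFunctor C n).Additive] [Pretriangulated C]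
  {A : Type u'} [Category.{v'} A] [Abelian A] {w : WeightStructure C}

lemma WeightStructure.leIn_app_map_leOut (w : WeightStructure C) (k : ℤ) {G G' : Cᵒᵖ ⥤ A} (α : G ⟶ G') {X Y : C}
    (g : X ⟶ Y) :
    w.leIn k G Y ≫ ((w.tauLE A k).map α).app (op Y) ≫ ((w.tauLE A k).obj G').map g.op ≫
      w.leOut k G' X = α.app _ ≫ G'.map (w.leMap g (by lia : k ≤ k + 1)).op := by
  rw [← Category.assoc, leIn_app, Category.assoc, leIn_map_leOut]

lemma WeightStructure.geIn_app_map_geOut (w : WeightStructure C) (k : ℤ) {G G' : Cᵒᵖ ⥤ A} (α : G ⟶ G') {X Y : C}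
    (g : X ⟶ Y) :
    w.geIn k G Y ≫ ((w.tauGE A k).map α).app (op Y) ≫ ((w.tauGE A k).obj G').map g.op ≫
      w.geOut k G' X = α.app _ ≫ G'.map (w.geMap g (by lia : k - 1 ≤ k)).op := by
  rw [← Category.assoc, geIn_app, Category.assoc, geIn_map_geOut]

lemma WeightStructure.tau_halfExact (w : WeightStructure C) {G : Cᵒᵖ ⥤ A} (hG : HalfExact G) (l m : ℤ) :
    HalfExact ((w.tauLE A m).obj ((w.tauGE A l).obj G)) :=
  w.tauLE_halfExact (w.tauGE_halfExact hG l) m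

open Tower in
variable (A w) in
/-- The presentation of the graded pieces of the filtration on virtual `t`-truncations. -/
lemma exists_presentation_gr {n : ℤ} (hn : 1 ≤ n) (p b d l m : ℤ)
    (hb : p + 1 + n = b) (hd : d + n = p) (hl : l = -p + 1 - n) (hm : m = -p + n - 1) :
    ∃ (u : ∀ (P : Tower w) (G : Cᵒᵖ ⥤ A), HalfExact G → (G.obj (op (P.quo p b (by lia))) ⟶
        ((gr A w p).obj ((w.tauLE A m).obj ((w.tauGE A l).obj G))).obj (op P)))
      (v : ∀ (P : Tower w) (G : Cᵒᵖ ⥤ A),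
        ((gr A w p).obj ((w.tauLE A m).obj ((w.tauGE A l).obj G))).obj (op P) ⟶
        G.obj (op (P.quo d (p + 1) (by lia)))),
      (∀ P G hG, Epi (u P G hG)) ∧ (∀ P G, Mono (v P G)) ∧
      ∀ {G G' : Cᵒᵖ ⥤ A} (hG : HalfExact G) (α : G ⟶ G') {P P' : Tower w} (F : P' ⟶ P)
        (W : P'.quo d (p + 1) (by lia) ⟶ P.quo p b (by lia))
        (_ : P'.πy d (p + 1) (by lia) ≫ W ≫ P.quoToQ p b (by lia) =
          P'.toX (p + 1) ≫ Hom.g F ≫ P.πx p),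
        u P G hG ≫ ((gr A w p).map ((w.tauLE A m).map ((w.tauGE A l).map α))).app (op P) ≫
          ((gr A w p).obj ((w.tauLE A m).obj ((w.tauGE A l).obj G'))).map F.op ≫ v P' G' =
            α.app _ ≫ G'.map W.op := by
  -- Here `l - 1 = 1 - b`, so `a` and `a'` exhibit `Y_b / Y_p` as an alternative choice of `w_{≥
  -- l-1}` of `X / Y_p`.
  choose a ha using fun P : Tower w => P.exists_lift_quo (a := p) (b := b) (by lia)
    (w.ge_geObj (l - 1) (P.Qx p)) (by lia) (w.geι (l - 1) (P.Qx p))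
  choose a' ha' using fun P : Tower w => (w.dec (l - 1 - 1) (P.Qx p)).exists_lift
    (P.ge_quo p b (by lia)) (by lia) (P.quoToQ p b (by lia))
  -- As `-p ≤ m`, the object `X / Y_p` may serve as its own `w_{≤ m}`.
  choose s hs using fun P : Tower w => (w.dec m (P.Qx p)).exists_desc (P.le_Qx p) (by lia)
    (𝟙 (P.Qx p))
  -- Here `m + 1 = -d`, so `t` and `t'` exhibit `Y_{p+1} / Y_d` as a choice of `w_{≤ m+1} Y_{p+1}`.
  choose t ht using fun P : Tower w => (P.decY d (p + 1) (by lia)).exists_desc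
    (w.le_leObj (m + 1) (P.Y (p + 1))) (by lia) (w.leπ (m + 1) (P.Y (p + 1)))
  choose t' ht' using fun P : Tower w => (w.dec (m + 1) (P.Y (p + 1))).exists_desc
    (P.le_quo d (p + 1) (by lia)) (by lia) (P.πy d (p + 1) (by lia))
  -- The weight of `Y_{p+1} / Y_d` is `≥ -p ≥ l`, so this object is its own `w_{≥ l}`.
  choose e he using fun P : Tower w => (w.dec (l - 1) (P.quo d (p + 1) (by lia))).exists_lift
    (P.ge_quo d (p + 1) (by lia)) (by lia) (𝟙 (P.quo d (p + 1) (by lia)))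
  change ∀ P, a' P ≫ w.geι (l - 1) (P.Qx p) = P.quoToQ p b (by lia) at ha'
  change ∀ P, w.leπ m (P.Qx p) ≫ s P = 𝟙 (P.Qx p) at hs
  change ∀ P, P.πy d (p + 1) (by lia) ≫ t P = w.leπ (m + 1) (P.Y (p + 1)) at ht
  change ∀ P, w.leπ (m + 1) (P.Y (p + 1)) ≫ t' P = P.πy d (p + 1) (by lia) at ht'
  change ∀ P, e P ≫ w.geι l (P.quo d (p + 1) (by lia)) = 𝟙 (P.quo d (p + 1) (by lia)) at he
  refine ⟨fun P G hG => G.map (a P).op ≫ w.geIn l G (P.Qx p) ≫ ((w.tauGE A l).obj G).map (s P).op ≫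
      w.leIn m ((w.tauGE A l).obj G) (P.Qx p) ≫ P.grIn p (w.tau_halfExact hG l m),
    fun P G => P.grOut _ p ≫ w.leOut m ((w.tauGE A l).obj G) (P.Y (p + 1)) ≫
      ((w.tauGE A l).obj G).map (t P).op ≫ w.geOut l G (P.quo d (p + 1) (by lia)) ≫
        G.map (e P).op, ?_, ?_, ?_⟩
  · intro P G hG
    have h₁ := w.epi_geIn_of_choice l G (a P) (a' P) (by rw [ha', ha])
    have h₂ := w.epi_leIn_of_choice m ((w.tauGE A l).obj G) (s P) (w.leπ m (P.Qx p))
      (by rw [← Category.assoc, hs, Category.id_comp])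
    have : Epi ((G.map (a P).op ≫ w.geIn l G (P.Qx p)) ≫ (((w.tauGE A l).obj G).map (s P).op ≫
      w.leIn m ((w.tauGE A l).obj G) (P.Qx p)) ≫ P.grIn p (w.tau_halfExact hG l m)) := inferInstance
    simpa only [Category.assoc] using this
  · intro P G
    have h₁ := w.mono_leOut_of_choice m ((w.tauGE A l).obj G) (t P) (t' P)
      (by rw [← Category.assoc, ht', ht])
    have h₂ := w.mono_geOut_of_choice l G (e P) (w.geι l _)
      (by rw [he, Category.comp_id])
    have : Mono (P.grOut _ p ≫ (w.leOut m ((w.tauGE A l).obj G) (P.Y (p + 1)) ≫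
      ((w.tauGE A l).obj G).map (t P).op) ≫ w.geOut l G (P.quo d (p + 1) (by lia)) ≫
        G.map (e P).op) := inferInstance
    simpa only [Category.assoc] using this
  · intro G G' hG α P P' F W hW
    simp only [Category.assoc]
    rw [reassoc_of% (grIn_grOut (A := A) p (w.tau_halfExact hG l m)
        ((w.tauLE A m).map ((w.tauGE A l).map α)) F),
      reassoc_of% (w.leIn_app_map_leOut m ((w.tauGE A l).map α)
        (P'.toX (p + 1) ≫ Hom.g F ≫ P.πx p)), NatTrans.naturality_assoc,
      ← Functor.map_comp_assoc, ← Functor.map_comp_assoc, ← op_comp, ← op_comp,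
      reassoc_of% (w.geIn_app_map_geOut l α), NatTrans.naturality_assoc, ← Functor.map_comp,
      ← Functor.map_comp, ← op_comp, ← op_comp]
    congr 3
    -- The composite of all the chosen morphisms is a morphism `Y'_{p+1} / Y'_d ⟶ Y_b / Y_p`. Since
    -- `d < p` and `p + 1 < b`, it is determined by its composite `Y'_{p+1} ⟶ X / Y_p`, where the
    -- choices disappear.
    apply P'.quo_hom_ext (by lia) (by lia)
    rw [hW]
    simp only [Category.assoc]
    rw [ha, w.geMap_geι, reassoc_of% (he P'), reassoc_of% (ht P'), reassoc_of% (w.leπ_leMap), hs]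
    simp only [Category.comp_id]

end TruncatedGraded

end WeightSS

end

noncomputable section

namespace WeightSS

/-! ### The higher pages as graded pieces of virtual truncations -/

section HigherPages

variable {C : Type u} [Category.{v} C] [Preadditive C] [HasZeroObject C] [HasShift C ℤ]
  [∀ n : ℤ, (shiftFunctor C n).Additive] [Pretriangulated C]
  {A : Type u'} [Category.{v'} A] [Abelian A]

/-- The identification of `H (X[-p][-q])` with `H (X[-p-q])`. -/
def bishIso (H : Cᵒᵖ ⥤ A) (p q : ℤ) : bish H p q ≅ (coh C A (p + q)).obj H :=
  NatIso.ofComponents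
    (fun X => H.mapIso ((shiftFunctorAdd' C (-p) (-q) (-(p + q)) (by ring)).app X.unop).op)
    (fun {X Y} g => by
      change H.map _ ≫ H.map _ = H.map _ ≫ H.map _
      rw [← H.map_comp, ← H.map_comp]
      congr 1
      exact congrArg Quiver.Hom.op
        ((shiftFunctorAdd' C (-p) (-q) (-(p + q)) (by ring)).hom.naturality g.unop).symm)

lemma bishIso_naturality {H H' : Cᵒᵖ ⥤ A} (α : H ⟶ H') (p q : ℤ) (X : C) :
    (bishIso H p q).hom.app (op X) ≫ ((coh C A (p + q)).map α).app (op X) =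
      (bishMap α p q).app (op X) ≫ (bishIso H' p q).hom.app (op X) :=
  α.naturality _

variable (A) (w : WeightStructure C)

open Tower in
-- With `n = r - 1`, both sides are presented by values at `Y_{p+r} / Y_p` and `Y_{p+1} /
-- Y_{p+1-r}`, and both composites are induced by the morphism through `X_p`.
theorem nonempty_page_iso_gr (r : ℤ) (hr : 2 ≤ r) (p q : ℤ) :
    Nonempty (weightSS A w ⋙ (Functor.whiskeringRight _ _ _).obj
          (SpectralSequence.pageFunctor A _ 1 r (le_trans (by norm_num) hr) ⋙
            HomologicalComplex.eval _ _ (p, q)) ≅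
        (isCohomological C A).ι ⋙ coh C A (p + q) ⋙
          w.tauIcc A (-p + 2 - r) (-p + r - 2) ⋙ gr A w p) := by
  have hr' : (1 : ℤ) ≤ r := by lia
  have hb : p < p + r := by lia
  have hd : p + 1 - r < p + 1 := by lia
  obtain ⟨u, v, hu, hv, h, -, -⟩ := exists_presentation_E (C := C) (A := A) (w := w)
    (n := (r - 1).toNat) (by lia) (ExactCouple.couple A r hr')
    (fun S => ExactCouple.Derived.iter S _ r (by lia))
    (fun f => ExactCouple.Derived.Compat.iter f _ r (by lia)) p q (p + 1) (p + r) (p + 1 - r) rfl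
    (by lia) (by lia)
  obtain ⟨u', v', hu', hv', h'⟩ := exists_presentation_gr A w (n := r - 1) (by lia) p (p + r)
    (p + 1 - r) (-p + 2 - r) (-p + r - 2) (by lia) (by lia) (by lia) (by lia)
  have hH : ∀ H : Coh C A, HalfExact ((coh C A (p + q)).obj H.obj) := fun H =>
    H.property.halfExact.precomp _
  obtain ⟨e, -⟩ := exists_natIso_of_presentation
    (weightSS A w ⋙ (Functor.whiskeringRight _ _ _).obj
          (SpectralSequence.pageFunctor A _ 1 r hr' ⋙
            HomologicalComplex.eval _ _ (p, q)))
    ((isCohomological C A).ι ⋙ coh C A (p + q) ⋙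
          w.tauIcc A (-p + 2 - r) (-p + r - 2) ⋙ gr A w p)
    (fun H P => (bish H.obj p q).obj (op (P.unop.quo p (p + r) hb)))
    (fun H P => (bish H.obj p q).obj (op (P.unop.quo (p + 1 - r) (p + 1) hd)))
    u (fun H P => (bishIso H.obj p q).hom.app _ ≫ u' P.unop ((coh C A (p + q)).obj H.obj) (hH H))
    v (fun H P => v' P.unop ((coh C A (p + q)).obj H.obj) ≫ (bishIso H.obj p q).inv.app _)
    hu (fun H P => @epi_comp A _ _ _ _ _ inferInstance _ (hu' P.unop _ (hH H)))
    hv (fun H P => @mono_comp A _ _ _ _ _ (hv' P.unop _) _ inferInstance)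
    (fun {H H'} α {P P'} F => by
      refine (h α F).trans ?_
      -- The morphism through `X_p` has the composite `Y'_{p+1} ⟶ X' ⟶ X ⟶ X / Y_p` that
      -- characterizes the morphism on the truncation side.
      have h₁ := h' (hH H) ((coh C A (p + q)).map α.hom) F.unop
        (P'.unop.quoToZ (p + 1 - r) p (p + 1) rfl (by lia) ≫ Hom.z F.unop p ≫
            P.unop.zToQuo p (p + 1) (p + r) rfl (by lia)) (by
          simp only [Category.assoc]
          have h₂ := Hom.comm_toX F.unop (p + 1)
          rw [reassoc_of% (P'.unop.π_quoToZ), reassoc_of% (Hom.comm_c F.unop),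
            reassoc_of% (P.unop.c_zToQuo), π_quoToQ, reassoc_of% (P.unop.ft_toX),
            reassoc_of% h₂])
      have h₃ := congrArg (fun t => (bishIso H.obj p q).hom.app _ ≫ t ≫
        (bishIso H'.obj p q).inv.app _) h₁
      refine Eq.trans ?_ (h₃.symm.trans ?_)
      · rw [Category.assoc, (bishIso H'.obj p q).inv.naturality,
          reassoc_of% (bishIso_naturality α.hom p q), Iso.hom_inv_id_app_assoc]
      · refine Eq.trans ?_ (Category.assoc _ _ _).symm
        refine congrArg (_ ≫ ·) ?_
        simp only [Category.assoc]
        rfl)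
  exact ⟨e⟩

end HigherPages

end WeightSS

end

noncomputable section

namespace WeightSS

/-! ### The first page and its differential -/

section FirstPage

variable {C : Type u} [Category.{v} C] [Preadditive C] [HasZeroObject C] [HasShift C ℤ]
  [∀ n : ℤ, (shiftFunctor C n).Additive] [Pretriangulated C]
  {A : Type u'} [Category.{v'} A] [Abelian A]

variable (A) (w : WeightStructure C)

/-- The identification of the first page of the weight spectral sequence. -/
def firstPageIso (p q : ℤ) :
    weightSS A w ⋙ (Functor.whiskeringRight _ _ _).obj
          (SpectralSequence.pageFunctor A _ 1 1 le_rfl ⋙ HomologicalComplex.eval _ _ (p, q)) ≅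
        (isCohomological C A).ι ⋙ coh C A q ⋙
          (Functor.whiskeringLeft _ _ _).obj (Tower.factor w p).op :=
  NatIso.ofComponents (fun H => NatIso.ofComponents (fun P => Iso.refl _)
      (fun {P P'} F => (Category.comp_id _).trans (Category.id_comp _).symm))
    (fun {H H'} α => by
      ext P
      exact (Category.comp_id _).trans (Category.id_comp _).symm)

variable {A w}

/-- Associativity of the shift: the three shifts may be merged from the left instead of from the
right. -/
lemma sh3_eq (X : C) {x y z s c d : ℤ} (h : x + y = s) (h' : x + (y + z) = c + d)
    (h'' : s + z = c + d) :
    (sh3 x y z c d h').hom.app X =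
      ((shiftFunctorAdd' C x y s h).inv.app X)⟦z⟧' ≫ (shIso s z c d h'').hom.app X := by
  have e := shiftFunctorAdd'_assoc_inv_app x y z s (y + z) (s + z) h rfl (by rw [h]) X
  have e' : (shIso (C := C) s z c d h'').hom.app X = (shiftFunctorAdd' C s z (s + z) rfl).inv.app X ≫
      (shiftFunctorAdd' C c d (s + z) h''.symm).hom.app X := rfl
  rw [e', reassoc_of% e]
  subst h
  have key : ∀ t (h₁ : x + (y + z) = t) (h₂ : c + d = t),
      (shiftFunctorAdd' C x (y + z) t h₁).inv.app X ≫ (shiftFunctorAdd' C c d t h₂).hom.app X =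
        (shIso x (y + z) c d h').hom.app X := by
    rintro t rfl _
    rfl
  rw [key]
  rfl

/-- The shift isomorphisms in `j` and `k` combine to the identification of `[1][-p']` with `[-p]`,
which is the one used in `weightD`. -/
lemma Tower.homK_homJ (P : Tower w) (p p' q : ℤ) (h : p + 1 = p')
    (h₁ : ((p, q) : ℤ × ℤ) + (1, 0) = (p', q)) (h₂ : ((p', q) : ℤ × ℤ) + (1 - 1, 1 - 1) = (p', q)) :
    P.homJ (p', q) (p', q) h₂ ≫ P.homK (p, q) (p', q) h₁ = (P.weightD p p' h)⟦-q⟧' := by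
  have e : (sh3 (C := C) 1 (-p') (-q) (1 - p') (-q) (by lia)).hom.app (P.Y p') ≫
      (shIso (1 - p') (-q) (-p) (-q) (by lia)).hom.app (P.Y p') =
      ((shiftFunctorAdd' C 1 (-p') (-p) (by lia)).inv.app (P.Y p'))⟦-q⟧' := by
    rw [sh3_trans, sh3_eq (P.Y p') (s := -p) (by lia) _ rfl, shIso_refl]
    exact Category.comp_id _
  change ((P.γ' p' p' _)⟦-p'⟧'⟦-q⟧' ≫ (sh3 1 (-p') (-q) (1 - p') (-q) _).hom.app (P.Y p')) ≫
    (shIso (1 - p') (-q) (-p) (-q) _).hom.app (P.Y p') ≫ (P.c p p' h)⟦-p⟧'⟦-q⟧' = _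
  have e' : (P.weightD p p' h)⟦-q⟧' = (P.γ p')⟦-p'⟧'⟦-q⟧' ≫
      ((shiftFunctorAdd' C 1 (-p') (-p) (by lia)).inv.app (P.Y p'))⟦-q⟧' ≫
        (P.c p p' h)⟦-p⟧'⟦-q⟧' := by
    rw [← Functor.map_comp, ← Functor.map_comp]
    refine congrArg (shiftFunctor C (-q)).map ?_
    refine Eq.trans ?_ (congrArg (_ ≫ ·)
      ((shiftFunctorAdd' C 1 (-p') (-p) (by lia)).inv.naturality (P.c p p' h)))
    exact (congrArg (· ≫ _) (Functor.map_comp _ _ _)).trans (Category.assoc _ _ _)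
  rw [γ'_self, Category.assoc, reassoc_of% e, e']

lemma firstPage_d (H : Coh C A) (P : Tower w) (p q : ℤ) :
    ((((weightSS A w).obj H).obj (op P)).page 1 le_rfl).d (p, q) (p + 1, q) ≫
            (((firstPageIso A w (p + 1) q).hom.app H).app (op P)) =
          (((firstPageIso A w p q).hom.app H).app (op P)) ≫
            ((coh C A q).obj H.obj).map (P.weightD p (p + 1) rfl).op := by
  refine (Category.comp_id _).trans (Eq.trans ?_ (Category.id_comp _).symm)
  have h₁ : ((p, q) : ℤ × ℤ) + (1, 0) = (p + 1, q) := by ext <;> simp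
  have h₂ : ((p + 1, q) : ℤ × ℤ) + (1 - 1, 1 - 1) = (p + 1, q) := by ext <;> simp
  refine ((P.exactCouple H.property).complex_d h₁ h₂).trans ?_
  refine (H.obj.map_comp _ _).symm.trans (congrArg H.obj.map ?_)
  exact congrArg Quiver.Hom.op (P.homK_homJ p (p + 1) q rfl h₁ h₂)

end FirstPage

end WeightSS

end

/-! ### Convergence for bounded objects -/

noncomputable section

namespace WeightSS

/-- Two subobjects agree if each is locally contained in the other. -/
lemma exists_iso_of_mono {A : Type u'} [Category.{v'} A] [Abelian A] {M N D : A} (m : M ⟶ D) (n : N ⟶ D)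
    [Mono m] [Mono n]
    (h : ∃ (T : A) (π : T ⟶ M) (_ : Epi π) (y : T ⟶ N), π ≫ m = y ≫ n)
    (h' : ∃ (T : A) (π : T ⟶ N) (_ : Epi π) (y : T ⟶ M), π ≫ n = y ≫ m) :
    ∃ φ : M ≅ N, φ.hom ≫ n = m := by
  have key : ∀ {M N : A} (m : M ⟶ D) (n : N ⟶ D) [Mono n],
      (∃ (T : A) (π : T ⟶ M) (_ : Epi π) (y : T ⟶ N), π ≫ m = y ≫ n) → ∃ f : M ⟶ N, f ≫ n = m := by
    rintro M N m n _ ⟨T, π, hπ, y, hy⟩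
    have : m ≫ cokernel.π n = 0 := by
      rw [← cancel_epi π, reassoc_of% hy, cokernel.condition, comp_zero, comp_zero]
    exact ⟨Abelian.monoLift n m this, Abelian.monoLift_comp n m this⟩
  obtain ⟨f, hf⟩ := key m n h
  obtain ⟨g, hg⟩ := key n m h'
  refine ⟨⟨f, g, ?_, ?_⟩, hf⟩
  · rw [← cancel_mono m, Category.assoc, hg, hf, Category.id_comp]
  · rw [← cancel_mono n, Category.assoc, hf, hg, Category.id_comp]

section Convergence

variable {C : Type u} [Category.{v} C] [Preadditive C] [HasZeroObject C] [HasShift C ℤ]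
  [∀ n : ℤ, (shiftFunctor C n).Additive] [Pretriangulated C]
  {A : Type u'} [Category.{v'} A] [Abelian A] {w : WeightStructure C}

namespace Tower

section Bounded

variable (P : Tower w)

lemma toX_eq_zero {k : ℤ} (h : w.le k P.X) {p : ℤ} (hp : p ≤ -k) : P.toX p = 0 :=
  w.hom_eq_zero (by lia) (P.ge p) h _

/-- If the weight of `X` is at least `1 - p`, the identity of `X` lifts along `Y_p ⟶ X`. -/
lemma exists_section {k : ℤ} (h : w.ge k P.X) {p : ℤ} (hp : 1 - k ≤ p) :
    ∃ s : P.X ⟶ P.Y p, s ≫ P.toX p = 𝟙 _ :=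
  P.exists_lift h (by lia) (𝟙 _)

/-- If `X` is bounded, then `Y_a ⟶ Y_b` factors through `X` for large `b - a`. -/
lemma exists_ft_eq {k l : ℤ} (hk : w.le k P.X) (hl : w.ge l P.X) {a b : ℤ} (hab : a < b)
    (h : 1 - l + k ≤ b - a) : ∃ s : P.X ⟶ P.Y b, P.ft a b hab = P.toX a ≫ s := by
  -- Either `Y_a ⟶ X` is zero, or the gap forces `b ≥ 1 - l` and `Y_b ⟶ X` has a section.
  by_cases ha : a ≤ -k
  · refine ⟨0, P.lift_unique (P.ge a) (by lia) ?_⟩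
    rw [ft_toX, P.toX_eq_zero hk ha, zero_comp, zero_comp]
  · obtain ⟨s, hs⟩ := P.exists_section hl (p := b) (by lia)
    exact ⟨s, P.lift_unique (P.ge a) (by lia) (by rw [ft_toX, Category.assoc, hs, Category.comp_id])⟩

lemma filSub_eq_top {G : Cᵒᵖ ⥤ A} (hG : HalfExact G) {k : ℤ} (h : w.le k P.X) {p : ℤ} (hp : p ≤ -k) :
    P.filSub G p = ⊤ := by
  have key : ∀ {M N : A} (f : M ⟶ N), f = 0 → kernelSubobject f = ⊤ := by
    rintro M N f rfl
    exact kernelSubobject_zero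
  exact key _ (by rw [P.toX_eq_zero h hp, hG.map_zero])

lemma filSub_eq_bot (G : Cᵒᵖ ⥤ A) {k : ℤ} (h : w.ge k P.X) {p : ℤ} (hp : 1 - k ≤ p) :
    P.filSub G p = ⊥ := by
  obtain ⟨s, hs⟩ := P.exists_section h hp
  have : Mono (G.map (P.toX p).op) := by
    refine Preadditive.mono_of_cancel_zero _ fun {T} z hz => ?_
    have e : G.map (P.toX p).op ≫ G.map s.op = 𝟙 _ := by
      rw [← G.map_comp, ← op_comp, hs, op_id, G.map_id]
    rw [← Category.comp_id z, ← e, reassoc_of% hz, zero_comp]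
  exact Subobject.mk_eq_bot_iff_zero.2 (kernel.ι_of_mono _)

end Bounded

section

variable (H : Coh C A) (P : Tower w) (p q : ℤ)

/-- The identification of `H^{p+q}(Y_a)` with a term of the couple. -/
def cohToD (a : ℤ × ℤ) (h : 1 - a.1 + -a.2 = -p + -q) :
    ((coh C A (p + q)).obj H.obj).obj (op (P.Y a.1)) ⟶ (P.exactCouple H.property).D a :=
  (bishIso H.obj p q).inv.app _ ≫ P.toD H.property p q a h

instance (a : ℤ × ℤ) (h : 1 - a.1 + -a.2 = -p + -q) : IsIso (P.cohToD H p q a h) := by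
  unfold cohToD
  infer_instance

lemma cohToD_iPow (n : ℕ) (a b : ℤ × ℤ) (h : a + (-(n : ℤ), (n : ℤ)) = b)
    (h₁ : 1 - a.1 + -a.2 = -p + -q) (h₂ : 1 - b.1 + -b.2 = -p + -q) (h₃ : b.1 < a.1) :
    P.cohToD H p q a h₁ ≫ (P.exactCouple H.property).iPow n a b h =
      ((coh C A (p + q)).obj H.obj).map (P.ft b.1 a.1 h₃).op ≫ P.cohToD H p q b h₂ := by
  rw [cohToD, Category.assoc, P.toD_iPow H.property p q n a b h h₁ h₂ h₃, cohToD,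
    NatTrans.naturality_assoc]

/-- Two ways of identifying the shifts of `Y_{p+1}` coincide; this replaces `grOut` by the morphism
used in the statement. -/
lemma grOut_cohToD (h : 1 - (p + 1) + -q = -p + -q) :
    P.grOut ((coh C A (p + q)).obj H.obj) p ≫ P.cohToD H p q (p + 1, q) h = grToD H P p q := by
  refine (cancel_epi (P.grπ ((coh C A (p + q)).obj H.obj) p)).1 ?_
  have e : P.cohToD H p q (p + 1, q) h = H.obj.map ((shiftFunctorAdd' C (1 - (p + 1)) (-q) (-(p + q))
      (by ring)).inv.app (P.Y (p + 1))).op := by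
    refine (H.obj.map_comp _ _).symm.trans (congrArg (fun t => H.obj.map (Quiver.Hom.op t)) ?_)
    change (shIso (1 - (p + 1)) (-q) (-p) (-q) h).hom.app _ ≫ (shiftFunctorAdd' C (-p) (-q) (-(p + q)) (by ring)).inv.app _ = _
    have key : ∀ t (h₁ : 1 - (p + 1) + -q = t) (h₂ : -p + -q = t),
      (shIso (1 - (p + 1)) (-q) (-p) (-q) h).hom.app (P.Y (p + 1)) ≫
        (shiftFunctorAdd' C (-p) (-q) t h₂).inv.app (P.Y (p + 1)) =
        (shiftFunctorAdd' C (1 - (p + 1)) (-q) t h₁).inv.app (P.Y (p + 1)) := by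
      rintro t rfl h₂
      change ((shiftFunctorAdd' C (1 - (p + 1)) (-q) _ rfl).inv.app _ ≫
        (shiftFunctorAdd' C (-p) (-q) _ h₂).hom.app _) ≫ _ = _
      rw [Category.assoc, Iso.hom_inv_id_app]
      exact Category.comp_id _
    exact key _ _ _
  have e' : P.grπ ((coh C A (p + q)).obj H.obj) p ≫ P.grOut ((coh C A (p + q)).obj H.obj) p ≫
      P.cohToD H p q (p + 1, q) h = P.filι ((coh C A (p + q)).obj H.obj) p ≫
        ((coh C A (p + q)).obj H.obj).map (P.toX (p + 1)).op ≫ P.cohToD H p q (p + 1, q) h := by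
    rw [reassoc_of% (P.grπ_grOut)]
  refine e'.trans (Eq.trans ?_ (cokernel.π_desc _ _ _).symm)
  exact congrArg (fun t => P.filι ((coh C A (p + q)).obj H.obj) p ≫
        ((coh C A (p + q)).obj H.obj).map (P.toX (p + 1)).op ≫ t) e

end

section

variable {H : Coh C A} {P : Tower w} {n : ℕ} {r' : ℤ}
  {S' : ExactCouple A r'} (R : ExactCouple.Derived n (P.exactCouple H.property) S') (hn : 1 ≤ n)
  (hr : 1 + n = r')
  (hs : ∀ (a b : ℤ) (hab : a < b), b - a = n → ∃ s : P.X ⟶ P.Y b, P.ft a b hab = P.toX a ≫ s)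

include R hn hs

include hr in
-- In the presentation, `j'` is induced by the boundary `Y_{p+1} / Y_{p-n} ⟶ Y_{p-n}[1]` followed by
-- the morphism to `Y_p[1]`. If `Y_{p-n} ⟶ Y_p` factors through `X`, it factors through `Y_{p+1}` as
-- well, and two consecutive morphisms of a triangle compose to zero.
lemma derived_j_eq_zero (a b : ℤ × ℤ) (hab : a + (r' - 1, 1 - r') = b) : S'.j a b hab = 0 := by
  obtain ⟨p, q⟩ := b
  obtain rfl : a = (p - n, q + n) := by
    rw [← sub_eq_iff_eq_add.2 hab.symm, ← hr]
    ext <;> simp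
  obtain ⟨y, v, -, hv, -, h⟩ := Tower.exists_presentation H.property R hn p q (p + 1) (p + 1 + n) (p - n) rfl rfl (by lia)
  have hj := Tower.presentation_j H.property R hn rfl (by lia) h hab (by lia)
  have e₅ : ((p, q) : ℤ × ℤ) + (-(n : ℤ), (n : ℤ)) = (p - n, q + n) := by ext <;> simp; ring
  obtain ⟨π, hπ, hπι, -⟩ := R.exists_π _ _ e₅
  have hi' := P.iPow_ofD H.property p q n (p, q) (p - n, q + n) e₅ (by dsimp only; ring)
    (by dsimp only; lia) (by dsimp only; lia)
  obtain ⟨s, hs⟩ := hs (p - n) p (by lia) (by lia)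
  have h₁ : P.δy (p - n) (p + 1) (by lia) ≫ (P.ft (p - n) p (by lia))⟦(1 : ℤ)⟧' = 0 := by
    have h₂ : P.δy (p - n) (p + 1) (by lia) ≫ (P.ft (p - n) (p + 1) (by lia))⟦(1 : ℤ)⟧' = 0 :=
      comp_distTriang_mor_zero₃₁ _ (P.dist_y (p - n) (p + 1) (by lia))
    rw [hs, ← P.ft_toX (p - n) (p + 1) (by lia), Functor.map_comp, Functor.map_comp,
      Category.assoc, reassoc_of% h₂, zero_comp]
  rw [← cancel_mono v, zero_comp, hj, ← cancel_epi π, comp_zero, ← Category.assoc, hπι, ← Category.assoc, hi',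
    Category.assoc, ← Functor.map_comp, ← op_comp]
  dsimp only
  rw [h₁, (H.property.halfExact.bish p q).map_zero, comp_zero]

include hr in
/-- If `Y_a ⟶ Y_{a+n}` always factors through `X`, then the `n`-th derived couple computes the graded pieces of
the filtration. -/
lemma exists_derived_iso_gr (p q : ℤ) (h : ((p, q) : ℤ × ℤ) + (1, 0) = (p + 1, q))
    (e₀ : 1 - (p + 1) + -q = -p + -q) :
    ∃ φ : S'.E (p, q) ≅ ((gr A w p).obj ((coh C A (p + q)).obj H.obj)).obj (op P),
      φ.hom ≫ P.grOut _ p ≫ P.cohToD H p q (p + 1, q) e₀ = S'.k (p, q) (p + 1, q) h ≫ R.ι (p + 1, q) := by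
  let G := (coh C A (p + q)).obj H.obj
  have e₁ : ((p + 1 + n, q - n) : ℤ × ℤ) + (-(n : ℤ), (n : ℤ)) = (p + 1, q) := by ext <;> simp
  have e₂ : ((p + 1, q) : ℤ × ℤ) + (-1, 1) = (p, q + 1) := by ext <;> simp
  have e₂' : ((p + 1, q) : ℤ × ℤ) + (-((1 : ℕ) : ℤ), ((1 : ℕ) : ℤ)) = (p, q + 1) := by ext <;> simp
  have e₃ : ((p, q) : ℤ × ℤ) + (-(r' - 1), -(1 - r')) + (r' - 1, 1 - r') = (p, q) := by
    ext <;> simp <;> ring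
  have hι := P.cohToD_iPow H p q n _ _ e₁ (by dsimp only; ring) e₀ (by dsimp only; lia)
  have hi := P.cohToD_iPow H p q 1 _ _ e₂' e₀ (by dsimp only; ring) (by dsimp only; lia)
  rw [ExactCouple.iPow_one _ _ _ _ e₂] at hi
  dsimp only at hi hι
  have hi' : G.map (P.toX (p + 1)).op ≫ P.cohToD H p q (p + 1, q) e₀ ≫
      (P.exactCouple H.property).i (p + 1, q) (p, q + 1) e₂ =
        G.map (P.toX p).op ≫ P.cohToD H p q (p, q + 1) (by dsimp only; ring) := by
    rw [hi, ← Functor.map_comp_assoc, ← op_comp, ft_toX]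
  obtain ⟨π, hπ, hπι, -⟩ := R.exists_π _ _ e₁
  -- By exactness the kernel of `k'` is the image of `j'`, which is zero.
  have hk : Mono (S'.k (p, q) (p + 1, q) h) := by
    refine Preadditive.mono_of_cancel_zero _ fun {T} z hz => ?_
    obtain ⟨T', ρ, hρ, y, hy⟩ := S'.lift_jk e₃ h z hz
    apply eq_zero_of_refinement hρ
    rw [hy, derived_j_eq_zero R hn hr hs, comp_zero]
  have : Mono (P.grOut G p ≫ P.cohToD H p q (p + 1, q) e₀) := mono_comp _ _
  obtain ⟨s, hs⟩ := hs (p + 1) (p + 1 + n) (by lia) (by lia)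
  refine exists_iso_of_mono _ _ ?_ ?_
  · obtain ⟨T, ρ, hρ, t, ht⟩ := surjective_up_to_refinements_of_epi π (S'.k (p, q) (p + 1, q) h)
    have h₁ : ρ ≫ S'.k (p, q) (p + 1, q) h ≫ R.ι (p + 1, q) = (t ≫ inv (P.cohToD H p q (p + 1 + n, q - n)
        (by dsimp only; ring)) ≫ G.map s.op) ≫ G.map (P.toX (p + 1)).op ≫ P.cohToD H p q (p + 1, q) e₀ := by
      rw [reassoc_of% ht, hπι, Category.assoc, Category.assoc, ← Functor.map_comp_assoc, ← op_comp, ← hs, ← hι,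
        IsIso.inv_hom_id_assoc]
    obtain ⟨y, hy⟩ := P.exists_fil_lift G p (t ≫ inv (P.cohToD H p q (p + 1 + n, q - n)
        (by dsimp only; ring)) ≫ G.map s.op) (by
      rw [← cancel_mono (P.cohToD H p q (p, q + 1) (by dsimp only; ring)), zero_comp, Category.assoc, ← hi',
        ← Category.assoc (G.map (P.toX (p + 1)).op), ← Category.assoc, ← h₁, Category.assoc, Category.assoc,
        ← R.i_ι, reassoc_of% (S'.zero_ki), zero_comp, comp_zero])
    refine ⟨T, ρ, hρ, y ≫ P.grπ G p, ?_⟩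
    rw [h₁, ← hy, Category.assoc, Category.assoc, reassoc_of% (P.grπ_grOut)]
  · have h₁ : P.filι G p ≫ G.map (P.toX (p + 1)).op ≫ P.cohToD H p q (p + 1, q) e₀ =
        (P.filι G p ≫ G.map (P.toX (p + 1 + n)).op ≫ P.cohToD H p q (p + 1 + n, q - n)
          (by dsimp only; ring) ≫ π) ≫ R.ι (p + 1, q) := by
      rw [← P.ft_toX (p + 1) (p + 1 + n) (by lia), op_comp, Functor.map_comp]
      simp only [Category.assoc]
      rw [hπι, hι]
    obtain ⟨T, ρ, hρ, t, ht⟩ := S'.lift_ki h e₂ (P.filι G p ≫ G.map (P.toX (p + 1 + n)).op ≫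
        P.cohToD H p q (p + 1 + n, q - n) (by dsimp only; ring) ≫ π) (by
      rw [← cancel_mono (R.ι (p, q + 1)), zero_comp, Category.assoc, R.i_ι, ← Category.assoc, ← h₁, Category.assoc,
        Category.assoc, hi', reassoc_of% (P.filι_map G p), zero_comp])
    refine ⟨T, ρ ≫ P.grπ G p, inferInstance, t, ?_⟩
    rw [Category.assoc, reassoc_of% (P.grπ_grOut), h₁, ← Category.assoc, ht, Category.assoc]

end

end Tower

lemma convergence (H : Coh C A) (P : Tower w) (hP : w.bounded P.X) :
      (∀ m : ℤ, (∃ p₀ : ℤ, ∀ p ≤ p₀, P.filSub ((coh C A m).obj H.obj) p = ⊤) ∧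
        ∃ p₁ : ℤ, ∀ p ≥ p₁, P.filSub ((coh C A m).obj H.obj) p = ⊥) ∧
      ∃ r₀ : ℤ, ∀ (r : ℤ) (hr : 1 ≤ r), r₀ ≤ r →
        (∀ a b : ℤ × ℤ, ((((weightSS A w).obj H).obj (op P)).page r hr).d a b = 0) ∧
        ∀ p q : ℤ, ∃ φ : ((((weightSS A w).obj H).obj (op P)).page r hr).X (p, q) ≅
            ((gr A w p).obj ((coh C A (p + q)).obj H.obj)).obj (op P),
          φ.hom ≫ grToD H P p q =
            ((ExactCouple.couple A r hr).obj (((towerCouple A w).obj H).obj (op P))).k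
                (p, q) (p + 1, q) (by simp) ≫
              (ExactCouple.coupleι A r hr (p + 1, q)).app (((towerCouple A w).obj H).obj (op P)) := by
  obtain ⟨⟨k, hk⟩, ⟨l, hl⟩⟩ := hP
  refine ⟨fun m => ⟨⟨-k, fun p hp => P.filSub_eq_top (H.property.halfExact.precomp _) hk hp⟩,
    -- With `n = r - 1` the bound says that `n ≥ 1` and `n ≥ 1 - l + k`, the gap required by
    -- `exists_ft_eq`; it does not involve `p` and `q`.
    ⟨1 - l, fun p hp => P.filSub_eq_bot _ hl hp⟩⟩, max 2 (2 - l + k), fun r hr hr₀ => ?_⟩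
  have hn : 1 ≤ (r - 1).toNat := by lia
  have hr' : (1 : ℤ) + (r - 1).toNat = r := by lia
  have hs : ∀ (a b : ℤ) (hab : a < b), b - a = (r - 1).toNat → ∃ s : P.X ⟶ P.Y b, P.ft a b hab = P.toX a ≫ s :=
    fun a b hab h => P.exists_ft_eq hk hl hab (by lia)
  refine ⟨fun a b => ?_, fun p q => ?_⟩
  · by_cases hab : a + (r, 1 - r) = b
    · have h₁ : a + (1, 0) + (r - 1, 1 - r) = b := by rw [← hab]; ext <;> simp
      refine (ExactCouple.complex_d _ rfl h₁).trans ?_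
      exact (congrArg (_ ≫ ·) (Tower.derived_j_eq_zero
        (ExactCouple.Derived.iter (P.exactCouple H.property) _ r hr') hn hr' hs _ _ h₁)).trans comp_zero
    · exact HomologicalComplex.shape _ _ _ hab
  · obtain ⟨φ, hφ⟩ := Tower.exists_derived_iso_gr (ExactCouple.Derived.iter (P.exactCouple H.property) _ r hr')
      hn hr' hs p q (by simp) (by ring)
    rw [ExactCouple.Derived.iter_ι] at hφ
    exact ⟨φ, (congrArg (φ.hom ≫ ·) (P.grOut_cohToD H p q (by ring)).symm).trans hφ⟩

end Convergence

end WeightSS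

end

noncomputable section

namespace WeightSS

/-! ### The presentation of `τ_{≥ 0} τ_{≤ 0}` by a tower -/

section VirtualPresentation

variable {C : Type u} [Category.{v} C] [Preadditive C] [HasZeroObject C] [HasShift C ℤ]
  [∀ n : ℤ, (shiftFunctor C n).Additive] [Pretriangulated C]
  {A : Type u'} [Category.{v'} A] [Abelian A] {w : WeightStructure C}

namespace WeightStructure

lemma tauGEπ_geOut (w : WeightStructure C) (k : ℤ) (G : Cᵒᵖ ⥤ A) (X : C) :
    ((w.tauGEπ A k).app G).app (op X) ≫ w.geOut k G X = G.map (w.geι k X).op := by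
  rw [tauGEπ_app, Category.assoc, geIn_geOut, ← G.map_comp, ← op_comp, geMap_geι, Category.comp_id]

lemma leIn_tauLEι (w : WeightStructure C) (k : ℤ) (G : Cᵒᵖ ⥤ A) (X : C) :
    w.leIn k G X ≫ ((w.tauLEι A k).app G).app (op X) = G.map (w.leπ k X).op := by
  rw [tauLEι_app, ← Category.assoc, leIn_leOut, ← G.map_comp, ← op_comp, leπ_leMap, Category.id_comp]

/-- The connecting morphism in terms of an arbitrary weight decomposition. -/
lemma comp_bd (w : WeightStructure C) {X X' : C} {k k' l : ℤ} (D : WeightDec w k X) (g : X ⟶ X') (hk : k' < k)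
    (h : l ≤ k') (e : D.Q ⟶ w.leObj k' X') (he : D.π ≫ e = g ≫ w.leπ k' X')
    (s : D.P⟦(1 : ℤ)⟧ ⟶ w.geObj l (X'⟦(1 : ℤ)⟧))
    (hs : s ≫ w.geι l (X'⟦(1 : ℤ)⟧) = (D.ι ≫ g)⟦(1 : ℤ)⟧') : e ≫ w.bd k' l h X' = D.δ ≫ s := by
  obtain ⟨a, ha⟩ := (w.dec k' X').exists_lift D.ge (by lia) (D.ι ≫ g)
  obtain ⟨c, hc₁, hc₂⟩ : ∃ c : D.Q ⟶ (w.dec k' X').Q,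
      D.π ≫ c = g ≫ (w.dec k' X').π ∧ D.δ ≫ a⟦(1 : ℤ)⟧' = c ≫ (w.dec k' X').δ :=
    complete_distinguished_triangle_morphism _ _ D.dist (w.dec k' X').dist a g ha.symm
  -- The third morphism of a morphism of triangles is not unique in general; here the strict
  -- inequality `k' < k` makes it so.
  have hc : e = c := D.desc_unique (w.le_leObj _ _) hk (he.trans hc₁.symm)
  have h3 : a⟦(1 : ℤ)⟧' ≫ (w.exists_bd k' l h X').choose = s := by
    apply w.geObj_ext (w.ge_shift (by lia : 1 + k = k + 1) D.ge) (by lia)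
    rw [Category.assoc, (w.exists_bd k' l h X').choose_spec, hs, ← Functor.map_comp, ha]
  rw [hc, bd, ← h3, ← Category.assoc, ← Category.assoc, hc₂]

end WeightStructure

namespace Tower

variable (P : Tower w)

section

variable (p b k : ℤ)

lemma ge_Y_shift {c n k : ℤ} (h : n + k ≤ 1 - c) : w.ge k ((P.Y c)⟦n⟧) :=
  w.ge_shift rfl (w.ge_mono h (P.ge c))

lemma exists_geToY (h : 1 - b + p ≤ k) : ∃ t : w.geObj k (P.X⟦-p⟧) ⟶ (P.Y b)⟦-p⟧,
    t ≫ (P.toX b)⟦-p⟧' = w.geι k (P.X⟦-p⟧) :=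
  ((P.decX b).shift (-p) (-b + p) (by ring)).exists_lift (w.ge_geObj k _) (by lia) _

/-- A morphism `w_{≥ k} (X[-p]) ⟶ Y_b[-p]` over `X[-p]`. -/
def geToY (h : 1 - b + p ≤ k) : w.geObj k (P.X⟦-p⟧) ⟶ (P.Y b)⟦-p⟧ := (P.exists_geToY p b k h).choose

lemma geToY_toX (h : 1 - b + p ≤ k) : P.geToY p b k h ≫ (P.toX b)⟦-p⟧' = w.geι k (P.X⟦-p⟧) :=
  (P.exists_geToY p b k h).choose_spec

lemma exists_yToGe (h : k ≤ 1 - b + p) : ∃ t : (P.Y b)⟦-p⟧ ⟶ w.geObj k (P.X⟦-p⟧),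
    t ≫ w.geι k (P.X⟦-p⟧) = (P.toX b)⟦-p⟧' :=
  (w.dec (k - 1) (P.X⟦-p⟧)).exists_lift (P.ge_Y_shift (k := k) (by lia)) (by lia) _

/-- A morphism `Y_b[-p] ⟶ w_{≥ k} (X[-p])` over `X[-p]`. -/
def yToGe (h : k ≤ 1 - b + p) : (P.Y b)⟦-p⟧ ⟶ w.geObj k (P.X⟦-p⟧) := (P.exists_yToGe p b k h).choose

lemma yToGe_geι (h : k ≤ 1 - b + p) : P.yToGe p b k h ≫ w.geι k (P.X⟦-p⟧) = (P.toX b)⟦-p⟧' :=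
  (P.exists_yToGe p b k h).choose_spec

variable (a : ℤ) (hab : a < b)

lemma exists_leToQuo (h : p - a ≤ k) : ∃ t : w.leObj k ((P.Y b)⟦-p⟧) ⟶ (P.quo a b hab)⟦-p⟧,
    w.leπ k ((P.Y b)⟦-p⟧) ≫ t = (P.πy a b hab)⟦-p⟧' :=
  (w.dec k ((P.Y b)⟦-p⟧)).exists_desc (w.le_shift (k := -a) (k' := p - a) (by lia) (P.le_quo a b hab)) h _

/-- A morphism `w_{≤ k} (Y_b[-p]) ⟶ (Y_b / Y_a)[-p]` under `Y_b[-p]`. -/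
def leToQuo (h : p - a ≤ k) : w.leObj k ((P.Y b)⟦-p⟧) ⟶ (P.quo a b hab)⟦-p⟧ :=
  (P.exists_leToQuo p b k a hab h).choose

lemma leπ_leToQuo (h : p - a ≤ k) :
    w.leπ k ((P.Y b)⟦-p⟧) ≫ P.leToQuo p b k a hab h = (P.πy a b hab)⟦-p⟧' :=
  (P.exists_leToQuo p b k a hab h).choose_spec

lemma exists_quoToLe (h : k ≤ p - a) : ∃ t : (P.quo a b hab)⟦-p⟧ ⟶ w.leObj k ((P.Y b)⟦-p⟧),
    (P.πy a b hab)⟦-p⟧' ≫ t = w.leπ k ((P.Y b)⟦-p⟧) :=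
  ((P.decY a b hab).shift (-p) (p - a) (by ring)).exists_desc (w.le_leObj k _) h _

/-- A morphism `(Y_b / Y_a)[-p] ⟶ w_{≤ k} (Y_b[-p])` under `Y_b[-p]`. -/
def quoToLe (h : k ≤ p - a) : (P.quo a b hab)⟦-p⟧ ⟶ w.leObj k ((P.Y b)⟦-p⟧) :=
  (P.exists_quoToLe p b k a hab h).choose

lemma π_quoToLe (h : k ≤ p - a) :
    (P.πy a b hab)⟦-p⟧' ≫ P.quoToLe p b k a hab h = w.leπ k ((P.Y b)⟦-p⟧) :=
  (P.exists_quoToLe p b k a hab h).choose_spec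

end

section

variable (G : Cᵒᵖ ⥤ A) (p b d p' : ℤ) {G' : Cᵒᵖ ⥤ A}

/-- The epimorphism `G ((Y_{p+2} / Y_p)[-p]) ⟶ (τ_{≥ 0} τ_{≤ 0} G)(X[-p])`. -/
def virtIn (hb : p + 1 + 1 = b) : G.obj (op ((P.quo p b (by lia))⟦-p⟧)) ⟶
    ((w.tauGE A 0).obj ((w.tauLE A 0).obj G)).obj (op (P.X⟦-p⟧)) :=
  G.map (P.leToQuo p b 0 p (by lia) (by lia)).op ≫ w.leIn 0 G ((P.Y b)⟦-p⟧) ≫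
    ((w.tauLE A 0).obj G).map (P.geToY p b (0 - 1) (by lia)).op ≫
      w.geIn 0 ((w.tauLE A 0).obj G) (P.X⟦-p⟧)

/-- The monomorphism `(τ_{≥ 0} τ_{≤ 0} G)(X[-p]) ⟶ G ((Y_{p+1} / Y_{p-1})[-p])`. -/
def virtOut (hp : p + 1 = p') (hd : d + 1 = p) : ((w.tauGE A 0).obj ((w.tauLE A 0).obj G)).obj (op (P.X⟦-p⟧)) ⟶
    G.obj (op ((P.quo d p' (by lia))⟦-p⟧)) :=
  w.geOut 0 ((w.tauLE A 0).obj G) (P.X⟦-p⟧) ≫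
    ((w.tauLE A 0).obj G).map (P.yToGe p p' 0 (by lia)).op ≫ w.leOut 0 G ((P.Y p')⟦-p⟧) ≫
      G.map (P.quoToLe p p' (0 + 1) d (by lia) (by lia)).op

/-- With `b = p + 2`, `Y_b[-p]` is a choice of `w_{≥ -1} (X[-p])`, and `(Y_b / Y_p)[-p]` is a choice
of `w_{≤ 0} (Y_b[-p])`. -/
lemma epi_virtIn (hb : p + 1 + 1 = b) : Epi (P.virtIn G p b hb) := by
  have h₁ : Epi (G.map (P.leToQuo p b 0 p (by lia) (by lia)).op ≫ w.leIn 0 G ((P.Y b)⟦-p⟧)) :=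
    w.epi_leIn_of_choice 0 G _ (P.quoToLe p b 0 p (by lia) (by lia)) (by
      rw [reassoc_of% (P.leπ_leToQuo), π_quoToLe])
  have h₂ : Epi (((w.tauLE A 0).obj G).map (P.geToY p b (0 - 1) (by lia)).op ≫
      w.geIn 0 ((w.tauLE A 0).obj G) (P.X⟦-p⟧)) :=
    w.epi_geIn_of_choice 0 _ _ (P.yToGe p b (0 - 1) (by lia)) (by rw [yToGe_geι, geToY_toX])
  rw [virtIn, ← Category.assoc]
  exact epi_comp _ _

/-- `Y_{p+1}[-p]` is a choice of `w_{≥ 0} (X[-p])`, and `(Y_{p+1} / Y_{p-1})[-p]` is a choice of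
`w_{≤ 1} (Y_{p+1}[-p])`. -/
lemma mono_virtOut (hp : p + 1 = p') (hd : d + 1 = p) : Mono (P.virtOut G p d p' hp hd) := by
  have h₁ : Mono (w.geOut 0 ((w.tauLE A 0).obj G) (P.X⟦-p⟧) ≫
      ((w.tauLE A 0).obj G).map (P.yToGe p p' 0 (by lia)).op) :=
    w.mono_geOut_of_choice 0 _ _ (P.geToY p p' 0 (by lia)) (by rw [yToGe_geι, geToY_toX])
  have h₂ : Mono (w.leOut 0 G ((P.Y p')⟦-p⟧) ≫
      G.map (P.quoToLe p p' (0 + 1) d (by lia) (by lia)).op) :=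
    w.mono_leOut_of_choice 0 G _ (P.leToQuo p p' (0 + 1) d (by lia) (by lia)) (by
      rw [reassoc_of% (P.leπ_leToQuo), π_quoToLe])
  rw [virtOut, ← Category.assoc]
  exact mono_comp _ _

variable {G}

/-- The composite is the morphism through `X_p`, as in the presentation of the second page. The
identities `h₂` and `h₄` hold by uniqueness: the weights on the two sides differ by one, the gap
built into the definition of virtual truncations. -/
lemma virtIn_virtOut (β : G ⟶ G') {P P' : Tower w} (F : P' ⟶ P) (hb : p + 1 + 1 = b)
    (hp : p + 1 = p') (hd : d + 1 = p) :
    P.virtIn G p b hb ≫ ((w.tauGE A 0).map ((w.tauLE A 0).map β)).app (op (P.X⟦-p⟧)) ≫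
      ((w.tauGE A 0).obj ((w.tauLE A 0).obj G')).map ((Hom.g F)⟦-p⟧').op ≫ P'.virtOut G' p d p' hp hd =
    β.app _ ≫ G'.map ((P'.quoToZ d p p' hp (by lia) ≫ Hom.z F p ≫
      P.zToQuo p p' b hp (by lia))⟦-p⟧').op := by
  have h₁ := w.geIn_app_map_geOut 0 ((w.tauLE A 0).map β) ((Hom.g F)⟦-p⟧')
  have h₂ : P'.yToGe p p' 0 (by lia) ≫ w.geMap ((Hom.g F)⟦-p⟧') (by lia : (0 : ℤ) - 1 ≤ 0) ≫
      P.geToY p b (0 - 1) (by lia) = (Hom.y F p' ≫ P.ft p' b (by lia))⟦-p⟧' := by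
    apply ((P.decX b).shift (-p) (-b + p) (by ring)).lift_unique (P'.ge_Y_shift (k := 0) (by lia)) (by lia)
    change (_ ≫ _ ≫ _) ≫ (P.toX b)⟦-p⟧' = _ ≫ (P.toX b)⟦-p⟧'
    rw [Category.assoc, Category.assoc, geToY_toX, w.geMap_geι, reassoc_of% (P'.yToGe_geι),
      ← Functor.map_comp, ← Functor.map_comp, Category.assoc, ft_toX, Hom.comm_toX]
  have h₃ := w.leIn_app_map_leOut 0 β ((Hom.y F p' ≫ P.ft p' b (by lia))⟦-p⟧')
  have h₄ : P'.quoToLe p p' (0 + 1) d (by lia) (by lia) ≫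
      w.leMap ((Hom.y F p' ≫ P.ft p' b (by lia))⟦-p⟧') (by lia : (0 : ℤ) ≤ 0 + 1) ≫
        P.leToQuo p b 0 p (by lia) (by lia) =
      (P'.quoToZ d p p' hp (by lia) ≫ Hom.z F p ≫ P.zToQuo p p' b hp (by lia))⟦-p⟧' := by
    apply ((P'.decY d p' (by lia)).shift (-p) (p - d) (by ring)).desc_unique
      (w.le_shift (k := -p) (k' := 0) (by lia) (P.le_quo p b (by lia))) (by lia)
    change (P'.πy d p' _)⟦-p⟧' ≫ _ = (P'.πy d p' _)⟦-p⟧' ≫ _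
    rw [reassoc_of% (P'.π_quoToLe), reassoc_of% (w.leπ_leMap), leπ_leToQuo, ← Functor.map_comp,
      ← Functor.map_comp, reassoc_of% (P'.π_quoToZ), reassoc_of% (Hom.comm_c F), c_zToQuo, Category.assoc]
  rw [virtIn, virtOut]
  simp only [Category.assoc]
  rw [reassoc_of% h₁, NatTrans.naturality_assoc, ← Functor.map_comp_assoc, ← Functor.map_comp_assoc,
    ← op_comp, ← op_comp, h₂, reassoc_of% h₃, NatTrans.naturality_assoc, ← Functor.map_comp,
    ← Functor.map_comp, ← op_comp, ← op_comp, Category.assoc, h₄]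

end

end Tower

end VirtualPresentation

end WeightSS

end

noncomputable section

namespace WeightSS

/-! ### The terms `D` of the virtual couple and its morphisms `i`, `k` -/

section VirtualCouple

variable {C : Type u} [Category.{v} C] [Preadditive C] [HasZeroObject C] [HasShift C ℤ]
  [∀ n : ℤ, (shiftFunctor C n).Additive] [Pretriangulated C]
  {A : Type u'} [Category.{v'} A] [Abelian A] {w : WeightStructure C}

/-- The canonical isomorphism `X[a][b] ⟶ X[c][d]` for `a + b = c + d`. -/
def sh (X : C) (a b c d : ℤ) (h : a + b = c + d) : X⟦a⟧⟦b⟧ ⟶ X⟦c⟧⟦d⟧ := (shIso a b c d h).hom.app X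

lemma sh_naturality {X Y : C} (f : X ⟶ Y) (a b c d : ℤ) (h : a + b = c + d) :
    f⟦a⟧'⟦b⟧' ≫ sh Y a b c d h = sh X a b c d h ≫ f⟦c⟧'⟦d⟧' :=
  (shIso a b c d h).hom.naturality f

lemma sh_sh (X : C) {a b c d e f : ℤ} (h : a + b = c + d) (h' : c + d = e + f) :
    sh X a b c d h ≫ sh X c d e f h' = sh X a b e f (h.trans h') :=
  shIso_trans X h h'

lemma sh_refl (X : C) (a b : ℤ) (h : a + b = a + b) : sh X a b a b h = 𝟙 _ := shIso_refl X a b h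

/-- The morphism `H^q (Z) ⟶ H (W)` induced by a morphism `W ⟶ Z[-q]`. -/
def cohMap (H : Cᵒᵖ ⥤ A) (q : ℤ) {Z W : C} (f : W ⟶ Z⟦-q⟧) : ((coh C A q).obj H).obj (op Z) ⟶ H.obj (op W) :=
  H.map f.op

lemma map_cohMap (H : Cᵒᵖ ⥤ A) (q : ℤ) {Z Z' W : C} (g : Z ⟶ Z') (f : W ⟶ Z⟦-q⟧) :
    ((coh C A q).obj H).map g.op ≫ cohMap H q f = cohMap H q (f ≫ g⟦-q⟧') :=
  (H.map_comp _ _).symm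

lemma cohMap_map (H : Cᵒᵖ ⥤ A) (q : ℤ) {Z W W' : C} (f : W ⟶ Z⟦-q⟧) (g : W' ⟶ W) :
    cohMap H q f ≫ H.map g.op = cohMap H q (g ≫ f) :=
  (H.map_comp _ _).symm

namespace Tower

variable (P : Tower w)

/-- The weight decomposition of `X[1-p][-q]` given by `Y_p`. -/
abbrev decD (a : ℤ × ℤ) : WeightDec w (a.2 - 1) (P.X⟦1 - a.1⟧⟦-a.2⟧) :=
  ((P.decX a.1).shift (1 - a.1) (-1) (by ring)).shift (-a.2) (a.2 - 1) (by ring)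

/-- The morphism `Y_p[1-p][-q] ⟶ X[1-p][-q]`. -/
def objDToX (a : ℤ × ℤ) : P.objD a ⟶ P.X⟦1 - a.1⟧⟦-a.2⟧ := (P.toX a.1)⟦1 - a.1⟧'⟦-a.2⟧'

lemma ge_objD (a : ℤ × ℤ) : w.ge a.2 (P.objD a) := by
  have := (P.decD a).ge
  rwa [sub_add_cancel] at this

lemma exists_lift_objD {a : ℤ × ℤ} {k : ℤ} {T : C} (hT : w.ge k T) (h : a.2 ≤ k) (t : T ⟶ P.X⟦1 - a.1⟧⟦-a.2⟧) :
    ∃ t' : T ⟶ P.objD a, t' ≫ P.objDToX a = t :=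
  (P.decD a).exists_lift hT (by lia) t

lemma objD_ext {a : ℤ × ℤ} {k : ℤ} {T : C} (hT : w.ge k T) (h : a.2 < k) {t t' : T ⟶ P.objD a}
    (ht : t ≫ P.objDToX a = t' ≫ P.objDToX a) : t = t' :=
  (P.decD a).lift_unique hT (by lia) ht

lemma exists_toGe (a : ℤ × ℤ) : ∃ t : P.objD a ⟶ w.geObj a.2 (P.X⟦1 - a.1⟧⟦-a.2⟧),
    t ≫ w.geι a.2 _ = P.objDToX a :=
  (w.dec (a.2 - 1) _).exists_lift (P.ge_objD a) (by lia) _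

/-- A morphism `Y_p[1-p][-q] ⟶ w_{≥ q} (X[1-p][-q])` over `X[1-p][-q]`. -/
def toGe (a : ℤ × ℤ) : P.objD a ⟶ w.geObj a.2 (P.X⟦1 - a.1⟧⟦-a.2⟧) := (P.exists_toGe a).choose

lemma toGe_geι (a : ℤ × ℤ) : P.toGe a ≫ w.geι a.2 _ = P.objDToX a := (P.exists_toGe a).choose_spec

lemma shift_eq {a b : ℤ × ℤ} (h : a + (-1, 1) = b) : 1 - b.1 + -b.2 = 1 - a.1 + -a.2 := by
  rw [← h]; simp; ring

lemma exists_ofGe (a b : ℤ × ℤ) (h : a + (-1, 1) = b) :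
    ∃ t : w.geObj (b.2 - 1) (P.X⟦1 - b.1⟧⟦-b.2⟧) ⟶ P.objD a, t ≫ P.objDToX a =
      w.geι (b.2 - 1) _ ≫ sh P.X (1 - b.1) (-b.2) (1 - a.1) (-a.2) (shift_eq h) :=
  P.exists_lift_objD (w.ge_geObj _ _) (by rw [← h]; simp) _

/-- A morphism `w_{≥ q-1} (X[1-p][-q]) ⟶ Y_{p+1}[-p][1-q]` over `X`. -/
def ofGe (a b : ℤ × ℤ) (h : a + (-1, 1) = b) :
    w.geObj (b.2 - 1) (P.X⟦1 - b.1⟧⟦-b.2⟧) ⟶ P.objD a := (P.exists_ofGe a b h).choose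

lemma ofGe_objDToX (a b : ℤ × ℤ) (h : a + (-1, 1) = b) : P.ofGe a b h ≫ P.objDToX a =
    w.geι (b.2 - 1) _ ≫ sh P.X (1 - b.1) (-b.2) (1 - a.1) (-a.2) (shift_eq h) :=
  (P.exists_ofGe a b h).choose_spec

lemma homI_objDToX (a b : ℤ × ℤ) (h : a + (-1, 1) = b) : P.homI a b h ≫ P.objDToX a =
    P.objDToX b ≫ sh P.X (1 - b.1) (-b.2) (1 - a.1) (-a.2) (shift_eq h) := by
  have e : b.1 + 1 = a.1 := by rw [← h]; simp
  have h₁ := sh_naturality (P.toX a.1) (1 - b.1) (-b.2) (1 - a.1) (-a.2) (shift_eq h)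
  refine (Category.assoc _ _ _).trans ((congrArg (_ ≫ ·) h₁.symm).trans ?_)
  refine (Category.assoc _ _ _).symm.trans (congrArg (· ≫ _) ?_)
  refine (Functor.map_comp _ _ _).symm.trans (congrArg (shiftFunctor C (-b.2)).map ?_)
  exact (Functor.map_comp _ _ _).symm.trans (congrArg (shiftFunctor C (1 - b.1)).map (P.comm b.1 a.1 e))

variable (H : Cᵒᵖ ⥤ A)

/-- The epimorphism `H (Y_{p+1}[-p][1-q]) ⟶ (τ_{≥ q} H)(X[1-p][-q])`. -/
def dIn (a b : ℤ × ℤ) (h : a + (-1, 1) = b) :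
    H.obj (op (P.objD a)) ⟶ ((w.tauGE A b.2).obj H).obj (op (P.X⟦1 - b.1⟧⟦-b.2⟧)) :=
  H.map (P.ofGe a b h).op ≫ w.geIn b.2 H _

/-- The monomorphism `(τ_{≥ q} H)(X[1-p][-q]) ⟶ H (Y_p[1-p][-q])`. -/
def dOut (a : ℤ × ℤ) :
    ((w.tauGE A a.2).obj H).obj (op (P.X⟦1 - a.1⟧⟦-a.2⟧)) ⟶ H.obj (op (P.objD a)) :=
  w.geOut a.2 H _ ≫ H.map (P.toGe a).op

instance (a b : ℤ × ℤ) (h : a + (-1, 1) = b) : Epi (P.dIn H a b h) := by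
  obtain ⟨t, ht⟩ := (w.dec (b.2 - 1 - 1) (P.X⟦1 - b.1⟧⟦-b.2⟧)).exists_lift (P.ge_objD a)
    (by rw [← h]; simp) (P.objDToX a ≫
      sh P.X (1 - a.1) (-a.2) (1 - b.1) (-b.2) (shift_eq h).symm)
  refine w.epi_geIn_of_choice _ _ _ t ?_
  change _ ≫ t ≫ (w.dec (b.2 - 1 - 1) _).ι = _
  rw [ht, reassoc_of% (P.ofGe_objDToX), sh_sh, sh_refl, Category.comp_id]

instance (a : ℤ × ℤ) : Mono (P.dOut H a) := by
  obtain ⟨t, ht⟩ := P.exists_lift_objD (a := a) (w.ge_geObj a.2 _) le_rfl (w.geι a.2 _)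
  exact w.mono_geOut_of_choice _ _ _ t (by rw [toGe_geι, ht])

variable {H}

/-- Presents `τ_{≥ q} H` as the image of `i`: its two defining truncations of `X[1-p][-q]` are
replaced by shifts of `Y_{p+1}` and `Y_p`. -/
lemma dIn_dOut {H' : Cᵒᵖ ⥤ A} (β : H ⟶ H') {P P' : Tower w} (F : P' ⟶ P) (a b : ℤ × ℤ) (h : a + (-1, 1) = b) :
    P.dIn H a b h ≫ ((w.tauGE A b.2).map β).app (op (P.X⟦1 - b.1⟧⟦-b.2⟧)) ≫
      ((w.tauGE A b.2).obj H').map ((Hom.g F)⟦1 - b.1⟧'⟦-b.2⟧').op ≫ P'.dOut H' b =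
    β.app (op (P.objD a)) ≫ H'.map (P'.homI a b h ≫ (Hom.y F a.1)⟦1 - a.1⟧'⟦-a.2⟧').op := by
  have h₁ := w.geIn_app_map_geOut b.2 β ((Hom.g F)⟦1 - b.1⟧'⟦-b.2⟧')
  have h₂ : P'.toGe b ≫ w.geMap ((Hom.g F)⟦1 - b.1⟧'⟦-b.2⟧') (by lia : b.2 - 1 ≤ b.2) ≫ P.ofGe a b h =
      P'.homI a b h ≫ (Hom.y F a.1)⟦1 - a.1⟧'⟦-a.2⟧' := by
    apply P.objD_ext (P'.ge_objD b) (by rw [← h]; simp)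
    have h₃ : (Hom.y F a.1)⟦1 - a.1⟧'⟦-a.2⟧' ≫ P.objDToX a =
        P'.objDToX a ≫ (Hom.g F)⟦1 - a.1⟧'⟦-a.2⟧' := by
      rw [objDToX, objDToX, ← Functor.map_comp, ← Functor.map_comp, ← Functor.map_comp, ← Functor.map_comp,
        Hom.comm_toX]
    rw [Category.assoc, Category.assoc, ofGe_objDToX, reassoc_of% (w.geMap_geι), reassoc_of% (P'.toGe_geι),
      Category.assoc, h₃, reassoc_of% (P'.homI_objDToX), sh_naturality]
  rw [dIn, dOut, Category.assoc, reassoc_of% h₁, NatTrans.naturality_assoc, ← Functor.map_comp,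
    ← Functor.map_comp, ← op_comp, ← op_comp, Category.assoc, h₂]

variable (H)

lemma tauGETrans_dOut (a b : ℤ × ℤ) (h : a + (-1, 1) = b) (h' : a.2 ≤ b.2) :
    ((w.tauGETrans A a.2 b.2 h').app H).app (op (P.X⟦1 - a.1⟧⟦-a.2⟧)) ≫
      ((w.tauGE A b.2).obj H).map (sh P.X (1 - b.1) (-b.2) (1 - a.1) (-a.2) (shift_eq h)).op ≫
        P.dOut H b = P.dOut H a ≫ H.map (P.homI a b h).op := by
  have h₁ := w.map_geOut b.2 H (sh P.X (1 - b.1) (-b.2) (1 - a.1) (-a.2) (shift_eq h))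
  have h₂ : P.toGe b ≫ w.geMap (sh P.X (1 - b.1) (-b.2) (1 - a.1) (-a.2) (shift_eq h))
      le_rfl ≫ w.geMap (𝟙 _) h' = P.homI a b h ≫ P.toGe a := by
    apply w.geObj_ext (P.ge_objD b) (by rw [← h]; simp)
    rw [Category.assoc, Category.assoc, w.geMap_geι, Category.comp_id, w.geMap_geι, reassoc_of% (P.toGe_geι),
      Category.assoc, toGe_geι, homI_objDToX]
  rw [dOut, reassoc_of% h₁, ← Category.assoc, w.tauGETrans_geOut, dOut, Category.assoc, Category.assoc,
    ← H.map_comp, ← H.map_comp, ← H.map_comp, ← op_comp, ← op_comp, ← op_comp, Category.assoc, h₂]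

/-- Forgetting `τ_{≤ 0}` restricts a class from `Y_b / Y_p` to `Y_b`, since `Y_b[-p] ⟶ w_{≤ 0}
(Y_b[-p]) ⟶ (Y_b / Y_p)[-p]` is the projection. -/
lemma virtIn_tauLEι (G : Cᵒᵖ ⥤ A) (p b : ℤ) (hb : p + 1 + 1 = b) :
    P.virtIn G p b hb ≫ ((w.tauGE A 0).map ((w.tauLEι A 0).app G)).app (op (P.X⟦-p⟧)) =
      G.map (P.geToY p b (0 - 1) (by lia) ≫ (P.πy p b (by lia))⟦-p⟧').op ≫ w.geIn 0 G (P.X⟦-p⟧) := by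
  have h₁ : w.geIn 0 ((w.tauLE A 0).obj G) (P.X⟦-p⟧) ≫
      ((w.tauGE A 0).map ((w.tauLEι A 0).app G)).app (op (P.X⟦-p⟧)) =
      ((w.tauLEι A 0).app G).app _ ≫ w.geIn 0 G (P.X⟦-p⟧) := w.geIn_app 0 _ _
  have h₂ : ((w.tauLE A 0).obj G).map (P.geToY p b (0 - 1) (by lia)).op ≫ ((w.tauLEι A 0).app G).app _ =
      ((w.tauLEι A 0).app G).app _ ≫ G.map (P.geToY p b (0 - 1) (by lia)).op :=
    ((w.tauLEι A 0).app G).naturality _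
  have h₃ : G.map (P.leToQuo p b 0 p (by lia) (by lia)).op ≫ w.leIn 0 G ((P.Y b)⟦-p⟧) ≫
      ((w.tauLEι A 0).app G).app (op ((P.Y b)⟦-p⟧)) = G.map ((P.πy p b (by lia))⟦-p⟧').op := by
    rw [w.leIn_tauLEι, ← G.map_comp, ← op_comp, leπ_leToQuo]
  have h₄ : P.virtIn G p b hb ≫ ((w.tauGE A 0).map ((w.tauLEι A 0).app G)).app (op (P.X⟦-p⟧)) =
      (G.map (P.leToQuo p b 0 p (by lia) (by lia)).op ≫ w.leIn 0 G ((P.Y b)⟦-p⟧) ≫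
        ((w.tauLE A 0).obj G).map (P.geToY p b (0 - 1) (by lia)).op) ≫
        (w.geIn 0 ((w.tauLE A 0).obj G) (P.X⟦-p⟧) ≫
      ((w.tauGE A 0).map ((w.tauLEι A 0).app G)).app (op (P.X⟦-p⟧))) := by
    simp only [virtIn, Category.assoc]
  refine h₄.trans ((congrArg (_ ≫ ·) h₁).trans ?_)
  rw [op_comp, G.map_comp, ← h₃]
  refine Eq.trans ?_ ((congrArg (fun t => (G.map (P.leToQuo p b 0 p (by lia) (by lia)).op ≫
    w.leIn 0 G ((P.Y b)⟦-p⟧) ≫ t) ≫ w.geIn 0 G (P.X⟦-p⟧)) h₂).trans ?_)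
  · simp only [Category.assoc]
  · simp only [Category.assoc]

/-- The transformation `tauGESh`, for `H^q`. -/
def geShift (q : ℤ) (h : q + -q = 0) (X : C) : ((w.tauGE A 0).obj ((coh C A q).obj H)).obj (op X) ⟶
    ((w.tauGE A q).obj H).obj (op (X⟦-q⟧)) :=
  ((w.tauGESh A (-q) 0 q h).app H).app (op X)

lemma geIn_geShift (q : ℤ) (h : q + -q = 0) (X : C) :
    w.geIn 0 ((coh C A q).obj H) X ≫ geShift (w := w) H q h X ≫ w.geOut q H (X⟦-q⟧) =
    cohMap H q (w.geSh (-q) 0 q (by lia) X ≫ (w.geMap (𝟙 X) (by lia : (0 : ℤ) - 1 ≤ 0))⟦-q⟧') := by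
  have h₁ : geShift (w := w) H q h X ≫ w.geOut q H (X⟦-q⟧) =
      w.geOut 0 ((coh C A q).obj H) X ≫ cohMap H q (w.geSh (-q) 0 q (by lia) X) :=
    w.tauGESh_geOut (-q) 0 q h H X
  rw [h₁, ← Category.assoc, w.geIn_geOut, map_cohMap]

/-- Compatibility with `E' ⟶ D'`. -/
lemma virtIn_dOut (p q b p' : ℤ) (hb : p + 1 + 1 = b) (hp : p + 1 = p') (h₀ : q + -q = 0)
    (hs : 1 - p' + -q = -p + -q) :
    P.virtIn ((coh C A q).obj H) p b hb ≫
      ((w.tauGE A 0).map ((w.tauLEι A 0).app ((coh C A q).obj H))).app (op (P.X⟦-p⟧)) ≫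
      geShift H q h₀ (P.X⟦-p⟧) ≫
      ((w.tauGE A q).obj H).map (sh P.X (1 - p') (-q) (-p) (-q) hs).op ≫ P.dOut H (p', q) =
    cohMap H q (sh (P.Y p') (1 - p') (-q) (-p) (-q) hs ≫
      (P.ft p' b (by lia) ≫ P.πy p b (by lia))⟦-p⟧'⟦-q⟧') := by
  have h₁ := P.virtIn_tauLEι ((coh C A q).obj H) p b hb
  have h₂ := geIn_geShift (w := w) H q h₀ (P.X⟦-p⟧)
  have h₃ := w.map_geOut q H (sh P.X (1 - p') (-q) (-p) (-q) hs)
  have h₄ : P.toGe (p', q) ≫ w.geMap (sh P.X (1 - p') (-q) (-p) (-q) hs) le_rfl ≫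
      w.geSh (-q) 0 q (by lia) (P.X⟦-p⟧) ≫ (w.geMap (𝟙 (P.X⟦-p⟧)) (by lia : (0 : ℤ) - 1 ≤ 0))⟦-q⟧' ≫
      (P.geToY p b (0 - 1) (by lia))⟦-q⟧' =
      sh (P.Y p') (1 - p') (-q) (-p) (-q) hs ≫ (P.ft p' b (by lia))⟦-p⟧'⟦-q⟧' := by
    apply (((P.decX b).shift (-p) (p - b) (by ring)).shift (-q) (p - b + q) (by ring)).lift_unique
      (P.ge_objD (p', q)) (by dsimp only; lia)
    change _ ≫ (P.toX b)⟦-p⟧'⟦-q⟧' = _ ≫ (P.toX b)⟦-p⟧'⟦-q⟧'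
    simp only [Category.assoc]
    rw [← Functor.map_comp, ← Functor.map_comp, ← Functor.map_comp, ← Functor.map_comp, ft_toX,
      geToY_toX, w.geMap_geι, Category.comp_id, w.geSh_geι, w.geMap_geι]
    have h₅ := P.toGe_geι (p', q)
    dsimp only at h₅
    rw [reassoc_of% h₅, ← sh_naturality]
    rfl
  rw [reassoc_of% h₁, dOut]
  dsimp only
  rw [reassoc_of% h₃, reassoc_of% h₂, reassoc_of% (map_cohMap H q), ← H.map_comp, ← op_comp, cohMap_map,
    Functor.map_comp, Functor.map_comp, Functor.map_comp, ← reassoc_of% h₄]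
  simp only [Category.assoc]

end Tower

end VirtualCouple

end WeightSS

end

noncomputable section

namespace WeightSS

/-! ### The connecting morphism and its sign -/

section Connecting

variable {C : Type u} [Category.{v} C] [Preadditive C] [HasZeroObject C] [HasShift C ℤ]
  [∀ n : ℤ, (shiftFunctor C n).Additive] [Pretriangulated C]
  {A : Type u'} [Category.{v'} A] [Abelian A] {w : WeightStructure C}

lemma shiftFunctorComm_add' (X : C) (a b s : ℤ) (h : a + b = s) (h' : b + a = s) :
    (shiftFunctorComm C a b).hom.app X ≫ (shiftFunctorAdd' C b a s h').inv.app X =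
      (shiftFunctorAdd' C a b s h).inv.app X := by
  rw [shiftFunctorComm_eq C a b s h]
  simp

/-- The canonical isomorphism `X[1][a][b] ⟶ X[a][b][1]`. -/
def comm₂ (X : C) (a b : ℤ) : X⟦(1 : ℤ)⟧⟦a⟧⟦b⟧ ⟶ X⟦a⟧⟦b⟧⟦(1 : ℤ)⟧ :=
  ((shiftFunctorComm C 1 a).hom.app X)⟦b⟧' ≫ (shiftFunctorComm C 1 b).hom.app (X⟦a⟧)

lemma comm₂_naturality {X Y : C} (f : X ⟶ Y) (a b : ℤ) :
    f⟦(1 : ℤ)⟧'⟦a⟧'⟦b⟧' ≫ comm₂ Y a b = comm₂ X a b ≫ f⟦a⟧'⟦b⟧'⟦(1 : ℤ)⟧' := by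
  have h₁ : f⟦(1 : ℤ)⟧'⟦a⟧' ≫ (shiftFunctorComm C 1 a).hom.app Y =
    (shiftFunctorComm C 1 a).hom.app X ≫ f⟦a⟧'⟦(1 : ℤ)⟧' := (shiftFunctorComm C 1 a).hom.naturality f
  have h₂ : f⟦a⟧'⟦(1 : ℤ)⟧'⟦b⟧' ≫ (shiftFunctorComm C 1 b).hom.app (Y⟦a⟧) =
    (shiftFunctorComm C 1 b).hom.app (X⟦a⟧) ≫ f⟦a⟧'⟦b⟧'⟦(1 : ℤ)⟧' :=
    (shiftFunctorComm C 1 b).hom.naturality (f⟦a⟧')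
  have h₃ := congrArg (shiftFunctor C b).map h₁
  rw [Functor.map_comp, Functor.map_comp] at h₃
  exact (Category.assoc _ _ _).symm.trans ((congrArg (· ≫ _) h₃).trans ((Category.assoc _ _ _).trans
    ((congrArg (_ ≫ ·) h₂).trans (Category.assoc _ _ _).symm)))

/-- The canonical isomorphism `X[a][b][1] ⟶ X[c][d]`. -/
def shOne (X : C) (a b s c d : ℤ) (hs : b + 1 = s) (h : a + s = c + d) : X⟦a⟧⟦b⟧⟦(1 : ℤ)⟧ ⟶ X⟦c⟧⟦d⟧ :=
  (shiftFunctorAdd' C b 1 s hs).inv.app (X⟦a⟧) ≫ sh X a s c d h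

/-- Moving `[1]` past the other shifts and then merging gives the canonical identification, without
a sign; the sign in `comp_bd_shift` comes only from the shifted triangle. -/
lemma comm₂_shOne (X : C) (a b s c d : ℤ) (hs : b + 1 = s) (h : a + s = c + d)
    (h' : 1 + (a + b) = c + d) :
    comm₂ X a b ≫ shOne X a b s c d hs h = (sh3 1 a b c d h').hom.app X := by
  have h₁ := shiftFunctorComm_add' (X⟦a⟧) 1 b s (by lia) hs
  have h₂ := shiftFunctorComm_add' X 1 a (1 + a) rfl (by lia)
  have h₃ := shiftFunctorAdd'_assoc_inv_app a 1 b (1 + a) s (a + s) (by lia) (by lia) (by lia) X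
  rw [sh3_eq X (rfl : 1 + a = 1 + a) h' (by lia), ← h₂, Functor.map_comp, Category.assoc]
  have key : ∀ t (e₁ : 1 + a + b = t) (e₂ : c + d = t),
      (shiftFunctorAdd' C (1 + a) b t e₁).inv.app X ≫ (shiftFunctorAdd' C c d t e₂).hom.app X =
        (shIso (1 + a) b c d (by lia)).hom.app X := by
    rintro t rfl _
    rfl
  rw [← key (a + s) (by lia) h.symm, ← Category.assoc ((shiftFunctorAdd' C a 1 (1 + a) _).inv.app X⟦b⟧'),
    h₃, comm₂, shOne, Category.assoc, reassoc_of% h₁, Category.assoc]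
  rfl

/-- The morphism `H (W) ⟶ H^q (Z)` induced by a morphism `Z[-q] ⟶ W`. -/
def mapCoh (H : Cᵒᵖ ⥤ A) (q : ℤ) {Z W : C} (f : Z⟦-q⟧ ⟶ W) : H.obj (op W) ⟶ ((coh C A q).obj H).obj (op Z) :=
  H.map f.op

lemma mapCoh_map (H : Cᵒᵖ ⥤ A) (q : ℤ) {Z Z' W : C} (f : Z⟦-q⟧ ⟶ W) (g : Z' ⟶ Z) :
    mapCoh H q f ≫ ((coh C A q).obj H).map g.op = mapCoh H q (g⟦-q⟧' ≫ f) :=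
  (H.map_comp _ _).symm

lemma map_mapCoh (H : Cᵒᵖ ⥤ A) (q : ℤ) {Z W W' : C} (f : Z⟦-q⟧ ⟶ W) (g : W ⟶ W') :
    H.map g.op ≫ mapCoh H q f = mapCoh H q (f ≫ g) :=
  (H.map_comp _ _).symm

lemma mapCoh_smul (H : Cᵒᵖ ⥤ A) [H.Additive] (q : ℤ) {Z W : C} (f : Z⟦-q⟧ ⟶ W) (ε : ℤˣ) :
    mapCoh H q (ε • f) = ε • mapCoh H q f := by
  rcases Int.units_eq_one_or ε with rfl | rfl
  · rw [one_smul, one_smul]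
  · rw [Units.neg_smul, one_smul, Units.neg_smul, one_smul]
    exact H.map_neg

/-- Elements of `τ_{≥ k} H (X)` come from `w_{≥ k-1} X`, so a morphism to `w_{≥ k} X` matters only
through its composite to `w_{≥ k-1} X`. -/
lemma WeightStructure.geOut_comp_mapCoh_eq (w : WeightStructure C) (H : Cᵒᵖ ⥤ A) (q : ℤ) {k l : ℤ} (hl : l + 1 = k)
    {X T : C} {m m' : T⟦-q⟧ ⟶ w.geObj k X}
    (h : m ≫ w.geMap (𝟙 X) (by lia : l ≤ k) = m' ≫ w.geMap (𝟙 X) (by lia : l ≤ k)) :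
    w.geOut k H X ≫ mapCoh H q m = w.geOut k H X ≫ mapCoh H q m' := by
  obtain rfl : l = k - 1 := by lia
  rw [← cancel_epi (w.geIn k H X), ← Category.assoc, ← Category.assoc, w.geIn_geOut, map_mapCoh, map_mapCoh, h]

namespace Tower

variable (P : Tower w)

/-- `comp_bd` is applied to the decomposition of `Y_{p+1}` by `Y_d`, shifted by `-p` and `-q`. Each
shift by `n` changes the boundary by `(-1)^n`, whence `(-1)^{p+q}`. -/
lemma comp_bd_shift (p q d p' : ℤ) (hp : p + 1 = p') (hd : d + 1 = p)
    (e : (P.quo d p' (by lia))⟦-p⟧⟦-q⟧ ⟶ w.leObj q (P.X⟦-p⟧⟦-q⟧))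
    (he : (P.πy d p' (by lia))⟦-p⟧'⟦-q⟧' ≫ e = (P.toX p')⟦-p⟧'⟦-q⟧' ≫ w.leπ q _)
    (s : (P.Y d)⟦-p⟧⟦-q⟧⟦(1 : ℤ)⟧ ⟶ w.geObj q (P.X⟦-p⟧⟦-q⟧⟦(1 : ℤ)⟧))
    (hs : s ≫ w.geι q _ = (P.toX d)⟦-p⟧'⟦-q⟧'⟦(1 : ℤ)⟧') :
    e ≫ w.bd q q le_rfl (P.X⟦-p⟧⟦-q⟧) =
      (p + q).negOnePow • ((P.δy d p' (by lia))⟦-p⟧'⟦-q⟧' ≫ comm₂ (P.Y d) (-p) (-q) ≫ s) := by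
  have h₂ := w.comp_bd (((P.decY d p' (by lia)).shift (-p) (p - d) (by ring)).shift (-q) (q + 1) (by lia))
    ((P.toX p')⟦-p⟧'⟦-q⟧') (by lia : q < q + 1) le_rfl e he s (hs.trans (by
      change _ = ((P.ft d p' (by lia))⟦-p⟧'⟦-q⟧' ≫ _)⟦(1 : ℤ)⟧'
      rw [← Functor.map_comp, ← Functor.map_comp, ft_toX]))
  have h₃ : (((P.decY d p' (by lia)).shift (-p) (p - d) (by ring)).shift (-q) (q + 1) (by lia)).δ =
      (p + q).negOnePow • ((P.δy d p' (by lia))⟦-p⟧'⟦-q⟧' ≫ comm₂ (P.Y d) (-p) (-q)) := by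
    change (-q).negOnePow • (((-p).negOnePow • ((P.δy d p' (by lia))⟦-p⟧' ≫
        (shiftFunctorComm C 1 (-p)).hom.app (P.Y d)))⟦-q⟧' ≫
          (shiftFunctorComm C 1 (-q)).hom.app ((P.Y d)⟦-p⟧)) = _
    rw [Functor.map_units_smul, Functor.map_comp, Linear.units_smul_comp, smul_smul, Int.negOnePow_neg,
      Int.negOnePow_neg, ← Int.negOnePow_add, add_comm q p, Category.assoc]
    rfl
  have h₄ : ((p + q).negOnePow • ((P.δy d p' (by lia))⟦-p⟧'⟦-q⟧' ≫ comm₂ (P.Y d) (-p) (-q))) ≫ s =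
      (p + q).negOnePow • ((P.δy d p' (by lia))⟦-p⟧'⟦-q⟧' ≫ comm₂ (P.Y d) (-p) (-q) ≫ s) := by
    rw [Linear.units_smul_comp, Category.assoc]
  exact h₂.trans ((congrArg (· ≫ s) h₃).trans h₄)

/-- The sources have weight `≥ q+1`, so morphisms to `w_{≥ q}` are determined over `X` while those
to `w_{≥ q+1}` are not; this is why both sides carry a transition to `w_{≥ q}`. -/
lemma quoToLe_bd (p q d p' : ℤ) (hp : p + 1 = p') (hd : d + 1 = p) (h : -p + (1 - q) = 1 - d + -(q + 1))
    (h' : 1 + (-p + -q) = 1 - d + -(q + 1)) :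
    ((P.quoToLe p p' (0 + 1) d (by lia) (by lia))⟦-q⟧' ≫
      (w.leMap ((P.toX p')⟦-p⟧') (le_refl (0 + 1)))⟦-q⟧' ≫ w.leSh (-q) (0 + 1) (q + 1) (by lia) (P.X⟦-p⟧) ≫
      w.bd (q + 1) (q + 1) le_rfl (P.X⟦-p⟧⟦-q⟧) ≫
      w.geMap (shOne P.X (-p) (-q) (1 - q) (1 - d) (-(q + 1)) (by lia) h) le_rfl) ≫
      w.geMap (𝟙 _) (by lia : q ≤ q + 1) =
    ((p + q).negOnePow • ((P.δy d p' (by lia))⟦-p⟧'⟦-q⟧' ≫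
      (sh3 1 (-p) (-q) (1 - d) (-(q + 1)) h').hom.app (P.Y d) ≫ P.toGe (d, q + 1))) ≫
      w.geMap (𝟙 _) (by lia : q ≤ q + 1) := by
  have hge : w.ge (q + 1) ((P.Y d)⟦(1 : ℤ)⟧⟦-p⟧⟦-q⟧) :=
    w.ge_shift (k := 1) (by lia) (w.ge_shift (k := -d) (by lia) (w.ge_shift (by lia) (P.ge d)))
  have hge' : w.ge q ((P.Y d)⟦-p⟧⟦-q⟧⟦(1 : ℤ)⟧) :=
    w.ge_mono (by lia : q ≤ q + 1) (w.ge_shift (k := q + 2) (by lia) (w.ge_shift (k := 2) (by lia)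
      (w.ge_shift (by lia) (P.ge d))))
  obtain ⟨s, hs⟩ := (w.dec (q - 1) (P.X⟦-p⟧⟦-q⟧⟦(1 : ℤ)⟧)).exists_lift hge' (by lia)
    ((P.toX d)⟦-p⟧'⟦-q⟧'⟦(1 : ℤ)⟧')
  have hs' : s ≫ w.geι q _ = (P.toX d)⟦-p⟧'⟦-q⟧'⟦(1 : ℤ)⟧' := hs
  have h₁ := P.comp_bd_shift p q d p' hp hd
    ((P.quoToLe p p' (0 + 1) d (by lia) (by lia))⟦-q⟧' ≫
      (w.leMap ((P.toX p')⟦-p⟧') (le_refl (0 + 1)))⟦-q⟧' ≫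
      w.leSh (-q) (0 + 1) (q + 1) (by lia) (P.X⟦-p⟧) ≫ w.leMap (𝟙 _) (by lia)) (by
      rw [← Functor.map_comp_assoc, ← Functor.map_comp_assoc, π_quoToLe, w.leπ_leMap,
        Functor.map_comp, Category.assoc, reassoc_of% (w.leπ_leSh),
        w.leπ_leMap, Category.id_comp]) s hs'
  have h₂ := w.leMap_bd (𝟙 (P.X⟦-p⟧⟦-q⟧)) (by lia : q < q + 1) (le_refl q) (le_refl (q + 1)) (by lia)
  rw [CategoryTheory.Functor.map_id] at h₂
  have h₃ : w.geMap (shOne P.X (-p) (-q) (1 - q) (1 - d) (-(q + 1)) (by lia) h) (le_refl (q + 1)) ≫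
      w.geMap (𝟙 _) (by lia : q ≤ q + 1) = w.geMap (𝟙 _) (by lia : q ≤ q + 1) ≫
        w.geMap (shOne P.X (-p) (-q) (1 - q) (1 - d) (-(q + 1)) (by lia) h) (le_refl q) := by
    apply w.geObj_ext (w.ge_geObj _ _) (by lia)
    simp only [Category.assoc, w.geMap_geι, Category.comp_id]
    rw [reassoc_of% (w.geMap_geι), Category.id_comp]
  have h₄ : comm₂ (P.Y d) (-p) (-q) ≫ s ≫
      w.geMap (shOne P.X (-p) (-q) (1 - q) (1 - d) (-(q + 1)) (by lia) h) (le_refl q) =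
      (sh3 1 (-p) (-q) (1 - d) (-(q + 1)) h').hom.app (P.Y d) ≫ P.toGe (d, q + 1) ≫
        w.geMap (𝟙 _) (by lia : q ≤ q + 1) := by
    apply w.geObj_ext hge (by lia)
    have h₅ := P.toGe_geι (d, q + 1)
    dsimp only [objDToX] at h₅
    have h₆ : (sh3 1 (-p) (-q) (1 - d) (-(q + 1)) h').hom.app (P.Y d) ≫ (P.toX d)⟦1 - d⟧'⟦-(q + 1)⟧' =
        (P.toX d)⟦(1 : ℤ)⟧'⟦-p⟧'⟦-q⟧' ≫ (sh3 1 (-p) (-q) (1 - d) (-(q + 1)) h').hom.app P.X :=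
      ((sh3 1 (-p) (-q) (1 - d) (-(q + 1)) h').hom.naturality (P.toX d)).symm
    have h₇ : (sh3 1 (-p) (-q) (1 - d) (-(q + 1)) h').hom.app (P.Y d) ≫ P.toGe (d, q + 1) ≫
        w.geι (q + 1) _ = _ := (congrArg ((sh3 1 (-p) (-q) (1 - d) (-(q + 1)) h').hom.app (P.Y d) ≫ ·) h₅).trans h₆
    rw [Category.assoc, Category.assoc, w.geMap_geι, reassoc_of% hs', ← reassoc_of% comm₂_naturality,
      comm₂_shOne _ _ _ _ _ _ _ _ h', ← h₇]
    have h₈ : P.toGe (d, q + 1) ≫ w.geι (q + 1) _ = (P.toGe (d, q + 1) ≫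
        w.geMap (𝟙 _) (by lia : q ≤ q + 1)) ≫ w.geι q _ := by
      rw [Category.assoc, w.geMap_geι, Category.comp_id]
    exact (congrArg ((sh3 1 (-p) (-q) (1 - d) (-(q + 1)) h').hom.app (P.Y d) ≫ ·) h₈).trans
      (Category.assoc _ _ _).symm
  simp only [Category.assoc] at h₁ ⊢
  rw [h₃, ← reassoc_of% h₂, reassoc_of% h₁, Linear.units_smul_comp, Linear.units_smul_comp]
  simp only [Category.assoc]
  rw [h₄]

variable (H : Cᵒᵖ ⥤ A)

/-- The transformation `tauLESh`, for `H^q`. -/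
def leShift (q : ℤ) (h : q + -q = 0) (X : C) : ((w.tauLE A q).obj H).obj (op (X⟦-q⟧)) ⟶
    ((w.tauLE A 0).obj ((coh C A q).obj H)).obj (op X) :=
  ((w.tauLESh A (-q) 0 q h).app H).app (op X)

lemma leShift_leOut (q : ℤ) (h : q + -q = 0) (X : C) :
    leShift (w := w) H q h X ≫ w.leOut 0 ((coh C A q).obj H) X =
      w.leOut q H (X⟦-q⟧) ≫ mapCoh H q (w.leSh (-q) (0 + 1) (q + 1) (by lia) X) :=
  w.tauLESh_leOut (-q) 0 q h H X

/-- The connecting morphism `tauδ`. -/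
def conn (k k' : ℤ) (h : k + 1 = k') (X : C) : ((w.tauGE A k').obj H).obj (op (X⟦(1 : ℤ)⟧)) ⟶
    ((w.tauLE A k).obj H).obj (op X) :=
  ((w.tauδ A k k' h).app H).app (op X)

lemma conn_leOut (k k' : ℤ) (h : k + 1 = k') (X : C) :
    conn (w := w) H k k' h X ≫ w.leOut k H X =
      w.geOut k' H (X⟦(1 : ℤ)⟧) ≫ H.map (w.bd (k + 1) k' (by lia) X).op :=
  w.tauδ_leOut _ _ h H X

/-- Compatibility with `D' ⟶ E'`. -/
lemma connecting_virtOut [H.Additive] (p q d p' : ℤ) (hp : p + 1 = p') (hd : d + 1 = p) (h₀ : q + -q = 0)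
    (hs : -q + 1 = 1 - q) (h : -p + (1 - q) = 1 - d + -(q + 1))
    (h' : 1 + (-p + -q) = 1 - d + -(q + 1)) :
    ((w.tauGE A (q + 1)).obj H).map (shOne P.X (-p) (-q) (1 - q) (1 - d) (-(q + 1)) hs h).op ≫
      conn H q (q + 1) rfl (P.X⟦-p⟧⟦-q⟧) ≫ leShift H q h₀ (P.X⟦-p⟧) ≫
      ((w.tauGEπ A 0).app ((w.tauLE A 0).obj ((coh C A q).obj H))).app (op (P.X⟦-p⟧)) ≫
      P.virtOut ((coh C A q).obj H) p d p' hp hd =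
    (p + q).negOnePow • (P.dOut H (d, q + 1) ≫ mapCoh H q ((P.δy d p' (by lia))⟦-p⟧'⟦-q⟧' ≫
      (sh3 1 (-p) (-q) (1 - d) (-(q + 1)) h').hom.app (P.Y d))) := by
  have h₁ := w.tauGEπ_geOut 0 ((w.tauLE A 0).obj ((coh C A q).obj H)) (P.X⟦-p⟧)
  have h₂ : ((w.tauLE A 0).obj ((coh C A q).obj H)).map (w.geι 0 (P.X⟦-p⟧)).op ≫
      ((w.tauLE A 0).obj ((coh C A q).obj H)).map (P.yToGe p p' 0 (by lia)).op =
      ((w.tauLE A 0).obj ((coh C A q).obj H)).map ((P.toX p')⟦-p⟧').op := by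
    rw [← Functor.map_comp, ← op_comp, yToGe_geι]
  have h₃ := w.map_leOut 0 ((coh C A q).obj H) ((P.toX p')⟦-p⟧')
  have h₄ := leShift_leOut (w := w) H q h₀ (P.X⟦-p⟧)
  have h₅ := conn_leOut (w := w) H q (q + 1) rfl (P.X⟦-p⟧⟦-q⟧)
  have h₆ := w.map_geOut (q + 1) H (shOne P.X (-p) (-q) (1 - q) (1 - d) (-(q + 1)) hs h)
  have h₇ := P.quoToLe_bd p q d p' hp hd h h'
  rw [virtOut, reassoc_of% h₁, reassoc_of% h₂, reassoc_of% h₃, reassoc_of% h₄, reassoc_of% h₅, reassoc_of% h₆,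
    ← Functor.map_comp, ← op_comp, mapCoh_map, map_mapCoh, map_mapCoh, dOut]
  have h₈ : P.δy d p' (by lia)⟦-p⟧'⟦-q⟧' ≫
      (sh3 1 (-p) (-q) (1 - d) (-(q + 1)) h').hom.app (P.Y d) ≫ P.toGe (d, q + 1) =
      (P.δy d p' (by lia)⟦-p⟧'⟦-q⟧' ≫
      (sh3 1 (-p) (-q) (1 - d) (-(q + 1)) h').hom.app (P.Y d)) ≫ P.toGe (d, q + 1) :=
    (Category.assoc _ _ _).symm
  -- The comparison of `quoToLe_bd` suffices, because only elements of the virtual truncation are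
  -- considered.
  have h₉ := w.geOut_comp_mapCoh_eq H q rfl h₇
  rw [mapCoh_smul, h₈] at h₉
  simp only [Category.assoc] at h₉ ⊢
  rw [Functor.map_comp, Category.assoc]
  refine h₉.trans ?_
  rw [Linear.comp_units_smul]
  exact congrArg (fun t => (p + q).negOnePow • (w.geOut (q + 1) H (P.X⟦1 - d⟧⟦-(q + 1)⟧) ≫ t))
    ((congrArg (mapCoh H q) h₈).trans (map_mapCoh H q _ _).symm)

end Tower

end Connecting

end WeightSS

end

noncomputable section

namespace WeightSS

/-! ### Componentwise isomorphisms between the derived and the virtual couple -/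

section VirtualIso

variable {C : Type u} [Category.{v} C] [Preadditive C] [HasZeroObject C] [HasShift C ℤ]
  [∀ n : ℤ, (shiftFunctor C n).Additive] [Pretriangulated C]
  {A : Type u'} [Category.{v'} A] [Abelian A] {w : WeightStructure C}

namespace WeightStructure

variable (w)

/-- The value of `virtI`. -/
def vI (H : Cᵒᵖ ⥤ A) (a b : ℤ × ℤ) (h : a + (-1, 1) = b) (X : C) :
    ((w.tauGE A a.2).obj H).obj (op (X⟦1 - a.1⟧⟦-a.2⟧)) ⟶ ((w.tauGE A b.2).obj H).obj (op (X⟦1 - b.1⟧⟦-b.2⟧)) :=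
  ((w.virtI A a b h).app H).app (op X)

lemma vI_eq (H : Cᵒᵖ ⥤ A) (a b : ℤ × ℤ) (h : a + (-1, 1) = b) (h' : a.2 ≤ b.2) (X : C) :
    w.vI H a b h X = ((w.tauGETrans A a.2 b.2 h').app H).app (op (X⟦1 - a.1⟧⟦-a.2⟧)) ≫
      ((w.tauGE A b.2).obj H).map (sh X (1 - b.1) (-b.2) (1 - a.1) (-a.2) (Tower.shift_eq h)).op :=
  rfl

/-- The value of `virtK`. -/
def vK (H : Cᵒᵖ ⥤ A) (p q p' : ℤ) (h : ((p, q) : ℤ × ℤ) + (1, 0) = (p', q)) (X : C) :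
    ((w.tauGE A 0).obj ((w.tauLE A 0).obj ((coh C A q).obj H))).obj (op (X⟦-p⟧)) ⟶
      ((w.tauGE A q).obj H).obj (op (X⟦1 - p'⟧⟦-q⟧)) :=
  ((w.virtK A (p, q) (p', q) h).app H).app (op X)

lemma vK_eq (H : Cᵒᵖ ⥤ A) (p q p' : ℤ) (h : ((p, q) : ℤ × ℤ) + (1, 0) = (p', q)) (h₀ : q + -q = 0)
    (hs : 1 - p' + -q = -p + -q) (X : C) :
    w.vK H p q p' h X = ((w.tauGE A 0).map ((w.tauLEι A 0).app ((coh C A q).obj H))).app (op (X⟦-p⟧)) ≫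
      Tower.geShift H q h₀ (X⟦-p⟧) ≫ ((w.tauGE A q).obj H).map (sh X (1 - p') (-q) (-p) (-q) hs).op :=
  Category.assoc _ _ _

/-- The value of `virtJ`. -/
def vJ (H : Cᵒᵖ ⥤ A) (p q d : ℤ) (h : ((d, q + 1) : ℤ × ℤ) + (2 - 1, 1 - 2) = (p, q)) (X : C) :
    ((w.tauGE A (q + 1)).obj H).obj (op (X⟦1 - d⟧⟦-(q + 1)⟧)) ⟶
      ((w.tauGE A 0).obj ((w.tauLE A 0).obj ((coh C A q).obj H))).obj (op (X⟦-p⟧)) :=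
  ((w.virtJ A (d, q + 1) (p, q) h).app H).app (op X)

lemma vJ_eq (H : Cᵒᵖ ⥤ A) (p q d : ℤ) (h : ((d, q + 1) : ℤ × ℤ) + (2 - 1, 1 - 2) = (p, q)) (h₀ : q + -q = 0)
    (hs : -q + 1 = 1 - q) (h' : -p + (1 - q) = 1 - d + -(q + 1)) (X : C) :
    w.vJ H p q d h X =
      ((w.tauGE A (q + 1)).obj H).map (shOne X (-p) (-q) (1 - q) (1 - d) (-(q + 1)) hs h').op ≫
      Tower.conn H q (q + 1) rfl (X⟦-p⟧⟦-q⟧) ≫ Tower.leShift H q h₀ (X⟦-p⟧) ≫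
      ((w.tauGEπ A 0).app ((w.tauLE A 0).obj ((coh C A q).obj H))).app (op (X⟦-p⟧)) := by
  rw [shOne, op_comp, Functor.map_comp]
  rfl

end WeightStructure

namespace Tower

lemma vI_dOut (P : Tower w) (H : Cᵒᵖ ⥤ A) (a b : ℤ × ℤ) (h : a + (-1, 1) = b) :
    w.vI H a b h P.X ≫ P.dOut H b = P.dOut H a ≫ H.map (P.homI a b h).op := by
  have h' : a.2 ≤ b.2 := by rw [← h]; simp
  rw [w.vI_eq _ _ _ _ h', Category.assoc]
  exact P.tauGETrans_dOut H a b h h'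

lemma vJ_virtOut (P : Tower w) (H : Cᵒᵖ ⥤ A) [H.Additive] (p q d p' : ℤ) (hp : p + 1 = p') (hd : d + 1 = p)
    (h : ((d, q + 1) : ℤ × ℤ) + (2 - 1, 1 - 2) = (p, q)) (h' : 1 + (-p + -q) = 1 - d + -(q + 1)) :
    w.vJ H p q d h P.X ≫ P.virtOut ((coh C A q).obj H) p d p' hp hd =
    (p + q).negOnePow • (P.dOut H (d, q + 1) ≫ mapCoh H q ((P.δy d p' (by lia))⟦-p⟧'⟦-q⟧' ≫
      (sh3 1 (-p) (-q) (1 - d) (-(q + 1)) h').hom.app (P.Y d))) := by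
  have e : -p + (1 - q) = 1 - d + -(q + 1) := by lia
  rw [w.vJ_eq H p q d h (add_neg_cancel q) (by ring) e, Category.assoc, Category.assoc, Category.assoc]
  exact P.connecting_virtOut H p q d p' hp hd (add_neg_cancel q) (by ring) e h'

end Tower

namespace ExactCouple

lemma epi_derπ {r : ℤ} (S : ExactCouple A r) (a b : ℤ × ℤ) (h : a + (-1, 1) = b) : Epi (S.derπ a b h) :=
  inferInstance

lemma mono_derι {r : ℤ} (S : ExactCouple A r) (a : ℤ × ℤ) : Mono (S.derι a) := inferInstance

lemma derπ_map_derι {r : ℤ} {S T U : ExactCouple A r} (f : S ⟶ T) (g : T ⟶ U) (a b : ℤ × ℤ)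
    (h : a + (-1, 1) = b) : S.derπ a b h ≫ derDMap f b ≫ derDMap g b ≫ U.derι b =
      CoupleData.Hom.hD f a ≫ T.i a b h ≫ CoupleData.Hom.hD g b := by
  rw [derDMap_derι, reassoc_of% (derDMap_derι f), reassoc_of% (S.derπ_derι),
    ← reassoc_of% (CoupleData.Hom.comm_i f)]

end ExactCouple

/-- Both sides are presented as the image of `H` of the morphism `homI`. The compatibility with the
monomorphisms to `D_1` is recorded for testing `i`, `j` and `k`. -/
lemma exists_isoD (a : ℤ × ℤ) :
    ∃ e : towerCouple A w ⋙ (Functor.whiskeringRight _ _ _).obj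
        (ExactCouple.deriveFunctor A (by norm_num : (1 : ℤ) + 1 = 2) ⋙ ExactCouple.evalD A 2 a) ≅
      (isCohomological C A).ι ⋙ w.virtD A a ⋙ (Functor.whiskeringLeft _ _ _).obj (Tower.forget w).op,
    ∀ (H : Coh C A) (P : (Tower w)ᵒᵖ), (e.hom.app H).app P ≫ P.unop.dOut H.obj a =
      (((towerCouple A w).obj H).obj P).derι a := by
  have h : a + (1, -1) + (-1, 1) = a := by ext <;> simp
  obtain ⟨e, he⟩ := exists_natIso_of_presentation
    (towerCouple A w ⋙ (Functor.whiskeringRight _ _ _).obj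
        (ExactCouple.deriveFunctor A (by norm_num : (1 : ℤ) + 1 = 2) ⋙ ExactCouple.evalD A 2 a))
    ((isCohomological C A).ι ⋙ w.virtD A a ⋙ (Functor.whiskeringLeft _ _ _).obj (Tower.forget w).op)
    (fun H P => H.obj.obj (op (P.unop.objD (a + (1, -1))))) (fun H P => H.obj.obj (op (P.unop.objD a)))
    (fun H P => (((towerCouple A w).obj H).obj P).derπ _ a h)
    (fun H P => P.unop.dIn H.obj _ a h)
    (fun H P => (((towerCouple A w).obj H).obj P).derι a)
    (fun H P => P.unop.dOut H.obj a)
    (fun H P => ExactCouple.epi_derπ _ _ _ _) (fun H P => inferInstanceAs (Epi (P.unop.dIn H.obj _ a h)))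
    (fun H P => ExactCouple.mono_derι _ _) (fun H P => inferInstanceAs (Mono (P.unop.dOut H.obj a))) (by
      intro H H' α P P' F
      refine Eq.trans ?_ (Tower.dIn_dOut (w := w) α.hom F.unop (a + (1, -1)) a h).symm
      refine (ExactCouple.derπ_map_derι (((towerCouple A w).map α).app P) (((towerCouple A w).obj H').map F)
        (a + (1, -1)) a h).trans ?_
      exact congrArg (α.hom.app (op (P.unop.objD (a + (1, -1)))) ≫ ·) ((H'.obj.map_comp _ _).symm.trans
        (congrArg (fun t => H'.obj.map t.op) (Tower.homI_naturality F.unop (a + (1, -1)) a h).symm)))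
  exact ⟨e, fun H P => (he H P).2⟩

/-- The case `n = 1` of the presentation of `E` is matched with `virtIn` and `virtOut`. The
additional clauses express `k` and `j` through the presentations; in the second one no sign appears
yet, as it enters with `vJ_virtOut`. -/
lemma exists_isoE (p q p' d : ℤ) (hp : p + 1 = p') (hd : d + 1 = p) :
    ∃ e : towerCouple A w ⋙ (Functor.whiskeringRight _ _ _).obj
        (ExactCouple.deriveFunctor A (by norm_num : (1 : ℤ) + 1 = 2) ⋙ ExactCouple.evalE A 2 (p, q)) ≅
      (isCohomological C A).ι ⋙ w.virtE A (p, q) ⋙ (Functor.whiskeringLeft _ _ _).obj (Tower.forget w).op,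
    (∀ (H : Coh C A) (P : (Tower w)ᵒᵖ) (e₁ : ((p, q) : ℤ × ℤ) + (1, 0) = (p', q)),
      ((((towerCouple A w).obj H).obj P).derive (by norm_num : (1 : ℤ) + 1 = 2)).k (p, q) (p', q) e₁ ≫
        (((towerCouple A w).obj H).obj P).derι (p', q) =
      (e.hom.app H).app P ≫ w.vK H.obj p q p' e₁ P.unop.X ≫ P.unop.dOut H.obj (p', q)) ∧
    (∀ (H : Coh C A) (P : (Tower w)ᵒᵖ) (e₁ : ((d, q + 1) : ℤ × ℤ) + (2 - 1, 1 - 2) = (p, q))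
      (h' : 1 + (-p + -q) = 1 - d + -(q + 1)),
      ((((towerCouple A w).obj H).obj P).derive (by norm_num : (1 : ℤ) + 1 = 2)).j (d, q + 1) (p, q) e₁ ≫
        (e.hom.app H).app P ≫ P.unop.virtOut ((coh C A q).obj H.obj) p d p' hp hd =
      (((towerCouple A w).obj H).obj P).derι (d, q + 1) ≫
        mapCoh H.obj q ((P.unop.δy d p' (by lia))⟦-p⟧'⟦-q⟧' ≫
          (sh3 1 (-p) (-q) (1 - d) (-(q + 1)) h').hom.app (P.unop.Y d))) := by
  have hd' : d + ((1 : ℕ) : ℤ) = p := by simpa using hd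
  obtain ⟨u, v, hu, hv, h₁, h₂, h₃⟩ := exists_presentation_E (A := A) (w := w) (n := 1) le_rfl
    (ExactCouple.deriveFunctor A (by norm_num : (1 : ℤ) + 1 = 2))
    (fun S => ExactCouple.Derived.derive S (by norm_num : (1 : ℤ) + 1 = 2))
    (fun f => ExactCouple.Derived.Compat.derive f _) p q p' (p + 1 + 1) d hp (by simp) hd'
  obtain ⟨e, he⟩ := exists_natIso_of_presentation
    (towerCouple A w ⋙ (Functor.whiskeringRight _ _ _).obj
        (ExactCouple.deriveFunctor A (by norm_num : (1 : ℤ) + 1 = 2) ⋙ ExactCouple.evalE A 2 (p, q)))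
    ((isCohomological C A).ι ⋙ w.virtE A (p, q) ⋙ (Functor.whiskeringLeft _ _ _).obj (Tower.forget w).op)
    (fun H P => (bish H.obj p q).obj (op (P.unop.quo p (p + 1 + 1) (by lia))))
    (fun H P => (bish H.obj p q).obj (op (P.unop.quo d p' (by lia))))
    u (fun H P => P.unop.virtIn ((coh C A q).obj H.obj) p (p + 1 + 1) rfl)
    v (fun H P => P.unop.virtOut ((coh C A q).obj H.obj) p d p' hp hd)
    hu (fun H P => P.unop.epi_virtIn _ _ _ _) hv (fun H P => P.unop.mono_virtOut _ _ _ _ _ _) (by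
      intro H H' α P P' F
      refine (h₁ α F).trans (Tower.virtIn_virtOut (w := w) p (p + 1 + 1) d p' ((coh C A q).map α.hom) F.unop
        rfl hp hd).symm)
  refine ⟨e, ?_, ?_⟩
  · intro H P e₁
    have hu' := hu H P
    have e₃ : 1 - p' + -q = -p + -q := by lia
    refine (cancel_epi (u H P)).1 ?_
    refine (h₂ H P e₁ e₃).trans ?_
    have h₄ := P.unop.virtIn_dOut H.obj p q (p + 1 + 1) p' rfl hp (add_neg_cancel q) e₃
    have h₅ : w.vK H.obj p q p' e₁ P.unop.X ≫ P.unop.dOut H.obj (p', q) =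
        ((w.tauGE A 0).map ((w.tauLEι A 0).app ((coh C A q).obj H.obj))).app (op (P.unop.X⟦-p⟧)) ≫
        Tower.geShift H.obj q (add_neg_cancel q) (P.unop.X⟦-p⟧) ≫ ((w.tauGE A q).obj H.obj).map
          (sh P.unop.X (1 - p') (-q) (-p) (-q) e₃).op ≫ P.unop.dOut H.obj (p', q) := by
      rw [w.vK_eq H.obj p q p' e₁ (add_neg_cancel q) e₃, Category.assoc, Category.assoc]
    refine Eq.trans ?_ ((Category.assoc _ _ _).symm.trans (congrArg (· ≫ w.vK H.obj p q p' e₁ P.unop.X ≫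
        P.unop.dOut H.obj (p', q)) (he H P).1)).symm
    exact Eq.trans (H.obj.map_comp _ _).symm ((congrArg (_ ≫ ·) h₅).trans h₄).symm
  · intro H P e₁ h'
    exact (congrArg (_ ≫ ·) (he H P).2).trans ((h₃ H P e₁ h').trans
      (congrArg (_ ≫ ·) (H.obj.map_comp _ _).symm))

end VirtualIso

end WeightSS

end

noncomputable section

namespace WeightSS

/-! ### Removing the sign -/

section Signs

/-- The solution is `(-1)^{m(m-1)/2}`. -/
lemma exists_sign : ∃ s : ℤ → ℤˣ, ∀ m, s (m + 1) = m.negOnePow * s m := by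
  refine ⟨fun m => (m * (m - 1) / 2).negOnePow, fun m => ?_⟩
  dsimp only
  rw [← Int.negOnePow_add, show (m + 1) * (m + 1 - 1) = m * (m - 1) + m * 2 by ring,
    Int.add_mul_ediv_right _ _ two_ne_zero, add_comm]

variable {𝓗 : Type*} [Category* 𝓗] {𝓧 : Type*} [Category* 𝓧] {A : Type u'} [Category.{v'} A] [Abelian A]

/-- Isomorphisms of functors to couples, from components that commute with `j` up to the sign
`(-1)^{p+q}`. -/
lemma nonempty_iso_of_sign (F G : 𝓗 ⥤ 𝓧 ⥤ CoupleData A 2)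
    (eD : ∀ a H X, ((F.obj H).obj X).D a ≅ ((G.obj H).obj X).D a)
    (eE : ∀ a H X, ((F.obj H).obj X).E a ≅ ((G.obj H).obj X).E a)
    (hi : ∀ H X a b h, ((F.obj H).obj X).i a b h ≫ (eD b H X).hom =
      (eD a H X).hom ≫ ((G.obj H).obj X).i a b h)
    (hj : ∀ H X a b h, (b.1 + b.2).negOnePow • (((F.obj H).obj X).j a b h ≫ (eE b H X).hom) =
      (eD a H X).hom ≫ ((G.obj H).obj X).j a b h)
    (hk : ∀ H X a b h, ((F.obj H).obj X).k a b h ≫ (eD b H X).hom =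
      (eE a H X).hom ≫ ((G.obj H).obj X).k a b h)
    (nD : ∀ a H {X Y : 𝓧} (f : X ⟶ Y), CoupleData.Hom.hD ((F.obj H).map f) a ≫ (eD a H Y).hom =
      (eD a H X).hom ≫ CoupleData.Hom.hD ((G.obj H).map f) a)
    (nE : ∀ a H {X Y : 𝓧} (f : X ⟶ Y), CoupleData.Hom.hE ((F.obj H).map f) a ≫ (eE a H Y).hom =
      (eE a H X).hom ≫ CoupleData.Hom.hE ((G.obj H).map f) a)
    (mD : ∀ a {H H' : 𝓗} (α : H ⟶ H') X, CoupleData.Hom.hD ((F.map α).app X) a ≫ (eD a H' X).hom =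
      (eD a H X).hom ≫ CoupleData.Hom.hD ((G.map α).app X) a)
    (mE : ∀ a {H H' : 𝓗} (α : H ⟶ H') X, CoupleData.Hom.hE ((F.map α).app X) a ≫ (eE a H' X).hom =
      (eE a H X).hom ≫ CoupleData.Hom.hE ((G.map α).app X) a) : Nonempty (F ≅ G) := by
  obtain ⟨s, hs⟩ := exists_sign
  have key : ∀ {X Y X' Y' : A} {f : X ⟶ Y} {g : X' ⟶ Y'} {x : X ≅ X'} {y : Y ≅ Y'} {ε ε' : ℤˣ},
      f ≫ y.hom = x.hom ≫ g → ε = ε' → f ≫ (ε • y).hom = (ε' • x).hom ≫ g := by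
    rintro X Y X' Y' f g x y ε _ h rfl
    rw [Preadditive.smul_iso_hom, Preadditive.smul_iso_hom, Linear.comp_units_smul, Linear.units_smul_comp, h]
  -- In terms of total degree `m`, `D` is scaled by `s m` and `E` by `s (m + 1)`. Then `i` and `k`
  -- stay compatible, as `i` preserves the degree and `k` raises it by one, while `j` preserves it
  -- and gains `s (m + 1) / s m = (-1)^m`.
  refine ⟨coupleIsoOfComponents F G (fun a H X => s (a.1 + a.2) • eD a H X)
    (fun a H X => s (a.1 + a.2 + 1) • eE a H X) (fun H X a b h => key (hi H X a b h) ?_) ?_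
    (fun H X a b h => key (hk H X a b h) ?_) (fun a H _ _ f => key (nD a H f) rfl)
    (fun a H _ _ f => key (nE a H f) rfl) (fun a _ _ α X => key (mD a α X) rfl)
    (fun a _ _ α X => key (mE a α X) rfl)⟩
  · rw [← h]
    simp only [Prod.fst_add, Prod.snd_add]
    congr 1
    ring
  · intro H X a b h
    have e : a.1 + a.2 = b.1 + b.2 := by
      rw [← h]
      simp only [Prod.fst_add, Prod.snd_add]
      ring
    rw [Preadditive.smul_iso_hom, Preadditive.smul_iso_hom, Linear.comp_units_smul, Linear.units_smul_comp,
      ← hj, hs, e, smul_smul, mul_comm]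
  · rw [← h]
    simp only [Prod.fst_add, Prod.snd_add]
    congr 1
    ring

lemma comp_eq_of_sign {X Y Z V W U : A} {j : X ⟶ Y} {e : Y ⟶ Z} {o : Z ⟶ V} {f : X ⟶ W} {g : W ⟶ Z}
    {d : W ⟶ U} {m : U ⟶ V} {t : X ⟶ U} {ε : ℤˣ} (h₁ : j ≫ e ≫ o = t ≫ m) (h₂ : f ≫ d = t)
    (h₃ : g ≫ o = ε • (d ≫ m)) : (ε • (j ≫ e)) ≫ o = (f ≫ g) ≫ o := by
  rw [Linear.units_smul_comp, Category.assoc, h₁, Category.assoc, h₃, Linear.comp_units_smul, reassoc_of% h₂]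

end Signs

/-! ### The isomorphism of the derived couple with the virtual couple -/

section VirtualIso

variable {C : Type u} [Category.{v} C] [Preadditive C] [HasZeroObject C] [HasShift C ℤ]
  [∀ n : ℤ, (shiftFunctor C n).Additive] [Pretriangulated C]
  {A : Type u'} [Category.{v'} A] [Abelian A]

open scoped CategoryTheory.Pretriangulated.Opposite in
lemma isCohomological.additive {H : Cᵒᵖ ⥤ A} (hH : isCohomological C A H) : H.Additive := by
  have : H.IsHomological := hH
  infer_instance

variable (A) in
/-- The derived couple in terms of virtual truncations. -/
lemma nonempty_derived_iso_virtCouple (w : WeightStructure C) :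
    Nonempty (towerCouple A w ⋙ (Functor.whiskeringRight _ _ _).obj
          (ExactCouple.deriveFunctor A (by norm_num : (1 : ℤ) + 1 = 2) ⋙ ExactCouple.forget A 2) ≅
        (isCohomological C A).ι ⋙ w.virtCouple A ⋙
          (Functor.whiskeringLeft _ _ _).obj (Tower.forget w).op) := by
  choose eD hD using exists_isoD (A := A) (w := w)
  choose eE hE₁ hE₂ using fun p q => exists_isoE (A := A) (w := w) p q (p + 1) (p - 1) rfl (sub_add_cancel p 1)
  refine nonempty_iso_of_sign _ _ (fun a H P => ((eD a).app H).app P) (fun a H P => ((eE a.1 a.2).app H).app P)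
    ?_ ?_ ?_ (fun a H _ _ f => ((eD a).hom.app H).naturality f)
    (fun a H _ _ f => ((eE a.1 a.2).hom.app H).naturality f)
    (fun a _ _ α P => congrArg (fun t => t.app P) ((eD a).hom.naturality α))
    (fun a _ _ α P => congrArg (fun t => t.app P) ((eE a.1 a.2).hom.naturality α))
  -- Each compatibility is tested after the monomorphism out of the virtual term, where both sides
  -- have been computed.
  · intro H P a b h
    refine (cancel_mono (P.unop.dOut H.obj b)).1 ?_
    have h₁ := P.unop.vI_dOut H.obj a b h
    have h₂ : (((((towerCouple A w).obj H).obj P).derι a ≫ (((towerCouple A w).obj H).obj P).derπ a b h) ≫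
        ((eD b).hom.app H).app P) ≫ P.unop.dOut H.obj b =
        (((towerCouple A w).obj H).obj P).derι a ≫ (((towerCouple A w).obj H).obj P).i a b h :=
      (Category.assoc _ _ _).trans ((congrArg (_ ≫ ·) (hD b H P)).trans ((Category.assoc _ _ _).trans
        (congrArg (_ ≫ ·) ((((towerCouple A w).obj H).obj P).derπ_derι a b h))))
    have h₃ : (((eD a).hom.app H).app P ≫ w.vI H.obj a b h P.unop.X) ≫ P.unop.dOut H.obj b =
        (((towerCouple A w).obj H).obj P).derι a ≫ (((towerCouple A w).obj H).obj P).i a b h :=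
      (Category.assoc _ _ _).trans ((congrArg (_ ≫ ·) h₁).trans ((Category.assoc _ _ _).symm.trans
        (congrArg (· ≫ H.obj.map (P.unop.homI a b h).op) (hD a H P))))
    exact h₂.trans h₃.symm
  · rintro H P a ⟨p, q⟩ h
    obtain rfl : a = (p - 1, q + 1) := by
      rw [← sub_eq_iff_eq_add.2 h.symm]
      ext <;> simp
    have := H.property.additive
    have h' : 1 + (-p + -q) = 1 - (p - 1) + -(q + 1) := by ring
    have := P.unop.mono_virtOut ((coh C A q).obj H.obj) p (p - 1) (p + 1) rfl (sub_add_cancel p 1)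
    refine (cancel_mono (P.unop.virtOut ((coh C A q).obj H.obj) p (p - 1) (p + 1) rfl (sub_add_cancel p 1))).1 ?_
    exact comp_eq_of_sign (hE₂ p q H P h h') (hD (p - 1, q + 1) H P)
      (P.unop.vJ_virtOut H.obj p q (p - 1) (p + 1) rfl (sub_add_cancel p 1) h h')
  · rintro H P ⟨p, q⟩ b h
    obtain rfl : b = (p + 1, q) := by
      rw [← h]
      ext <;> simp
    refine (cancel_mono (P.unop.dOut H.obj (p + 1, q))).1 ?_
    exact (Category.assoc _ _ _).trans ((congrArg (_ ≫ ·) (hD (p + 1, q) H P)).trans ((hE₁ p q H P h).trans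
      (Category.assoc _ _ _).symm))

end VirtualIso

end WeightSS

end

noncomputable section

namespace WeightSS

/-! ### Functoriality from the second page on -/

section SecondPage

variable {C : Type u} [Category.{v} C] [Preadditive C] [HasZeroObject C] [HasShift C ℤ]
  [∀ n : ℤ, (shiftFunctor C n).Additive] [Pretriangulated C]
  (A : Type u') [Category.{v'} A] [Abelian A] (w : WeightStructure C)

/-- Exactness is not checked directly: every object has a tower, and the virtual couple is
isomorphic to the derived couple of that tower. -/
lemma exists_exact_virtCouple (H : Coh C A) (X : Cᵒᵖ) : ∃ T : ExactCouple A 2,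
    T.toCoupleData = (((isCohomological C A).ι ⋙ w.virtCouple A).obj H).obj X := by
  obtain ⟨e⟩ := nonempty_derived_iso_virtCouple A w
  obtain ⟨P, hP⟩ := Tower.exists_tower w X.unop
  obtain rfl : op P.X = X := congrArg op hP
  exact ExactCouple.exact_of_iso ((((towerCouple A w).obj H).obj (op P)).derive (by norm_num)) _
    ((e.app H).app (op P))

/-- The weight spectral sequence is functorial in `X` from the second page on. -/
lemma exists_secondPage_functor : ∃ T₂ : Coh C A ⥤ Cᵒᵖ ⥤ CohomologicalSpectralSequence A 2,
    Nonempty (weightSS A w ⋙ (Functor.whiskeringRight _ _ _).obj (restrictPages A 1 2 (by norm_num)) ≅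
      T₂ ⋙ (Functor.whiskeringLeft _ _ _).obj (Tower.forget w).op) := by
  obtain ⟨W, hW⟩ := exists_exact_lift _ (exists_exact_virtCouple A w)
  obtain ⟨e⟩ := nonempty_derived_iso_virtCouple A w
  let e₁ : towerCouple A w ⋙ (Functor.whiskeringRight _ _ _).obj
      (ExactCouple.deriveFunctor A (by norm_num : (1 : ℤ) + 1 = 2)) ≅
      W ⋙ (Functor.whiskeringLeft _ _ _).obj (Tower.forget w).op :=
    exactIsoOfForget _ _ (e ≪≫ eqToIso
      (congrArg (· ⋙ (Functor.whiskeringLeft _ _ _).obj (Tower.forget w).op) hW.symm))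
  -- `T₂` is the spectral sequence of the virtual couple. The pages from the second on are those of
  -- the derived couple, which is isomorphic to the virtual one as an exact couple.
  exact ⟨W ⋙ (Functor.whiskeringRight _ _ _).obj (ExactCouple.spectralSequence A 2),
    ⟨Functor.isoWhiskerLeft (towerCouple A w) ((Functor.whiskeringRight _ _ _).mapIso
      (ExactCouple.spectralSequenceDerive A (by norm_num : (1 : ℤ) + 1 = 2))) ≪≫
      Functor.isoWhiskerRight e₁ ((Functor.whiskeringRight _ _ _).obj (ExactCouple.spectralSequence A 2))⟩⟩

end SecondPage

end WeightSS

end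

theorem theorem2p4p2 {C : Type u} [Category.{v} C] [Preadditive C] [HasZeroObject C] [HasShift C ℤ]
    [∀ n : ℤ, (shiftFunctor C n).Additive] [Pretriangulated C] [IsTriangulated C]
    {A : Type u'} [Category.{v'} A] [Abelian A] (w : WeightStructure C) :
    -- The first page of the spectral sequence, naturally in `H` and in the tower.
    (∃ e : ∀ p q : ℤ,
        weightSS A w ⋙ (Functor.whiskeringRight _ _ _).obj
          (SpectralSequence.pageFunctor A _ 1 1 le_rfl ⋙ HomologicalComplex.eval _ _ (p, q)) ≅
        (isCohomological C A).ι ⋙ coh C A q ⋙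
          (Functor.whiskeringLeft _ _ _).obj (Tower.factor w p).op,
      ∀ (H : Coh C A) (P : Tower w) (p q : ℤ),
        ((((weightSS A w).obj H).obj (op P)).page 1 le_rfl).d (p, q) (p + 1, q) ≫
            ((e (p + 1) q).hom.app H).app (op P) =
          ((e p q).hom.app H).app (op P) ≫
            ((coh C A q).obj H.obj).map (P.weightD p (p + 1) rfl).op) ∧
    -- Convergence to `H^{p+q}(X)` for bounded `X`.
    (∀ (H : Coh C A) (P : Tower w), w.bounded P.X →
      (∀ m : ℤ, (∃ p₀ : ℤ, ∀ p ≤ p₀, P.filSub ((coh C A m).obj H.obj) p = ⊤) ∧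
        ∃ p₁ : ℤ, ∀ p ≥ p₁, P.filSub ((coh C A m).obj H.obj) p = ⊥) ∧
      ∃ r₀ : ℤ, ∀ (r : ℤ) (hr : 1 ≤ r), r₀ ≤ r →
        (∀ a b : ℤ × ℤ, ((((weightSS A w).obj H).obj (op P)).page r hr).d a b = 0) ∧
        ∀ p q : ℤ, ∃ φ : ((((weightSS A w).obj H).obj (op P)).page r hr).X (p, q) ≅
            ((gr A w p).obj ((coh C A (p + q)).obj H.obj)).obj (op P),
          φ.hom ≫ grToD H P p q =
            ((ExactCouple.couple A r hr).obj (((towerCouple A w).obj H).obj (op P))).k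
                (p, q) (p + 1, q) (by simp) ≫
              (ExactCouple.coupleι A r hr (p + 1, q)).app (((towerCouple A w).obj H).obj (op P))) ∧
    -- Functoriality in `X` from the second page on, and independence of the tower.
    ((Tower.forget w).Full ∧ (∀ X : C, ∃ P : Tower w, P.X = X) ∧
      ∃ T₂ : Coh C A ⥤ Cᵒᵖ ⥤ CohomologicalSpectralSequence A 2,
        Nonempty (weightSS A w ⋙
            (Functor.whiskeringRight _ _ _).obj (restrictPages A 1 2 (by norm_num)) ≅
          T₂ ⋙ (Functor.whiskeringLeft _ _ _).obj (Tower.forget w).op)) ∧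
    -- The filtration is the weight filtration.
    (∀ (H : Coh C A) (P : Tower w) (k m : ℤ) (D : WeightDec w k P.X),
      P.filSub ((coh C A m).obj H.obj) (-k) = D.W ((coh C A m).obj H.obj)) ∧
    -- The derived couple in terms of virtual `t`-truncations.
    Nonempty (towerCouple A w ⋙ (Functor.whiskeringRight _ _ _).obj
          (ExactCouple.deriveFunctor A (by norm_num : (1 : ℤ) + 1 = 2) ⋙ ExactCouple.forget A 2) ≅
        (isCohomological C A).ι ⋙ w.virtCouple A ⋙
          (Functor.whiskeringLeft _ _ _).obj (Tower.forget w).op) ∧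
    -- The filtration in terms of virtual `t`-truncations.
    (∀ (H : Coh C A) (P : Tower w) (k m : ℤ),
      P.filSub ((coh C A m).obj H.obj) (-k) =
        imageSubobject (((w.tauLEι A k).app ((coh C A m).obj H.obj)).app (op P.X))) ∧
    -- The terms `E_r^{pq}` in terms of virtual `t`-truncations.
    (∀ (r : ℤ) (hr : 2 ≤ r) (p q : ℤ),
      Nonempty (weightSS A w ⋙ (Functor.whiskeringRight _ _ _).obj
          (SpectralSequence.pageFunctor A _ 1 r (le_trans (by norm_num) hr) ⋙
            HomologicalComplex.eval _ _ (p, q)) ≅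
        (isCohomological C A).ι ⋙ coh C A (p + q) ⋙
          w.tauIcc A (-p + 2 - r) (-p + r - 2) ⋙ gr A w p)) := by
  exact ⟨⟨firstPageIso A w, firstPage_d⟩, convergence,
    ⟨Tower.forget_full, Tower.exists_tower w, exists_secondPage_functor A w⟩,
    fun H P k _ D => P.filSub_eq_W (H.property.halfExact.precomp _) k D,
    nonempty_derived_iso_virtCouple A w,
    fun H P k _ => (P.filSub_eq_W (H.property.halfExact.precomp _) k (w.dec k P.X)).trans
      (w.image_tauLEι _ k P.X).symm,
    nonempty_page_iso_gr A w⟩
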